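/- **Hamiltonian simulation by a truncated Dyson series with duplicated registers.** *Setting.* Let $n_s,n_a\ge 0$ and $M\ge 1$ be integers, $\alpha>0$, $0\le t\le \frac1{2\alpha}$, $\epsilon>0$. Let $H(s)$, $s\in[0,t]$, be Hermitian matrices in $\mathbb C^{2^{n_s}\times 2^{n_s}}$, differentiable in $s$ with integrable derivative, and $\|H(s)\|\le\alpha$ (spectral norm). Put $\langle\|\dot H\|\rangle=\frac1t\int_0^t\|\frac{dH}{ds}\|ds$ (read as $0$ if $t=0$), $X=\frac{t^2}{\epsilon}\big(\langle\|\dot H\|\rangle+\max_s\|H(s)\|^2\big)$ and $\mathcal T[e^{-i\int_0^tH(s)ds}]=\sum_{k\ge0}(-i)^k\int_{0\le t_1\le\dots\le t_k\le t}H(t_k)\cdots H(t_1)\,dt_1\cdots dt_k$. The oracle HAM-T is a unitary on a time register $d$ of $\lceil\log_2M\rceil$ qubits, a register $a$ of $n_a$ qubits and the system register $s$ of $n_s$ qubits, with $$(\langle0|_a\otimes 1)\,\text{HAM-T}\,(|0\rangle_a\otimes 1)\,(|m\rangle_d\otimes 1)=|m\rangle_d\otimes\tfrac{H(mt/M)}{\alpha}\qquad(0\le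 m<M).$$ A query is one use of HAM-T, of its inverse, or of a controlled version of these. A primitive gate is any unitary on at most two qubits. A circuit $V$ on the system and ancilla qubits implements $W=(\langle0|_{\rm anc}\otimes1_s)V(|0\rangle_{\rm anc}\otimes1_s)$; its failure probability on a normalized state $\psi$ is $1-\|W\psi\|^2$. Write $\ell=\log\max(X,e)$ and $r(\epsilon)=\frac{\log(1/\epsilon')}{\log\log(1/\epsilon')}$ with $\epsilon'=\min(\epsilon,e^{-e})$; thus $r(\epsilon)=\frac{\log(1/\epsilon)}{\log\log(1/\epsilon)}$ for $\epsilon\le e^{-e}$ and $\ell=\log X$ for $X\ge e$. *Claim.* There is an absolute constant $c_0>0$ such that for every $c_1$ there is a $C>0$, depending only on $c_1$, with the following property. For all $n_s,n_a,M,\alpha,t,\epsilon$ as above there are two circuits, which depend on $H$ and HAM-T only through queries, such that for all $H$ and HAM-T as above with $c_0X\le M\le c_1\max(1,X)$ (that is, $M$ is of the order of $X$) each of them implements a $W$ with $$\big\|W-\mathcal T[e^{-i\int_0^tH(s)ds}]\big\|\le\epsilon$$ and failure probability at most $C\epsilon$ on every input state, at the following costs. 1. The first circuit uses at most $C\,r(\epsilon)$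 queries, $n_s+m$ qubits with $m\le C(n_a+\ell)$, and at most $C(n_a+\ell)\,r(\epsilon)$ primitive gates. 2. The second circuit uses at most $C\,r(\epsilon)$ queries and at most $C(n_a+\ell)\,r(\epsilon)$ primitive gates, has $n_s+m'$ qubits with $m'\le C(n_a+\ell)\,r(\epsilon)$, and has the following form with duplicated registers. For some $K$, its ancillas are $K$ copies $a_1,\dots,a_K$ and $d_1,\dots,d_K$ of the registers $a$ and $d$, a register $b$ of $K$ qubits, a register $c$ of two qubits, a qubit $p$ and some work qubits. It is $-V\cdot\text{REF}\cdot V^\dagger\cdot\text{REF}\cdot V$ with $$V=\text{COEF}'^\dagger\cdot\text{PREP}^\dagger\cdot\text{HAM-T}_K\cdot\text{PREP}\cdot\text{COEF},$$ where $\text{HAM-T}_K$ consists of $K$ controlled queries in sequence, the $j$-th one applying HAM-T to $(d_j,a_j,s)$ if the $j$-th qubit of $b$ is $|0\rangle$, followed by a swap of the two qubits of $c$; $\text{REF}$ is a query-free circuit that acts as $1-2|0\rangle\langle0|_{\rm anc}$ as long as the work qubits are $|0\rangle$; $\text{COEF},\text{COEF}'$ are query-free circuits on $b$, $p$ and the work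 qubits; and $\text{PREP}$ is a query-free circuit on $b,c,d_1,\dots,d_K$ and the work qubits that prepares the time-ordered index states by rejection sampling: for $0\le k\le K$, with $|k\rangle_b=|0\rangle^{\otimes k}|1\rangle^{\otimes(K-k)}$ and the work qubits starting and ending in $|0\rangle$, $$\text{PREP}\,|k\rangle_b|00\rangle_c|0\rangle_d=|k\rangle_b\big(\gamma_k|00\rangle_c|s_k\rangle_d+|01\rangle_c|\cdots\rangle_d\big),\qquad\gamma_k=\sqrt{\tbinom Mk/M^k},$$ $$|s_k\rangle=\tbinom Mk^{-1/2}\sum_{0\le m_1<\dots<m_k<M}|m_1,\dots,m_k,0,\dots,0\rangle\qquad(\gamma_k|s_k\rangle=0\text{ if }k>M).$$ -/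

import Mathlib

open scoped Matrix Matrix.Norms.L2Operator Nat

noncomputable section

namespace DysonSim

/-! ### Qubits, operators, circuits with an oracle -/

/-- Operators on the Hilbert space of a set `Q` of qubits, as matrices in the computational
basis; basis states are the bit assignments `Q → Bool` (`false` is `|0⟩`, `true` is `|1⟩`). -/
abbrev Operator (Q : Type) := Matrix (Q → Bool) (Q → Bool) ℂ

/-- The operator `U` applied to the qubits selected by `e`, tensored with the identity on all
other qubits. -/
def applyOn {R Q : Type} (e : R ↪ Q) (U : Operator R) : Operator Q :=
  open Classical in
  Matrix.of fun x y => if ∀ q, q ∉ Set.range e → x q = y q then U (x ∘ e) (y ∘ e) else 0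

/-- The controlled operator `|0⟩⟨0| ⊗ U + |1⟩⟨1| ⊗ 1`; the control qubit is `none`. -/
def controlled {R : Type} (U : Operator R) : Operator (Option R) :=
  open Classical in
  Matrix.of fun x y =>
    if x none = y none then
      (if y none = false then U (x ∘ some) (y ∘ some)
        else if x ∘ some = y ∘ some then 1 else 0)
    else 0

/-- An elementary step of a circuit on the qubits `Q`, with access to an oracle acting on a
register `R`: a primitive gate (an arbitrary unitary on at most two qubits), or a query, i.e.
one application of the oracle or of its inverse (`dag = true`) or of the controlled version of
one of them, to chosen qubits of the circuit. -/
inductive Gate (R Q : Type) : Type where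
  | prim (k : ℕ) (hk : k ≤ 2) (e : Fin k ↪ Q) (U : Matrix.unitaryGroup (Fin k → Bool) ℂ) :
      Gate R Q
  | query (e : R ↪ Q) (dag : Bool) : Gate R Q
  | ctrlQuery (e : Option R ↪ Q) (dag : Bool) : Gate R Q

/-- The operator of a gate when the oracle is `O`. -/
def Gate.op {R Q : Type} (O : Operator R) : Gate R Q → Operator Q
  | .prim _ _ e U => applyOn e (U : Operator _)
  | .query e dag => applyOn e (if dag then Oᴴ else O)
  | .ctrlQuery e dag => applyOn e (controlled (if dag then Oᴴ else O))

/-- The inverse gate. -/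
def Gate.adj {R Q : Type} : Gate R Q → Gate R Q
  | .prim k hk e U => .prim k hk e (star U)
  | .query e dag => .query e (!dag)
  | .ctrlQuery e dag => .ctrlQuery e (!dag)

/-- Is the gate a query? -/
def Gate.isQuery {R Q : Type} : Gate R Q → Bool
  | .prim _ _ _ _ => false
  | .query _ _ => true
  | .ctrlQuery _ _ => true

/-- The qubits on which a gate acts. -/
def Gate.support {R Q : Type} : Gate R Q → Set Q
  | .prim _ _ e _ => Set.range e
  | .query e _ => Set.range e
  | .ctrlQuery e _ => Set.range e

/-- A circuit is a list of gates; the head of the list is applied first. -/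
abbrev Circuit (R Q : Type) := List (Gate R Q)

/-- The operator of a circuit when the oracle is `O`. -/
def Circuit.op {R Q : Type} [Fintype Q] [DecidableEq Q] (O : Operator R) :
    Circuit R Q → Operator Q
  | [] => 1
  | g :: C => Circuit.op O C * g.op O

/-- The inverse circuit. -/
def Circuit.adj {R Q : Type} (C : Circuit R Q) : Circuit R Q := (C.map Gate.adj).reverse

/-- Number of oracle queries. -/
def Circuit.queries {R Q : Type} (C : Circuit R Q) : ℕ := C.countP Gate.isQuery

/-- Number of primitive gates (all gates that are not queries). -/
def Circuit.primitives {R Q : Type} (C : Circuit R Q) : ℕ := C.countP fun g => !g.isQuery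

/-- The circuit only touches the qubits in `S`. -/
def Circuit.ActsOn {R Q : Type} (C : Circuit R Q) (S : Set Q) : Prop :=
  ∀ g ∈ C, g.support ⊆ S

/-- `(⟨0|_A ⊗ 1_s) V (|0⟩_A ⊗ 1_s)`: the operation on the `ns` system qubits obtained by
preparing all ancilla qubits `A` in `|0⟩`, applying `V`, and postselecting all ancillas
on `|0⟩`. -/
def ancillaBlock {ns : ℕ} {A : Type} (V : Operator (Fin ns ⊕ A)) : Operator (Fin ns) :=
  Matrix.of fun x y => V (Sum.elim x fun _ => false) (Sum.elim y fun _ => false)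

/-- The operation `W` is within spectral-norm distance `ε` of `U`, and on every normalized input
state the probability that `W` fails (the postselection defining `W` does not succeed) is at
most `p`. -/
def Simulates {ns : ℕ} (W U : Operator (Fin ns)) (ε p : ℝ) : Prop :=
  ‖W - U‖ ≤ ε ∧
    ∀ ψ : (Fin ns → Bool) → ℂ, ∑ x, ‖ψ x‖ ^ 2 = 1 → 1 - ∑ x, ‖(W *ᵥ ψ) x‖ ^ 2 ≤ p

/-! ### Time-dependent Hamiltonians -/

/-- The `k`-th Dyson term
`D_k(t) = ∫_{0 ≤ t_1 ≤ ⋯ ≤ t_k ≤ t} H(t_k) ⋯ H(t_1)`, as a nested integral. -/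
def dysonTerm {ns : ℕ} (H : ℝ → Operator (Fin ns)) : ℕ → ℝ → Operator (Fin ns)
  | 0, _ => 1
  | k + 1, t => ∫ s in (0 : ℝ)..t, H s * dysonTerm H k s

/-- The time-ordered exponential `𝒯 exp(-i ∫₀ᵗ H(s) ds) = ∑ₖ (-i)ᵏ D_k(t)`. -/
def timeOrderedExp {ns : ℕ} (H : ℝ → Operator (Fin ns)) (t : ℝ) : Operator (Fin ns) :=
  ∑' k : ℕ, (-Complex.I) ^ k • dysonTerm H k t

/-- `max_{s ∈ [0,t]} ‖H(s)‖`, in the spectral norm. -/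
def maxNorm {ns : ℕ} (H : ℝ → Operator (Fin ns)) (t : ℝ) : ℝ :=
  sSup ((fun s => ‖H s‖) '' Set.Icc 0 t)

/-- `⟨‖Ḣ‖⟩ = (1/t) ∫₀ᵗ ‖dH/ds‖ ds`. -/
def avgRate {ns : ℕ} (H : ℝ → Operator (Fin ns)) (t : ℝ) : ℝ :=
  1 / t * ∫ s in (0 : ℝ)..t, ‖derivWithin H (Set.Icc 0 t) s‖

/-- `(t² / ε) (⟨‖Ḣ‖⟩ + max_s ‖H(s)‖²)`. -/
def gridSize {ns : ℕ} (H : ℝ → Operator (Fin ns)) (t ε : ℝ) : ℝ :=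
  t ^ 2 / ε * (avgRate H t + maxNorm H t ^ 2)

/-- `log ((t² / ε) (⟨‖Ḣ‖⟩ + max_s ‖H(s)‖²))`, bounded below by `1`. -/
def logGrid {ns : ℕ} (H : ℝ → Operator (Fin ns)) (t ε : ℝ) : ℝ :=
  Real.log (max (gridSize H t ε) (Real.exp 1))

/-- `log (1/ε) / log log (1/ε)` for `ε ≤ e^{-e}`; constant for larger `ε`. -/
def logRatio (ε : ℝ) : ℝ :=
  let δ := min ε (Real.exp (-Real.exp 1))
  Real.log (1 / δ) / Real.log (Real.log (1 / δ))

/-! ### The oracle -/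

/-- The integer with the given binary digits. -/
def bitsVal {n : ℕ} (b : Fin n → Bool) : ℕ := ∑ i, if b i then 2 ^ (i : ℕ) else 0

/-- The register of the oracle: `⌈log₂ M⌉` qubits for the time index, `na` ancilla qubits and
`ns` system qubits. -/
abbrev OracleReg (ns na M : ℕ) := Fin (Nat.clog 2 M) ⊕ Fin na ⊕ Fin ns

/-- `O` is a unitary time-dependent matrix encoding of `H` on `[0,t]` with `M` time bins:
`(⟨0|_a ⊗ 1) O (|0⟩_a ⊗ 1) = ∑_{m < M} |m⟩⟨m| ⊗ H(m t / M) / α`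
on the span of the time indices `m < M`.  If `M` is not a power of two, nothing is
prescribed on inputs whose time index is not one of `0, …, M - 1`. -/
def IsHamT {ns na M : ℕ} (O : Operator (OracleReg ns na M)) (H : ℝ → Operator (Fin ns))
    (α t : ℝ) : Prop :=
  O ∈ Matrix.unitaryGroup (OracleReg ns na M → Bool) ℂ ∧
    ∀ (m' m : Fin (Nat.clog 2 M) → Bool) (x y : Fin ns → Bool), bitsVal m < M →
      O (Sum.elim m' (Sum.elim (fun _ => false) x)) (Sum.elim m (Sum.elim (fun _ => false) y)) =
        if m' = m then H ((bitsVal m : ℝ) * t / (M : ℝ)) x y / (α : ℂ) else 0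

/-! ### Circuits with duplicated registers -/

/-- Ancilla qubits of the construction with duplicated registers: `K` copies of the ancilla
register `a` and of the time register `d` of the oracle, a unary order register `b`, a flag
register `c` of two qubits, a qubit `p` that rescales the success amplitude, and `w` work qubits. -/
inductive DupAncilla (na M K w : ℕ) : Type where
  | a (j : Fin K) (i : Fin na) : DupAncilla na M K w
  | b (j : Fin K) : DupAncilla na M K w
  | c (i : Fin 2) : DupAncilla na M K w
  | d (j : Fin K) (i : Fin (Nat.clog 2 M)) : DupAncilla na M K w
  | p : DupAncilla na M K w
  | work (i : Fin w) : DupAncilla na M K w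
  deriving DecidableEq, Fintype

/-- All qubits of the construction with duplicated registers. -/
abbrev DupQubit (ns na M K w : ℕ) := Fin ns ⊕ DupAncilla na M K w

/-- The amplitude of `|m₁, …, m_K⟩` in the time-ordered index state `|s_k⟩`, the uniform
superposition of all `|m₁, …, m_k, 0, …, 0⟩` with `0 ≤ m₁ < ⋯ < m_k < M`. -/
def timeOrderedState (M K k : ℕ) (m : Fin K → ℕ) : ℝ :=
  open Classical in
  if (∀ i j : Fin K, i < j → (j : ℕ) < k → m i < m j) ∧ (∀ j : Fin K, (j : ℕ) < k → m j < M) ∧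
      (∀ j : Fin K, k ≤ (j : ℕ) → m j = 0)
  then √(1 / (M.choose k : ℝ)) else 0

/-- The amplitude with which rejection sampling from all of `{0, …, M-1}^k` yields `|s_k⟩`. -/
def rejectionAmplitude (M k : ℕ) : ℝ := √((M.choose k : ℝ) / (M : ℝ) ^ k)

section Dup

variable {ns na M K w : ℕ}

/-- The qubits of the `j`-th copy of the oracle's registers (sharing the system register),
with the `j`-th qubit of `b` as control. -/
def copyEmbedding (j : Fin K) : Option (OracleReg ns na M) ↪ DupQubit ns na M K w where
  toFun
    | none => .inr (.b j)
    | some (.inl i) => .inr (.d j i)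
    | some (.inr (.inl i)) => .inr (.a j i)
    | some (.inr (.inr i)) => .inl i
  inj' := by
    rintro (_ | _ | _ | _) (_ | _ | _ | _) h <;> simp_all

/-- The two flag qubits. -/
def flagEmbedding : Fin 2 ↪ DupQubit ns na M K w where
  toFun i := .inr (.c i)
  inj' := by
    intro i j h
    simpa using h

/-- The swap of two qubits. -/
def swapGate : Matrix.unitaryGroup (Fin 2 → Bool) ℂ :=
  ⟨Matrix.of fun x y => if x = y ∘ Equiv.swap 0 1 then 1 else 0, by
    have key : ∀ x y : Fin 2 → Bool,
        (x = y ∘ Equiv.swap 0 1) ↔ (y = x ∘ Equiv.swap 0 1) := by decide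
    have invol : ∀ x : Fin 2 → Bool, x = (x ∘ Equiv.swap 0 1) ∘ Equiv.swap 0 1 := by decide
    rw [Matrix.mem_unitaryGroup_iff]
    ext x y
    simp only [Matrix.mul_apply, Matrix.star_apply, Matrix.of_apply, Matrix.one_apply, key x]
    rw [Finset.sum_eq_single (x ∘ Equiv.swap 0 1)]
    · by_cases h : x = y
      · subst h
        simp [← invol x]
      · rw [← invol x]
        simp [h, Ne.symm h]
    · intro z _ hz
      simp [hz]
    · simp⟩

/-- `K` controlled queries in sequence, the `j`-th to the `j`-th copy of the registers, followed
by a swap of the flag qubits. -/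
def hamTK : Circuit (OracleReg ns na M) (DupQubit ns na M K w) :=
  (List.finRange K).map (fun j => Gate.ctrlQuery (copyEmbedding j) false) ++
    [Gate.prim 2 le_rfl flagEmbedding swapGate]

/-- `COEF'† · PREP† · HAM-T_K · PREP · COEF`. -/
def tdsStep (coef coef' prep : Circuit (OracleReg ns na M) (DupQubit ns na M K w)) :
    Circuit (OracleReg ns na M) (DupQubit ns na M K w) :=
  coef ++ prep ++ hamTK ++ prep.adj ++ coef'.adj

/-- One round of oblivious amplitude amplification: `- V · REF · V† · REF · V`, where `V` is
the circuit above. -/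
def dupCircuit (coef coef' prep ref : Circuit (OracleReg ns na M) (DupQubit ns na M K w)) :
    Circuit (OracleReg ns na M) (DupQubit ns na M K w) :=
  tdsStep coef coef' prep ++ ref ++ (tdsStep coef coef' prep).adj ++ ref ++
    tdsStep coef coef' prep ++ [Gate.prim 0 (Nat.zero_le 2) ⟨Fin.elim0, fun i => i.elim0⟩ (-1)]

/-- `coef` is a query-free circuit on the order register, the rescaling qubit and work qubits. -/
def IsCoef (coef : Circuit (OracleReg ns na M) (DupQubit ns na M K w)) : Prop :=
  coef.queries = 0 ∧
    coef.ActsOn ({q | ∃ j, q = .inr (.b j)} ∪ {.inr .p} ∪ {q | ∃ i, q = .inr (.work i)})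

/-- `prep` is a query-free circuit on the registers `b`, `c`, `d` and the work qubits that prepares
the time-ordered index states by rejection sampling: for every `k ≤ K`, with
`|k⟩_b = |0⟩^{⊗ k} |1⟩^{⊗ (K - k)}`,
`PREP |k⟩_b |00⟩_c |0⟩_d = |k⟩_b (γ_k |00⟩_c |s_k⟩_d + |01⟩_c |…⟩_d)`,
work qubits starting and ending in `|0⟩`. -/
def IsPrep (prep : Circuit (OracleReg ns na M) (DupQubit ns na M K w)) : Prop :=
  prep.queries = 0 ∧
    prep.ActsOn ({q | ∃ j, q = .inr (.b j)} ∪ {q | ∃ i, q = .inr (.c i)} ∪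
      {q | ∃ j i, q = .inr (.d j i)} ∪ {q | ∃ i, q = .inr (.work i)}) ∧
    ∀ k ≤ K, ∀ x y : DupQubit ns na M K w → Bool,
      (∀ j : Fin K, y (.inr (.b j)) = decide (k ≤ (j : ℕ))) →
      (∀ i, y (.inr (.c i)) = false) → (∀ j i, y (.inr (.d j i)) = false) →
      (∀ i, y (.inr (.work i)) = false) →
      let same : Prop := ∀ q, (∀ i, q ≠ .inr (.c i)) → (∀ j i, q ≠ .inr (.d j i)) → x q = y q
      (same → x (.inr (.c 0)) = false → x (.inr (.c 1)) = false →
        prep.op 1 x y =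
          ((rejectionAmplitude M k *
            timeOrderedState M K k (fun j => bitsVal fun i => x (.inr (.d j i))) : ℝ) : ℂ)) ∧
      (¬ same ∨ x (.inr (.c 0)) = true → prep.op 1 x y = 0)

/-- `ref` is a query-free circuit which, while the work qubits are in `|0⟩`, implements the
reflection `1 - 2 |0⟩⟨0|` of the ancilla qubits. -/
def IsRef (ref : Circuit (OracleReg ns na M) (DupQubit ns na M K w)) : Prop :=
  ref.queries = 0 ∧
    ∀ x y : DupQubit ns na M K w → Bool, (∀ i, y (.inr (.work i)) = false) →
      ref.op 1 x y =
        open Classical in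
        if x = y then (if ∀ z, y (.inr z) = false then -1 else 1) else 0

end Dup

end DysonSim

end

/-! Both circuits block-encode one half of the same operator, the Dyson series cut off at order `K`
and discretized with strictly increasing grid times, S = ∑_{k ≤ K} (-i t/M)^k ∑_{m_1 < ⋯ < m_k < M}
H(m_k t/M) ⋯ H(m_1 t/M) (`truncatedDyson`), and one round of oblivious amplitude amplification
removes the factor 1/2.

Error of S. Since the times are strictly increasing, the series without cutoff is exactly the Euler
product ∏ (1 - i (t/M) H(m t/M)) (`descProd_eq_sum`). Its distance to the time-ordered exponential
is that of Euler's method: a step of length t/M costs t/M times the variation of H on the bin plus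
(t/M)² max ‖H‖², errors grow by at most e^{αt} < 2, and the total is 2 (t²/M)(⟨‖Ḣ‖⟩ + max ‖H‖²)
(`norm_timeOrderedExp_sub_le`). This is at most ε/10 if M ≥ 20 X. As αt ≤ 1/2, the tail beyond `K`
is at most 1/(K+1)!, and it vanishes if K ≥ M (`truncatedDyson_bounds`). A power of two K + 1 = 2^r
of size O(log(1/ε) / log log(1/ε)) makes the tail at most ε/10; limiting it by the size of M also
keeps r = O(log M) (`exists_truncation_order`).

Amplification. If V has the block B, then -V REF V† REF V has the block 3B - 4BB†B
(`ancillaBlock_amplify`). For B = S/2 this is (3S - SS†S)/2, a map that fixes unitaries and, for ‖S‖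
≤ 2, magnifies the distance to a unitary by at most 5 (`norm_amplify_sub_le`). So the error ε/5 of S
becomes ε, and the failure probability is at most 2ε (`simulates_of_norm_le`).

Weights. Let x = αt and g = ∑_{k ≤ K} x^k, which lies in [1, 2]. The order k is prepared with
amplitude √(x^k/g), and unprepared with the same amplitude times i^k, whose conjugate is (-i)^k, and
times g/2 from the rotation of the qubit `p`. Each time is prepared and unprepared with amplitude
M^{-1/2}, and each query contributes 1/α. The product of all these is (-i t/M)^k / 2.

Duplicated registers. All times are prepared independently and uniformly, and a flag records whether
they fail to be increasing. The swap of the two flag qubits after the queries moves this record to a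
qubit that must end in zero, so that unordered times drop out (`hamTK_apply`,
`ancillaBlock_tdsStep_coef`).

Sequential circuit. Only two time registers are used, in alternation. Each stage prepares a new
time, queries H there, checks that it exceeds the previous time, and then unprepares the previous
one. A stage fails if the order is wrong or a register that should be cleared is not; the label of
the first failure is kept in a register of r + 1 qubits. Ending with this register at zero has the
effect of a projection to success after every stage (`checkedCirc_apply`), and unpreparing with
projection to zero sums over the old time (`Represents.back`). By induction on the stages the
ordered sums build up (`represents_seqStages`). The order is stored in binary, which costs only r
qubits; its geometric amplitudes are then a product state, because K + 1 is a power of two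
(`prod_one_add_pow`).

Circuits are studied through their matrix entries in the computational basis. Classical reversible
logic is compiled from Boolean expressions by computing, copying and uncomputing (`xorEval_fn`),
which is correct only while the work qubits are zero; the predicate `Clean` carries this condition
through products, adjoints and the amplification. -/

set_option linter.unusedSectionVars false

noncomputable section

namespace DysonSim

/-! ### Operators on subregisters -/

section Basic

variable {R Q : Type}

/-- Splits an assignment into its part on the range of `e` and the rest. -/
def splitEquiv (e : R ↪ Q) :
    (Q → Bool) ≃ (R → Bool) × ({q // q ∉ Set.range e} → Bool) :=
  Equiv.ofBijective (fun x => (x ∘ e, fun q => x q)) <| by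
    constructor
    · intro x y h
      simp only [Prod.mk.injEq] at h
      funext q
      by_cases hq : q ∈ Set.range e
      · obtain ⟨r, rfl⟩ := hq
        exact congrFun h.1 r
      · exact congrFun h.2 ⟨q, hq⟩
    · rintro ⟨u, v⟩
      classical
      refine ⟨fun q => if h : q ∈ Set.range e then u h.choose else v ⟨q, h⟩, ?_⟩
      refine Prod.ext (funext fun r => ?_) (funext fun q => ?_)
      · have h : e r ∈ Set.range e := ⟨r, rfl⟩
        have h2 : h.choose = r := e.injective h.choose_spec
        simp only [Function.comp_apply, dif_pos h]
        rw [h2]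
      · simp only [dif_neg q.2]

theorem applyOn_apply (e : R ↪ Q) (U : Operator R) (x y : Q → Bool)
    [Decidable (∀ q, q ∉ Set.range e → x q = y q)] :
    applyOn e U x y = if ∀ q, q ∉ Set.range e → x q = y q then U (x ∘ e) (y ∘ e) else 0 := by
  unfold applyOn
  simp only [Matrix.of_apply]
  congr

theorem controlled_apply (U : Operator R) (x y : Option R → Bool) [DecidableEq (R → Bool)] :
    controlled U x y = if x none = y none then
      (if y none = false then U (x ∘ some) (y ∘ some)
        else if x ∘ some = y ∘ some then 1 else 0) else 0 := by
  unfold controlled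
  simp only [Matrix.of_apply]
  congr

/-- Splitting assignments along the range of `e` turns `applyOn` into a Kronecker product with the
identity; `applyOn_one` and `applyOn_mul` are then facts about Kronecker products. -/
theorem applyOn_eq_submatrix (e : R ↪ Q) (U : Operator R)
    [DecidableEq ({q // q ∉ Set.range e} → Bool)] :
    applyOn e U = (Matrix.kronecker U (1 : Matrix ({q // q ∉ Set.range e} → Bool) _ ℂ)).submatrix
      (splitEquiv e) (splitEquiv e) := by
  classical
  ext x y
  have h1 : ∀ z, (splitEquiv e z).1 = z ∘ e := fun _ => rfl
  have h2 : ∀ z, (splitEquiv e z).2 = fun q : {q // q ∉ Set.range e} => z q := fun _ => rfl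
  rw [applyOn_apply]
  simp only [Matrix.submatrix_apply, Matrix.kronecker, Matrix.kroneckerMap_apply, h1, h2,
    Matrix.one_apply, funext_iff, Subtype.forall]
  split_ifs <;> simp

theorem applyOn_one [DecidableEq (R → Bool)] [DecidableEq (Q → Bool)] (e : R ↪ Q) :
    applyOn e (1 : Operator R) = 1 := by
  classical
  rw [applyOn_eq_submatrix, Matrix.kronecker, Matrix.kroneckerMap_one_one _ (by simp) (by simp)
    (by simp)]
  simp

theorem applyOn_mul [Fintype R] [DecidableEq R] [Fintype Q] [DecidableEq Q] (e : R ↪ Q)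
    (U V : Operator R) : applyOn e (U * V) = applyOn e U * applyOn e V := by
  classical
  rw [applyOn_eq_submatrix, applyOn_eq_submatrix, applyOn_eq_submatrix,
    Matrix.submatrix_mul_equiv]
  congr 1
  rw [Matrix.kronecker, ← Matrix.mul_kronecker_mul, Matrix.one_mul]

theorem applyOn_conjTranspose (e : R ↪ Q) (U : Operator R) :
    applyOn e Uᴴ = (applyOn e U)ᴴ := by
  classical
  ext x y
  simp only [Matrix.conjTranspose_apply, applyOn_apply]
  simp only [eq_comm]
  split_ifs <;> simp

theorem applyOn_mem_unitary [Fintype R] [DecidableEq R] [Fintype Q] [DecidableEq Q] (e : R ↪ Q)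
    {U : Operator R} (hU : U ∈ Matrix.unitaryGroup (R → Bool) ℂ) :
    applyOn e U ∈ Matrix.unitaryGroup (Q → Bool) ℂ := by
  rw [Matrix.mem_unitaryGroup_iff, Matrix.star_eq_conjTranspose, ← applyOn_conjTranspose,
    ← applyOn_mul, ← Matrix.star_eq_conjTranspose, Matrix.mem_unitaryGroup_iff.1 hU, applyOn_one]

/-- The control acts on `false`, so the block of `true` is the identity. Products can be computed
blockwise. -/
theorem controlled_eq_submatrix (U : Operator R) [DecidableEq (R → Bool)] :
    controlled U = (Matrix.blockDiagonal fun b : Bool => if b then 1 else U).submatrix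
      (fun x => (x ∘ some, x none)) (fun x => (x ∘ some, x none)) := by
  ext x y
  rw [controlled_apply]
  simp only [Matrix.submatrix_apply, Matrix.blockDiagonal_apply]
  cases h : x none <;> cases h' : y none <;> simp [Matrix.one_apply]

/-- Splits an assignment into the control bit and the rest. -/
def optionEquiv : (Option R → Bool) ≃ (R → Bool) × Bool where
  toFun x := (x ∘ some, x none)
  invFun p := fun o => o.elim p.2 p.1
  left_inv x := by funext o; cases o <;> rfl
  right_inv p := rfl

theorem controlled_mul [Fintype R] [DecidableEq R] (U V : Operator R) :
    controlled (U * V) = controlled U * controlled V := by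
  have h : ∀ W : Operator R, controlled W =
      (Matrix.blockDiagonal fun b : Bool => if b then 1 else W).submatrix
        optionEquiv optionEquiv := fun W => controlled_eq_submatrix W
  rw [h, h, h, Matrix.submatrix_mul_equiv, ← Matrix.blockDiagonal_mul]
  congr 2
  funext b
  cases b <;> simp

theorem controlled_one [Fintype R] [DecidableEq R] : controlled (1 : Operator R) = 1 := by
  have h : controlled (1 : Operator R) =
      (Matrix.blockDiagonal fun b : Bool => if b then 1 else 1).submatrix
        optionEquiv optionEquiv := controlled_eq_submatrix 1
  rw [h]
  simp only [ite_self]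
  have : (fun _ : Bool => (1 : Operator R)) = 1 := rfl
  rw [this, Matrix.blockDiagonal_one, Matrix.submatrix_one_equiv]

theorem controlled_conjTranspose (U : Operator R) : controlled Uᴴ = (controlled U)ᴴ := by
  classical
  ext x y
  simp only [Matrix.conjTranspose_apply, controlled_apply]
  cases h : x none <;> cases h' : y none <;> simp [eq_comm]

theorem controlled_mem_unitary [Fintype R] [DecidableEq R]
    {U : Operator R} (hU : U ∈ Matrix.unitaryGroup (R → Bool) ℂ) :
    controlled U ∈ Matrix.unitaryGroup (Option R → Bool) ℂ := by
  rw [Matrix.mem_unitaryGroup_iff, Matrix.star_eq_conjTranspose, ← controlled_conjTranspose,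
    ← controlled_mul, ← Matrix.star_eq_conjTranspose, Matrix.mem_unitaryGroup_iff.1 hU,
    controlled_one]

end Basic

/-! ### Circuits -/

section Circuits

variable {R Q : Type}

theorem Gate.adj_op (O : Operator R) (g : Gate R Q) : g.adj.op O = (g.op O)ᴴ := by
  cases g with
  | prim k hk e U => simp [Gate.adj, Gate.op, ← applyOn_conjTranspose, Matrix.star_eq_conjTranspose]
  | query e dag => cases dag <;> simp [Gate.adj, Gate.op, ← applyOn_conjTranspose]
  | ctrlQuery e dag =>
    cases dag <;> simp [Gate.adj, Gate.op, ← applyOn_conjTranspose, ← controlled_conjTranspose]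

theorem Gate.adj_isQuery (g : Gate R Q) : g.adj.isQuery = g.isQuery := by
  cases g <;> rfl

theorem Gate.adj_support (g : Gate R Q) : g.adj.support = g.support := by
  cases g <;> rfl

variable [Fintype Q] [DecidableEq Q]

theorem Gate.op_mem_unitary [Fintype R] [DecidableEq R] {O : Operator R}
    (hO : O ∈ Matrix.unitaryGroup (R → Bool) ℂ) (g : Gate R Q) :
    g.op O ∈ Matrix.unitaryGroup (Q → Bool) ℂ := by
  have hO' : Oᴴ ∈ Matrix.unitaryGroup (R → Bool) ℂ := by
    rw [← Matrix.star_eq_conjTranspose]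
    exact Unitary.star_mem hO
  cases g with
  | prim k hk e U => exact applyOn_mem_unitary e U.2
  | query e dag => cases dag <;> simp only [Gate.op] <;> exact applyOn_mem_unitary e (by simpa)
  | ctrlQuery e dag =>
    cases dag <;> simp only [Gate.op] <;>
      exact applyOn_mem_unitary e (controlled_mem_unitary (by simpa))

namespace Circuit

@[simp] theorem op_nil (O : Operator R) : Circuit.op O ([] : Circuit R Q) = 1 := rfl

@[simp] theorem op_cons (O : Operator R) (g : Gate R Q) (C : Circuit R Q) :
    Circuit.op O (g :: C) = Circuit.op O C * g.op O := rfl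

theorem op_append (O : Operator R) (C D : Circuit R Q) :
    Circuit.op O (C ++ D) = Circuit.op O D * Circuit.op O C := by
  induction C with
  | nil => simp
  | cons g C ih => simp [ih, Matrix.mul_assoc]

theorem op_adj (O : Operator R) (C : Circuit R Q) :
    Circuit.op O C.adj = (Circuit.op O C)ᴴ := by
  induction C with
  | nil => simp [Circuit.adj]
  | cons g C ih =>
    have : Circuit.adj (g :: C) = Circuit.adj C ++ [g.adj] := by simp [Circuit.adj]
    rw [this, op_append, ih]
    simp [Gate.adj_op, Matrix.conjTranspose_mul]

theorem op_mem_unitary [Fintype R] [DecidableEq R] {O : Operator R}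
    (hO : O ∈ Matrix.unitaryGroup (R → Bool) ℂ) (C : Circuit R Q) :
    Circuit.op O C ∈ Matrix.unitaryGroup (Q → Bool) ℂ := by
  induction C with
  | nil => exact one_mem _
  | cons g C ih => exact mul_mem ih (g.op_mem_unitary hO)

theorem queries_append {R Q : Type} (C D : Circuit R Q) :
    Circuit.queries (C ++ D) = C.queries + D.queries := List.countP_append ..

theorem primitives_append {R Q : Type} (C D : Circuit R Q) :
    Circuit.primitives (C ++ D) = C.primitives + D.primitives := List.countP_append ..

theorem queries_adj {R Q : Type} (C : Circuit R Q) : C.adj.queries = C.queries := by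
  simp only [Circuit.adj, Circuit.queries, List.countP_reverse, List.countP_map]
  congr 1
  funext g
  simp [Gate.adj_isQuery]

theorem primitives_adj {R Q : Type} (C : Circuit R Q) : C.adj.primitives = C.primitives := by
  simp only [Circuit.adj, Circuit.primitives, List.countP_reverse, List.countP_map]
  congr 1
  funext g
  simp [Gate.adj_isQuery]

theorem ActsOn.append {R Q : Type} {C D : Circuit R Q} {S : Set Q} (hC : C.ActsOn S)
    (hD : D.ActsOn S) : Circuit.ActsOn (C ++ D) S := by
  intro g hg
  rcases List.mem_append.1 hg with h | h
  exacts [hC g h, hD g h]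

theorem ActsOn.mono {R Q : Type} {C : Circuit R Q} {S T : Set Q} (hC : C.ActsOn S)
    (h : S ⊆ T) : C.ActsOn T := fun g hg => (hC g hg).trans h

theorem ActsOn.adj {R Q : Type} {C : Circuit R Q} {S : Set Q} (hC : C.ActsOn S) :
    C.adj.ActsOn S := by
  intro g hg
  simp only [Circuit.adj, List.mem_reverse, List.mem_map] at hg
  obtain ⟨g', hg', rfl⟩ := hg
  rw [Gate.adj_support]
  exact hC g' hg'

/-- Circuits do not change the qubits on which they do not act. -/
theorem eq_off_of_op_ne_zero (O : Operator R) {C : Circuit R Q} {S : Set Q} (hC : C.ActsOn S)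
    {x y : Q → Bool} (h : Circuit.op O C x y ≠ 0) {q : Q} (hq : q ∉ S) : x q = y q := by
  classical
  induction C generalizing y with
  | nil =>
    by_contra hne
    apply h
    rw [op_nil, Matrix.one_apply_ne]
    rintro rfl
    exact hne rfl
  | cons g C ih =>
    rw [op_cons, Matrix.mul_apply] at h
    obtain ⟨z, -, hz⟩ := Finset.exists_ne_zero_of_sum_ne_zero h
    rw [ih (fun g' hg' => hC g' (List.mem_cons_of_mem _ hg')) (left_ne_zero_of_mul hz)]
    have hs : q ∉ g.support := fun h' => hq (hC g List.mem_cons_self h')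
    have hg := right_ne_zero_of_mul hz
    cases g <;> simp only [Gate.op, applyOn_apply, ne_eq, ite_eq_right_iff, Classical.not_imp] at hg <;>
      exact hg.1 q hs

end Circuit

end Circuits

/-! ### Permutations of basis states and multiplexed one-qubit operators -/

section Ops

variable {R Q : Type} [Fintype Q] [DecidableEq Q]

/-- The operator that maps the basis state `y` to the basis state `f y`. -/
def permOp (f : (Q → Bool) → (Q → Bool)) : Operator Q :=
  Matrix.of fun x y => if x = f y then 1 else 0

theorem permOp_apply (f : (Q → Bool) → (Q → Bool)) (x y : Q → Bool) :
    permOp f x y = if x = f y then 1 else 0 := rfl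

theorem permOp_id : permOp (id : (Q → Bool) → (Q → Bool)) = 1 := by
  ext x y
  simp [permOp_apply, Matrix.one_apply]

theorem mul_permOp_apply (A : Operator Q) (f : (Q → Bool) → (Q → Bool)) (x y : Q → Bool) :
    (A * permOp f) x y = A x (f y) := by
  simp [Matrix.mul_apply, permOp_apply]

theorem permOp_mul (f g : (Q → Bool) → (Q → Bool)) :
    permOp f * permOp g = permOp (f ∘ g) := by
  ext x y
  rw [mul_permOp_apply]
  rfl

theorem permOp_mul_apply {f : (Q → Bool) → (Q → Bool)} (hf : Function.Involutive f)
    (A : Operator Q) (x y : Q → Bool) : (permOp f * A) x y = A (f x) y := by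
  rw [Matrix.mul_apply, Finset.sum_eq_single (f x)]
  · simp [permOp_apply, hf x]
  · intro z _ hz
    rw [permOp_apply, if_neg, zero_mul]
    rintro rfl
    exact hz (hf z).symm
  · simp

/-- A one-qubit operator on `t` that depends on the values of the other qubits. -/
def muxOp (t : Q) (F : (Q → Bool) → Matrix Bool Bool ℂ) : Operator Q :=
  Matrix.of fun x y => if ∀ q, q ≠ t → x q = y q then F y (x t) (y t) else 0

theorem muxOp_apply (t : Q) (F : (Q → Bool) → Matrix Bool Bool ℂ) (x y : Q → Bool) :
    muxOp t F x y = if ∀ q, q ≠ t → x q = y q then F y (x t) (y t) else 0 := rfl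

/-- `F` does not depend on the value of the qubit `t`. -/
def Indep {α : Type} (t : Q) (F : (Q → Bool) → α) : Prop :=
  ∀ x y : Q → Bool, (∀ q, q ≠ t → x q = y q) → F x = F y

theorem sum_eq_of_agree (t : Q) (y : Q → Bool) (g : (Q → Bool) → ℂ)
    (hg : ∀ z, (¬ ∀ q, q ≠ t → z q = y q) → g z = 0) :
    ∑ z, g z = ∑ b, g (Function.update y t b) := by
  rw [← Finset.sum_image (f := g) (s := Finset.univ) (g := fun b => Function.update y t b)]
  · symm
    apply Finset.sum_subset (Finset.subset_univ _)
    intro z _ hz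
    apply hg
    intro h
    apply hz
    rw [Finset.mem_image]
    refine ⟨z t, Finset.mem_univ _, ?_⟩
    funext q
    by_cases hq : q = t
    · subst hq; simp
    · simp [hq, h q hq]
  · intro a _ b _ h
    simpa using congrFun h t

/-- In the product, `F` is read at an intermediate state that differs from the column `y` only at
`t`. Independence of `t` moves it to `y`; for `G` nothing is needed. -/
theorem muxOp_mul (t : Q) {F G : (Q → Bool) → Matrix Bool Bool ℂ} (hF : Indep t F) :
    muxOp t F * muxOp t G = muxOp t fun y => F y * G y := by
  ext x y
  rw [Matrix.mul_apply, sum_eq_of_agree t y]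
  · rw [muxOp_apply]
    have h1 : ∀ b, (∀ q, q ≠ t → x q = Function.update y t b q) ↔ ∀ q, q ≠ t → x q = y q :=
      fun b => forall₂_congr fun q hq => by rw [Function.update_of_ne hq]
    have h2 : ∀ b, ∀ q, q ≠ t → Function.update y t b q = y q :=
      fun b q hq => Function.update_of_ne hq _ _
    simp only [muxOp_apply, h1, if_pos (h2 _), hF _ y (h2 _), Function.update_self]
    split_ifs
    · rw [Matrix.mul_apply]
    · simp
  · intro z hz
    rw [muxOp_apply t G, if_neg hz, mul_zero]

theorem muxOp_one (t : Q) : muxOp t (fun _ => (1 : Matrix Bool Bool ℂ)) = 1 := by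
  ext x y
  rw [muxOp_apply, Matrix.one_apply, Matrix.one_apply]
  have : x = y ↔ (∀ q, q ≠ t → x q = y q) ∧ x t = y t := by
    constructor
    · rintro rfl; simp
    · rintro ⟨h, h'⟩
      funext q
      by_cases hq : q = t
      · rw [hq, h']
      · exact h q hq
  by_cases h : ∀ q, q ≠ t → x q = y q <;> by_cases h' : x t = y t <;> simp_all

theorem muxOp_conjTranspose (t : Q) {F : (Q → Bool) → Matrix Bool Bool ℂ} (hF : Indep t F) :
    (muxOp t F)ᴴ = muxOp t fun y => (F y)ᴴ := by
  ext x y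
  simp only [Matrix.conjTranspose_apply, muxOp_apply, eq_comm (a := y _)]
  split_ifs with h
  · rw [hF x y h]
  · simp

theorem muxOp_mem_unitary (t : Q) {F : (Q → Bool) → Matrix Bool Bool ℂ} (hF : Indep t F)
    (hU : ∀ y, F y ∈ Matrix.unitaryGroup Bool ℂ) :
    muxOp t F ∈ Matrix.unitaryGroup (Q → Bool) ℂ := by
  rw [Matrix.mem_unitaryGroup_iff, Matrix.star_eq_conjTranspose, muxOp_conjTranspose t hF,
    muxOp_mul t hF, ← muxOp_one t]
  congr 1
  funext y
  exact Matrix.mem_unitaryGroup_iff.1 (hU y)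

/-- Gates are defined on one or two qubits; this moves them to the full set of qubits, where all
later computations take place. -/
theorem applyOn_muxOp [Fintype R] [DecidableEq R] (e : R ↪ Q) (t : R)
    (F : (R → Bool) → Matrix Bool Bool ℂ) :
    applyOn e (muxOp t F) = muxOp (e t) fun y => F (y ∘ e) := by
  classical
  ext x y
  rw [applyOn_apply, muxOp_apply, muxOp_apply]
  have : (∀ q, q ≠ e t → x q = y q) ↔ (∀ q, q ∉ Set.range e → x q = y q) ∧
      ∀ r, r ≠ t → (x ∘ e) r = (y ∘ e) r := by
    constructor
    · intro h
      refine ⟨fun q hq => h q ?_, fun r hr => h _ (e.injective.ne hr)⟩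
      rintro rfl
      exact hq ⟨t, rfl⟩
    · rintro ⟨h1, h2⟩ q hq
      by_cases hq' : q ∈ Set.range e
      · obtain ⟨r, rfl⟩ := hq'
        exact h2 r fun h => hq (by rw [h])
      · exact h1 q hq'
  rw [← ite_and]
  exact if_congr this.symm rfl rfl

/-- Conjugation with a permutation of basis states that leaves `t` alone only changes which
one-qubit operator is selected. The Toffoli gate is computed in this way. -/
theorem permOp_conj_muxOp {f : (Q → Bool) → (Q → Bool)} (hf : Function.Involutive f) (t : Q)
    (hft : ∀ x, f x t = x t)
    (hfi : ∀ x y, (∀ q, q ≠ t → x q = y q) → ∀ q, q ≠ t → f x q = f y q)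
    (F : (Q → Bool) → Matrix Bool Bool ℂ) :
    permOp f * (muxOp t F * permOp f) = muxOp t (F ∘ f) := by
  ext x y
  rw [permOp_mul_apply hf, mul_permOp_apply, muxOp_apply, muxOp_apply, hft, hft]
  refine if_congr ⟨fun h => ?_, hfi x y⟩ rfl rfl
  have := hfi _ _ h
  rwa [hf, hf] at this

/-- Adds `g` to the qubit `t`. -/
def flipAt (t : Q) (g : (Q → Bool) → Bool) (y : Q → Bool) : Q → Bool :=
  Function.update y t (y t ^^ g y)

@[simp] theorem flipAt_self (t : Q) (g : (Q → Bool) → Bool) (y : Q → Bool) :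
    flipAt t g y t = (y t ^^ g y) := by simp [flipAt]

end Ops
/-! ### One- and two-qubit gates, and the Toffoli gate -/

section Gates

variable {R Q : Type} [Fintype Q] [DecidableEq Q]

/-- The matrix of the bit flip if `b` is true, else the identity. -/
def xMat (b : Bool) : Matrix Bool Bool ℂ := Matrix.of fun i j => if i = (j ^^ b) then 1 else 0

theorem muxOp_xMat (t : Q) (g : (Q → Bool) → Bool) :
    muxOp t (fun y => xMat (g y)) = permOp (flipAt t g) := by
  ext x y
  rw [muxOp_apply, permOp_apply]
  have : x = flipAt t g y ↔ (∀ q, q ≠ t → x q = y q) ∧ x t = (y t ^^ g y) := by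
    constructor
    · rintro rfl
      exact ⟨fun q hq => Function.update_of_ne hq _ _, by simp⟩
    · rintro ⟨h, h'⟩
      funext q
      by_cases hq : q = t
      · rw [hq, h', flipAt_self]
      · rw [h q hq, flipAt, Function.update_of_ne hq]
  rw [if_congr this rfl rfl, ite_and]
  rfl

theorem xMat_mem_unitary (b : Bool) : xMat b ∈ Matrix.unitaryGroup Bool ℂ := by
  rw [Matrix.mem_unitaryGroup_iff]
  ext i j
  cases b <;> cases i <;> cases j <;>
    simp [Matrix.mul_apply, xMat, Matrix.star_eq_conjTranspose, Matrix.conjTranspose_apply]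

/-- An embedding of two different qubits. -/
def pairEmb (u t : Q) (h : u ≠ t) : Fin 2 ↪ Q where
  toFun i := if i = 0 then u else t
  inj' := by
    intro i j hij
    fin_cases i <;> fin_cases j <;> simp_all

/-- The one-qubit gate `U` on `t`. -/
def gateOne (t : Q) (U : Matrix.unitaryGroup Bool ℂ) : Circuit R Q :=
  [.prim 1 one_le_two ⟨fun _ => t, fun _ _ _ => Subsingleton.elim _ _⟩
    ⟨muxOp 0 fun _ => (U : Matrix Bool Bool ℂ),
      muxOp_mem_unitary 0 (fun _ _ _ => rfl) fun _ => U.2⟩]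

/-- The two-qubit gate that applies `F b` to `t` if the value of `u` is `b`. -/
def gateMux (u t : Q) (F : Bool → Matrix.unitaryGroup Bool ℂ) : Circuit R Q :=
  if h : u ≠ t then
    [.prim 2 le_rfl (pairEmb u t h) ⟨muxOp 1 fun y => (F (y 0) : Matrix Bool Bool ℂ),
      muxOp_mem_unitary 1 (fun x y hxy => by rw [hxy 0 (by decide)]) fun _ => (F _).2⟩]
  else []

theorem gateOne_op (O : Operator R) (t : Q) (U : Matrix.unitaryGroup Bool ℂ) :
    Circuit.op O (gateOne t U) = muxOp t fun _ => (U : Matrix Bool Bool ℂ) := by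
  simp only [gateOne, Circuit.op_cons, Circuit.op_nil, Matrix.one_mul, Gate.op, applyOn_muxOp]
  rfl

theorem gateMux_op (O : Operator R) {u t : Q} (h : u ≠ t)
    (F : Bool → Matrix.unitaryGroup Bool ℂ) :
    Circuit.op O (gateMux u t F) = muxOp t fun y => (F (y u) : Matrix Bool Bool ℂ) := by
  simp only [gateMux, dif_pos h, Circuit.op_cons, Circuit.op_nil, Matrix.one_mul, Gate.op,
    applyOn_muxOp]
  rfl

/-- A circuit without queries, with at most `n` gates, that acts on the qubits in `S`. -/
structure Cost (C : Circuit R Q) (n : ℕ) (S : Set Q) : Prop where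
  queries : C.queries = 0
  primitives : C.primitives ≤ n
  actsOn : C.ActsOn S

theorem Cost.nil (S : Set Q) : Cost ([] : Circuit R Q) 0 S :=
  ⟨rfl, le_rfl, fun _ h => by simp at h⟩

theorem Cost.append {C D : Circuit R Q} {n m : ℕ} {S : Set Q} (hC : Cost C n S)
    (hD : Cost D m S) : Cost (C ++ D) (n + m) S :=
  ⟨by rw [Circuit.queries_append, hC.1, hD.1],
    by rw [Circuit.primitives_append]; exact add_le_add hC.2 hD.2, hC.3.append hD.3⟩

theorem Cost.mono {C : Circuit R Q} {n m : ℕ} {S T : Set Q} (hC : Cost C n S) (h : n ≤ m)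
    (h' : S ⊆ T) : Cost C m T := ⟨hC.1, hC.2.trans h, hC.3.mono h'⟩

theorem Cost.adj {C : Circuit R Q} {n : ℕ} {S : Set Q} (hC : Cost C n S) : Cost C.adj n S :=
  ⟨by rw [Circuit.queries_adj, hC.1], by rw [Circuit.primitives_adj]; exact hC.2, hC.3.adj⟩

theorem Cost.flatMap {α : Type} {f : α → Circuit R Q} {n : ℕ} {S : Set Q} {l : List α}
    (h : ∀ a ∈ l, Cost (f a) n S) : Cost (l.flatMap f) (l.length * n) S := by
  induction l with
  | nil => simpa using Cost.nil S
  | cons a l ih =>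
    rw [List.flatMap_cons, List.length_cons]
    exact ((h a List.mem_cons_self).append
      (ih fun b hb => h b (List.mem_cons_of_mem _ hb))).mono (by linarith) subset_rfl

theorem gateOne_cost (t : Q) (U : Matrix.unitaryGroup Bool ℂ) {S : Set Q} (ht : t ∈ S) :
    Cost (gateOne t U : Circuit R Q) 1 S := by
  refine ⟨rfl, le_rfl, fun g hg => ?_⟩
  simp only [gateOne, List.mem_singleton] at hg
  subst hg
  rintro _ ⟨_, rfl⟩
  exact ht

theorem gateMux_cost (u t : Q) (F : Bool → Matrix.unitaryGroup Bool ℂ) {S : Set Q} (hu : u ∈ S)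
    (ht : t ∈ S) : Cost (gateMux u t F : Circuit R Q) 1 S := by
  unfold gateMux
  split_ifs
  · refine ⟨rfl, le_rfl, fun g hg => ?_⟩
    simp only [List.mem_singleton] at hg
    subst hg
    rintro _ ⟨i, rfl⟩
    change (if i = 0 then u else t) ∈ S
    split_ifs <;> assumption
  · exact (Cost.nil S).mono (by simp) subset_rfl

/-- The bit flip on `t`. -/
def notGate (t : Q) : Circuit R Q := gateOne t ⟨xMat true, xMat_mem_unitary _⟩

/-- Adds `u` to `t`. -/
def cnotGate (u t : Q) : Circuit R Q := gateMux u t fun b => ⟨xMat b, xMat_mem_unitary _⟩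

theorem notGate_op (O : Operator R) (t : Q) :
    Circuit.op O (notGate t) = permOp (flipAt t fun _ => true) := by
  rw [notGate, gateOne_op, ← muxOp_xMat]

theorem cnotGate_op (O : Operator R) {u t : Q} (h : u ≠ t) :
    Circuit.op O (cnotGate u t) = permOp (flipAt t fun y => y u) := by
  rw [cnotGate, gateMux_op O h, ← muxOp_xMat]

/-- A square root of the bit flip. -/
def sqrtX : Matrix Bool Bool ℂ :=
  Matrix.of fun i j => if i = j then (1 + Complex.I) / 2 else (1 - Complex.I) / 2

theorem sqrtX_mul_self : sqrtX * sqrtX = xMat true := by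
  ext i j
  cases i <;> cases j <;> simp [Matrix.mul_apply, sqrtX, xMat] <;> ring_nf <;>
    simp [Complex.I_sq] <;> norm_num

theorem sqrtX_mem_unitary : sqrtX ∈ Matrix.unitaryGroup Bool ℂ := by
  rw [Matrix.mem_unitaryGroup_iff]
  have h2 : (starRingEnd ℂ) 2 = 2 := map_ofNat _ 2
  ext i j
  cases i <;> cases j <;>
    simp [Matrix.mul_apply, sqrtX, Matrix.star_eq_conjTranspose, Matrix.conjTranspose_apply,
      h2] <;> ring_nf <;> simp [Complex.I_sq] <;> norm_num

/-- The gate controlled by `u` that applies `U` to `t` if `u` is true. -/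
def ctrlGate (u t : Q) (U : Matrix.unitaryGroup Bool ℂ) : Circuit R Q :=
  gateMux u t fun b => if b then U else 1

/-- The Toffoli gate, adding the conjunction of `u` and `v` to `t`. -/
def toffoli (u v t : Q) : Circuit R Q :=
  ctrlGate v t ⟨sqrtX, sqrtX_mem_unitary⟩ ++ (cnotGate u v ++
    (ctrlGate v t (star ⟨sqrtX, sqrtX_mem_unitary⟩) ++ (cnotGate u v ++
      ctrlGate u t ⟨sqrtX, sqrtX_mem_unitary⟩)))

theorem flipAt_involutive {t : Q} {g : (Q → Bool) → Bool} (hg : Indep t g) :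
    Function.Involutive (flipAt t g) := by
  intro x
  have h : g (flipAt t g x) = g x := hg _ _ fun q hq => Function.update_of_ne hq _ _
  funext q
  by_cases hq : q = t
  · subst hq
    rw [flipAt_self, flipAt_self, h]
    simp
  · simp [flipAt, Function.update_of_ne hq]

/-- The exponents of the square root of the flip add up to v - (u ⊕ v) + u = 2uv, and its square is
the flip. -/
theorem toffoli_op (O : Operator R) {u v t : Q} (huv : u ≠ v) (hut : u ≠ t) (hvt : v ≠ t) :
    Circuit.op O (toffoli u v t) = permOp (flipAt t fun y => y u && y v) := by
  have hcn : Indep v fun y : Q → Bool => y u := fun x y h => h u huv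
  rw [toffoli]
  simp only [Circuit.op_append, ctrlGate, gateMux_op O hut, gateMux_op O hvt, cnotGate_op O huv]
  -- Regrouped so that the two additions of `u` to `v` conjugate the gate between them.
  rw [show ∀ A P B C : Operator Q, A * P * B * P * C = A * (P * (B * P)) * C from
    fun A P B C => by simp only [Matrix.mul_assoc]]
  rw [permOp_conj_muxOp (flipAt_involutive hcn) t
    (fun x => Function.update_of_ne hvt.symm _ _)
    (fun x y h q hq => by
      by_cases hqv : q = v
      · subst hqv
        rw [flipAt_self, flipAt_self, h q hq, h u hut]
      · simp only [flipAt, Function.update_of_ne hqv, h q hq]),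
    muxOp_mul t, muxOp_mul t, ← muxOp_xMat]
  · congr 1
    funext y
    have h1 : flipAt v (fun y => y u) y v = (y v ^^ y u) := flipAt_self _ _ _
    simp only [Function.comp_apply, h1]
    have hs := Matrix.mem_unitaryGroup_iff.1 sqrtX_mem_unitary
    have hs' := Matrix.mem_unitaryGroup_iff'.1 sqrtX_mem_unitary
    have h0 : xMat false = 1 := by
      ext i j
      simp [xMat, Matrix.one_apply]
    cases y u <;> cases y v <;> simp [hs, hs', h0, sqrtX_mul_self]
  · intro x y h
    simp only [h u hut, h v hvt, Function.comp_apply, flipAt_self]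
  · intro x y h
    simp only [h u hut]

theorem toffoli_cost (u v t : Q) {S : Set Q} (hu : u ∈ S) (hv : v ∈ S) (ht : t ∈ S) :
    Cost (toffoli u v t : Circuit R Q) 5 S :=
  (gateMux_cost v t _ hv ht).append <| (gateMux_cost u v _ hu hv).append <|
    (gateMux_cost v t _ hv ht).append <| (gateMux_cost u v _ hu hv).append <|
      gateMux_cost u t _ hu ht

end Gates
/-! ### Classical reversible programs and Boolean expressions -/

section Classical

variable {R Q : Type} [Fintype Q] [DecidableEq Q]

theorem Indep.flipAt_flipAt {t : Q} {g g' : (Q → Bool) → Bool} (hg : Indep t g) (x : Q → Bool) :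
    flipAt t g (flipAt t g' x) = flipAt t (fun y => g' y ^^ g y) x := by
  have h : g (flipAt t g' x) = g x := hg _ _ fun q hq => Function.update_of_ne hq _ _
  funext q
  by_cases hq : q = t
  · subst hq
    simp only [flipAt_self, h, Bool.xor_assoc]
  · simp [flipAt, Function.update_of_ne hq]

/-- An elementary step of a classical reversible program. -/
inductive Step (Q : Type) : Type where
  | not (t : Q) : Step Q
  | cnot (u t : Q) : Step Q
  | tof (g : Bool → Bool → Bool) (u v t : Q) : Step Q

namespace Step

/-- The action of a step on basis states. -/
def fn : Step Q → (Q → Bool) → (Q → Bool)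
  | not t => flipAt t fun _ => true
  | cnot u t => flipAt t fun y => y u
  | tof g u v t => flipAt t fun y => g (y u) (y v)

/-- The qubits of a step are different. -/
def WF : Step Q → Prop
  | not _ => True
  | cnot u t => u ≠ t
  | tof _ u v t => u ≠ v ∧ u ≠ t ∧ v ≠ t

/-- The qubits of a step. -/
def qubits : Step Q → Set Q
  | not t => {t}
  | cnot u t => {u, t}
  | tof _ u v t => {u, v, t}

/-- The circuit of a step. -/
def circ : Step Q → Circuit R Q
  | not t => notGate t
  | cnot u t => cnotGate u t
  | tof g u v t =>
    -- The algebraic normal form of `g` over the field with two elements: the coefficients of 1, u,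
    -- v and uv decide which gates occur.
    (if g false false then notGate t else []) ++
      ((if g false false ^^ g true false then cnotGate u t else []) ++
        ((if g false false ^^ g false true then cnotGate v t else []) ++
          if (g false false ^^ g true false) ^^ (g false true ^^ g true true) then toffoli u v t
          else []))

theorem circ_op (O : Operator R) {s : Step Q} (hs : s.WF) :
    Circuit.op O s.circ = permOp s.fn := by
  cases s with
  | not t => exact notGate_op O t
  | cnot u t => exact cnotGate_op O hs
  | tof g u v t =>
    obtain ⟨huv, hut, hvt⟩ := hs
    have h0 : ∀ b : Bool, Circuit.op O (if b then notGate t else []) =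
        permOp (flipAt t fun _ => b) := by
      intro b
      cases b
      · have : flipAt t (fun _ : Q → Bool => false) = id := by funext x; simp [flipAt]
        simp [this, permOp_id]
      · exact notGate_op O t
    have h1 : ∀ b : Bool, ∀ w, w ≠ t → Circuit.op O (if b then cnotGate w t else []) =
        permOp (flipAt t fun y => b && y w) := by
      intro b w hw
      cases b
      · have : flipAt t (fun _ : Q → Bool => false) = id := by funext x; simp [flipAt]
        simp [this, permOp_id]
      · simpa using cnotGate_op O hw
    have h2 : ∀ b : Bool, Circuit.op O (if b then toffoli u v t else []) =
        permOp (flipAt t fun y => b && (y u && y v)) := by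
      intro b
      cases b
      · have : flipAt t (fun _ : Q → Bool => false) = id := by funext x; simp [flipAt]
        simp [this, permOp_id]
      · simpa using toffoli_op O huv hut hvt
    simp only [circ, Circuit.op_append, h0, h1 _ u hut, h1 _ v hvt, h2, permOp_mul]
    congr 1
    funext x
    have i1 : ∀ b : Bool, Indep t fun y : Q → Bool => b && y u :=
      fun b x y h => by simp only [h u hut]
    have i2 : ∀ b : Bool, Indep t fun y : Q → Bool => b && y v :=
      fun b x y h => by simp only [h v hvt]
    have i3 : ∀ b : Bool, Indep t fun y : Q → Bool => b && (y u && y v) :=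
      fun b x y h => by simp only [h u hut, h v hvt]
    simp only [Function.comp_apply, (i1 _).flipAt_flipAt, (i2 _).flipAt_flipAt,
      (i3 _).flipAt_flipAt, fn]
    congr 1
    funext y
    cases y u <;> cases y v <;> cases g false false <;> cases g true false <;>
      cases g false true <;> cases g true true <;> rfl

/-- The worst case is a flip, two controlled flips and a Toffoli gate of five gates. -/
theorem circ_cost {s : Step Q} {S : Set Q} (h : s.qubits ⊆ S) :
    Cost (s.circ : Circuit R Q) 8 S := by
  cases s with
  | not t => exact (gateOne_cost t _ (h rfl)).mono (by norm_num) subset_rfl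
  | cnot u t =>
    have : Cost (cnotGate u t : Circuit R Q) 1 S :=
      gateMux_cost u t _ (h (Or.inl rfl)) (h (Or.inr rfl))
    exact this.mono (by norm_num) subset_rfl
  | tof g u v t =>
    have hu : u ∈ S := h (Or.inl rfl)
    have hv : v ∈ S := h (Or.inr (Or.inl rfl))
    have ht : t ∈ S := h (Or.inr (Or.inr rfl))
    have hif : ∀ (b : Bool) (C : Circuit R Q) (n : ℕ), Cost C n S →
        Cost (if b then C else []) n S := by
      intro b C n hC
      cases b
      · exact (Cost.nil S).mono (Nat.zero_le _) subset_rfl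
      · exact hC
    exact ((hif _ _ _ (gateOne_cost t _ ht)).append <| (hif _ _ _ (gateMux_cost u t _ hu ht)).append
      <| (hif _ _ _ (gateMux_cost v t _ hv ht)).append <|
        hif _ _ _ (toffoli_cost u v t hu hv ht)).mono (by norm_num) subset_rfl

theorem fn_involutive {s : Step Q} (hs : s.WF) : Function.Involutive s.fn := by
  cases s with
  | not t => exact flipAt_involutive fun _ _ _ => rfl
  | cnot u t => exact flipAt_involutive fun x y h => h u hs
  | tof g u v t => exact flipAt_involutive fun x y h => by rw [h u hs.2.1, h v hs.2.2]

theorem fn_of_notMem {s : Step Q} {q : Q} (hq : q ∉ s.qubits) (x : Q → Bool) : s.fn x q = x q := by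
  cases s <;> simp only [qubits, Set.mem_insert_iff, Set.mem_singleton_iff, not_or] at hq <;>
    simp [fn, flipAt, hq]

theorem fn_update {s : Step Q} {q : Q} (hq : q ∉ s.qubits) (x : Q → Bool) (b : Bool) :
    s.fn (Function.update x q b) = Function.update (s.fn x) q b := by
  cases s <;> simp only [qubits, Set.mem_insert_iff, Set.mem_singleton_iff, not_or] at hq <;>
    simp only [fn, flipAt] <;> rw [Function.update_comm (by tauto)] <;>
    simp [eq_comm, hq]

end Step

/-- The action of a program on basis states. -/
def stepsFn : List (Step Q) → (Q → Bool) → (Q → Bool)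
  | [] => id
  | s :: l => stepsFn l ∘ s.fn

theorem stepsFn_append (l l' : List (Step Q)) (x : Q → Bool) :
    stepsFn (l ++ l') x = stepsFn l' (stepsFn l x) := by
  induction l generalizing x with
  | nil => rfl
  | cons s l ih => exact ih _

/-- Every step is an involution, so running a program backwards uncomputes it. -/
theorem stepsFn_reverse {l : List (Step Q)} (hl : ∀ s ∈ l, s.WF) (x : Q → Bool) :
    stepsFn l.reverse (stepsFn l x) = x := by
  induction l generalizing x with
  | nil => rfl
  | cons s l ih =>
    rw [List.reverse_cons, stepsFn_append]
    change s.fn (stepsFn l.reverse (stepsFn l (s.fn x))) = x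
    rw [ih fun s' hs' => hl s' (List.mem_cons_of_mem _ hs')]
    exact Step.fn_involutive (hl s List.mem_cons_self) x

theorem stepsFn_of_notMem {l : List (Step Q)} {q : Q} (hq : ∀ s ∈ l, q ∉ s.qubits) (x : Q → Bool) :
    stepsFn l x q = x q := by
  induction l generalizing x with
  | nil => rfl
  | cons s l ih =>
    rw [stepsFn, Function.comp_apply, ih fun s' hs' => hq s' (List.mem_cons_of_mem _ hs'),
      Step.fn_of_notMem (hq s List.mem_cons_self)]

/-- A program commutes with changing a qubit that it does not involve. Hence the result of a
computation can be copied out before the computation is undone. -/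
theorem stepsFn_update {l : List (Step Q)} {q : Q} (hq : ∀ s ∈ l, q ∉ s.qubits) (x : Q → Bool)
    (b : Bool) : stepsFn l (Function.update x q b) = Function.update (stepsFn l x) q b := by
  induction l generalizing x with
  | nil => rfl
  | cons s l ih =>
    rw [stepsFn, Function.comp_apply, Step.fn_update (hq s List.mem_cons_self),
      ih fun s' hs' => hq s' (List.mem_cons_of_mem _ hs')]
    rfl

/-- The circuit of a program. -/
def stepsCirc (l : List (Step Q)) : Circuit R Q := l.flatMap Step.circ

theorem stepsCirc_op (O : Operator R) {l : List (Step Q)} (hl : ∀ s ∈ l, s.WF) :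
    Circuit.op O (stepsCirc l) = permOp (stepsFn l) := by
  induction l with
  | nil => exact permOp_id.symm
  | cons s l ih =>
    rw [stepsCirc, List.flatMap_cons, Circuit.op_append, Step.circ_op O (hl s List.mem_cons_self)]
    change Circuit.op O (stepsCirc l) * _ = _
    rw [ih fun s' hs' => hl s' (List.mem_cons_of_mem _ hs'), permOp_mul]
    rfl

theorem stepsCirc_cost {l : List (Step Q)} {S : Set Q} (h : ∀ s ∈ l, s.qubits ⊆ S) :
    Cost (stepsCirc l : Circuit R Q) (l.length * 8) S :=
  Cost.flatMap fun s hs => Step.circ_cost (h s hs)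

/-- Boolean expressions in the values of the qubits. -/
inductive BExp (Q : Type) : Type where
  | const (b : Bool) : BExp Q
  | lit (q : Q) : BExp Q
  | node (g : Bool → Bool → Bool) (E F : BExp Q) : BExp Q

namespace BExp

/-- The value of an expression. -/
def eval : BExp Q → (Q → Bool) → Bool
  | const b, _ => b
  | lit q, x => x q
  | node g E F, x => g (E.eval x) (F.eval x)

/-- The number of nodes of an expression. -/
def size : BExp Q → ℕ
  | const _ => 1
  | lit _ => 1
  | node _ E F => 1 + E.size + F.size

/-- The qubits that occur in an expression. -/
def vars : BExp Q → Set Q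
  | const _ => ∅
  | lit q => {q}
  | node _ E F => E.vars ∪ F.vars

/-- Computes the values of all nodes of an expression into the work qubits from the `i`-th on. -/
def comp (wk : ℕ → Q) : BExp Q → ℕ → List (Step Q)
  | const b, i => if b then [.not (wk i)] else []
  | lit q, i => [.cnot q (wk i)]
  | node g E F, i => E.comp wk (i + 1) ++ (F.comp wk (i + 1 + E.size) ++
      [.tof g (wk (i + 1)) (wk (i + 1 + E.size)) (wk i)])

theorem one_le_size (E : BExp Q) : 1 ≤ E.size := by
  cases E <;> simp only [size] <;> omega

theorem eval_congr {E : BExp Q} {x y : Q → Bool} (h : ∀ q ∈ E.vars, x q = y q) :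
    E.eval x = E.eval y := by
  induction E with
  | const b => rfl
  | lit q => exact h q rfl
  | node g E F hE hF =>
    simp only [eval]
    rw [hE fun q hq => h q (Or.inl hq), hF fun q hq => h q (Or.inr hq)]

theorem length_comp (wk : ℕ → Q) (E : BExp Q) (i : ℕ) : (E.comp wk i).length ≤ E.size := by
  induction E generalizing i with
  | const b => cases b <;> simp [comp, size]
  | lit q => simp [comp, size]
  | node g E F hE hF =>
    have h1 := hE (i + 1)
    have h2 := hF (i + 1 + E.size)
    simp only [comp, size, List.length_append, List.length_singleton]
    omega

theorem qubits_comp (wk : ℕ → Q) (E : BExp Q) (i : ℕ) {s : Step Q} (hs : s ∈ E.comp wk i) :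
    s.qubits ⊆ E.vars ∪ {q | ∃ j, i ≤ j ∧ j < i + E.size ∧ q = wk j} := by
  induction E generalizing i with
  | const b =>
    cases b
    · simp [comp] at hs
    · simp only [comp, if_true, List.mem_singleton] at hs
      subst hs
      rintro q rfl
      exact Or.inr ⟨i, le_rfl, by simp [size], rfl⟩
  | lit q =>
    simp only [comp, List.mem_singleton] at hs
    subst hs
    rintro q' (rfl | rfl)
    · exact Or.inl rfl
    · exact Or.inr ⟨i, le_rfl, by simp [size], rfl⟩
  | node g E F hE hF =>
    simp only [comp, List.mem_append, List.mem_singleton] at hs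
    have hF1 := F.one_le_size
    have hE1 := E.one_le_size
    rcases hs with hs | hs | rfl
    · refine (hE _ hs).trans ?_
      rintro q (hq | ⟨j, h1, h2, rfl⟩)
      · exact Or.inl (Or.inl hq)
      · exact Or.inr ⟨j, by omega, by simp only [size]; omega, rfl⟩
    · refine (hF _ hs).trans ?_
      rintro q (hq | ⟨j, h1, h2, rfl⟩)
      · exact Or.inl (Or.inr hq)
      · exact Or.inr ⟨j, by omega, by simp only [size]; omega, rfl⟩
    · rintro q (rfl | rfl | rfl)
      · exact Or.inr ⟨_, by omega, by simp only [size]; omega, rfl⟩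
      · exact Or.inr ⟨_, by omega, by simp only [size]; omega, rfl⟩
      · exact Or.inr ⟨_, le_rfl, by simp only [size]; omega, rfl⟩

end BExp

/-- The first `N` work qubits are different. -/
def Works (wk : ℕ → Q) (N : ℕ) : Prop := ∀ i < N, ∀ j < N, wk i = wk j → i = j

/-- The first `N` work qubits are zero. -/
def Clear (wk : ℕ → Q) (N : ℕ) (x : Q → Bool) : Prop := ∀ j < N, x (wk j) = false

/-- The qubit is not one of the first `N` work qubits. -/
def Free (wk : ℕ → Q) (N : ℕ) (q : Q) : Prop := ∀ j < N, q ≠ wk j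

namespace BExp

variable {wk : ℕ → Q} {N : ℕ}

theorem comp_WF (hw : Works wk N) {E : BExp Q} (hE : ∀ q ∈ E.vars, Free wk N q) {i : ℕ}
    (hi : i + E.size ≤ N) {s : Step Q} (hs : s ∈ E.comp wk i) : s.WF := by
  induction E generalizing i with
  | const b => cases b <;> simp [comp] at hs; subst hs; trivial
  | lit q =>
    simp only [comp, List.mem_singleton] at hs
    subst hs
    exact hE q rfl i (by simp only [size] at hi; omega)
  | node g E F ihE ihF =>
    simp only [comp, List.mem_append, List.mem_singleton] at hs
    simp only [size] at hi
    have hF1 := F.one_le_size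
    have hE1 := E.one_le_size
    rcases hs with hs | hs | rfl
    · exact ihE (fun q hq => hE q (Or.inl hq)) (by omega) hs
    · exact ihF (fun q hq => hE q (Or.inr hq)) (by omega) hs
    · refine ⟨fun h => ?_, fun h => ?_, fun h => ?_⟩
      · have := hw _ (by omega) _ (by omega) h
        omega
      · have := hw _ (by omega) _ (by omega) h
        omega
      · have := hw _ (by omega) _ (by omega) h
        omega

theorem stepsFn_comp_off {E : BExp Q} (hE : ∀ q ∈ E.vars, Free wk N q) {i : ℕ}
    (hi : i + E.size ≤ N) (x : Q → Bool) {q : Q}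
    (hq : ∀ j, i ≤ j → j < i + E.size → q ≠ wk j) : stepsFn (E.comp wk i) x q = x q := by
  induction E generalizing i x with
  | const b =>
    cases b
    · simp [comp, stepsFn]
    · simp [comp, stepsFn, Step.fn, flipAt, hq i le_rfl (by simp [size])]
  | lit q' =>
    simp [comp, stepsFn, Step.fn, flipAt, hq i le_rfl (by simp [size])]
  | node g E F ihE ihF =>
    simp only [size] at hi hq
    simp only [comp, stepsFn_append]
    simp only [stepsFn, Step.fn, flipAt, Function.comp_apply, id,
      Function.update_of_ne (hq i le_rfl (by omega))]
    rw [ihF (fun q hq => hE q (Or.inr hq)) (by omega) _ fun j h1 h2 => hq j (by omega) (by omega),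
      ihE (fun q hq => hE q (Or.inl hq)) (by omega) _ fun j h1 h2 => hq j (by omega) (by omega)]

/-- The two subexpressions use disjoint blocks of work qubits and no variable is a work qubit, so
the value of `E` survives the computation of `F`, and `F` sees the original variables. -/
theorem stepsFn_comp_root {E : BExp Q} (hw : Works wk N) (hE : ∀ q ∈ E.vars, Free wk N q) {i : ℕ}
    (hi : i + E.size ≤ N) {x : Q → Bool}
    (hx : ∀ j, i ≤ j → j < i + E.size → x (wk j) = false) :
    stepsFn (E.comp wk i) x (wk i) = E.eval x := by
  induction E generalizing i x with
  | const b =>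
    have := hx i le_rfl (by simp [size])
    cases b <;> simp [comp, stepsFn, Step.fn, eval, this]
  | lit q' =>
    have := hx i le_rfl (by simp [size])
    simp [comp, stepsFn, Step.fn, eval, this]
  | node g E F ihE ihF =>
    simp only [size] at hi hx
    have hF1 := F.one_le_size
    have hE1 := E.one_le_size
    have hEv : ∀ q ∈ E.vars, Free wk N q := fun q hq => hE q (Or.inl hq)
    have hFv : ∀ q ∈ F.vars, Free wk N q := fun q hq => hE q (Or.inr hq)
    simp only [comp, stepsFn_append]
    simp only [stepsFn, Step.fn, Function.comp_apply, id, flipAt_self, eval]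
    have hne : ∀ j k, j < N → k < N → j ≠ k → wk j ≠ wk k :=
      fun j k hj hk hjk h => hjk (hw j hj k hk h)
    rw [stepsFn_comp_off hFv (by omega) _ (q := wk i)
        (fun j h1 h2 => hne _ _ (by omega) (by omega) (by omega)),
      stepsFn_comp_off hEv (by omega) _ (q := wk i)
        (fun j h1 h2 => hne _ _ (by omega) (by omega) (by omega)),
      stepsFn_comp_off hFv (by omega) _ (q := wk (i + 1))
        (fun j h1 h2 => hne _ _ (by omega) (by omega) (by omega)),
      ihE hEv (by omega) (fun j h1 h2 => hx j (by omega) (by omega)),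
      ihF hFv (by omega) (fun j h1 h2 => by
        rw [stepsFn_comp_off hEv (by omega) _
          (fun k h3 h4 => hne _ _ (by omega) (by omega) (by omega))]
        exact hx j (by omega) (by omega)),
      hx i le_rfl (by omega), Bool.false_xor]
    congr 1
    refine eval_congr fun q hq => ?_
    exact stepsFn_comp_off hEv (by omega) _ fun j h1 h2 => hFv q hq j (by omega)

end BExp

variable {wk : ℕ → Q} {N : ℕ}

/-- Adds the value of `E` to the qubit `t`. -/
def xorEval (wk : ℕ → Q) (E : BExp Q) (t : Q) : List (Step Q) :=
  E.comp wk 1 ++ (.cnot (wk 1) t :: (E.comp wk 1).reverse)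

theorem xorEval_WF (hw : Works wk N) {E : BExp Q} (hE : ∀ q ∈ E.vars, Free wk N q)
    (hN : E.size < N) {t : Q} (ht : ∀ j, 1 ≤ j → j < N → t ≠ wk j) {s : Step Q}
    (hs : s ∈ xorEval wk E t) : s.WF := by
  have h1 := E.one_le_size
  simp only [xorEval, List.mem_append, List.mem_cons, List.mem_reverse] at hs
  rcases hs with hs | rfl | hs
  · exact BExp.comp_WF hw hE (by omega) hs
  · exact (ht 1 le_rfl (by omega)).symm
  · exact BExp.comp_WF hw hE (by omega) hs

/-- Compute, copy, uncompute: the copy to `t` commutes with the computation, which does not involve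
`t`, and the reversed program then cancels it. The computation starts at `wk 1`, so `t` may be `wk
0`. -/
theorem xorEval_fn (hw : Works wk N) {E : BExp Q} (hE : ∀ q ∈ E.vars, Free wk N q)
    (hN : E.size < N) {t : Q} (ht : ∀ j, 1 ≤ j → j < N → t ≠ wk j) (ht' : t ∉ E.vars)
    {x : Q → Bool} (hx : ∀ j, 1 ≤ j → j < N → x (wk j) = false) :
    stepsFn (xorEval wk E t) x = flipAt t E.eval x := by
  have h1 := E.one_le_size
  have havoid : ∀ s ∈ E.comp wk 1, t ∉ s.qubits := by
    intro s hs h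
    rcases BExp.qubits_comp wk E 1 hs h with h | ⟨j, h1, h2, h3⟩
    · exact ht' h
    · exact ht j h1 (by omega) h3
  rw [xorEval, stepsFn_append, stepsFn, Function.comp_apply]
  have : (Step.cnot (wk 1) t).fn (stepsFn (E.comp wk 1) x) =
      stepsFn (E.comp wk 1) (flipAt t E.eval x) := by
    rw [flipAt, stepsFn_update havoid]
    simp only [Step.fn, flipAt]
    rw [BExp.stepsFn_comp_root hw hE (by omega) fun j h2 h3 => hx j h2 (by omega),
      stepsFn_of_notMem havoid]
  rw [this, stepsFn_reverse fun s hs => BExp.comp_WF hw hE (by omega) hs]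

theorem xorEval_cost (wk : ℕ → Q) (E : BExp Q) (t : Q) {S : Set Q} (hE : E.vars ⊆ S) (ht : t ∈ S)
    (hS : ∀ j ≤ E.size, wk j ∈ S) :
    Cost (stepsCirc (xorEval wk E t) : Circuit R Q) (24 * E.size) S := by
  have h1 := E.one_le_size
  have hq : ∀ s ∈ E.comp wk 1, s.qubits ⊆ S := by
    intro s hs
    refine (BExp.qubits_comp wk E 1 hs).trans ?_
    rintro q (hq | ⟨j, h2, h3, rfl⟩)
    · exact hE hq
    · exact hS j (by omega)
  refine (stepsCirc_cost (S := S) ?_).mono ?_ subset_rfl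
  · intro s hs
    simp only [xorEval, List.mem_append, List.mem_cons, List.mem_reverse] at hs
    rcases hs with hs | rfl | hs
    · exact hq s hs
    · rintro q (rfl | rfl)
      · exact hS 1 h1
      · exact ht
    · exact hq s hs
  · have := E.length_comp wk 1
    simp only [xorEval, List.length_append, List.length_cons, List.length_reverse]
    omega

/-- Flips the qubits in the list `ts`. -/
def flipList (ts : List Q) (x : Q → Bool) : Q → Bool := fun q => x q ^^ decide (q ∈ ts)

/-- If the value of `E` is true, flips all qubits in `ts`. -/
def condFlip (wk : ℕ → Q) (E : BExp Q) (ts : List Q) : List (Step Q) :=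
  xorEval wk E (wk 0) ++ (ts.map (Step.cnot (wk 0)) ++ xorEval wk E (wk 0))

theorem stepsFn_map_cnot {u : Q} {ts : List Q} (hu : u ∉ ts) (hts : ts.Nodup) (x : Q → Bool) :
    stepsFn (ts.map (Step.cnot u)) x = if x u then flipList ts x else x := by
  induction ts generalizing x with
  | nil =>
    have : flipList [] x = x := by funext q; simp [flipList]
    simp [stepsFn, this]
  | cons t ts ih =>
    simp only [List.mem_cons, not_or] at hu
    rw [List.nodup_cons] at hts
    rw [List.map_cons, stepsFn, Function.comp_apply, ih hu.2 hts.2]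
    have h1 : (Step.cnot u t).fn x u = x u := by
      simp [Step.fn, flipAt, hu.1]
    rw [h1]
    cases hxu : x u
    · simp [Step.fn, flipAt, hxu]
    · simp only [if_true]
      funext q
      by_cases hq : q = t
      · subst hq
        simp [flipList, Step.fn, hts.1, hxu]
      · simp [flipList, Step.fn, flipAt, hq]

theorem condFlip_WF (hw : Works wk N) {E : BExp Q} (hE : ∀ q ∈ E.vars, Free wk N q)
    (hN : E.size < N) {ts : List Q} (hts : ∀ t ∈ ts, Free wk N t) {s : Step Q}
    (hs : s ∈ condFlip wk E ts) : s.WF := by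
  have h0 : ∀ j, 1 ≤ j → j < N → wk 0 ≠ wk j := by
    intro j h1 h2 h
    have := hw 0 (by omega) j h2 h
    omega
  simp only [condFlip, List.mem_append, List.mem_map] at hs
  rcases hs with hs | ⟨t, ht, rfl⟩ | hs
  · exact xorEval_WF hw hE hN h0 hs
  · exact (hts t ht 0 (by omega)).symm
  · exact xorEval_WF hw hE hN h0 hs

/-- The value of `E` sits in `wk 0` while the flips are made and is then computed again to clear `wk
0`. This works only if the flips do not change the value, which is `hinv`. -/
theorem condFlip_fn (hw : Works wk N) {E : BExp Q} (hE : ∀ q ∈ E.vars, Free wk N q)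
    (hN : E.size < N) {ts : List Q} (hts : ∀ t ∈ ts, Free wk N t) (hnd : ts.Nodup)
    {x : Q → Bool} (hx : Clear wk N x) (hinv : E.eval (flipList ts x) = E.eval x) :
    stepsFn (condFlip wk E ts) x = if E.eval x then flipList ts x else x := by
  have h0 : ∀ j, 1 ≤ j → j < N → wk 0 ≠ wk j := by
    intro j h1 h2 h
    have := hw 0 (by omega) j h2 h
    omega
  have h0' : wk 0 ∉ E.vars := fun h => hE _ h 0 (by omega) rfl
  have h0t : wk 0 ∉ ts := fun h => hts _ h 0 (by omega) rfl
  rw [condFlip, stepsFn_append, stepsFn_append,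
    xorEval_fn hw hE hN h0 h0' (fun j _ h2 => hx j h2), stepsFn_map_cnot h0t hnd, flipAt_self,
    hx 0 (by omega), Bool.false_xor]
  have hclear : ∀ z : Q → Bool, (∀ j, 1 ≤ j → j < N → z (wk j) = x (wk j)) →
      ∀ j, 1 ≤ j → j < N → z (wk j) = false := fun z hz j h1 h2 => by rw [hz j h1 h2, hx j h2]
  have hf : ∀ j, 1 ≤ j → j < N → flipAt (wk 0) E.eval x (wk j) = x (wk j) :=
    fun j h1 h2 => Function.update_of_ne (h0 j h1 h2).symm _ _
  have hev : E.eval (flipAt (wk 0) E.eval x) = E.eval x :=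
    BExp.eval_congr fun q hq => Function.update_of_ne (hE q hq 0 (by omega)) _ _
  cases hE' : E.eval x
  · simp only [Bool.false_eq_true, if_false]
    rw [xorEval_fn hw hE hN h0 h0' (hclear _ hf), flipAt, hev, hE', flipAt, hE']
    simp
  · simp only [if_true]
    have hcomm : flipList ts (flipAt (wk 0) E.eval x) = flipAt (wk 0) (fun _ => true)
        (flipList ts x) := by
      funext q
      by_cases hq : q = wk 0
      · subst hq
        simp [flipList, h0t, hE']
      · simp [flipList, flipAt, Function.update_of_ne hq]
    rw [hcomm, xorEval_fn hw hE hN h0 h0' (hclear _ fun j h1 h2 => by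
      rw [flipAt, Function.update_of_ne (h0 j h1 h2).symm, flipList]
      have : wk j ∉ ts := fun h => hts _ h j h2 rfl
      simp [this])]
    have hev2 : E.eval (flipAt (wk 0) (fun _ => true) (flipList ts x)) = true := by
      rw [← hE', ← hinv]
      exact BExp.eval_congr fun q hq => Function.update_of_ne (hE q hq 0 (by omega)) _ _
    rw [flipAt, hev2]
    simp [flipAt]

theorem condFlip_cost (wk : ℕ → Q) (E : BExp Q) (ts : List Q) {S : Set Q} (hE : E.vars ⊆ S)
    (ht : ∀ t ∈ ts, t ∈ S) (hS : ∀ j ≤ E.size, wk j ∈ S) :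
    Cost (stepsCirc (condFlip wk E ts) : Circuit R Q) (48 * E.size + 8 * ts.length) S := by
  have h := xorEval_cost (R := R) wk E (wk 0) hE (hS 0 (Nat.zero_le _)) hS
  have hm : Cost (stepsCirc (ts.map (Step.cnot (wk 0))) : Circuit R Q)
      ((ts.map (Step.cnot (wk 0))).length * 8) S := by
    refine stepsCirc_cost ?_
    intro s hs
    obtain ⟨t, ht', rfl⟩ := List.mem_map.1 hs
    rintro q (rfl | rfl)
    · exact hS 0 (Nat.zero_le _)
    · exact ht _ ht'
  have : (stepsCirc (condFlip wk E ts) : Circuit R Q) = stepsCirc (xorEval wk E (wk 0)) ++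
      (stepsCirc (ts.map (Step.cnot (wk 0))) ++ stepsCirc (xorEval wk E (wk 0))) := by
    simp [stepsCirc, condFlip]
  rw [this]
  refine (h.append (hm.append h)).mono ?_ subset_rfl
  rw [List.length_map]
  omega

end Classical
/-! ### Some expressions -/

section Expressions

variable {Q : Type}

namespace BExp

/-- Conjunction of a list of expressions. -/
def all : List (BExp Q) → BExp Q
  | [] => const true
  | E :: l => node and E (all l)

theorem eval_all (l : List (BExp Q)) (x : Q → Bool) :
    (all l).eval x = true ↔ ∀ E ∈ l, E.eval x = true := by
  induction l with
  | nil => simp [all, eval]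
  | cons E l ih => simp [all, eval, ih]

theorem vars_all {l : List (BExp Q)} {S : Set Q} (h : ∀ E ∈ l, E.vars ⊆ S) : (all l).vars ⊆ S := by
  induction l with
  | nil => exact Set.empty_subset _
  | cons E l ih =>
    exact Set.union_subset (h E List.mem_cons_self) (ih fun F hF => h F (List.mem_cons_of_mem _ hF))

theorem size_all {l : List (BExp Q)} {n : ℕ} (h : ∀ E ∈ l, E.size ≤ n) :
    (all l).size ≤ 1 + l.length * (n + 1) := by
  induction l with
  | nil => simp [all, size]
  | cons E l ih =>
    have h1 := h E List.mem_cons_self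
    have h2 := ih fun F hF => h F (List.mem_cons_of_mem _ hF)
    simp only [all, size, List.length_cons]
    nlinarith

/-- The qubit `q` has the value `b`. -/
def litEq (q : Q) (b : Bool) : BExp Q := node (fun u _ => u == b) (lit q) (const true)

/-- All qubits `q i` have the value `b i`. -/
def regEq {ι : Type} (l : List ι) (q : ι → Q) (b : ι → Bool) : BExp Q :=
  all (l.map fun i => litEq (q i) (b i))

theorem eval_regEq {ι : Type} (l : List ι) (q : ι → Q) (b : ι → Bool) (x : Q → Bool) :
    (regEq l q b).eval x = true ↔ ∀ i ∈ l, x (q i) = b i := by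
  simp [regEq, eval_all, litEq, eval]

theorem vars_regEq {ι : Type} {l : List ι} {q : ι → Q} {b : ι → Bool} {S : Set Q}
    (h : ∀ i ∈ l, q i ∈ S) : (regEq l q b).vars ⊆ S := by
  refine vars_all ?_
  simp only [List.mem_map, forall_exists_index, and_imp, forall_apply_eq_imp_iff₂, litEq, vars,
    Set.union_empty, Set.singleton_subset_iff]
  exact h

theorem size_regEq {ι : Type} (l : List ι) (q : ι → Q) (b : ι → Bool) :
    (regEq l q b).size ≤ 1 + l.length * 4 := by
  have := size_all (l := l.map fun i => litEq (q i) (b i)) (n := 3) (by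
    simp [litEq, size])
  rwa [List.length_map] at this

/-- Comparison of two binary numbers, given by their digits. -/
def lt : (n : ℕ) → (Fin n → BExp Q) → (Fin n → BExp Q) → BExp Q
  | 0, _, _ => const false
  | n + 1, a, b =>
    node or (node (fun u v => !u && v) (a (Fin.last n)) (b (Fin.last n)))
      (node and (node (fun u v => u == v) (a (Fin.last n)) (b (Fin.last n)))
        (lt n (fun i => a i.castSucc) (fun i => b i.castSucc)))

end BExp

theorem bitsVal_succ {n : ℕ} (b : Fin (n + 1) → Bool) :
    bitsVal b = bitsVal (fun i => b i.castSucc) + if b (Fin.last n) then 2 ^ n else 0 := by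
  simp [bitsVal, Fin.sum_univ_castSucc]

theorem bitsVal_lt {n : ℕ} (b : Fin n → Bool) : bitsVal b < 2 ^ n := by
  induction n with
  | zero => simp [bitsVal]
  | succ n ih =>
    rw [bitsVal_succ, pow_succ]
    have := ih fun i => b i.castSucc
    split_ifs <;> omega

theorem bitsVal_injective {n : ℕ} : Function.Injective (bitsVal : (Fin n → Bool) → ℕ) := by
  induction n with
  | zero => intro a b _; exact Subsingleton.elim _ _
  | succ n ih =>
    intro a b h
    rw [bitsVal_succ, bitsVal_succ] at h
    have ha := bitsVal_lt fun i => a (Fin.castSucc i)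
    have hb := bitsVal_lt fun i => b (Fin.castSucc i)
    have hl : a (Fin.last n) = b (Fin.last n) := by
      cases h1 : a (Fin.last n) <;> cases h2 : b (Fin.last n) <;> simp_all <;> omega
    rw [hl] at h
    have := ih (Nat.add_right_cancel h)
    funext i
    refine Fin.lastCases hl (fun j => ?_) i
    exact congrFun this j

/-- The binary digits of a number. -/
def natBits (n m : ℕ) : Fin n → Bool := fun i => m.testBit i

theorem bitsVal_natBits {n m : ℕ} (h : m < 2 ^ n) : bitsVal (natBits n m) = m := by
  induction n generalizing m with
  | zero => simp only [pow_zero, Nat.lt_one_iff] at h; simp [bitsVal, h]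
  | succ n ih =>
    have h1 : bitsVal (natBits n (m % 2 ^ n)) = m % 2 ^ n := ih (Nat.mod_lt _ (by positivity))
    have h2 : (fun i : Fin n => natBits (n + 1) m i.castSucc) = natBits n (m % 2 ^ n) := by
      funext i
      simp [natBits, Nat.testBit_mod_two_pow]
    rw [bitsVal_succ, h2, h1]
    have h5 : natBits (n + 1) m (Fin.last n) = true ↔ m / 2 ^ n % 2 = 1 := by
      simp [natBits, Nat.testBit_eq_decide_div_mod_eq]
    simp only [h5]
    rw [pow_succ] at h
    have h3 := Nat.div_add_mod m (2 ^ n)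
    have h4 : m / 2 ^ n < 2 := by
      rw [Nat.div_lt_iff_lt_mul (by positivity)]
      linarith
    interval_cases m / 2 ^ n <;> simp at h3 ⊢ <;> omega

namespace BExp

theorem eval_lt (n : ℕ) (a b : Fin n → BExp Q) (x : Q → Bool) :
    (lt n a b).eval x = decide (bitsVal (fun i => (a i).eval x) < bitsVal fun i => (b i).eval x) := by
  induction n with
  | zero => simp [lt, eval, bitsVal]
  | succ n ih =>
    rw [bitsVal_succ, bitsVal_succ]
    simp only [lt, eval, ih]
    have ha := bitsVal_lt fun i => (a (Fin.castSucc i)).eval x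
    have hb := bitsVal_lt fun i => (b (Fin.castSucc i)).eval x
    cases h1 : (a (Fin.last n)).eval x <;> cases h2 : (b (Fin.last n)).eval x <;> simp <;> omega

theorem vars_lt {n : ℕ} {a b : Fin n → BExp Q} {S : Set Q} (ha : ∀ i, (a i).vars ⊆ S)
    (hb : ∀ i, (b i).vars ⊆ S) : (lt n a b).vars ⊆ S := by
  induction n with
  | zero => exact Set.empty_subset _
  | succ n ih =>
    simp only [lt, vars, Set.union_subset_iff]
    exact ⟨⟨ha _, hb _⟩, ⟨ha _, hb _⟩, ih (fun i => ha _) fun i => hb _⟩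

theorem size_lt {n : ℕ} {a b : Fin n → BExp Q} (ha : ∀ i, (a i).size = 1)
    (hb : ∀ i, (b i).size = 1) : (lt n a b).size = 8 * n + 1 := by
  induction n with
  | zero => rfl
  | succ n ih =>
    simp only [lt, size, ha, hb, ih (fun i => ha i.castSucc) fun i => hb i.castSucc]
    omega

/-- Comparison of two registers. -/
def ltReg (n : ℕ) (a b : Fin n → Q) : BExp Q := lt n (fun i => lit (a i)) fun i => lit (b i)

theorem eval_ltReg (n : ℕ) (a b : Fin n → Q) (x : Q → Bool) :
    (ltReg n a b).eval x = decide (bitsVal (fun i => x (a i)) < bitsVal fun i => x (b i)) :=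
  eval_lt ..

theorem vars_ltReg {n : ℕ} {a b : Fin n → Q} {S : Set Q} (ha : ∀ i, a i ∈ S) (hb : ∀ i, b i ∈ S) :
    (ltReg n a b).vars ⊆ S :=
  vars_lt (fun i => Set.singleton_subset_iff.2 (ha i)) fun i => Set.singleton_subset_iff.2 (hb i)

theorem size_ltReg (n : ℕ) (a b : Fin n → Q) : (ltReg n a b).size = 8 * n + 1 :=
  size_lt (fun _ => rfl) fun _ => rfl

end BExp

end Expressions
/-! ### Circuits that return their work qubits, and oblivious amplitude amplification -/

section Clean

variable {R Q : Type} [Fintype Q] [DecidableEq Q]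

/-- `A` maps basis states with cleared work qubits to such states, and conversely. -/
def Clean (wk : ℕ → Q) (N : ℕ) (A : Operator Q) : Prop :=
  ∀ x y, A x y ≠ 0 → (Clear wk N x ↔ Clear wk N y)

theorem Clean.mul {wk : ℕ → Q} {N : ℕ} {A B : Operator Q} (hA : Clean wk N A)
    (hB : Clean wk N B) : Clean wk N (A * B) := by
  intro x y h
  rw [Matrix.mul_apply] at h
  obtain ⟨z, -, hz⟩ := Finset.exists_ne_zero_of_sum_ne_zero h
  exact (hA x z (left_ne_zero_of_mul hz)).trans (hB z y (right_ne_zero_of_mul hz))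

theorem Clean.one {wk : ℕ → Q} {N : ℕ} : Clean wk N (1 : Operator Q) := by
  intro x y h
  have : x = y := by
    by_contra hne
    exact h (Matrix.one_apply_ne hne)
  rw [this]

theorem Clean.conjTranspose {wk : ℕ → Q} {N : ℕ} {A : Operator Q} (hA : Clean wk N A) :
    Clean wk N Aᴴ := by
  intro x y h
  refine (hA y x fun h0 => h ?_).symm
  rw [Matrix.conjTranspose_apply, h0, star_zero]

theorem sum_normSq_col {ι : Type*} [Fintype ι] [DecidableEq ι] {A : Matrix ι ι ℂ}
    (hA : A ∈ Matrix.unitaryGroup ι ℂ) (y : ι) : ∑ x, ‖A x y‖ ^ 2 = 1 := by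
  have h := congrFun (congrFun (Matrix.mem_unitaryGroup_iff'.1 hA) y) y
  rw [Matrix.mul_apply, Matrix.one_apply_eq] at h
  have h2 : ∀ x, (star A) y x * A x y = ((‖A x y‖ ^ 2 : ℝ) : ℂ) := by
    intro x
    rw [Matrix.star_apply, RCLike.star_def, RCLike.conj_mul]
    push_cast
    rfl
  simp only [h2] at h
  exact_mod_cast h

/-- In finite dimension a unitary that maps a subspace into itself also preserves the orthogonal
complement. Here the subspace is spanned by basis states, and counting squared entries suffices. -/
theorem Clean.of_forward {wk : ℕ → Q} {N : ℕ} {A : Operator Q}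
    (hA : A ∈ Matrix.unitaryGroup (Q → Bool) ℂ)
    (h : ∀ x y, A x y ≠ 0 → Clear wk N y → Clear wk N x) : Clean wk N A := by
  classical
  intro x y hxy
  refine ⟨fun hx => ?_, h x y hxy⟩
  by_contra hy
  set S : Finset (Q → Bool) := Finset.univ.filter fun z => Clear wk N z with hS
  have h1 : ∑ y' ∈ S, ∑ x' ∈ S, ‖A x' y'‖ ^ 2 = S.card := by
    rw [← nsmul_one, ← Finset.sum_const]
    refine Finset.sum_congr rfl fun y' hy' => ?_
    rw [← sum_normSq_col hA y']
    refine Finset.sum_subset (Finset.subset_univ _) fun x' _ hx' => ?_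
    have : A x' y' = 0 := by
      by_contra h0
      exact hx' (by simp only [hS, Finset.mem_filter, Finset.mem_univ, true_and] at hy' ⊢
                    exact h x' y' h0 hy')
    simp [this]
  have hA' : Aᴴ ∈ Matrix.unitaryGroup (Q → Bool) ℂ := by
    rw [← Matrix.star_eq_conjTranspose]
    exact Unitary.star_mem hA
  have h2 : ∑ x' ∈ S, ∑ y', ‖A x' y'‖ ^ 2 = S.card := by
    rw [← nsmul_one, ← Finset.sum_const]
    refine Finset.sum_congr rfl fun x' _ => ?_
    rw [← sum_normSq_col hA' x']
    refine Finset.sum_congr rfl fun y' _ => ?_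
    simp [Matrix.conjTranspose_apply]
  rw [Finset.sum_comm] at h1
  -- The squared entries in S × S already exhaust the rows in S, whose squared norms are one, so all
  -- entries in S × Sᶜ vanish.
  have h3 : ∑ x' ∈ S, (∑ y', ‖A x' y'‖ ^ 2 - ∑ y' ∈ S, ‖A x' y'‖ ^ 2) = 0 := by
    rw [Finset.sum_sub_distrib, h1, h2, sub_self]
  have h4 : ∀ x', ∑ y', ‖A x' y'‖ ^ 2 - ∑ y' ∈ S, ‖A x' y'‖ ^ 2 =
      ∑ y' ∈ Sᶜ, ‖A x' y'‖ ^ 2 := by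
    intro x'
    rw [← Finset.sum_add_sum_compl S]
    ring
  simp only [h4] at h3
  rw [Finset.sum_eq_zero_iff_of_nonneg fun _ _ => Finset.sum_nonneg fun _ _ => by positivity] at h3
  have h5 := h3 x (by simpa [hS] using hx)
  rw [Finset.sum_eq_zero_iff_of_nonneg fun _ _ => by positivity] at h5
  have h6 := h5 y (by simpa [hS] using hy)
  exact hxy (by simpa using h6)

theorem Clean.of_actsOn {wk : ℕ → Q} {N : ℕ} (O : Operator R) {C : Circuit R Q}
    (h : C.ActsOn {q | Free wk N q}) : Clean wk N (Circuit.op O C) := by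
  intro x y hxy
  refine forall₂_congr fun j hj => ?_
  rw [Circuit.eq_off_of_op_ne_zero O h hxy fun hf => hf j hj rfl]

theorem Clean.permOp {wk : ℕ → Q} {N : ℕ} {f : (Q → Bool) → (Q → Bool)}
    (hu : permOp f ∈ Matrix.unitaryGroup (Q → Bool) ℂ)
    (h : ∀ y, Clear wk N y → Clear wk N (f y)) : Clean wk N (permOp f) := by
  refine Clean.of_forward hu fun x y hxy hy => ?_
  rw [permOp_apply] at hxy
  have : x = f y := by
    by_contra hne
    exact hxy (if_neg hne)
  rw [this]
  exact h y hy

end Clean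

/-! ### One round of oblivious amplitude amplification, and failure probabilities. -/

section Amplification

variable {ns : ℕ} {A : Type} [Fintype A] [DecidableEq A]

/-- The isometry that adds ancilla qubits in `|0⟩`. -/
def addAncilla (ns : ℕ) (A : Type) [Fintype A] :
    Matrix (Fin ns ⊕ A → Bool) (Fin ns → Bool) ℂ :=
  Matrix.of fun x y => if x = Sum.elim y fun _ => false then 1 else 0

theorem mul_addAncilla_apply {B : Type*} (X : Matrix B (Fin ns ⊕ A → Bool) ℂ) (x : B)
    (y : Fin ns → Bool) : (X * addAncilla ns A) x y = X x (Sum.elim y fun _ => false) := by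
  simp [Matrix.mul_apply, addAncilla]

theorem ancillaBlock_eq (X : Operator (Fin ns ⊕ A)) :
    ancillaBlock X = (addAncilla ns A)ᴴ * X * addAncilla ns A := by
  ext x y
  rw [mul_addAncilla_apply, Matrix.mul_apply]
  simp [ancillaBlock, addAncilla, Matrix.conjTranspose_apply]

theorem addAncilla_isometry : (addAncilla ns A)ᴴ * addAncilla ns A = 1 := by
  ext x y
  rw [mul_addAncilla_apply, Matrix.conjTranspose_apply, Matrix.one_apply]
  simp only [addAncilla, Matrix.of_apply]
  have : (Sum.elim y (fun _ => false) : Fin ns ⊕ A → Bool) = Sum.elim x (fun _ => false) ↔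
      x = y := by
    constructor
    · intro h
      funext i
      exact (congrFun h (Sum.inl i)).symm
    · rintro rfl; rfl
  rw [if_congr this rfl rfl]
  split_ifs <;> simp

/-- `R` acts as the reflection about the cleared ancillas while the work qubits are cleared. -/
def IsReflection (wk : ℕ → Fin ns ⊕ A) (N : ℕ) (R : Operator (Fin ns ⊕ A)) : Prop :=
  ∀ x y, Clear wk N y → R x y =
    if x = y then (if ∀ z, y (Sum.inr z) = false then -1 else 1) else 0

/-- With ι adding cleared ancillas and P = ιι†, the reflection is 1 - 2P on states with cleared work
qubits, and cleanness of `V` keeps every intermediate state there. Expanding -V(1 - 2P)V†(1 - 2P)V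
between ι† and ι gives -B + 2B + 2B - 4BB†B. -/
theorem ancillaBlock_amplify {wk : ℕ → Fin ns ⊕ A} {N : ℕ} (hwk : ∀ j < N, ∃ a, wk j = Sum.inr a)
    {V R : Operator (Fin ns ⊕ A)} (hV : V ∈ Matrix.unitaryGroup (Fin ns ⊕ A → Bool) ℂ)
    (hc : Clean wk N V) (hR : IsReflection wk N R) :
    ancillaBlock (-(V * (R * (Vᴴ * (R * V))))) =
      (3 : ℂ) • ancillaBlock V - (4 : ℂ) • (ancillaBlock V * (ancillaBlock V)ᴴ * ancillaBlock V) := by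
  classical
  set ι := addAncilla ns A with hι
  have hιι : ιᴴ * ι = 1 := addAncilla_isometry
  have hP : ∀ x y, (ι * ιᴴ) x y = if x = y then (if ∀ z, y (Sum.inr z) = false then 1 else 0) else 0 := by
    intro x y
    rw [Matrix.mul_apply]
    simp only [hι, addAncilla, Matrix.conjTranspose_apply, Matrix.of_apply]
    by_cases hy : ∀ z, y (Sum.inr z) = false
    · have hy' : y = Sum.elim (fun i => y (Sum.inl i)) fun _ => false := by
        funext q
        rcases q with i | z
        · rfl
        · exact hy z
      rw [Finset.sum_eq_single fun i => y (Sum.inl i)]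
      · rw [← hy', if_pos rfl, if_pos hy, star_one, mul_one]
      · intro z _ hz
        rw [if_neg (c := y = _), star_zero, mul_zero]
        intro h
        apply hz
        funext i
        rw [h]
        rfl
      · simp
    · rw [if_neg hy, ite_self]
      refine Finset.sum_eq_zero fun z _ => ?_
      rw [if_neg (c := y = _), star_zero, mul_zero]
      rintro rfl
      exact hy fun _ => rfl
  -- The reflection is prescribed only on columns with cleared work qubits, hence the condition on
  -- the support of `Z`.
  have key : ∀ Z : Matrix (Fin ns ⊕ A → Bool) (Fin ns → Bool) ℂ,
      (∀ y i, Z y i ≠ 0 → Clear wk N y) → R * Z = Z - (2 : ℂ) • (ι * (ιᴴ * Z)) := by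
    intro Z hZ
    rw [← Matrix.mul_assoc, ← Matrix.smul_mul]
    nth_rewrite 2 [← Matrix.one_mul Z]
    rw [← Matrix.sub_mul]
    ext x i
    rw [Matrix.mul_apply, Matrix.mul_apply]
    refine Finset.sum_congr rfl fun y _ => ?_
    by_cases h0 : Z y i = 0
    · rw [h0, mul_zero, mul_zero]
    rw [hR x y (hZ y i h0), Matrix.sub_apply, Matrix.smul_apply, hP, Matrix.one_apply]
    congr 1
    split_ifs <;> norm_num
  have clear_mul : ∀ {X : Operator (Fin ns ⊕ A)}, Clean wk N X →
      ∀ Z : Matrix (Fin ns ⊕ A → Bool) (Fin ns → Bool) ℂ, (∀ y i, Z y i ≠ 0 → Clear wk N y) →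
      ∀ y i, (X * Z) y i ≠ 0 → Clear wk N y := by
    intro X hX Z hZ y i h
    rw [Matrix.mul_apply] at h
    obtain ⟨z, -, hz⟩ := Finset.exists_ne_zero_of_sum_ne_zero h
    exact (hX y z (left_ne_zero_of_mul hz)).2 (hZ z i (right_ne_zero_of_mul hz))
  have hι0 : ∀ y i, ι y i ≠ 0 → Clear wk N y := by
    intro y i h j hj
    obtain ⟨a, ha⟩ := hwk j hj
    have : y = Sum.elim i fun _ => false := by
      by_contra hne
      exact h (if_neg hne)
    rw [ha, this]
    rfl
  have h1 := clear_mul hc ι hι0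
  have hsub : ∀ Z : Matrix (Fin ns ⊕ A → Bool) (Fin ns → Bool) ℂ,
      (∀ y i, Z y i ≠ 0 → Clear wk N y) →
      ∀ y i, (Z - (2 : ℂ) • (ι * (ιᴴ * Z))) y i ≠ 0 → Clear wk N y := by
    intro Z hZ y i h
    by_cases h0 : Z y i = 0
    · rw [Matrix.sub_apply, h0, zero_sub, Matrix.smul_apply, neg_ne_zero] at h
      have h2 : (ι * (ιᴴ * Z)) y i ≠ 0 := fun h0 => h (by rw [h0, smul_zero])
      rw [Matrix.mul_apply] at h2
      obtain ⟨z, -, hz⟩ := Finset.exists_ne_zero_of_sum_ne_zero h2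
      exact hι0 y z (left_ne_zero_of_mul hz)
    · exact hZ y i h0
  have h2 := hsub _ h1
  have h3 := clear_mul hc.conjTranspose _ h2
  have hVV : V * Vᴴ = 1 := Matrix.mem_unitaryGroup_iff.1 hV
  have hVV' : Vᴴ * V = 1 := Matrix.mem_unitaryGroup_iff'.1 hV
  have e1 : ∀ Z : Matrix (Fin ns ⊕ A → Bool) (Fin ns → Bool) ℂ, V * (Vᴴ * Z) = Z := fun Z => by
    rw [← Matrix.mul_assoc, hVV, Matrix.one_mul]
  have e2 : ∀ Z : Matrix (Fin ns ⊕ A → Bool) (Fin ns → Bool) ℂ, Vᴴ * (V * Z) = Z := fun Z => by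
    rw [← Matrix.mul_assoc, hVV', Matrix.one_mul]
  have e3 : ∀ Z : Operator (Fin ns), ιᴴ * (ι * Z) = Z := fun Z => by
    rw [← Matrix.mul_assoc, hιι, Matrix.one_mul]
  rw [ancillaBlock_eq, ancillaBlock_eq]
  simp only [Matrix.mul_neg, Matrix.neg_mul, Matrix.mul_assoc, ← hι]
  rw [key _ h1, key _ h3]
  simp only [Matrix.mul_sub, Matrix.mul_smul, e1, e2, e3, hιι, Matrix.conjTranspose_mul,
    Matrix.conjTranspose_conjTranspose, Matrix.mul_one, Matrix.mul_assoc]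
  module

/-- With B = S/2 the left operator is (3S - SS†S)/2, which fixes U. Telescoping SS†S - UU†U gives
three terms of norms at most 4η, 2η and η, so the total is at most (3/2)η + (7/2)η. -/
theorem norm_amplify_sub_le {S U : Operator (Fin ns)} (hU : ‖U‖ ≤ 1) (hUU : U * Uᴴ = 1)
    (hS : ‖S‖ ≤ 2) {η : ℝ} (h : ‖S - U‖ ≤ η) {B : Operator (Fin ns)} (hB : B = (1 / 2 : ℂ) • S) :
    ‖(3 : ℂ) • B - (4 : ℂ) • (B * Bᴴ * B) - U‖ ≤ 5 * η := by
  have e : (3 : ℂ) • B - (4 : ℂ) • (B * Bᴴ * B) - U = (3 / 2 : ℂ) • (S - U) -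
      (1 / 2 : ℂ) • ((S - U) * Sᴴ * S + U * (S - U)ᴴ * S + U * Uᴴ * (S - U)) := by
    have hh : star (2⁻¹ : ℂ) = 2⁻¹ := by simp
    rw [hB]
    simp only [Matrix.conjTranspose_smul, Matrix.conjTranspose_sub, Matrix.mul_sub, Matrix.sub_mul,
      Matrix.smul_mul, Matrix.mul_smul, smul_smul, hUU, Matrix.one_mul, Matrix.mul_assoc]
    simp only [one_div, hh]
    module
  have hη : 0 ≤ η := (norm_nonneg _).trans h
  have hS' : ‖Sᴴ‖ ≤ 2 := by rw [Matrix.l2_opNorm_conjTranspose]; exact hS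
  have hd' : ‖(S - U)ᴴ‖ ≤ η := by rw [Matrix.l2_opNorm_conjTranspose]; exact h
  rw [e]
  have t1 : ‖(S - U) * Sᴴ * S‖ ≤ η * 2 * 2 :=
    (norm_mul_le _ _).trans (mul_le_mul ((norm_mul_le _ _).trans
      (mul_le_mul h hS' (norm_nonneg _) hη)) hS (norm_nonneg _) (by positivity))
  have t2 : ‖U * (S - U)ᴴ * S‖ ≤ 1 * η * 2 :=
    (norm_mul_le _ _).trans (mul_le_mul ((norm_mul_le _ _).trans
      (mul_le_mul hU hd' (norm_nonneg _) zero_le_one)) hS (norm_nonneg _) (by positivity))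
  have t3 : ‖U * Uᴴ * (S - U)‖ ≤ η := by rw [hUU, one_mul]; exact h
  have t4 := norm_add₃_le (a := (S - U) * Sᴴ * S) (b := U * (S - U)ᴴ * S) (c := U * Uᴴ * (S - U))
  refine (norm_sub_le _ _).trans ?_
  rw [norm_smul, norm_smul]
  have n1 : ‖(3 / 2 : ℂ)‖ = 3 / 2 := by norm_num
  have n2 : ‖(1 / 2 : ℂ)‖ = 1 / 2 := by norm_num
  rw [n1, n2]
  linarith

theorem sum_normSq_eq (ψ : (Fin ns → Bool) → ℂ) :
    ∑ x, ‖ψ x‖ ^ 2 = ‖(WithLp.toLp 2 ψ : EuclideanSpace ℂ (Fin ns → Bool))‖ ^ 2 := by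
  rw [EuclideanSpace.norm_sq_eq]

/-- An isometry preserves the norm of ψ, so ‖Wψ‖ ≥ 1 - ε, and 1 - (1 - ε)² ≤ 2ε. -/
theorem simulates_of_norm_le {W U : Operator (Fin ns)} {ε : ℝ} (hUU : Uᴴ * U = 1)
    (h : ‖W - U‖ ≤ ε) : Simulates W U ε (2 * ε) := by
  refine ⟨h, fun ψ hψ => ?_⟩
  rw [sum_normSq_eq] at hψ ⊢
  have hψ1 : ‖(WithLp.toLp 2 ψ : EuclideanSpace ℂ (Fin ns → Bool))‖ = 1 := by
    have := norm_nonneg (WithLp.toLp 2 ψ : EuclideanSpace ℂ (Fin ns → Bool))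
    nlinarith
  have hU : ‖(WithLp.toLp 2 (U *ᵥ ψ) : EuclideanSpace ℂ (Fin ns → Bool))‖ ^ 2 = 1 := by
    rw [← hψ, ← sum_normSq_eq, ← sum_normSq_eq]
    have e : ∀ v : (Fin ns → Bool) → ℂ, ((∑ x, ‖v x‖ ^ 2 : ℝ) : ℂ) = star v ⬝ᵥ v := by
      intro v
      rw [dotProduct]
      push_cast
      refine Finset.sum_congr rfl fun x _ => ?_
      rw [Pi.star_apply, RCLike.star_def, RCLike.conj_mul]
      rfl
    have : ((∑ x, ‖(U *ᵥ ψ) x‖ ^ 2 : ℝ) : ℂ) = ((∑ x, ‖ψ x‖ ^ 2 : ℝ) : ℂ) := by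
      rw [e, e, Matrix.star_mulVec, ← Matrix.dotProduct_mulVec, Matrix.mulVec_mulVec, hUU,
        Matrix.one_mulVec]
    exact_mod_cast this
  have hU1 : ‖(WithLp.toLp 2 (U *ᵥ ψ) : EuclideanSpace ℂ (Fin ns → Bool))‖ = 1 := by
    have := norm_nonneg (WithLp.toLp 2 (U *ᵥ ψ) : EuclideanSpace ℂ (Fin ns → Bool))
    nlinarith
  have hd : ‖(WithLp.toLp 2 ((W - U) *ᵥ ψ) : EuclideanSpace ℂ (Fin ns → Bool))‖ ≤ ε := by
    have := Matrix.l2_opNorm_mulVec (W - U) (WithLp.toLp 2 ψ : EuclideanSpace ℂ (Fin ns → Bool))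
    rw [hψ1, mul_one] at this
    exact this.trans h
  have htri : 1 ≤ ‖(WithLp.toLp 2 (W *ᵥ ψ) : EuclideanSpace ℂ (Fin ns → Bool))‖ + ε := by
    have e : (WithLp.toLp 2 (U *ᵥ ψ) : EuclideanSpace ℂ (Fin ns → Bool)) =
        WithLp.toLp 2 (W *ᵥ ψ) - WithLp.toLp 2 ((W - U) *ᵥ ψ) := by
      rw [Matrix.sub_mulVec, ← WithLp.toLp_sub]
      congr 1
      abel
    rw [← hU1, e]
    exact (norm_sub_le _ _).trans (by linarith)
  have hW := norm_nonneg (WithLp.toLp 2 (W *ᵥ ψ) : EuclideanSpace ℂ (Fin ns → Bool))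
  -- Squaring the lower bound needs 1 - ε ≥ 0; for larger ε the claim is trivial, as 2ε ≥ 1.
  rcases le_total ε 1 with h1 | h1
  · have h2 := pow_le_pow_left₀ (sub_nonneg.2 h1) (sub_le_iff_le_add.2 htri) 2
    nlinarith [sq_nonneg ε]
  · nlinarith

end Amplification
/-! ### Preparation of uniform superpositions -/

section Uniform

variable {R Q : Type} [Fintype Q] [DecidableEq Q]

theorem muxOp_mulVec (t : Q) {F : (Q → Bool) → Matrix Bool Bool ℂ} (hF : Indep t F)
    (ψ : (Q → Bool) → ℂ) (x : Q → Bool) :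
    (muxOp t F *ᵥ ψ) x = ∑ b, F x (x t) b * ψ (Function.update x t b) := by
  rw [Matrix.mulVec, dotProduct, sum_eq_of_agree t x]
  · refine Finset.sum_congr rfl fun b _ => ?_
    have h : ∀ q, q ≠ t → x q = Function.update x t b q :=
      fun q hq => (Function.update_of_ne hq _ _).symm
    rw [muxOp_apply, if_pos h, Function.update_self, hF _ _ h]
  · intro z hz
    rw [muxOp_apply, if_neg, zero_mul]
    intro h
    exact hz fun q hq => (h q hq).symm

theorem permOp_mulVec {f : (Q → Bool) → (Q → Bool)} (hf : Function.Involutive f)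
    (ψ : (Q → Bool) → ℂ) (x : Q → Bool) : (permOp f *ᵥ ψ) x = ψ (f x) := by
  rw [Matrix.mulVec, dotProduct, Finset.sum_eq_single (f x)]
  · simp [permOp_apply, hf x]
  · intro z _ hz
    rw [permOp_apply, if_neg, zero_mul]
    rintro rfl
    exact hz (hf z).symm
  · simp

/-- `ψ` on the qubits `bit 0, …, bit (n - 1)` has the amplitudes `a`, and the other qubits are as
in `y`. -/
def regState (bit : ℕ → Q) (n : ℕ) (a : (Fin n → Bool) → ℂ) (y : Q → Bool) :
    (Q → Bool) → ℂ :=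
  open Classical in
  fun x => if ∀ q, (∀ i < n, q ≠ bit i) → x q = y q then a fun i => x (bit i) else 0

theorem regState_apply (bit : ℕ → Q) (n : ℕ) (a : (Fin n → Bool) → ℂ) (x y : Q → Bool)
    [Decidable (∀ q, (∀ i < n, q ≠ bit i) → x q = y q)] :
    regState bit n a y x = if ∀ q, (∀ i < n, q ≠ bit i) → x q = y q then a fun i => x (bit i)
      else 0 := by
  unfold regState
  congr

variable {bit : ℕ → Q} {n : ℕ}

theorem agree_succ_iff (hbit : Works bit (n + 1)) (x y : Q → Bool) (b : Bool) :
    (∀ q, (∀ i < n, q ≠ bit i) → x q = Function.update y (bit n) b q) ↔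
      (∀ q, (∀ i < n + 1, q ≠ bit i) → x q = y q) ∧ x (bit n) = b := by
  constructor
  · intro h
    refine ⟨fun q hq => ?_, ?_⟩
    · rw [h q fun i hi => hq i (by omega), Function.update_of_ne (hq n (by omega))]
    · rw [h (bit n) fun i hi he => by
        have := hbit n (by omega) i (by omega) he
        omega, Function.update_self]
  · rintro ⟨h, h'⟩ q hq
    by_cases hqn : q = bit n
    · rw [hqn, h', Function.update_self]
    · rw [Function.update_of_ne hqn]
      refine h q fun i hi => ?_
      by_cases hin : i = n
      · rwa [hin]
      · exact hq i (by omega)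

theorem regState_succ (hbit : Works bit (n + 1)) (a : (Fin (n + 1) → Bool) → ℂ) (y : Q → Bool) :
    regState bit (n + 1) a y =
      regState bit n (fun b => a (Fin.snoc (α := fun _ => Bool) b false))
        (Function.update y (bit n) false) +
      regState bit n (fun b => a (Fin.snoc (α := fun _ => Bool) b true))
        (Function.update y (bit n) true) := by
  classical
  funext x
  rw [Pi.add_apply, regState_apply, regState_apply, regState_apply,
    if_congr (agree_succ_iff hbit x y _) rfl rfl, if_congr (agree_succ_iff hbit x y _) rfl rfl]
  have hs : ∀ b, x (bit n) = b → Fin.snoc (α := fun _ => Bool) (fun i : Fin n => x (bit i)) b =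
      fun i : Fin (n + 1) => x (bit i) := by
    intro b hb
    funext i
    refine Fin.lastCases ?_ (fun j => ?_) i
    · simp [hb]
    · simp
  by_cases h : ∀ q, (∀ i < n + 1, q ≠ bit i) → x q = y q
  · cases hb : x (bit n) <;> simp [hs _ hb]
  · rw [if_neg h, if_neg fun h' => h h'.1, if_neg fun h' => h h'.1, add_zero]

theorem muxOp_regState (hbit : Works bit (n + 1)) {F : (Q → Bool) → Matrix Bool Bool ℂ}
    (hF : Indep (bit n) F) {G : Matrix Bool Bool ℂ} (a : (Fin (n + 1) → Bool) → ℂ) (y : Q → Bool)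
    (hG : ∀ x, (∀ q, (∀ i < n + 1, q ≠ bit i) → x q = y q) → F x = G) :
    muxOp (bit n) F *ᵥ regState bit (n + 1) a y =
      regState bit (n + 1) (fun b => ∑ c, G (b (Fin.last n)) c *
        a (Fin.snoc (α := fun _ => Bool) (fun i => b i.castSucc) c)) y := by
  classical
  funext x
  rw [muxOp_mulVec _ hF, regState_apply]
  have h1 : ∀ b, (∀ q, (∀ i < n + 1, q ≠ bit i) → Function.update x (bit n) b q = y q) ↔
      ∀ q, (∀ i < n + 1, q ≠ bit i) → x q = y q := fun b => forall₂_congr fun q hq => by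
    rw [Function.update_of_ne (hq n (by omega))]
  have h2 : ∀ b, (fun i : Fin (n + 1) => Function.update x (bit n) b (bit i)) =
      Fin.snoc (α := fun _ => Bool) (fun i : Fin n => x (bit i)) b := by
    intro b
    funext i
    refine Fin.lastCases ?_ (fun j => ?_) i
    · simp
    · have : bit j ≠ bit n := fun h => by
        have := hbit j (by omega) n (by omega) h
        omega
      simp [Function.update_of_ne this]
  simp only [regState_apply, h1, h2]
  split_ifs with h
  · rw [hG x h]
    simp
  · simp

theorem permOp_regState {t : Q} (ht : ∀ i < n, t ≠ bit i) {g : (Q → Bool) → Bool}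
    (hg : Indep t g) (hgb : ∀ x y : Q → Bool, (∀ q, (∀ i < n, q ≠ bit i) → x q = y q) → g x = g y)
    (a : (Fin n → Bool) → ℂ) (y : Q → Bool) :
    permOp (flipAt t g) *ᵥ regState bit n a y = regState bit n a (flipAt t g y) := by
  classical
  have hf := flipAt_involutive hg
  funext x
  rw [permOp_mulVec hf, regState_apply, regState_apply]
  have h1 : (fun i : Fin n => flipAt t g x (bit i)) = fun i : Fin n => x (bit i) := by
    funext i
    exact Function.update_of_ne (ht i i.2).symm _ _
  have h2 : ∀ x y : Q → Bool, (∀ q, (∀ i < n, q ≠ bit i) → x q = y q) →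
      ∀ q, (∀ i < n, q ≠ bit i) → flipAt t g x q = flipAt t g y q := by
    intro x y h q hq
    by_cases hqt : q = t
    · subst hqt
      rw [flipAt_self, flipAt_self, h q hq, hgb x y h]
    · simp only [flipAt, Function.update_of_ne hqt, h q hq]
  rw [h1]
  refine if_congr ⟨fun h => ?_, fun h => ?_⟩ rfl rfl
  · have := h2 _ _ h
    rwa [hf] at this
  · have := h2 _ _ h
    rwa [hf] at this

/-- The amplitudes of the uniform superposition of the numbers below `m`. -/
def unifAmp (m n : ℕ) (b : Fin n → Bool) : ℂ := if bitsVal b < m then ((√m)⁻¹ : ℝ) else 0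

/-- The rotation with cosine `c` and sine `s`. -/
def rotMat (c s : ℝ) : Matrix Bool Bool ℂ :=
  Matrix.of fun i j => if i = j then (c : ℂ) else if i then (s : ℂ) else -(s : ℂ)

theorem rotMat_mem_unitary {c s : ℝ} (h : c ^ 2 + s ^ 2 = 1) :
    rotMat c s ∈ Matrix.unitaryGroup Bool ℂ := by
  have h' : (c : ℂ) ^ 2 + (s : ℂ) ^ 2 = 1 := by exact_mod_cast h
  rw [Matrix.mem_unitaryGroup_iff]
  ext i j
  cases i <;> cases j <;>
    simp [Matrix.mul_apply, rotMat, Matrix.star_eq_conjTranspose, Matrix.conjTranspose_apply] <;>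
    first | linear_combination h' | ring1

/-- The rotation with cosine `c` and sine `s` as a gate, if there is one. -/
def rot (c s : ℝ) : Matrix.unitaryGroup Bool ℂ :=
  if h : c ^ 2 + s ^ 2 = 1 then ⟨rotMat c s, rotMat_mem_unitary h⟩ else 1

theorem rot_val {c s : ℝ} (h : c ^ 2 + s ^ 2 = 1) : (rot c s : Matrix Bool Bool ℂ) = rotMat c s := by
  rw [rot, dif_pos h]

/-- A real gate that maps `|0⟩` to the uniform superposition. -/
def had : Matrix.unitaryGroup Bool ℂ := rot (√2)⁻¹ (√2)⁻¹

theorem had_val : (had : Matrix Bool Bool ℂ) = rotMat (√2)⁻¹ (√2)⁻¹ :=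
  rot_val (by rw [inv_pow, Real.sq_sqrt zero_le_two]; norm_num)

/-- The adjoint of `had` takes a uniform qubit back to zero, and the rotation then gives it the
amplitudes `c` and `s`; so one gate replaces uniform amplitudes by these. -/
theorem rot_had_sum {c s : ℝ} (h : c ^ 2 + s ^ 2 = 1) (i : Bool) (z : ℂ) :
    ∑ j, ((rot c s * star had : Matrix.unitaryGroup Bool ℂ) : Matrix Bool Bool ℂ) i j *
      (((√2)⁻¹ : ℝ) * z) = (if i then (s : ℂ) else c) * z := by
  have h2 : (((√2 : ℝ) : ℂ)⁻¹) * (((√2 : ℝ) : ℂ)⁻¹) = 1 / 2 := by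
    rw [← mul_inv, ← Complex.ofReal_mul, Real.mul_self_sqrt zero_le_two]
    norm_num
  rw [Submonoid.coe_mul, rot_val h, Unitary.coe_star, had_val]
  cases i <;>
    simp [Matrix.mul_apply, rotMat, Matrix.star_eq_conjTranspose, Matrix.conjTranspose_apply]
  · linear_combination 2 * c * z * h2
  · linear_combination 2 * s * z * h2

/-- Turns the uniform superposition of all values of `bit 0, …, bit (n - 1)` into the uniform
superposition of the numbers below `m`, if `u` is true. -/
def unifTight (bit fl : ℕ → Q) : (n m : ℕ) → Q → Circuit R Q
  | 0, _, _ => []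
  | n + 1, m, u =>
    -- All numbers below `m` have top bit zero: the top bit is returned to zero, and the recursion
    -- continues on the lower bits.
    if m ≤ 2 ^ n then ctrlGate u (bit n) (rot 1 0 * star had) ++ unifTight bit fl n m u
    -- Of the numbers below `m`, 2^n have top bit zero and m - 2^n have top bit one. With top bit
    -- zero the lower bits are uniform already; with top bit one they are reduced recursively to
    -- numbers below m - 2^n, controlled by the flag u ∧ bit n, which is cleared afterwards.
    else ctrlGate u (bit n) (rot √(2 ^ n / m) √((m - 2 ^ n : ℕ) / m) * star had) ++
      (stepsCirc [.tof and u (bit n) (fl n)] ++ (unifTight bit fl n (m - 2 ^ n) (fl n) ++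
        stepsCirc [.tof and u (bit n) (fl n)]))

/-- The qubits of the preparation circuit are different. -/
structure UnifOK (bit fl : ℕ → Q) (n : ℕ) (u : Q) : Prop where
  bit_inj : Works bit n
  fl_inj : Works fl n
  bit_fl : ∀ i < n, ∀ j < n, bit i ≠ fl j
  ctrl_bit : ∀ i < n, u ≠ bit i
  ctrl_fl : ∀ i < n, u ≠ fl i

theorem UnifOK.pred {fl : ℕ → Q} {u : Q} (h : UnifOK bit fl (n + 1) u) : UnifOK bit fl n u :=
  ⟨fun i hi j hj => h.1 i (by omega) j (by omega), fun i hi j hj => h.2 i (by omega) j (by omega),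
    fun i hi j hj => h.3 i (by omega) j (by omega), fun i hi => h.4 i (by omega),
    fun i hi => h.5 i (by omega)⟩

theorem UnifOK.next {fl : ℕ → Q} {u : Q} (h : UnifOK bit fl (n + 1) u) :
    UnifOK bit fl n (fl n) :=
  ⟨h.pred.1, h.pred.2, h.pred.3, fun i hi he => h.3 i (by omega) n (by omega) he.symm,
    fun i hi he => by
      have := h.2 n (by omega) i (by omega) he
      omega⟩

theorem UnifOK.wf {fl : ℕ → Q} {u : Q} (h : UnifOK bit fl (n + 1) u) :
    ∀ s ∈ [Step.tof and u (bit n) (fl n)], s.WF := by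
  intro s hs
  rw [List.mem_singleton] at hs
  subst hs
  exact ⟨h.4 n (by omega), h.5 n (by omega), h.3 n (by omega) n (by omega)⟩

theorem UnifOK.tof_op {fl : ℕ → Q} {u : Q} (h : UnifOK bit fl (n + 1) u) (O : Operator R) :
    Circuit.op O (stepsCirc [Step.tof and u (bit n) (fl n)]) =
      permOp (flipAt (fl n) fun y => y u && y (bit n)) := by
  rw [stepsCirc_op O h.wf]
  rfl

theorem UnifOK.indep {fl : ℕ → Q} {u : Q} (h : UnifOK bit fl (n + 1) u) :
    Indep (fl n) fun y => y u && y (bit n) := fun x y hxy => by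
  simp only [hxy u (h.5 n (by omega)), hxy (bit n) (h.3 n (by omega) n (by omega))]

theorem ctrlGate_op (O : Operator R) {u t : Q} (h : u ≠ t) (U : Matrix.unitaryGroup Bool ℂ) :
    Circuit.op O (ctrlGate u t U) =
      muxOp t fun y => if y u then (U : Matrix Bool Bool ℂ) else 1 := by
  rw [ctrlGate, gateMux_op O h]
  congr 1
  funext y
  cases y u <;> simp

theorem indep_ctrl {α : Type} {u t : Q} (h : u ≠ t) (A B : α) :
    Indep t fun y : Q → Bool => if y u then A else B := fun x y hxy => by
  simp only [hxy u h]

theorem ctrlGate_mulVec_of_false (O : Operator R) {u t : Q} (h : u ≠ t)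
    (U : Matrix.unitaryGroup Bool ℂ) {ψ : (Q → Bool) → ℂ} (hψ : ∀ x, ψ x ≠ 0 → x u = false) :
    Circuit.op O (ctrlGate u t U) *ᵥ ψ = ψ := by
  funext x
  rw [ctrlGate_op O h, muxOp_mulVec t (indep_ctrl h _ _)]
  cases hx : x u
  · simp [Matrix.one_apply]
  · have h0 : ∀ b, ψ (Function.update x t b) = 0 := by
      intro b
      by_contra hne
      have := hψ _ hne
      rw [Function.update_of_ne h, hx] at this
      cases this
    have h1 : ψ x = 0 := by
      by_contra hne
      have := hψ _ hne
      rw [hx] at this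
      cases this
    simp [h0, h1]

theorem flipAt_of_false {t : Q} {g : (Q → Bool) → Bool} {x : Q → Bool} (h : g x = false) :
    flipAt t g x = x := by simp [flipAt, h]

theorem permOp_mulVec_of_false {t : Q} {g : (Q → Bool) → Bool} (hg : Indep t g)
    {ψ : (Q → Bool) → ℂ} (hψ : ∀ x, ψ x ≠ 0 → g x = false) :
    permOp (flipAt t g) *ᵥ ψ = ψ := by
  funext x
  rw [permOp_mulVec (flipAt_involutive hg)]
  cases hx : g x
  · rw [flipAt_of_false hx]
  · have h1 : ψ x = 0 := by
      by_contra hne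
      rw [hψ _ hne] at hx
      cases hx
    have h2 : ψ (flipAt t g x) = 0 := by
      by_contra hne
      have := hψ _ hne
      rw [hg _ x fun q hq => Function.update_of_ne hq _ _, hx] at this
      cases this
    rw [h1, h2]

/-- Every gate is controlled by `u` or by a flag, and the flags stay zero when `u` is zero. -/
theorem unifTight_of_false (O : Operator R) {bit fl : ℕ → Q} {n m : ℕ} {u : Q}
    (h : UnifOK bit fl n u) {ψ : (Q → Bool) → ℂ}
    (hψ : ∀ x, ψ x ≠ 0 → x u = false ∧ Clear fl n x) :
    Circuit.op O (unifTight bit fl n m u) *ᵥ ψ = ψ := by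
  induction n generalizing m u with
  | zero => simp [unifTight]
  | succ n ih =>
    have hn : u ≠ bit n := h.4 n (by omega)
    have hcl : ∀ x, Clear fl (n + 1) x → Clear fl n x := fun x hx j hj => hx j (by omega)
    rw [unifTight]
    split_ifs
    · rw [Circuit.op_append, ← Matrix.mulVec_mulVec,
        ctrlGate_mulVec_of_false O hn _ fun x hx => (hψ x hx).1,
        ih h.pred fun x hx => ⟨(hψ x hx).1, hcl x (hψ x hx).2⟩]
    · have ht : permOp (flipAt (fl n) fun y => y u && y (bit n)) *ᵥ ψ = ψ :=
        permOp_mulVec_of_false h.indep fun x hx => by simp [(hψ x hx).1]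
      simp only [Circuit.op_append, ← Matrix.mulVec_mulVec, h.tof_op]
      rw [ctrlGate_mulVec_of_false O hn _ fun x hx => (hψ x hx).1, ht,
        ih h.next fun x hx => ⟨(hψ x hx).2 n (by omega), hcl x (hψ x hx).2⟩, ht]

theorem muxOp_agree {t : Q} {F : (Q → Bool) → Matrix Bool Bool ℂ} {x y : Q → Bool}
    (h : muxOp t F x y ≠ 0) {q : Q} (hq : q ≠ t) : x q = y q := by
  rw [muxOp_apply] at h
  by_contra hne
  exact h (if_neg fun hall => hne (hall q hq))

theorem permOp_ne_zero {f : (Q → Bool) → (Q → Bool)} {x y : Q → Bool} (h : permOp f x y ≠ 0) :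
    x = f y := by
  by_contra hne
  exact h (if_neg hne)

theorem exists_of_mul_ne_zero {A B : Operator Q} {x y : Q → Bool} (h : (A * B) x y ≠ 0) :
    ∃ z, A x z ≠ 0 ∧ B z y ≠ 0 := by
  rw [Matrix.mul_apply] at h
  obtain ⟨z, -, hz⟩ := Finset.exists_ne_zero_of_sum_ne_zero h
  exact ⟨z, left_ne_zero_of_mul hz, right_ne_zero_of_mul hz⟩

/-- Holds for all values of the control and flags: the recursive call changes neither `u` nor the
top bit, so the second Toffoli gate undoes the first one. -/
theorem unifTight_agree (O : Operator R) {bit fl : ℕ → Q} {n m : ℕ} {u : Q}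
    (h : UnifOK bit fl n u) {x y : Q → Bool}
    (hxy : Circuit.op O (unifTight bit fl n m u) x y ≠ 0) {q : Q} (hq : ∀ i < n, q ≠ bit i) :
    x q = y q := by
  induction n generalizing m u x y q with
  | zero =>
    rw [unifTight, Circuit.op_nil] at hxy
    by_contra hne
    refine hxy (Matrix.one_apply_ne ?_)
    rintro rfl
    exact hne rfl
  | succ n ih =>
    have hn : u ≠ bit n := h.4 n (by omega)
    have hq' : ∀ i < n, q ≠ bit i := fun i hi => hq i (by omega)
    rw [unifTight] at hxy
    split_ifs at hxy
    · rw [Circuit.op_append, ctrlGate_op O hn] at hxy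
      obtain ⟨z, h1, h2⟩ := exists_of_mul_ne_zero hxy
      rw [ih h.pred h1 hq', muxOp_agree h2 (hq n (by omega))]
    · simp only [Circuit.op_append, h.tof_op, ctrlGate_op O hn] at hxy
      obtain ⟨z1, h1, h2⟩ := exists_of_mul_ne_zero hxy
      obtain ⟨z2, h3, h4⟩ := exists_of_mul_ne_zero h1
      obtain ⟨z3, h5, h6⟩ := exists_of_mul_ne_zero h3
      have e1 := permOp_ne_zero h4
      have e2 := permOp_ne_zero h5
      have hu : z3 u = z2 u := ih h.next h6 fun i hi => h.4 i (by omega)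
      have hb : z3 (bit n) = z2 (bit n) := ih h.next h6 fun i hi he => by
        have := h.1 n (by omega) i (by omega) he
        omega
      have hqq := ih h.next h6 hq'
      rw [← muxOp_agree h2 (hq n (by omega)), e2]
      have hgi : ∀ w : Q → Bool, flipAt (fl n) (fun y => y u && y (bit n)) w u = w u :=
        fun w => Function.update_of_ne (h.5 n (by omega)) _ _
      have hgb : ∀ w : Q → Bool, flipAt (fl n) (fun y => y u && y (bit n)) w (bit n) =
          w (bit n) := fun w => Function.update_of_ne (h.3 n (by omega) n (by omega)) _ _
      by_cases hf : q = fl n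
      · subst hf
        rw [flipAt_self, hqq, hu, hb, e1, flipAt_self, hgi, hgb]
        simp
      · rw [flipAt, Function.update_of_ne hf, hqq, e1, flipAt, Function.update_of_ne hf]

/-- Induction on the top bit. After its rotation the state is a sum of two branches, and √(2^n/m) ·
2^{-n/2} and √((m - 2^n)/m) · (m - 2^n)^{-1/2} both equal m^{-1/2}. -/
theorem unifTight_of_true (O : Operator R) {bit fl : ℕ → Q} {n m : ℕ} {u : Q}
    (h : UnifOK bit fl n u) (hm : 0 < m) (hmn : m ≤ 2 ^ n) {y : Q → Bool} (hu : y u = true)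
    (hy : Clear fl n y) :
    Circuit.op O (unifTight bit fl n m u) *ᵥ
      regState bit n (fun _ => ((((√2)⁻¹) ^ n : ℝ) : ℂ)) y = regState bit n (unifAmp m n) y := by
  induction n generalizing m u y with
  | zero =>
    have : m = 1 := by simp at hmn; omega
    subst this
    rw [unifTight, Circuit.op_nil, Matrix.one_mulVec]
    congr 1
    funext b
    simp [unifAmp, bitsVal]
  | succ n ih =>
    have hn : u ≠ bit n := h.4 n (by omega)
    have hcl : Clear fl n y := fun j hj => hy j (by omega)
    have hGF : ∀ c s : ℝ, c ^ 2 + s ^ 2 = 1 →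
        Circuit.op O (ctrlGate u (bit n) (rot c s * star had)) *ᵥ
          regState bit (n + 1) (fun _ => ((((√2)⁻¹) ^ (n + 1) : ℝ) : ℂ)) y =
        regState bit n (fun _ => (c : ℂ) * ((((√2)⁻¹) ^ n : ℝ) : ℂ))
          (Function.update y (bit n) false) +
        regState bit n (fun _ => (s : ℂ) * ((((√2)⁻¹) ^ n : ℝ) : ℂ))
          (Function.update y (bit n) true) := by
      intro c s hcs
      rw [ctrlGate_op O hn, muxOp_regState h.1 (indep_ctrl hn _ _)
        (G := ((rot c s * star had : Matrix.unitaryGroup Bool ℂ) : Matrix Bool Bool ℂ)) _ _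
        fun x hx => by rw [hx u fun i hi => h.4 i hi, hu, if_pos rfl]]
      have : ∀ i : Bool, ∑ j, ((rot c s * star had : Matrix.unitaryGroup Bool ℂ) :
          Matrix Bool Bool ℂ) i j * ((((√2)⁻¹) ^ (n + 1) : ℝ) : ℂ) =
          (if i then (s : ℂ) else c) * ((((√2)⁻¹) ^ n : ℝ) : ℂ) := by
        intro i
        rw [← rot_had_sum hcs]
        refine Finset.sum_congr rfl fun j _ => ?_
        rw [pow_succ']
        push_cast
        ring
      simp only [this]
      rw [regState_succ h.1]
      simp
    have hupd : ∀ b : Bool, Function.update y (bit n) b u = true := fun b => by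
      rw [Function.update_of_ne hn, hu]
    have hfl : ∀ b : Bool, ∀ j < n + 1, Function.update y (bit n) b (fl j) = false := fun b j hj => by
      rw [Function.update_of_ne (h.3 n (by omega) j hj).symm, hy j hj]
    have hsplit : regState bit (n + 1) (unifAmp m (n + 1)) y =
        regState bit n (fun b => unifAmp m (n + 1) (Fin.snoc (α := fun _ => Bool) b false))
          (Function.update y (bit n) false) +
        regState bit n (fun b => unifAmp m (n + 1) (Fin.snoc (α := fun _ => Bool) b true))
          (Function.update y (bit n) true) := regState_succ h.1 _ _
    have hsn : ∀ (b : Fin n → Bool) (c : Bool), bitsVal (Fin.snoc (α := fun _ => Bool) b c) =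
        bitsVal b + if c then 2 ^ n else 0 := by
      intro b c
      rw [bitsVal_succ]
      simp
    rw [unifTight, hsplit]
    split_ifs with hmn'
    · have hz : ∀ z, regState bit n (fun _ => (0 : ℂ)) z = 0 := by
        intro z
        funext x
        simp [regState]
      have hz' : ∀ b : Fin n → Bool, unifAmp m (n + 1) (Fin.snoc (α := fun _ => Bool) b true) = 0 := by
        intro b
        rw [unifAmp, hsn, if_neg]
        simp
        omega
      have hz'' : (fun b : Fin n → Bool =>
          unifAmp m (n + 1) (Fin.snoc (α := fun _ => Bool) b false)) = unifAmp m n := by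
        funext b
        rw [unifAmp, hsn]
        simp [unifAmp]
      rw [Circuit.op_append, ← Matrix.mulVec_mulVec, hGF 1 0 (by norm_num), hz'']
      simp only [Complex.ofReal_zero, zero_mul, hz, add_zero, Complex.ofReal_one, one_mul, hz']
      exact ih h.pred hm hmn' (hupd false) fun j hj => hfl false j (by omega)
    · have hm0 : (0 : ℝ) < m := by exact_mod_cast hm
      have hle : 2 ^ n ≤ m := by omega
      have hcs : √(2 ^ n / (m : ℝ)) ^ 2 + √(((m - 2 ^ n : ℕ) : ℝ) / m) ^ 2 = 1 := by
        rw [Real.sq_sqrt (by positivity), Real.sq_sqrt (by positivity), Nat.cast_sub hle]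
        push_cast
        field_simp
        ring
      have hsm : ∀ (c : ℂ) (a : (Fin n → Bool) → ℂ) z,
          regState bit n (fun b => c * a b) z = c • regState bit n a z := by
        intro c a z
        funext x
        simp only [regState, Pi.smul_apply, smul_eq_mul, mul_ite, mul_zero]
      have hpb : ∀ x y : Q → Bool, (∀ q, (∀ i < n, q ≠ bit i) → x q = y q) →
          (x u && x (bit n)) = (y u && y (bit n)) := fun x y hxy => by
        rw [hxy u fun i hi => h.4 i (by omega), hxy (bit n) fun i hi he => by
          have := h.1 n (by omega) i (by omega) he
          omega]
      have hpr : ∀ a z, permOp (flipAt (fl n) fun y => y u && y (bit n)) *ᵥ regState bit n a z =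
          regState bit n a (flipAt (fl n) (fun y => y u && y (bit n)) z) := fun a z =>
        permOp_regState (fun i hi he => h.3 i (by omega) n (by omega) he.symm) h.indep hpb a z
      have hf0 : flipAt (fl n) (fun y => y u && y (bit n)) (Function.update y (bit n) false) =
          Function.update y (bit n) false := flipAt_of_false (by simp)
      have hf1 : flipAt (fl n) (fun y => y u && y (bit n)) (Function.update y (bit n) true) =
          Function.update (Function.update y (bit n) true) (fl n) true := by
        rw [flipAt]
        congr 1
        simp [hupd, hfl true n (by omega)]
      have hff : flipAt (fl n) (fun y => y u && y (bit n))
          (Function.update (Function.update y (bit n) true) (fl n) true) =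
          Function.update y (bit n) true := by
        rw [← hf1]
        exact flipAt_involutive h.indep _
      simp only [Circuit.op_append, ← Matrix.mulVec_mulVec, h.tof_op]
      rw [hGF _ _ hcs]
      simp only [hsm, Matrix.mulVec_add, Matrix.mulVec_smul, hpr, hf0, hf1]
      -- In the branch with top bit zero the flag is zero and the recursive call does nothing; in
      -- the other branch the flag is one and the induction hypothesis applies to m - 2^n.
      rw [unifTight_of_false O h.next (ψ := regState bit n _ (Function.update y (bit n) false)),
        ih h.next (m := m - 2 ^ n) (by omega) (by rw [pow_succ] at hmn; omega) (by simp)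
          fun j hj => by
            have : fl j ≠ fl n := fun he => by
              have := h.2 j (by omega) n (by omega) he
              omega
            rw [Function.update_of_ne this, hfl true j (by omega)]]
      · rw [hpr, hpr, hf0, hff, ← hsm, ← hsm]
        congr 2
        · funext b
          have hb := bitsVal_lt b
          rw [unifAmp, hsn, if_pos (by simp; omega), ← Complex.ofReal_mul]
          congr 1
          rw [Real.sqrt_div (by positivity), inv_pow]
          have : √((2 : ℝ) ^ n) = √2 ^ n := by
            rw [Real.sqrt_eq_iff_mul_self_eq (by positivity) (by positivity), ← mul_pow,
              Real.mul_self_sqrt zero_le_two]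
          rw [this]
          have h2 : √2 ^ n ≠ 0 := by positivity
          field_simp
        · funext b
          rw [unifAmp, unifAmp, hsn]
          have hiff : bitsVal b + (if true = true then 2 ^ n else 0) < m ↔
              bitsVal b < m - 2 ^ n := by
            simp
            omega
          rw [if_congr hiff rfl rfl, mul_ite, mul_zero]
          refine if_congr Iff.rfl ?_ rfl
          rw [← Complex.ofReal_mul]
          congr 1
          have h3 : (0 : ℝ) < ((m - 2 ^ n : ℕ) : ℝ) := by
            have : 0 < m - 2 ^ n := by omega
            exact_mod_cast this
          rw [Real.sqrt_div (by positivity)]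
          have h4 : √((m - 2 ^ n : ℕ) : ℝ) ≠ 0 := by positivity
          field_simp
      · classical
        intro x hx
        rw [regState_apply] at hx
        have hag : ∀ q, (∀ i < n, q ≠ bit i) → x q = Function.update y (bit n) false q := by
          by_contra hne
          exact hx (if_neg hne)
        have hall : ∀ j < n + 1, x (fl j) = false := by
          intro j hj
          rw [hag (fl j) fun i hi he => h.3 i (by omega) j hj he.symm, hfl false j hj]
        exact ⟨hall n (by omega), fun j hj => hall j (by omega)⟩

/-- Applies `had` to `bit 0, …, bit (n - 1)`, if `u` is true. -/
def hads (bit : ℕ → Q) (u : Q) : ℕ → Circuit R Q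
  | 0 => []
  | n + 1 => hads bit u n ++ ctrlGate u (bit n) had

theorem hads_of_false (O : Operator R) {u : Q} (h : ∀ i < n, u ≠ bit i) {ψ : (Q → Bool) → ℂ}
    (hψ : ∀ x, ψ x ≠ 0 → x u = false) : Circuit.op O (hads bit u n) *ᵥ ψ = ψ := by
  induction n with
  | zero => simp [hads]
  | succ n ih =>
    rw [hads, Circuit.op_append, ← Matrix.mulVec_mulVec, ih fun i hi => h i (by omega),
      ctrlGate_mulVec_of_false O (h n (by omega)) _ hψ]

theorem hads_agree (O : Operator R) {u : Q} (h : ∀ i < n, u ≠ bit i) {x y : Q → Bool}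
    (hxy : Circuit.op O (hads bit u n) x y ≠ 0) {q : Q} (hq : ∀ i < n, q ≠ bit i) :
    x q = y q := by
  induction n generalizing x with
  | zero =>
    rw [hads, Circuit.op_nil] at hxy
    by_contra hne
    refine hxy (Matrix.one_apply_ne ?_)
    rintro rfl
    exact hne rfl
  | succ n ih =>
    rw [hads, Circuit.op_append, ctrlGate_op O (h n (by omega))] at hxy
    obtain ⟨z, h1, h2⟩ := exists_of_mul_ne_zero hxy
    rw [muxOp_agree h1 (hq n (by omega)), ih (fun i hi => h i (by omega)) h2
      fun i hi => hq i (by omega)]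

theorem hads_of_true (O : Operator R) {u : Q} (hbit : Works bit n) (h : ∀ i < n, u ≠ bit i)
    {y : Q → Bool} (hu : y u = true) (hy : ∀ i < n, y (bit i) = false) :
    Circuit.op O (hads bit u n) *ᵥ Pi.single y 1 =
      regState bit n (fun _ => ((((√2)⁻¹) ^ n : ℝ) : ℂ)) y := by
  induction n with
  | zero =>
    classical
    funext x
    rw [hads, Circuit.op_nil, Matrix.one_mulVec, regState_apply, Pi.single_apply]
    simp [funext_iff]
  | succ n ih =>
    have hn := h n (by omega)
    rw [hads, Circuit.op_append, ← Matrix.mulVec_mulVec,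
      ih (fun i hi j hj => hbit i (by omega) j (by omega)) (fun i hi => h i (by omega))
        fun i hi => hy i (by omega)]
    have hy' : Function.update y (bit n) false = y := by
      rw [← hy n (by omega), Function.update_eq_self]
    have h0 : regState bit n (fun _ => ((((√2)⁻¹) ^ n : ℝ) : ℂ)) y = regState bit (n + 1)
        (fun b => if b (Fin.last n) then 0 else ((((√2)⁻¹) ^ n : ℝ) : ℂ)) y := by
      rw [regState_succ hbit, hy']
      have hz : ∀ z, regState bit n (fun _ => (0 : ℂ)) z = 0 := by
        intro z
        funext x
        simp [regState]
      simp [hz]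
    rw [h0, ctrlGate_op O hn, muxOp_regState hbit (indep_ctrl hn _ _)
      (G := (had : Matrix Bool Bool ℂ)) _ _ fun x hx => by
        rw [hx u fun i hi => h i hi, hu, if_pos rfl]]
    congr 1
    funext b
    rw [had_val, pow_succ']
    cases b (Fin.last n) <;> simp [rotMat]

/-- Prepares the uniform superposition of the numbers below `m` in `bit 0, …, bit (n - 1)`, if `u`
is true. -/
def unif (bit fl : ℕ → Q) (n m : ℕ) (u : Q) : Circuit R Q :=
  hads bit u n ++ unifTight bit fl n m u

theorem unif_of_true (O : Operator R) {fl : ℕ → Q} {m : ℕ} {u : Q} (h : UnifOK bit fl n u)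
    (hm : 0 < m) (hmn : m ≤ 2 ^ n) {y : Q → Bool} (hu : y u = true) (hy : Clear fl n y)
    (hb : ∀ i < n, y (bit i) = false) (x : Q → Bool) :
    Circuit.op O (unif bit fl n m u) x y = regState bit n (unifAmp m n) y x := by
  rw [← unifTight_of_true O h hm hmn hu hy, ← hads_of_true O h.1 h.4 hu hb, Matrix.mulVec_mulVec,
    ← Circuit.op_append, Matrix.mulVec_single_one]
  rfl

theorem unif_of_false (O : Operator R) {fl : ℕ → Q} {m : ℕ} {u : Q} (h : UnifOK bit fl n u)
    {y : Q → Bool} (hu : y u = false) (hy : Clear fl n y) (x : Q → Bool) :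
    Circuit.op O (unif bit fl n m u) x y = if x = y then 1 else 0 := by
  have hsupp : ∀ z, (Pi.single y 1 : (Q → Bool) → ℂ) z ≠ 0 → z = y := by
    intro z hz
    by_contra hne
    exact hz (Pi.single_eq_of_ne hne _)
  have e : Circuit.op O (unif bit fl n m u) *ᵥ Pi.single y 1 = Pi.single y 1 := by
    rw [unif, Circuit.op_append, ← Matrix.mulVec_mulVec,
      hads_of_false O h.4 fun z hz => by rw [hsupp z hz, hu],
      unifTight_of_false O h fun z hz => by rw [hsupp z hz]; exact ⟨hu, hy⟩]
  have := congrFun e x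
  rw [Matrix.mulVec_single_one, Pi.single_apply] at this
  exact this

theorem unif_agree (O : Operator R) {fl : ℕ → Q} {m : ℕ} {u : Q} (h : UnifOK bit fl n u)
    {x y : Q → Bool} (hxy : Circuit.op O (unif bit fl n m u) x y ≠ 0) {q : Q}
    (hq : ∀ i < n, q ≠ bit i) : x q = y q := by
  rw [unif, Circuit.op_append] at hxy
  obtain ⟨z, h1, h2⟩ := exists_of_mul_ne_zero hxy
  rw [unifTight_agree O h h1 hq, hads_agree O h.4 h2 hq]

theorem hads_cost (bit : ℕ → Q) (u : Q) (n : ℕ) {S : Set Q} (hu : u ∈ S)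
    (hbit : ∀ i < n, bit i ∈ S) : Cost (hads bit u n : Circuit R Q) n S := by
  induction n with
  | zero => exact Cost.nil S
  | succ n ih =>
    exact (ih fun i hi => hbit i (by omega)).append (gateMux_cost _ _ _ hu (hbit n (by omega)))

/-- Each bit costs at most one controlled rotation and two programs of at most eight gates. -/
theorem unifTight_cost (bit fl : ℕ → Q) (n m : ℕ) (u : Q) {S : Set Q} (hu : u ∈ S)
    (hbit : ∀ i < n, bit i ∈ S) (hfl : ∀ i < n, fl i ∈ S) :
    Cost (unifTight bit fl n m u : Circuit R Q) (17 * n) S := by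
  induction n generalizing m u with
  | zero => exact Cost.nil S
  | succ n ih =>
    have hc : ∀ U, Cost (ctrlGate u (bit n) U : Circuit R Q) 1 S :=
      fun U => gateMux_cost _ _ _ hu (hbit n (by omega))
    have hs : Cost (stepsCirc [Step.tof and u (bit n) (fl n)] : Circuit R Q) (1 * 8) S := by
      refine stepsCirc_cost fun s hs => ?_
      rw [List.mem_singleton] at hs
      subst hs
      rintro q (rfl | rfl | rfl)
      exacts [hu, hbit n (by omega), hfl n (by omega)]
    have hb' : ∀ i < n, bit i ∈ S := fun i hi => hbit i (by omega)
    have hf' : ∀ i < n, fl i ∈ S := fun i hi => hfl i (by omega)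
    rw [unifTight]
    split_ifs
    · exact ((hc _).append (ih m u hu hb' hf')).mono (by omega) subset_rfl
    · exact ((hc _).append (hs.append ((ih _ _ (hfl n (by omega)) hb' hf').append hs))).mono
        (by omega) subset_rfl

theorem unif_cost (bit fl : ℕ → Q) (n m : ℕ) (u : Q) {S : Set Q} (hu : u ∈ S)
    (hbit : ∀ i < n, bit i ∈ S) (hfl : ∀ i < n, fl i ∈ S) :
    Cost (unif bit fl n m u : Circuit R Q) (18 * n) S :=
  ((hads_cost bit u n hu hbit).append (unifTight_cost bit fl n m u hu hbit hfl)).mono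
    (by omega) subset_rfl

end Uniform
/-! ### Building blocks of the simulation circuits -/

section Blocks

variable {R Q : Type} [Fintype Q] [DecidableEq Q]

/-- Allows replacing an operator by an ideal one that agrees with it only on the columns reached by
`A`, as for programs that are correct only on cleared work qubits. -/
theorem mul_congr_left {A B B' : Operator Q} {x y : Q → Bool}
    (h : ∀ z, A z y ≠ 0 → B x z = B' x z) : (B * A) x y = (B' * A) x y := by
  rw [Matrix.mul_apply, Matrix.mul_apply]
  refine Finset.sum_congr rfl fun z _ => ?_
  by_cases h0 : A z y = 0
  · rw [h0, mul_zero, mul_zero]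
  · rw [h z h0]

variable {wk : ℕ → Q} {N : ℕ}

theorem xorEval_clean [Fintype R] [DecidableEq R] {O : Operator R}
    (hO : O ∈ Matrix.unitaryGroup (R → Bool) ℂ) (hw : Works wk N) {E : BExp Q}
    (hE : ∀ q ∈ E.vars, Free wk N q) (hN : E.size < N) {t : Q} (ht : Free wk N t)
    (ht' : t ∉ E.vars) : Clean wk N (Circuit.op O (stepsCirc (xorEval wk E t))) := by
  have hwf : ∀ s ∈ xorEval wk E t, s.WF := fun s hs =>
    xorEval_WF hw hE hN (fun j _ h2 => ht j h2) hs
  have hu := Circuit.op_mem_unitary hO (stepsCirc (xorEval wk E t))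
  rw [stepsCirc_op O hwf] at hu ⊢
  refine Clean.permOp hu fun y hy => ?_
  rw [xorEval_fn hw hE hN (fun j _ h2 => ht j h2) ht' fun j _ h2 => hy j h2]
  intro j hj
  rw [flipAt, Function.update_of_ne (ht j hj).symm, hy j hj]

theorem xorEval_col (O : Operator R) (hw : Works wk N) {E : BExp Q}
    (hE : ∀ q ∈ E.vars, Free wk N q) (hN : E.size < N) {t : Q} (ht : ∀ j, 1 ≤ j → j < N → t ≠ wk j)
    (ht' : t ∉ E.vars) {x y : Q → Bool} (hy : ∀ j, 1 ≤ j → j < N → y (wk j) = false) :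
    Circuit.op O (stepsCirc (xorEval wk E t)) x y = permOp (flipAt t E.eval) x y := by
  rw [stepsCirc_op O fun s hs => xorEval_WF hw hE hN ht hs, permOp_apply, permOp_apply,
    xorEval_fn hw hE hN ht ht' hy]

theorem BExp.indep_eval {E : BExp Q} {t : Q} (h : t ∉ E.vars) : Indep t E.eval :=
  fun _ _ hxy => BExp.eval_congr fun q hq => hxy q fun he => h (he ▸ hq)

/-- The circuit `unif`, controlled by a qubit that is computed by the program `l`. -/
def unifIf (l : List (Step Q)) (bit wk : ℕ → Q) (n m : ℕ) : Circuit R Q :=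
  stepsCirc l ++ (unif bit (fun i => wk (i + 1)) n m (wk 0) ++ stepsCirc l)

/-- The amplitudes of `|0⟩`. -/
def zeroAmp (n : ℕ) (b : Fin n → Bool) : ℂ := if ∀ i, b i = false then 1 else 0

/-- Hypotheses on the qubits and the control program of `unifIf`. -/
structure UnifIfOK (l : List (Step Q)) (g : (Q → Bool) → Bool) (bit wk : ℕ → Q) (n N : ℕ) : Prop where
  size : n < N
  works : Works wk N
  bit_inj : Works bit n
  bit_free : ∀ i < n, Free wk N (bit i)
  wf : ∀ s ∈ l, s.WF
  fn : stepsFn l = flipAt (wk 0) g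
  indep : Indep (wk 0) g
  indep_bit : ∀ x y : Q → Bool, (∀ q, (∀ i < n, q ≠ bit i) → x q = y q) → g x = g y

variable {l : List (Step Q)} {g : (Q → Bool) → Bool} {bit : ℕ → Q} {n m : ℕ}

theorem UnifIfOK.unifOK (h : UnifIfOK l g bit wk n N) :
    UnifOK bit (fun i => wk (i + 1)) n (wk 0) := by
  have hs := h.size
  refine ⟨h.bit_inj, fun i hi j hj he => ?_, fun i hi j hj => h.bit_free i hi _ (by omega),
    fun i hi => (h.bit_free i hi 0 (by omega)).symm, fun i hi he => ?_⟩
  · have := h.works _ (by omega) _ (by omega) he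
    omega
  · have := h.works _ (by omega) _ (by omega) he
    omega

theorem UnifIfOK.op (h : UnifIfOK l g bit wk n N) (O : Operator R) (x y : Q → Bool) :
    Circuit.op O (unifIf l bit wk n m) x y =
      Circuit.op O (unif bit (fun i => wk (i + 1)) n m (wk 0)) (flipAt (wk 0) g x)
        (flipAt (wk 0) g y) := by
  rw [unifIf, Circuit.op_append, Circuit.op_append, stepsCirc_op O h.wf, h.fn, mul_permOp_apply,
    permOp_mul_apply (flipAt_involutive h.indep)]

/-- The control program adds `g` to `wk 0` before and after, and `g` does not depend on the bits
that are changed in between, so the two additions cancel. -/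
theorem unifIf_agree (h : UnifIfOK l g bit wk n N) (O : Operator R) {x y : Q → Bool}
    (hxy : Circuit.op O (unifIf l bit wk n m) x y ≠ 0) {q : Q} (hq : ∀ i < n, q ≠ bit i) :
    x q = y q := by
  have hs := h.size
  rw [h.op] at hxy
  have h1 : ∀ q, (∀ i < n, q ≠ bit i) → flipAt (wk 0) g x q = flipAt (wk 0) g y q :=
    fun q hq => unif_agree O h.unifOK hxy hq
  have h0 : ∀ i < n, wk 0 ≠ bit i := fun i hi => (h.bit_free i hi 0 (by omega)).symm
  have hg : g x = g y := by
    have e := h.indep_bit _ _ h1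
    rwa [h.indep (flipAt (wk 0) g x) x fun q hq => Function.update_of_ne hq _ _,
      h.indep (flipAt (wk 0) g y) y fun q hq => Function.update_of_ne hq _ _] at e
  have h2 := h1 q hq
  by_cases hq0 : q = wk 0
  · subst hq0
    rw [flipAt_self, flipAt_self, hg] at h2
    simpa using h2
  · rwa [flipAt, flipAt, Function.update_of_ne hq0, Function.update_of_ne hq0] at h2

theorem unifIf_clean (h : UnifIfOK l g bit wk n N) (O : Operator R) :
    Clean wk N (Circuit.op O (unifIf l bit wk n m)) := by
  intro x y hxy
  refine forall₂_congr fun j hj => ?_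
  rw [unifIf_agree h O hxy fun i hi => (h.bit_free i hi j hj).symm]

/-- The control lives in `wk 0` and the flags of the recursion from `wk 1` on. In both cases the
column is a state of the register alone, uniform or zero according to `g`. -/
theorem unifIf_col (h : UnifIfOK l g bit wk n N) (O : Operator R) (hm : 0 < m) (hmn : m ≤ 2 ^ n)
    {y : Q → Bool} (hy : Clear wk N y) (hb : ∀ i < n, y (bit i) = false) (x : Q → Bool) :
    Circuit.op O (unifIf l bit wk n m) x y =
      regState bit n (if g y then unifAmp m n else zeroAmp n) y x := by
  classical
  have hs := h.size
  have h0 : ∀ i < n, bit i ≠ wk 0 := fun i hi => h.bit_free i hi 0 (by omega)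
  have hne : ∀ q, q ≠ wk 0 → ∀ z, flipAt (wk 0) g z q = z q :=
    fun q hq z => Function.update_of_ne hq _ _
  have hy0 : flipAt (wk 0) g y (wk 0) = g y := by rw [flipAt_self, hy 0 (by omega), Bool.false_xor]
  have hcl : Clear (fun i => wk (i + 1)) n (flipAt (wk 0) g y) := by
    intro j hj
    have : wk (j + 1) ≠ wk 0 := fun he => by
      have := h.works _ (by omega) _ (by omega) he
      omega
    rw [hne _ this, hy _ (by omega)]
  have hinv := flipAt_involutive h.indep
  rw [h.op]
  cases hg : g y
  · rw [unif_of_false O h.unifOK (by rw [hy0, hg]) hcl, regState_apply]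
    have e : (flipAt (wk 0) g x = flipAt (wk 0) g y) ↔ x = y := hinv.injective.eq_iff
    simp only [e, Bool.false_eq_true, if_false, zeroAmp]
    by_cases hxy : x = y
    · subst hxy
      simp only [if_true, implies_true]
      rw [if_pos fun i : Fin n => hb i i.2]
    · rw [if_neg hxy]
      split_ifs with h1 h2
      · exfalso
        apply hxy
        funext q
        by_cases hq : ∃ i < n, q = bit i
        · obtain ⟨i, hi, rfl⟩ := hq
          rw [hb i hi]
          exact h2 ⟨i, hi⟩
        · push Not at hq
          exact h1 q hq
      · rfl
      · rfl
  · rw [unif_of_true O h.unifOK hm hmn (by rw [hy0, hg]) hcl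
      fun i hi => by rw [hne _ (h0 i hi), hb i hi]]
    have e := congrFun (permOp_regState (bit := bit) (n := n) (t := wk 0)
      (fun i hi => (h0 i hi).symm) h.indep h.indep_bit (unifAmp m n) (flipAt (wk 0) g y)) x
    rw [permOp_mulVec hinv, hinv y] at e
    rw [e]
    rfl

theorem unifIf_cost {S : Set Q} (hl : ∀ s ∈ l, s.qubits ⊆ S) (hbit : ∀ i < n, bit i ∈ S)
    (hwk : ∀ i ≤ n, wk i ∈ S) :
    Cost (unifIf l bit wk n m : Circuit R Q) (16 * l.length + 18 * n) S :=
  ((stepsCirc_cost hl).append ((unif_cost bit _ n m _ (hwk 0 (Nat.zero_le _)) hbit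
    fun i hi => hwk (i + 1) hi).append (stepsCirc_cost hl))).mono (by omega) subset_rfl

/-- The phase flip. -/
def zMat : Matrix.unitaryGroup Bool ℂ :=
  ⟨Matrix.of fun i j => if i = j then (if i then -1 else 1) else 0, by
    rw [Matrix.mem_unitaryGroup_iff]
    ext i j
    cases i <;> cases j <;>
      simp [Matrix.mul_apply, Matrix.star_eq_conjTranspose, Matrix.conjTranspose_apply]⟩

/-- Changes the sign of the basis states at which `E` is true. -/
def signFlip (wk : ℕ → Q) (E : BExp Q) : Circuit R Q :=
  stepsCirc (xorEval wk E (wk 0)) ++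
    (gateOne (wk 0) zMat ++ stepsCirc (xorEval wk E (wk 0)))

/-- The value of `E` is computed into `wk 0`, a phase flip there gives the sign, and the value is
uncomputed. The phase flip is diagonal, so nothing else changes. -/
theorem signFlip_col (O : Operator R) (hw : Works wk N) {E : BExp Q}
    (hE : ∀ q ∈ E.vars, Free wk N q) (hN : E.size < N) {x y : Q → Bool} (hy : Clear wk N y) :
    Circuit.op O (signFlip wk E) x y = if x = y then (if E.eval y then -1 else 1) else 0 := by
  have h0 : ∀ j, 1 ≤ j → j < N → wk 0 ≠ wk j := by
    intro j h1 h2 h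
    have := hw 0 (by omega) j h2 h
    omega
  have h0' : wk 0 ∉ E.vars := fun h => hE _ h 0 (by omega) rfl
  set f := flipAt (wk 0) E.eval with hf
  have hinv : Function.Involutive f := flipAt_involutive (BExp.indep_eval h0')
  set A := stepsCirc (R := R) (xorEval wk E (wk 0)) with hA
  have hA1 : ∀ z w, (∀ j, 1 ≤ j → j < N → w (wk j) = false) → Circuit.op O A z w = permOp f z w :=
    fun z w hz => xorEval_col O hw hE hN h0 h0' hz
  have hfy : ∀ j, 1 ≤ j → j < N → f y (wk j) = false := fun j h1 h2 => by
    rw [hf, flipAt, Function.update_of_ne (h0 j h1 h2).symm, hy j h2]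
  have hcol : ∀ B : Operator Q, (B * Circuit.op O A) x y = B x (f y) := by
    intro B
    rw [← mul_permOp_apply B f, Matrix.mul_apply, Matrix.mul_apply]
    exact Finset.sum_congr rfl fun z _ => by rw [hA1 z y fun j _ h2 => hy j h2]
  rw [signFlip, Circuit.op_append, Circuit.op_append, hcol, gateOne_op]
  have hsupp : ∀ z, muxOp (wk 0) (fun _ => (zMat : Matrix Bool Bool ℂ)) z (f y) ≠ 0 →
      Circuit.op O A x z = permOp f x z := by
    intro z hz
    refine hA1 x z fun j h1 h2 => ?_
    rw [muxOp_agree hz (h0 j h1 h2).symm, hfy j h1 h2]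
  rw [mul_congr_left hsupp, permOp_mul_apply hinv]
  by_cases hxy : x = y
  · subst hxy
    rw [if_pos rfl, muxOp_apply, if_pos fun _ _ => rfl, hf, flipAt_self, hy 0 (by omega),
      Bool.false_xor]
    simp [zMat]
  · rw [if_neg hxy]
    by_contra hne
    apply hxy
    apply hinv.injective
    funext q
    by_cases hq : q = wk 0
    · subst hq
      rw [muxOp_apply] at hne
      by_contra h3
      apply hne
      split_ifs
      · simp [zMat, h3]
      · rfl
    · exact muxOp_agree hne hq

theorem signFlip_cost (wk : ℕ → Q) (E : BExp Q) {S : Set Q} (hE : E.vars ⊆ S)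
    (hS : ∀ j ≤ E.size, wk j ∈ S) :
    Cost (signFlip wk E : Circuit R Q) (48 * E.size + 1) S := by
  have h := xorEval_cost (R := R) wk E (wk 0) hE (hS 0 (Nat.zero_le _)) hS
  exact (h.append ((gateOne_cost (wk 0) zMat (hS 0 (Nat.zero_le _))).append h)).mono
    (by omega) subset_rfl

end Blocks

/-! ### Controlled queries, and the reflection about the cleared ancillas. -/

section Queries

variable {ns na M : ℕ} {A : Type} [Fintype A] [DecidableEq A]

/-- The block encoding of the oracle, for a controlled query to qubits that contain the system. -/
theorem ctrlQuery_apply {O : Operator (OracleReg ns na M)} {H : ℝ → Operator (Fin ns)} {α t : ℝ}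
    (hO : IsHamT O H α t) (e : Option (OracleReg ns na M) ↪ Fin ns ⊕ A)
    (he : ∀ i, e (some (.inr (.inr i))) = .inl i) (hen : ∀ i, e none ≠ .inl i)
    (hed : ∀ r i, e (some (.inl r)) ≠ .inl i)
    {z z' : Fin ns ⊕ A → Bool}
    (ha : ∀ i, z (e (some (.inr (.inl i)))) = false)
    (ha' : ∀ i, z' (e (some (.inr (.inl i)))) = false)
    (hd : z' (e none) = false → bitsVal (fun i => z' (e (some (.inl i)))) < M) :
    (Gate.ctrlQuery e false).op O z z' =
      if ∀ a, z (.inr a) = z' (.inr a) then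
        (if z' (e none) then (1 : Operator (Fin ns)) else
          (α : ℂ)⁻¹ • H ((bitsVal (fun i => z' (e (some (.inl i)))) : ℝ) * t / (M : ℝ)))
          (fun i => z (.inl i)) (fun i => z' (.inl i)) else 0 := by
  classical
  simp only [Gate.op, Bool.false_eq_true, if_false]
  rw [applyOn_apply, controlled_apply]
  have hall : (∀ a, z (.inr a) = z' (.inr a)) ↔
      (∀ q, q ∉ Set.range e → z q = z' q) ∧ z (e none) = z' (e none) ∧
        ∀ i, z (e (some (.inl i))) = z' (e (some (.inl i))) := by
    constructor
    · intro h
      have hq : ∀ q, (∀ i, q ≠ .inl i) → z q = z' q := by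
        rintro (i | a) hq
        · exact absurd rfl (hq i)
        · exact h a
      refine ⟨fun q hq' => hq q ?_, hq _ hen, fun i => hq _ (hed i)⟩
      rintro i rfl
      exact hq' ⟨_, he i⟩
    · rintro ⟨h1, h2, h3⟩ a
      by_cases hr : (.inr a : Fin ns ⊕ A) ∈ Set.range e
      · obtain ⟨o, ho⟩ := hr
        rcases o with _ | r | r | r
        · rw [← ho, h2]
        · rw [← ho, h3]
        · rw [← ho, ha, ha']
        · rw [he] at ho
          cases ho
      · exact h1 _ hr
  rw [if_congr hall rfl rfl, ite_and, ite_and]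
  refine if_congr Iff.rfl ?_ rfl
  simp only [Function.comp_apply]
  refine if_congr Iff.rfl ?_ rfl
  have hs : ∀ y : Fin ns ⊕ A → Bool, (∀ i, y (e (some (.inr (.inl i)))) = false) →
      (y ∘ e) ∘ some = Sum.elim (fun i => y (e (some (.inl i))))
        (Sum.elim (fun _ => false) fun i => y (.inl i)) := by
    intro y hy
    funext r
    rcases r with r | r | r
    · rfl
    · exact hy r
    · simp [he]
  rw [hs z ha, hs z' ha']
  -- The query is made for control `false`, and only then must the time index be below `M`, where
  -- the block of the oracle is prescribed.
  by_cases hn : z' (e none) = false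
  · simp only [hn, if_true, Bool.false_eq_true, if_false]
    rw [hO.2 _ _ _ _ (hd hn)]
    simp only [funext_iff, Matrix.smul_apply, smul_eq_mul, div_eq_inv_mul]
  · rw [Bool.not_eq_false] at hn
    simp only [hn, Bool.true_eq_false, if_false, if_true, Matrix.one_apply]
    rw [← ite_and]
    refine if_congr ?_ rfl rfl
    simp only [funext_iff, Sum.forall, Sum.elim_inl, Sum.elim_inr, implies_true, true_and]

theorem sum_eq_sum_system (a : A → Bool) (g : (Fin ns ⊕ A → Bool) → ℂ)
    (hg : ∀ z, (¬ ∀ q, z (.inr q) = a q) → g z = 0) :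
    ∑ z, g z = ∑ s : Fin ns → Bool, g (Sum.elim s a) := by
  rw [← Equiv.sum_comp (Equiv.sumArrowEquivProdArrow (Fin ns) A Bool).symm, Fintype.sum_prod_type]
  refine Finset.sum_congr rfl fun s _ => ?_
  rw [Finset.sum_eq_single a]
  · rfl
  · intro b _ hb
    refine hg _ fun h => hb ?_
    funext q
    exact h q
  · simp

/-- The reflection about the cleared ancillas. -/
def refCirc {R ι : Type} (wk : ℕ → Fin ns ⊕ A) (l : List ι) (q : ι → A) : Circuit R (Fin ns ⊕ A) :=
  signFlip wk (BExp.regEq l (fun i => .inr (q i)) fun _ => false)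

/-- The sign depends only on the listed ancillas. Every ancilla is listed or is a work qubit, so on
cleared work qubits this is the condition that all ancillas vanish. -/
theorem refCirc_isReflection {R ι : Type} (O : Operator R) {wk : ℕ → Fin ns ⊕ A} {N : ℕ}
    (hw : Works wk N) {l : List ι} {q : ι → A} (hq : ∀ i, Free wk N (.inr (q i)))
    (hN : 1 + l.length * 4 < N)
    (hall : ∀ a, (∃ i ∈ l, q i = a) ∨ ∃ j < N, wk j = .inr a) :
    IsReflection wk N (Circuit.op O (refCirc wk l q)) := by
  intro x y hy
  rw [refCirc, signFlip_col O hw _ ((BExp.size_regEq ..).trans_lt hN) hy]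
  · refine if_congr Iff.rfl (if_congr ?_ rfl rfl) rfl
    rw [BExp.eval_regEq]
    constructor
    · intro h a
      rcases hall a with ⟨i, hi, rfl⟩ | ⟨j, hj, hja⟩
      · exact h i hi
      · rw [← hja]
        exact hy j hj
    · intro h i _
      exact h _
  · exact BExp.vars_regEq (S := {q | Free wk N q}) fun i _ => hq i

theorem refCirc_cost {R ι : Type} (wk : ℕ → Fin ns ⊕ A) (l : List ι) (q : ι → A) :
    Cost (refCirc wk l q : Circuit R (Fin ns ⊕ A)) (49 + 192 * l.length) Set.univ := by
  have h := BExp.size_regEq l (fun i => (Sum.inr (q i) : Fin ns ⊕ A)) fun _ => false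
  exact (signFlip_cost wk _ (Set.subset_univ _) fun _ _ => Set.mem_univ _).mono
    (by omega) subset_rfl

end Queries
/-! ### The index states of the circuit with duplicated registers -/

section Prep

variable {ns na M K w : ℕ}

/-- The work qubits of the circuit with duplicated registers. -/
def dupWork (i : ℕ) : DupQubit ns na M K w := if h : i < w then .inr (.work ⟨i, h⟩) else .inr .p

/-- The qubits of the `j`-th time register. -/
def dupTime (j : Fin K) (i : ℕ) : DupQubit ns na M K w :=
  if h : i < Nat.clog 2 M then .inr (.d j ⟨i, h⟩) else .inr .p

/-- The generic circuits index their registers by natural numbers; the value outside the range is a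
placeholder. -/
theorem dupWork_of_lt {i : ℕ} (h : i < w) :
    (dupWork i : DupQubit ns na M K w) = .inr (.work ⟨i, h⟩) := dif_pos h

theorem dupTime_of_lt (j : Fin K) {i : ℕ} (h : i < Nat.clog 2 M) :
    (dupTime j i : DupQubit ns na M K w) = .inr (.d j ⟨i, h⟩) := dif_pos h

theorem works_dupWork : Works (dupWork : ℕ → DupQubit ns na M K w) w := by
  intro i hi j hj h
  rw [dupWork_of_lt hi, dupWork_of_lt hj] at h
  simpa using h

theorem free_dupWork {q : DupQubit ns na M K w} (h : ∀ i, q ≠ .inr (.work i)) :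
    Free dupWork w q := by
  intro j hj
  rw [dupWork_of_lt hj]
  exact h _

theorem clear_dupWork_iff (x : DupQubit ns na M K w → Bool) :
    Clear dupWork w x ↔ ∀ i, x (.inr (.work i)) = false := by
  constructor
  · intro h i
    have := h i i.2
    rwa [dupWork_of_lt i.2] at this
  · intro h j hj
    rw [dupWork_of_lt hj]
    exact h _

theorem forall_dupTime_iff (j : Fin K) (q : DupQubit ns na M K w) :
    (∀ i < Nat.clog 2 M, q ≠ dupTime j i) ↔ ∀ i, q ≠ .inr (.d j i) := by
  constructor
  · intro h i
    have := h i i.2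
    rwa [dupTime_of_lt j i.2] at this
  · intro h i hi
    rw [dupTime_of_lt j hi]
    exact h _

/-- Prepares the `j`-th time register if the `j`-th qubit of `b` is zero. -/
def prepBlock (j : Fin K) : Circuit (OracleReg ns na M) (DupQubit ns na M K w) :=
  unifIf [.cnot (.inr (.b j)) (dupWork 0), .not (dupWork 0)] (dupTime j) dupWork (Nat.clog 2 M) M

theorem prepBlock_ok (hw : Nat.clog 2 M < w) (j : Fin K) :
    UnifIfOK (Q := DupQubit ns na M K w) [.cnot (.inr (.b j)) (dupWork 0), .not (dupWork 0)]
      (fun y => !y (.inr (.b j))) (dupTime j) dupWork (Nat.clog 2 M) w := by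
  have h0 : (dupWork 0 : DupQubit ns na M K w) = .inr (.work ⟨0, by omega⟩) :=
    dupWork_of_lt (by omega)
  have hb : (.inr (.b j) : DupQubit ns na M K w) ≠ dupWork 0 := by simp [h0]
  refine ⟨hw, works_dupWork, fun i hi i' hi' h => ?_, fun i hi => free_dupWork ?_, ?_, ?_, ?_, ?_⟩
  · rw [dupTime_of_lt j hi, dupTime_of_lt j hi'] at h
    simpa using h
  · rw [dupTime_of_lt j hi]
    simp
  · intro s hs
    simp only [List.mem_cons, List.not_mem_nil, or_false] at hs
    rcases hs with rfl | rfl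
    · exact hb
    · trivial
  · funext x
    have e : stepsFn [.cnot (.inr (.b j)) (dupWork 0), .not (dupWork 0)] x =
      flipAt (dupWork 0) (fun _ => true) (flipAt (dupWork 0) (fun y => y (.inr (.b j))) x) := rfl
    rw [e, Indep.flipAt_flipAt fun _ _ _ => rfl]
    simp
  · intro x y h
    simp only [h _ hb]
  · intro x y h
    rw [h _ ((forall_dupTime_iff j _).2 fun i => by simp)]

/-- Prepares the time registers in the list `l`. -/
def prepUnif (l : List (Fin K)) : Circuit (OracleReg ns na M) (DupQubit ns na M K w) :=
  l.flatMap prepBlock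

/-- The amplitude of the `j`-th time register after its preparation. -/
def timeAmp (y x : DupQubit ns na M K w → Bool) (j : Fin K) : ℂ :=
  (if !y (.inr (.b j)) then unifAmp M (Nat.clog 2 M) else zeroAmp (Nat.clog 2 M))
    fun i => x (.inr (.d j i))

theorem prepBlock_col (hM : 0 < M) (hw : Nat.clog 2 M < w) (O : Operator (OracleReg ns na M))
    (j : Fin K) {x y : DupQubit ns na M K w → Bool} (hy : Clear dupWork w y)
    (hd : ∀ i, y (.inr (.d j i)) = false)
    [Decidable (∀ q, (∀ i, q ≠ .inr (.d j i)) → x q = y q)] :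
    Circuit.op O (prepBlock j) x y =
      if ∀ q, (∀ i, q ≠ .inr (.d j i)) → x q = y q then timeAmp y x j else 0 := by
  classical
  rw [prepBlock, unifIf_col (prepBlock_ok hw j) O hM (Nat.le_pow_clog one_lt_two M) hy
    fun i hi => by rw [dupTime_of_lt j hi, hd], regState_apply]
  simp only [forall_dupTime_iff]
  refine if_congr Iff.rfl ?_ rfl
  have e : (fun i : Fin (Nat.clog 2 M) => x (dupTime j i)) = fun i => x (.inr (.d j i)) := by
    funext i
    rw [dupTime_of_lt j i.2]
  rw [timeAmp, e]

/-- The blocks change different registers and read only `b`, so their amplitudes multiply. -/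
theorem prepUnif_col (hM : 0 < M) (hw : Nat.clog 2 M < w) (O : Operator (OracleReg ns na M))
    {l : List (Fin K)} (hl : l.Nodup) {x y : DupQubit ns na M K w → Bool}
    (hy : Clear dupWork w y) (hd : ∀ j ∈ l, ∀ i, y (.inr (.d j i)) = false)
    [Decidable (∀ q, (∀ j ∈ l, ∀ i, q ≠ .inr (.d j i)) → x q = y q)] :
    Circuit.op O (prepUnif l) x y =
      if ∀ q, (∀ j ∈ l, ∀ i, q ≠ .inr (.d j i)) → x q = y q then (l.map (timeAmp y x)).prod
      else 0 := by
  classical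
  induction l generalizing y with
  | nil =>
    simp only [prepUnif, List.flatMap_nil, Circuit.op_nil, Matrix.one_apply, funext_iff]
    refine if_congr ?_ (by simp) rfl
    simp
  | cons j l ih =>
    rw [List.nodup_cons] at hl
    have hop : Circuit.op O (prepUnif (j :: l)) x y = ∑ z, Circuit.op O (prepUnif l) x z *
        Circuit.op O (prepBlock j) z y := by
      rw [prepUnif, List.flatMap_cons, Circuit.op_append, Matrix.mul_apply]
      rfl
    have hdj := hd j List.mem_cons_self
    have hz : ∀ z, Circuit.op O (prepBlock j) z y ≠ 0 →
        ∀ q, (∀ i, q ≠ .inr (.d j i)) → z q = y q := by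
      intro z h
      rw [prepBlock_col hM hw O j hy hdj] at h
      by_contra hne
      exact h (if_neg hne)
    have hIH : ∀ z : DupQubit ns na M K w → Bool, (∀ q, (∀ i, q ≠ .inr (.d j i)) → z q = y q) →
        Circuit.op O (prepUnif l) x z =
        if ∀ q, (∀ j ∈ l, ∀ i, q ≠ .inr (.d j i)) → x q = z q then (l.map (timeAmp y x)).prod
        else 0 := by
      intro z h
      rw [ih hl.2]
      · refine if_congr Iff.rfl ?_ rfl
        congr 2
        funext j'
        rw [timeAmp, timeAmp, h (.inr (.b j')) (by simp)]
      · rw [clear_dupWork_iff] at hy ⊢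
        intro i
        rw [h _ (by simp), hy]
      · intro j' hj' i
        rw [h _ fun i' he => ?_, hd j' (List.mem_cons_of_mem _ hj')]
        simp only [Sum.inr.injEq, DupAncilla.d.injEq] at he
        exact hl.1 (he.1 ▸ hj')
    -- The only intermediate state that contributes: the `j`-th time register has its final value,
    -- all other qubits their initial one.
    set z0 : DupQubit ns na M K w → Bool := fun q => if ∃ i, q = .inr (.d j i) then x q else y q
      with hz0
    have hz0y : ∀ q, (∀ i, q ≠ .inr (.d j i)) → z0 q = y q := by
      intro q hq
      rw [hz0]
      exact if_neg (by push Not; exact hq)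
    have hz0x : ∀ i, z0 (.inr (.d j i)) = x (.inr (.d j i)) := fun i => if_pos ⟨i, rfl⟩
    rw [hop, Finset.sum_eq_single z0]
    · rw [hIH z0 hz0y, prepBlock_col hM hw O j hy hdj, if_pos hz0y, List.map_cons, List.prod_cons,
        mul_comm, mul_ite, mul_zero]
      refine if_congr ?_ ?_ rfl
      · constructor
        · intro h q hq
          rw [h q fun j' hj' => hq j' (List.mem_cons_of_mem _ hj'), hz0y q (hq j List.mem_cons_self)]
        · intro h q hq
          by_cases hqj : ∃ i, q = .inr (.d j i)
          · obtain ⟨i, rfl⟩ := hqj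
            rw [hz0x]
          · push Not at hqj
            rw [hz0y q hqj]
            refine h q fun j' hj' => ?_
            rcases List.mem_cons.1 hj' with rfl | hj'
            · exact hqj
            · exact hq j' hj'
      · congr 1
        have e : (fun i => z0 (.inr (.d j i))) = fun i => x (.inr (.d j i)) := funext hz0x
        rw [timeAmp, timeAmp, e]
    · intro z _ hne
      by_contra h
      apply hne
      have h1 := hz z (right_ne_zero_of_mul h)
      have h2 := left_ne_zero_of_mul h
      rw [hIH z h1] at h2
      have h3 : ∀ q, (∀ j ∈ l, ∀ i, q ≠ .inr (.d j i)) → x q = z q := by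
        by_contra hne
        exact h2 (if_neg hne)
      funext q
      by_cases hqj : ∃ i, q = .inr (.d j i)
      · obtain ⟨i, rfl⟩ := hqj
        rw [hz0x, h3]
        intro j' hj' i' he
        simp only [Sum.inr.injEq, DupAncilla.d.injEq] at he
        exact hl.1 (he.1 ▸ hj')
      · push Not at hqj
        rw [h1 q hqj, hz0y q hqj]
    · simp

/-- The `j`-th and the next time register are ordered, or the latter is not in use. -/
def pairExp (j : Fin K) : BExp (DupQubit ns na M K w) :=
  if h : (j : ℕ) + 1 < K then
    .node or (.lit (.inr (.b ⟨j + 1, h⟩)))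
      (.ltReg (Nat.clog 2 M) (fun i => .inr (.d j i)) fun i => .inr (.d ⟨j + 1, h⟩ i))
  else .const true

/-- The time registers in use are not ordered. -/
def disorderExp : BExp (DupQubit ns na M K w) :=
  .node (fun u _ => !u) (.all ((List.finRange K).map pairExp)) (.const true)

theorem eval_disorderExp (x : DupQubit ns na M K w → Bool) :
    disorderExp.eval x = false ↔ ∀ j (h : j + 1 < K), x (.inr (.b ⟨j + 1, h⟩)) = false →
      bitsVal (fun i => x (.inr (.d ⟨j, by omega⟩ i))) <
        bitsVal fun i => x (.inr (.d ⟨j + 1, h⟩ i)) := by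
  simp only [disorderExp, BExp.eval, Bool.not_eq_false', BExp.eval_all, List.mem_map,
    List.mem_finRange, true_and, forall_exists_index, forall_apply_eq_imp_iff]
  constructor
  · intro h j hj hb
    have := h ⟨j, by omega⟩
    simp only [pairExp, dif_pos hj, BExp.eval, hb, BExp.eval_ltReg, Bool.false_or,
      decide_eq_true_eq] at this
    exact this
  · intro h j
    by_cases hj : (j : ℕ) + 1 < K
    · simp only [pairExp, dif_pos hj, BExp.eval, BExp.eval_ltReg, Bool.or_eq_true,
        decide_eq_true_eq]
      cases hb : x (.inr (.b ⟨j + 1, hj⟩))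
      · exact Or.inr (h j hj hb)
      · exact Or.inl rfl
    · simp only [pairExp, dif_neg hj, BExp.eval]

/-- The registers `b` and `d`. -/
def orderQubits : Set (DupQubit ns na M K w) :=
  {q | ∃ j, q = .inr (.b j)} ∪ {q | ∃ j i, q = .inr (.d j i)}

theorem vars_disorderExp :
    (disorderExp : BExp (DupQubit ns na M K w)).vars ⊆ orderQubits := by
  refine Set.union_subset (BExp.vars_all ?_) (Set.empty_subset _)
  intro E hE
  obtain ⟨j, -, rfl⟩ := List.mem_map.1 hE
  unfold pairExp
  split_ifs
  · refine Set.union_subset ?_ (BExp.vars_ltReg (fun i => Or.inr ⟨_, _, rfl⟩)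
      fun i => Or.inr ⟨_, _, rfl⟩)
    exact Set.singleton_subset_iff.2 (Or.inl ⟨_, rfl⟩)
  · exact Set.empty_subset _

theorem size_disorderExp :
    (disorderExp : BExp (DupQubit ns na M K w)).size ≤ 3 + K * (8 * Nat.clog 2 M + 4) := by
  have h := BExp.size_all (l := (List.finRange K).map
    (pairExp : Fin K → BExp (DupQubit ns na M K w))) (n := 8 * Nat.clog 2 M + 3) ?_
  · simp only [List.length_map, List.length_finRange] at h
    simp only [disorderExp, BExp.size]
    linarith
  · intro E hE
    obtain ⟨j, -, rfl⟩ := List.mem_map.1 hE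
    unfold pairExp
    split_ifs
    · simp only [BExp.size, BExp.size_ltReg]
      omega
    · simp [BExp.size]

/-- Prepares the time-ordered index states by rejection sampling. -/
def prepCirc : Circuit (OracleReg ns na M) (DupQubit ns na M K w) :=
  -- Rejection is coherent: all times in use are independent and uniform, and the second flag qubit
  -- marks the tuples that are not increasing.
  prepUnif (List.finRange K) ++ stepsCirc (xorEval dupWork disorderExp (.inr (.c 1)))

/-- There are enough work qubits. -/
structure EnoughWork (na M K w : ℕ) : Prop where
  pos : 0 < M
  time : Nat.clog 2 M < w
  order : 3 + K * (8 * Nat.clog 2 M + 4) < w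

theorem free_of_mem_orderQubits {q : DupQubit ns na M K w} (hq : q ∈ orderQubits) :
    Free dupWork w q := by
  refine free_dupWork fun i => ?_
  rcases hq with ⟨j, rfl⟩ | ⟨j, i, rfl⟩ <;> simp

theorem prepCirc_cost (hw : EnoughWork na M K w) :
    Cost (prepCirc : Circuit (OracleReg ns na M) (DupQubit ns na M K w))
      (K * (32 + 18 * Nat.clog 2 M) + 24 * (3 + K * (8 * Nat.clog 2 M + 4)))
      ({q | ∃ j, q = .inr (.b j)} ∪ {q | ∃ i, q = .inr (.c i)} ∪
        {q | ∃ j i, q = .inr (.d j i)} ∪ {q | ∃ i, q = .inr (.work i)}) := by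
  have hwk : ∀ i < w, (dupWork i : DupQubit ns na M K w) ∈
      ({q | ∃ j, q = .inr (.b j)} ∪ {q | ∃ i, q = .inr (.c i)} ∪
        {q | ∃ j i, q = .inr (.d j i)} ∪ {q | ∃ i, q = .inr (.work i)} :
          Set (DupQubit ns na M K w)) := fun i hi => by
    rw [dupWork_of_lt hi]
    exact Or.inr ⟨_, rfl⟩
  have h1 := hw.time
  have h2 := hw.order
  have h3 := size_disorderExp (ns := ns) (na := na) (M := M) (K := K) (w := w)
  refine (Cost.append (n := K * (32 + 18 * Nat.clog 2 M)) ?_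
    (xorEval_cost dupWork disorderExp _ (vars_disorderExp.trans ?_) ?_ ?_)).mono (by omega)
      subset_rfl
  · have key := Cost.flatMap (l := List.finRange K) (n := 32 + 18 * Nat.clog 2 M)
      (f := fun j : Fin K => (prepBlock j : Circuit (OracleReg ns na M) (DupQubit ns na M K w)))
      (S := {q | ∃ j, q = .inr (.b j)} ∪ {q | ∃ i, q = .inr (.c i)} ∪
        {q | ∃ j i, q = .inr (.d j i)} ∪ {q | ∃ i, q = .inr (.work i)}) ?_
    · rwa [List.length_finRange] at key
    intro j _
    refine unifIf_cost ?_ ?_ ?_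
    · intro s hs
      simp only [List.mem_cons, List.not_mem_nil, or_false] at hs
      rcases hs with rfl | rfl
      · rintro q (rfl | rfl)
        · exact Or.inl (Or.inl (Or.inl ⟨_, rfl⟩))
        · exact hwk 0 (by omega)
      · rintro q rfl
        exact hwk 0 (by omega)
    · intro i hi
      rw [dupTime_of_lt j hi]
      exact Or.inl (Or.inr ⟨_, _, rfl⟩)
    · exact fun i hi => hwk i (by omega)
  · rintro q (hq | hq)
    · exact Or.inl (Or.inl (Or.inl hq))
    · exact Or.inl (Or.inr hq)
  · exact Or.inl (Or.inl (Or.inr ⟨_, rfl⟩))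
  · exact fun j hj => hwk j (by omega)

theorem c_notMem_vars (i : Fin 2) :
    (.inr (.c i) : DupQubit ns na M K w) ∉ (disorderExp : BExp (DupQubit ns na M K w)).vars := by
  intro h
  rcases vars_disorderExp h with ⟨j, h⟩ | ⟨j, i, h⟩ <;> simp at h

theorem prepCirc_clean (hw : EnoughWork na M K w) {O : Operator (OracleReg ns na M)}
    (hO : O ∈ Matrix.unitaryGroup (OracleReg ns na M → Bool) ℂ) :
    Clean dupWork w (Circuit.op O (prepCirc : Circuit (OracleReg ns na M)
      (DupQubit ns na M K w))) := by
  rw [prepCirc, Circuit.op_append]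
  refine Clean.mul (xorEval_clean hO works_dupWork
    (fun q hq => free_of_mem_orderQubits (vars_disorderExp hq))
    (size_disorderExp.trans_lt hw.order) (free_dupWork fun i => by simp) (c_notMem_vars 1)) ?_
  rw [prepUnif]
  induction List.finRange K with
  | nil => exact Clean.one
  | cons j l ih =>
    rw [List.flatMap_cons, Circuit.op_append]
    exact ih.mul (unifIf_clean (prepBlock_ok hw.time j) O)

/-- Setting the disorder flag permutes basis states after the product preparation, so the entry is
that of the product state at the row with its flag reset. -/
theorem prepCirc_col (hw : EnoughWork na M K w) (O : Operator (OracleReg ns na M))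
    {x y : DupQubit ns na M K w → Bool} (hy : Clear dupWork w y)
    (hd : ∀ j i, y (.inr (.d j i)) = false)
    [Decidable (∀ q, (∀ j i, q ≠ .inr (.d j i)) → x q = y q)] :
    Circuit.op O prepCirc x y =
      if ∀ q, (∀ j i, q ≠ .inr (.d j i)) →
        flipAt (.inr (.c 1)) disorderExp.eval x q = y q then
        ((List.finRange K).map (timeAmp y x)).prod else 0 := by
  classical
  have hcol : ∀ x, Circuit.op O (prepUnif (List.finRange K)) x y =
      if ∀ q, (∀ j i, q ≠ .inr (.d j i)) → x q = y q then
        ((List.finRange K).map (timeAmp y x)).prod else 0 := by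
    intro x
    rw [prepUnif_col hw.pos hw.time O (List.nodup_finRange K) hy fun j _ => hd j]
    simp only [List.mem_finRange, forall_const]
  rw [prepCirc, Circuit.op_append, mul_congr_left (B' := permOp (flipAt (.inr (.c 1))
    disorderExp.eval)), permOp_mul_apply (flipAt_involutive (BExp.indep_eval (c_notMem_vars 1))),
    hcol]
  · refine if_congr Iff.rfl ?_ rfl
    congr 2
  · intro z hz
    refine xorEval_col O works_dupWork
      (fun q hq => free_of_mem_orderQubits (vars_disorderExp hq))
      (size_disorderExp.trans_lt hw.order) (fun j _ h2 => free_dupWork (fun i => by simp) j h2)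
      (c_notMem_vars 1) fun j _ h2 => ?_
    have : ∀ q, (∀ j i, q ≠ .inr (.d j i)) → z q = y q := by
      rw [hcol] at hz
      by_contra hne
      exact hz (if_neg hne)
    rw [this, hy j h2]
    intro j' i
    rw [dupWork_of_lt h2]
    simp

end Prep
/-! ### The preparation circuit prepares the time-ordered index states -/

section PrepSpec

variable {ns na M K w : ℕ}

theorem bitsVal_eq_zero_iff {n : ℕ} (b : Fin n → Bool) : bitsVal b = 0 ↔ ∀ i, b i = false := by
  have h0 : bitsVal (fun _ : Fin n => false) = 0 := by simp [bitsVal]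
  rw [← h0, bitsVal_injective.eq_iff, funext_iff]

theorem ordered_of_consecutive {k : ℕ} {m : Fin K → ℕ}
    (h : ∀ j (hj : j + 1 < K), j + 1 < k → m ⟨j, by omega⟩ < m ⟨j + 1, hj⟩) (i j : Fin K)
    (hij : i < j) (hj : (j : ℕ) < k) : m i < m j := by
  obtain ⟨j, hjK⟩ := j
  induction j with
  | zero => exact absurd hij (Nat.not_lt_zero _)
  | succ j ih =>
    have h1 := h j hjK hj
    rcases Nat.lt_succ_iff_lt_or_eq.1 (show (i : ℕ) < j + 1 from hij) with h2 | h2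
    · exact (ih (by omega) h2 (by simp only at hj ⊢; omega)).trans h1
    · have : i = ⟨j, by omega⟩ := Fin.ext h2
      rwa [this]

/-- Pigeonhole. It ensures that `M.choose k` is positive whenever an increasing tuple exists. -/
theorem le_of_ordered {k : ℕ} (hk : k ≤ K) {m : Fin K → ℕ}
    (h : ∀ i j : Fin K, i < j → (j : ℕ) < k → m i < m j) (hM : ∀ j : Fin K, (j : ℕ) < k → m j < M) :
    k ≤ M := by
  have hinj : Function.Injective fun i : Fin k => (⟨m ⟨i, by omega⟩, hM _ i.2⟩ : Fin M) := by
    intro i j hij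
    simp only [Fin.mk.injEq] at hij
    rcases lt_trichotomy i j with h1 | h1 | h1
    · exact absurd hij (h ⟨i, by omega⟩ ⟨j, by omega⟩ h1 j.2).ne
    · exact h1
    · exact absurd hij (h ⟨j, by omega⟩ ⟨i, by omega⟩ h1 i.2).ne'
  simpa using Fintype.card_le_of_injective _ hinj

/-- The binomial coefficients cancel and leave M^{-k/2}, the amplitude of a single tuple in the
uniform superposition of all M^k tuples. -/
theorem rejectionAmplitude_mul (hM : 0 < M) {k : ℕ} (hk : k ≤ M) :
    rejectionAmplitude M k * √(1 / (M.choose k : ℝ)) = (√(M : ℝ))⁻¹ ^ k := by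
  have hc : (0 : ℝ) < M.choose k := by exact_mod_cast Nat.choose_pos hk
  have hM' : (0 : ℝ) < M := by exact_mod_cast hM
  have e : (M.choose k : ℝ) / (M : ℝ) ^ k * (1 / (M.choose k : ℝ)) = ((√(M : ℝ))⁻¹ ^ k) ^ 2 := by
    rw [← pow_mul, mul_comm k 2, pow_mul, inv_pow, Real.sq_sqrt hM'.le, inv_pow]
    field_simp
  rw [rejectionAmplitude, ← Real.sqrt_mul (by positivity), e, Real.sqrt_sq (by positivity)]

theorem prod_timeAmp {k : ℕ} (hk : k ≤ K) {x y : DupQubit ns na M K w → Bool}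
    (hb : ∀ j : Fin K, y (.inr (.b j)) = decide (k ≤ (j : ℕ)))
    [Decidable ((∀ j : Fin K, (j : ℕ) < k → bitsVal (fun i => x (.inr (.d j i))) < M) ∧
      ∀ j : Fin K, k ≤ (j : ℕ) → bitsVal (fun i => x (.inr (.d j i))) = 0)] :
    ((List.finRange K).map (timeAmp y x)).prod =
      if (∀ j : Fin K, (j : ℕ) < k → bitsVal (fun i => x (.inr (.d j i))) < M) ∧
        ∀ j : Fin K, k ≤ (j : ℕ) → bitsVal (fun i => x (.inr (.d j i))) = 0
      then (((√(M : ℝ))⁻¹ ^ k : ℝ) : ℂ) else 0 := by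
  have h1 : ∀ j : Fin K, (j : ℕ) < k → timeAmp y x j =
      if bitsVal (fun i => x (.inr (.d j i))) < M then (((√(M : ℝ))⁻¹ : ℝ) : ℂ) else 0 := by
    intro j hj
    have : y (.inr (.b j)) = false := by rw [hb]; simpa using hj
    simp [timeAmp, this, unifAmp]
  have h2 : ∀ j : Fin K, k ≤ (j : ℕ) → timeAmp y x j =
      if bitsVal (fun i => x (.inr (.d j i))) = 0 then 1 else 0 := by
    intro j hj
    have : y (.inr (.b j)) = true := by rw [hb]; simpa using hj
    simp only [timeAmp, this, zeroAmp, Bool.not_true, Bool.false_eq_true, if_false,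
      bitsVal_eq_zero_iff]
  rw [← Fin.prod_univ_def]
  split_ifs with h
  · have h3 : ∀ j, timeAmp y x j = if (j : ℕ) < k then (((√(M : ℝ))⁻¹ : ℝ) : ℂ) else 1 := by
      intro j
      split_ifs with hj
      · rw [h1 j hj, if_pos (h.1 j hj)]
      · rw [h2 j (not_lt.1 hj), if_pos (h.2 j (not_lt.1 hj))]
    rw [Finset.prod_congr rfl fun j _ => h3 j, Finset.prod_ite, Finset.prod_const_one, mul_one,
      Finset.prod_const, Complex.ofReal_pow]
    congr 1
    have : (Finset.univ.filter fun j : Fin K => (j : ℕ) < k).card = k := by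
      rw [Fin.card_filter_val_lt, min_eq_right hk]
    exact this
  · rw [not_and_or] at h
    push Not at h
    rcases h with ⟨j, hj, hne⟩ | ⟨j, hj, hne⟩
    · exact Finset.prod_eq_zero (Finset.mem_univ j) (by rw [h1 j hj, if_neg (not_lt.2 hne)])
    · exact Finset.prod_eq_zero (Finset.mem_univ j) (by rw [h2 j hj, if_neg hne])

/-- Restricting the uniform superposition of all tuples to the increasing ones, where the flag is
zero, gives γ_k times the normalized state, by `rejectionAmplitude_mul`. Consecutive comparisons
suffice to test the order. -/
theorem isPrep_prepCirc (hw : EnoughWork na M K w) :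
    IsPrep (prepCirc : Circuit (OracleReg ns na M) (DupQubit ns na M K w)) := by
  classical
  have hcost := prepCirc_cost (ns := ns) hw
  refine ⟨hcost.queries, hcost.actsOn, fun k hk x y hb hc hd hwk => ?_⟩
  have hcol := prepCirc_col hw 1 (x := x) ((clear_dupWork_iff y).2 hwk) hd
  have hoff : ∀ q, q ≠ .inr (.c 1) → flipAt (.inr (.c 1)) disorderExp.eval x q = x q :=
    fun q hq => Function.update_of_ne hq _ _
  refine ⟨fun hsame h0 h1 => ?_, fun h => ?_⟩
  · rw [hcol, timeOrderedState]
    have hb' : ∀ j : Fin K, x (.inr (.b j)) = decide (k ≤ (j : ℕ)) := fun j => by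
      rw [hsame _ (by simp) (by simp), hb]
    cases hv : disorderExp.eval x
    · rw [flipAt_of_false hv, if_pos]
      · rw [eval_disorderExp] at hv
        have hord := ordered_of_consecutive (k := k)
          (m := fun j => bitsVal fun i => x (.inr (.d j i))) fun j hj hjk =>
            hv j hj (by rw [hb']; simpa using hjk)
        rw [prod_timeAmp hk hb]
        by_cases hall : (∀ j : Fin K, (j : ℕ) < k → bitsVal (fun i => x (.inr (.d j i))) < M) ∧
            ∀ j : Fin K, k ≤ (j : ℕ) → bitsVal (fun i => x (.inr (.d j i))) = 0
        · rw [if_pos hall, if_pos ⟨hord, hall⟩,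
            rejectionAmplitude_mul hw.pos (le_of_ordered hk hord hall.1)]
        · rw [if_neg hall, if_neg fun h => hall h.2, mul_zero, Complex.ofReal_zero]
      · intro q hq
        by_cases hqc : ∃ i, q = .inr (.c i)
        · obtain ⟨i, rfl⟩ := hqc
          rw [hc]
          fin_cases i
          exacts [h0, h1]
        · push Not at hqc
          exact hsame q hqc hq
    · rw [if_neg, if_neg, mul_zero, Complex.ofReal_zero]
      · rintro ⟨hord, -, -⟩
        rw [← Bool.not_eq_false, eval_disorderExp] at hv
        apply hv
        intro j hj hbj
        rw [hb'] at hbj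
        exact hord ⟨j, by omega⟩ ⟨j + 1, hj⟩ (Nat.lt_succ_self j) (by simpa using hbj)
      · intro h
        have := h (.inr (.c 1)) (by simp)
        rw [flipAt_self, hv, h1, hc] at this
        cases this
  · rw [hcol, if_neg]
    intro hall
    rcases h with h | h
    · refine h fun q hqc hqd => ?_
      rw [← hoff q (hqc 1), hall q hqd]
    · have := hall (.inr (.c 0)) (by simp)
      rw [hoff _ (by simp), h, hc] at this
      cases this

end PrepSpec
/-! ### Superpositions of unary numbers -/

section Chain

variable {R Q : Type} [Fintype Q] [DecidableEq Q]

/-- The `i`-th gate of `chain`. -/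
def chainGate (bit : ℕ → Q) (c s : ℕ → ℝ) : ℕ → Circuit R Q
  | 0 => gateOne (bit 0) (rot (c 0) (s 0))
  | i + 1 => gateMux (bit i) (bit (i + 1)) fun v =>
      if v then ⟨xMat true, xMat_mem_unitary _⟩ else rot (c (i + 1)) (s (i + 1))

/-- Prepares a superposition of the unary numbers `|0⟩^{⊗ k} |1⟩^{⊗ (n - k)}`; the number ends at
the `i`-th place with the amplitude `s i`, and continues with the amplitude `c i`. -/
def chain (bit : ℕ → Q) (c s : ℕ → ℝ) : ℕ → Circuit R Q
  | 0 => []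
  | n + 1 => chain bit c s n ++ chainGate bit c s n

/-- The bit before the `i`-th one. -/
def prevBit (b : ℕ → Bool) : ℕ → Bool
  | 0 => false
  | i + 1 => b i

/-- The amplitude of a bit, depending on the previous one. -/
def chainFac (c s : ℝ) (prev cur : Bool) : ℂ :=
  if prev then (if cur then 1 else 0) else (if cur then s else c)

/-- The amplitudes of the superposition prepared by `chain`. -/
def chainAmp (c s : ℕ → ℝ) (n : ℕ) (b : ℕ → Bool) : ℂ :=
  ∏ i ∈ Finset.range n, chainFac (c i) (s i) (prevBit b i) (b i)

theorem chainGate_op (O : Operator R) {bit : ℕ → Q} {c s : ℕ → ℝ} {n : ℕ}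
    (hbit : Works bit (n + 1)) (hcs : c n ^ 2 + s n ^ 2 = 1) :
    ∃ F : (Q → Bool) → Matrix Bool Bool ℂ, Indep (bit n) F ∧
      Circuit.op O (chainGate bit c s n) = muxOp (bit n) F ∧
      ∀ x b, F x b false = chainFac (c n) (s n) (prevBit (fun i => x (bit i)) n) b := by
  cases n with
  | zero =>
    refine ⟨_, fun _ _ _ => rfl, gateOne_op O _ _, fun x b => ?_⟩
    rw [rot_val hcs]
    cases b <;> simp [rotMat, chainFac, prevBit]
  | succ n =>
    have hne : bit n ≠ bit (n + 1) := fun h => by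
      have := hbit _ (by omega) _ (by omega) h
      omega
    refine ⟨fun y => ((if y (bit n) then ⟨xMat true, xMat_mem_unitary _⟩ else
      rot (c (n + 1)) (s (n + 1)) : Matrix.unitaryGroup Bool ℂ) : Matrix Bool Bool ℂ),
      fun x y h => ?_, by rw [chainGate, gateMux_op O hne], fun x b => ?_⟩
    · simp only
      rw [h _ hne]
    · simp only [prevBit]
      cases x (bit n)
      · rw [if_neg Bool.false_ne_true, rot_val hcs]
        cases b <;> simp [rotMat, chainFac]
      · cases b <;> simp [xMat, chainFac]

/-- The last gate acts on a qubit that is still zero, so only its column `false` matters, and this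
entry depends on the previous bit alone. Amplitudes therefore multiply along the bits. -/
theorem chain_apply (O : Operator R) {bit : ℕ → Q} {c s : ℕ → ℝ} {n : ℕ} (hbit : Works bit n)
    (hcs : ∀ i < n, c i ^ 2 + s i ^ 2 = 1) {y : Q → Bool} (hy : ∀ i < n, y (bit i) = false)
    (x : Q → Bool) [Decidable (∀ q, (∀ i < n, q ≠ bit i) → x q = y q)] :
    Circuit.op O (chain bit c s n) x y =
      if ∀ q, (∀ i < n, q ≠ bit i) → x q = y q then chainAmp c s n fun i => x (bit i) else 0 := by
  classical
  induction n generalizing x with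
  | zero =>
    rw [chain, Circuit.op_nil, Matrix.one_apply]
    refine if_congr ?_ (by simp [chainAmp]) rfl
    simp [funext_iff]
  | succ n ih =>
    have ih' := ih (fun i hi j hj => hbit i (by omega) j (by omega)) (fun i hi => hcs i (by omega))
      (fun i hi => hy i (by omega))
    obtain ⟨F, hF, hop, hval⟩ := chainGate_op O hbit (hcs n (by omega))
    have e := muxOp_mulVec (bit n) hF (fun z => Circuit.op O (chain bit c s n) z y) x
    rw [chain, Circuit.op_append, hop]
    refine Eq.trans (show _ = (muxOp (bit n) F *ᵥ
      fun z => Circuit.op O (chain bit c s n) z y) x from rfl) (e.trans ?_)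
    have hne : ∀ i < n, bit i ≠ bit n := fun i hi h => by
      have := hbit _ (by omega) _ (by omega) h
      omega
    have h1 : ∀ b, (∀ q, (∀ i < n, q ≠ bit i) → Function.update x (bit n) b q = y q) ↔
        b = false ∧ ∀ q, (∀ i < n + 1, q ≠ bit i) → x q = y q := by
      intro b
      constructor
      · intro h
        refine ⟨?_, fun q hq => ?_⟩
        · have := h (bit n) fun i hi => (hne i hi).symm
          rwa [Function.update_self, hy n (by omega)] at this
        · rw [← h q fun i hi => hq i (by omega), Function.update_of_ne (hq n (by omega))]
      · rintro ⟨rfl, h⟩ q hq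
        by_cases hqn : q = bit n
        · rw [hqn, Function.update_self, hy n (by omega)]
        · rw [Function.update_of_ne hqn]
          refine h q fun i hi => ?_
          rcases Nat.lt_succ_iff_lt_or_eq.1 hi with h | rfl
          exacts [hq i h, hqn]
    have h2 : ∀ b, chainAmp c s n (fun i => Function.update x (bit n) b (bit i)) =
        chainAmp c s n fun i => x (bit i) := by
      intro b
      refine Finset.prod_congr rfl fun i hi => ?_
      rw [Finset.mem_range] at hi
      have h3 : ∀ j < n, Function.update x (bit n) b (bit j) = x (bit j) :=
        fun j hj => Function.update_of_ne (hne j hj) _ _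
      have h4 : prevBit (fun i => Function.update x (bit n) b (bit i)) i =
          prevBit (fun i => x (bit i)) i := by
        cases i with
        | zero => rfl
        | succ i => exact h3 i (by omega)
      simp only [h3 i hi, h4]
    simp only [ih', h1, h2]
    rw [Fintype.sum_bool]
    simp only [Bool.true_eq_false, false_and, if_false, mul_zero, zero_add, true_and]
    rw [hval, mul_ite, mul_zero]
    refine if_congr Iff.rfl ?_ rfl
    rw [chainAmp, chainAmp, Finset.prod_range_succ, mul_comm]

theorem chain_cost (bit : ℕ → Q) (c s : ℕ → ℝ) (n : ℕ) {S : Set Q} (hbit : ∀ i < n, bit i ∈ S) :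
    Cost (chain bit c s n : Circuit R Q) n S := by
  induction n with
  | zero => exact Cost.nil S
  | succ n ih =>
    refine (ih fun i hi => hbit i (by omega)).append ?_
    cases n with
    | zero => exact gateOne_cost _ _ (hbit 0 (by omega))
    | succ n =>
      rw [chainGate]
      exact gateMux_cost _ _ _ (hbit n (by omega)) (hbit (n + 1) (by omega))

/-- After a bit one, the factors of all later bits zero vanish. -/
theorem exists_unary_of_chainAmp_ne_zero {c s : ℕ → ℝ} {n : ℕ} {b : ℕ → Bool}
    (h : chainAmp c s n b ≠ 0) : ∃ k ≤ n, ∀ i < n, b i = decide (k ≤ i) := by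
  induction n with
  | zero => exact ⟨0, le_rfl, fun i hi => absurd hi (Nat.not_lt_zero _)⟩
  | succ n ih =>
    rw [chainAmp, Finset.prod_range_succ] at h
    obtain ⟨k, hk, hb⟩ := ih (left_ne_zero_of_mul h)
    have h2 := right_ne_zero_of_mul h
    rcases hk.lt_or_eq with hlt | rfl
    · refine ⟨k, by omega, fun i hi => ?_⟩
      rcases Nat.lt_succ_iff_lt_or_eq.1 hi with h' | rfl
      · exact hb i h'
      · have hp : prevBit b i = true := by
          cases i with
          | zero => omega
          | succ i =>
            rw [prevBit, hb i (by omega)]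
            simp
            omega
        rw [chainFac, hp, if_pos rfl] at h2
        have : b i = true := by
          by_contra hf
          exact h2 (if_neg hf)
        rw [this]
        simp
        omega
    · cases hbk : b k
      · refine ⟨k + 1, le_rfl, fun i hi => ?_⟩
        rcases Nat.lt_succ_iff_lt_or_eq.1 hi with h' | rfl
        · rw [hb i h', decide_eq_decide]
          omega
        · rw [hbk]
          simp
      · refine ⟨k, by omega, fun i hi => ?_⟩
        rcases Nat.lt_succ_iff_lt_or_eq.1 hi with h' | rfl
        · exact hb i h'
        · rw [hbk]
          simp

/-- The partial sums of the geometric series. -/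
def geomSum (x : ℝ) (n : ℕ) : ℝ := ∑ i ∈ Finset.range (n + 1), x ^ i

theorem geomSum_succ (x : ℝ) (n : ℕ) : geomSum x (n + 1) = 1 + x * geomSum x n := by
  rw [geomSum, Finset.sum_range_succ', geomSum, Finset.mul_sum, add_comm]
  simp [pow_succ']

theorem one_le_geomSum {x : ℝ} (hx : 0 ≤ x) (n : ℕ) : 1 ≤ geomSum x n := by
  cases n with
  | zero => simp [geomSum]
  | succ n =>
    have : 0 ≤ geomSum x n := Finset.sum_nonneg fun i _ => pow_nonneg hx i
    rw [geomSum_succ]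
    nlinarith [mul_nonneg hx this]

theorem geomSum_le_two {x : ℝ} (hx : 0 ≤ x) (hx' : x ≤ 1 / 2) (n : ℕ) : geomSum x n ≤ 2 := by
  induction n with
  | zero => simp [geomSum]
  | succ n ih =>
    rw [geomSum_succ]
    nlinarith [one_le_geomSum hx n]

/-- The amplitude for continuing a unary number. -/
def geomCont (x : ℝ) (K i : ℕ) : ℝ := √(x * geomSum x (K - i - 1) / geomSum x (K - i))

/-- The amplitude for ending a unary number. -/
def geomStop (x : ℝ) (K i : ℕ) : ℝ := √(1 / geomSum x (K - i))

/-- The recursion g_{n+1} = 1 + x g_n splits the remaining weight into stopping and continuing. -/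
theorem geomCont_sq_add {x : ℝ} (hx : 0 ≤ x) {K i : ℕ} (hi : i < K) :
    geomCont x K i ^ 2 + geomStop x K i ^ 2 = 1 := by
  have h1 := one_le_geomSum hx (K - i - 1)
  have h2 := one_le_geomSum hx (K - i)
  have h3 : geomSum x (K - i) = 1 + x * geomSum x (K - i - 1) := by
    rw [← geomSum_succ]
    congr 1
    omega
  rw [geomCont, geomStop, Real.sq_sqrt (by positivity), Real.sq_sqrt (by positivity),
    ← add_div, add_comm, ← h3, div_self (by linarith)]

/-- The squared amplitudes x g_{K-i-1}/g_{K-i} for continuing telescope to x^k g_{K-k}/g_K, and the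
squared amplitude 1/g_{K-k} for stopping cancels the remaining sum. -/
theorem chainAmp_geom {x : ℝ} (hx : 0 ≤ x) {K k : ℕ} (hk : k ≤ K) {b : ℕ → Bool}
    (hb : ∀ i < K, b i = decide (k ≤ i)) :
    chainAmp (geomCont x K) (geomStop x K) K b = (√(x ^ k / geomSum x K) : ℝ) := by
  have hpos : ∀ n, 0 < geomSum x n := fun n => by linarith [one_le_geomSum hx n]
  have hpre : ∀ n ≤ k, chainAmp (geomCont x K) (geomStop x K) n b =
      (√(x ^ n * geomSum x (K - n) / geomSum x K) : ℝ) := by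
    intro n hn
    induction n with
    | zero => simp [chainAmp, (hpos K).ne']
    | succ n ih =>
      have hp : prevBit b n = false := by
        cases n with
        | zero => rfl
        | succ n =>
          rw [prevBit, hb n (by omega)]
          simp
          omega
      have hbn : b n = false := by
        rw [hb n (by omega)]
        simp
        omega
      rw [chainAmp, Finset.prod_range_succ, ← chainAmp, ih (by omega), hp, hbn]
      simp only [chainFac, Bool.false_eq_true, if_false]
      have h1 := hpos (K - n)
      have h2 := hpos K
      rw [geomCont, ← Complex.ofReal_mul, ← Real.sqrt_mul (by positivity)]
      congr 2
      rw [show K - (n + 1) = K - n - 1 by omega]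
      field_simp
      ring
  have hpost : ∀ n, k < n → n ≤ K → chainAmp (geomCont x K) (geomStop x K) n b =
      (√(x ^ k / geomSum x K) : ℝ) := by
    intro n hkn hn
    induction n with
    | zero => omega
    | succ n ih =>
      rw [chainAmp, Finset.prod_range_succ, ← chainAmp]
      have hbn : b n = true := by
        rw [hb n (by omega)]
        simp
        omega
      rcases Nat.lt_succ_iff_lt_or_eq.1 hkn with h' | rfl
      · have hp : prevBit b n = true := by
          cases n with
          | zero => omega
          | succ n =>
            rw [prevBit, hb n (by omega)]
            simp
            omega
        rw [ih h' (by omega), hp, hbn]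
        simp [chainFac]
      · have hp : prevBit b k = false := by
          cases k with
          | zero => rfl
          | succ n =>
            rw [prevBit, hb n (by omega)]
            simp
        rw [hpre k le_rfl, hp, hbn]
        have h1 := hpos (K - k)
        have h2 := hpos K
        simp only [chainFac, Bool.false_eq_true, if_false, if_true]
        rw [geomStop, ← Complex.ofReal_mul, ← Real.sqrt_mul (by positivity)]
        congr 2
        field_simp
  -- For k = K there is no bit at which the number ends; then g_0 = 1 and no stopping factor is
  -- needed.
  rcases hk.lt_or_eq with h | rfl
  · exact hpost K h le_rfl
  · rw [hpre k le_rfl]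
    simp [geomSum]

/-- The gate `|0⟩⟨0| u + |1⟩⟨1|`. -/
def phaseGate (u : ℂ) : Matrix.unitaryGroup Bool ℂ :=
  if h : u * star u = 1 then
    ⟨Matrix.of fun i j => if i = j then (if i then 1 else u) else 0, by
      rw [Matrix.mem_unitaryGroup_iff]
      ext i j
      have h' : u * (starRingEnd ℂ) u = 1 := h
      cases i <;> cases j <;>
        simp [Matrix.mul_apply, Matrix.star_eq_conjTranspose, Matrix.conjTranspose_apply, h']⟩
  else 1

theorem phaseGate_apply {u : ℂ} (h : u * star u = 1) (i j : Bool) :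
    (phaseGate u : Matrix Bool Bool ℂ) i j = if i = j then (if i then 1 else u) else 0 := by
  rw [phaseGate, dif_pos h]
  rfl

/-- Phases on the first `n` bits. -/
def phases (bit : ℕ → Q) (u : ℕ → ℂ) : ℕ → Circuit R Q
  | 0 => []
  | n + 1 => phases bit u n ++ gateOne (bit n) (phaseGate (u n))

theorem phases_op (O : Operator R) (bit : ℕ → Q) {u : ℕ → ℂ} (hu : ∀ i, u i * star (u i) = 1)
    (n : ℕ) : Circuit.op O (phases bit u n) =
      Matrix.diagonal fun x => ∏ i ∈ Finset.range n, if x (bit i) then 1 else u i := by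
  induction n with
  | zero => simp [phases]
  | succ n ih =>
    have : muxOp (bit n) (fun _ => (phaseGate (u n) : Matrix Bool Bool ℂ)) =
        Matrix.diagonal fun x => if x (bit n) then 1 else u n := by
      ext x y
      rw [muxOp_apply, phaseGate_apply (hu n), Matrix.diagonal_apply, ← ite_and]
      refine if_congr ?_ rfl rfl
      constructor
      · rintro ⟨h1, h2⟩
        funext q
        by_cases hq : q = bit n
        · rw [hq, h2]
        · exact h1 q hq
      · rintro rfl
        exact ⟨fun _ _ => rfl, rfl⟩
    rw [phases, Circuit.op_append, gateOne_op, ih, this, Matrix.diagonal_mul_diagonal]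
    congr 1
    funext x
    rw [Finset.prod_range_succ, mul_comm]

theorem phases_cost (bit : ℕ → Q) (u : ℕ → ℂ) (n : ℕ) {S : Set Q} (hbit : ∀ i < n, bit i ∈ S) :
    Cost (phases bit u n : Circuit R Q) n S := by
  induction n with
  | zero => exact Cost.nil S
  | succ n ih => exact (ih fun i hi => hbit i (by omega)).append (gateOne_cost _ _ (hbit n (by omega)))

theorem chainAmp_congr {c s : ℕ → ℝ} {n : ℕ} {b b' : ℕ → Bool} (h : ∀ i < n, b i = b' i) :
    chainAmp c s n b = chainAmp c s n b' := by
  refine Finset.prod_congr rfl fun i hi => ?_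
  rw [Finset.mem_range] at hi
  have h' : prevBit b i = prevBit b' i := by
    cases i with
    | zero => rfl
    | succ i => exact h i (by omega)
  rw [h i hi, h']

/-- A rotation of a cleared qubit after a circuit that does not involve it. -/
theorem rot_mul_apply (O : Operator R) {p : Q} {c s : ℝ} (hcs : c ^ 2 + s ^ 2 = 1) {A : Operator Q}
    {x y : Q → Bool} (hA : ∀ x, A x y ≠ 0 → x p = false) :
    (Circuit.op O (gateOne p (rot c s)) * A) x y =
      (if x p then (s : ℂ) else c) * A (Function.update x p false) y := by
  have e := muxOp_mulVec p (F := fun _ => ((rot c s : Matrix.unitaryGroup Bool ℂ) :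
    Matrix Bool Bool ℂ)) (fun _ _ _ => rfl) (fun z => A z y) x
  rw [gateOne_op]
  refine Eq.trans (show _ = (muxOp p (fun _ => ((rot c s : Matrix.unitaryGroup Bool ℂ) :
    Matrix Bool Bool ℂ)) *ᵥ fun z => A z y) x from rfl) (e.trans ?_)
  have h0 : A (Function.update x p true) y = 0 := by
    by_contra h
    have := hA _ h
    simp at this
  rw [Fintype.sum_bool, h0, rot_val hcs]
  cases x p <;> simp [rotMat]

end Chain
/-! ### Time-ordered elementary symmetric polynomials -/

section OrderedSums

variable {A : Type*} [Ring A]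

/-- The product `f (n - 1) ⋯ f 1 f 0`. -/
def descProd (f : ℕ → A) : ℕ → A
  | 0 => 1
  | n + 1 => f n * descProd f n

theorem descProd_congr {f g : ℕ → A} {n : ℕ} (h : ∀ i < n, f i = g i) :
    descProd f n = descProd g n := by
  induction n with
  | zero => rfl
  | succ n ih => rw [descProd, descProd, h n (by omega), ih fun i hi => h i (by omega)]

theorem descProd_eq_list (f : ℕ → A) (n : ℕ) :
    ((List.finRange n).reverse.map fun j : Fin n => f j).prod = descProd f n := by
  have h : (List.finRange n).reverse.map (fun j : Fin n => f j) =
      (List.range n).reverse.map f := by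
    rw [← List.map_coe_finRange_eq_range, ← List.map_reverse, List.map_map]
    rfl
  rw [h]
  clear h
  induction n with
  | zero => rfl
  | succ n ih =>
    rw [List.range_succ, List.reverse_append, List.map_append, List.prod_append, ih, descProd]
    simp

theorem descProd_eq_of_le {f : ℕ → A} {n k : ℕ} (hk : k ≤ n) (h : ∀ i, k ≤ i → f i = 1) :
    descProd f n = descProd f k := by
  induction n with
  | zero => rw [Nat.le_zero.1 hk]
  | succ n ih =>
    rcases hk.lt_or_eq with h' | h'
    · rw [descProd, h n (by omega), one_mul, ih (by omega)]
    · rw [h']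

/-- The sum of the products `h (m_k) ⋯ h (m_1)` over all `m_1 < ⋯ < m_k < m`. -/
def orderedSum (h : ℕ → A) : ℕ → ℕ → A
  | 0, _ => 1
  | _ + 1, 0 => 0
  | k + 1, m + 1 => orderedSum h (k + 1) m + h m * orderedSum h k m

/-- Isolates the largest index, which is the leftmost factor. -/
theorem orderedSum_succ (h : ℕ → A) (k m : ℕ) :
    orderedSum h (k + 1) m = ∑ l ∈ Finset.range m, h l * orderedSum h k l := by
  induction m with
  | zero => simp [orderedSum]
  | succ m ih => rw [Finset.sum_range_succ, ← ih, orderedSum]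

/-- The value of the last entry is a bound for an increasing sequence. -/
theorem strictMono_snoc_iff {M k : ℕ} (t : Fin k → Fin M) (l : Fin M) :
    StrictMono (Fin.snoc (α := fun _ => Fin M) t l) ↔ StrictMono t ∧ ∀ i, t i < l := by
  constructor
  · intro h
    refine ⟨fun i j hij => ?_, fun i => ?_⟩
    · have := h (Fin.castSucc_lt_castSucc_iff.2 hij)
      simpa using this
    · have := h (Fin.castSucc_lt_last i)
      simpa using this
  · rintro ⟨h1, h2⟩ i j hij
    induction j using Fin.lastCases with
    | last =>
      induction i using Fin.lastCases with
      | last => exact absurd hij (lt_irrefl _)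
      | cast i => simpa using h2 i
    | cast j =>
      induction i using Fin.lastCases with
      | last => exact absurd hij (not_lt.2 (Fin.le_last _))
      | cast i => simpa using h1 (Fin.castSucc_lt_castSucc_iff.1 hij)

/-- The `j`-th entry of a sequence, or zero. -/
def entry {M k : ℕ} (t : Fin k → Fin M) (j : ℕ) : ℕ := if h : j < k then t ⟨j, h⟩ else 0

/-- Removing the last entry of an increasing tuple removes the leftmost factor of the product and
bounds the other entries, which is the recursion `orderedSum_succ`. -/
theorem sum_strictMono (h : ℕ → A) {M : ℕ} (k m : ℕ) (hm : m ≤ M)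
    [∀ t : Fin k → Fin M, Decidable (StrictMono t ∧ ∀ i, (t i : ℕ) < m)] :
    ∑ t : Fin k → Fin M, (if StrictMono t ∧ ∀ i, (t i : ℕ) < m then
      descProd (fun j => h (entry t j)) k else 0) = orderedSum h k m := by
  classical
  induction k generalizing m with
  | zero =>
    rw [Fintype.sum_subsingleton _ (Fin.elim0 : Fin 0 → Fin M), if_pos]
    · simp [descProd, orderedSum]
    · exact ⟨fun i => i.elim0, fun i => i.elim0⟩
  | succ k ih =>
    rw [← Equiv.sum_comp (Fin.snocEquiv fun _ => Fin M), Fintype.sum_prod_type, orderedSum_succ]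
    have key : ∀ l : Fin M, (∑ t : Fin k → Fin M,
        if StrictMono (Fin.snocEquiv (fun _ => Fin M) (l, t)) ∧
          ∀ i, (Fin.snocEquiv (fun _ => Fin M) (l, t) i : ℕ) < m then
        descProd (fun j => h (entry (Fin.snocEquiv (fun _ => Fin M) (l, t)) j)) (k + 1) else 0) =
        if (l : ℕ) < m then h l * orderedSum h k l else 0 := by
      intro l
      have he : ∀ t : Fin k → Fin M, descProd
          (fun j => h (entry (Fin.snocEquiv (fun _ => Fin M) (l, t)) j)) (k + 1) =
          h l * descProd (fun j => h (entry t j)) k := by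
        intro t
        rw [descProd]
        congr 1
        · simp only [entry, lt_add_iff_pos_right, zero_lt_one, dif_pos]
          have : (⟨k, by omega⟩ : Fin (k + 1)) = Fin.last k := rfl
          rw [this]
          simp [Fin.snocEquiv]
        · refine descProd_congr fun i hi => ?_
          simp only [entry, dif_pos hi, dif_pos (show i < k + 1 by omega)]
          change h (Fin.snoc (α := fun _ => Fin M) t l (Fin.castSucc ⟨i, hi⟩) : ℕ) = _
          rw [Fin.snoc_castSucc]
      have hc : ∀ t : Fin k → Fin M, (StrictMono (Fin.snocEquiv (fun _ => Fin M) (l, t)) ∧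
          ∀ i, (Fin.snocEquiv (fun _ => Fin M) (l, t) i : ℕ) < m) ↔
          (l : ℕ) < m ∧ StrictMono t ∧ ∀ i, (t i : ℕ) < l := by
        intro t
        have e : Fin.snocEquiv (fun _ => Fin M) (l, t) = Fin.snoc (α := fun _ => Fin M) t l := rfl
        rw [e, strictMono_snoc_iff]
        constructor
        · rintro ⟨⟨h1, h2⟩, h3⟩
          have := h3 (Fin.last k)
          rw [Fin.snoc_last] at this
          exact ⟨this, h1, h2⟩
        · rintro ⟨h1, h2, h3⟩
          refine ⟨⟨h2, h3⟩, fun i => ?_⟩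
          induction i using Fin.lastCases with
          | last => rwa [Fin.snoc_last]
          | cast i =>
            rw [Fin.snoc_castSucc]
            exact (h3 i).trans h1
      simp only [he, hc]
      split_ifs with hl
      · simp only [hl, true_and, ← mul_ite_zero, ← Finset.mul_sum]
        rw [ih l l.2.le]
      · simp [hl]
    rw [Finset.sum_congr rfl fun l _ => key l,
      Fin.sum_univ_eq_sum_range (fun l => if l < m then h l * orderedSum h k l else 0) M,
      ← Finset.sum_filter]
    refine Finset.sum_congr ?_ fun _ _ => rfl
    ext l
    simp only [Finset.mem_filter, Finset.mem_range]
    omega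

theorem orderedSum_smul {𝕜 : Type*} [CommRing 𝕜] [Algebra 𝕜 A] (c : 𝕜) (h : ℕ → A) (k m : ℕ) :
    orderedSum (fun i => c • h i) k m = c ^ k • orderedSum h k m := by
  induction m generalizing k with
  | zero => cases k <;> simp [orderedSum]
  | succ m ih =>
    cases k with
    | zero => simp [orderedSum]
    | succ k =>
      rw [orderedSum, orderedSum, ih, ih, smul_add, smul_mul_smul_comm, pow_succ']

end OrderedSums

/-- The truncated and discretized Dyson series
`∑_{k ≤ K} (-i t / M)^k ∑_{m_1 < ⋯ < m_k < M} H(m_k t / M) ⋯ H(m_1 t / M)`. -/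
def truncatedDyson {ns : ℕ} (H : ℝ → Operator (Fin ns)) (t : ℝ) (M K : ℕ) : Operator (Fin ns) :=
  ∑ k ∈ Finset.range (K + 1), (-Complex.I * (t / M : ℝ)) ^ k •
    orderedSum (fun m => H ((m : ℝ) * t / (M : ℝ))) k M
/-! ### The block of the circuit with duplicated registers -/

section DupBlock

variable {ns na M K w : ℕ}

/-- The operator applied by the `j`-th controlled query. -/
def dupFactor (H : ℝ → Operator (Fin ns)) (α t : ℝ) (a : DupAncilla na M K w → Bool) (j : Fin K) :
    Operator (Fin ns) :=
  if a (.b j) then 1 else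
    (α : ℂ)⁻¹ • H ((bitsVal (fun i => a (.d j i)) : ℝ) * t / (M : ℝ))

theorem copyEmbedding_eq_a {j j' : Fin K} {i : Fin na} {o : Option (OracleReg ns na M)}
    (h : (copyEmbedding j o : DupQubit ns na M K w) = .inr (.a j' i)) : j = j' := by
  rcases o with _ | r | r | r
  · have h' : (.inr (.b j) : DupQubit ns na M K w) = .inr (.a j' i) := h
    simp at h'
  · have h' : (.inr (.d j r) : DupQubit ns na M K w) = .inr (.a j' i) := h
    simp at h'
  · have h' : (.inr (.a j r) : DupQubit ns na M K w) = .inr (.a j' i) := h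
    simp only [Sum.inr.injEq, DupAncilla.a.injEq] at h'
    exact h'.1
  · have h' : (.inl r : DupQubit ns na M K w) = .inr (.a j' i) := h
    simp at h'

/-- All controlled queries between states with cleared oracle ancillas. -/
theorem queryList_apply {O : Operator (OracleReg ns na M)} {H : ℝ → Operator (Fin ns)} {α t : ℝ}
    (hO : IsHamT O H α t) {l : List (Fin K)} (hl : l.Nodup) {z z' : DupQubit ns na M K w → Bool}
    (ha : ∀ j i, z (.inr (.a j i)) = false) (ha' : ∀ j i, z' (.inr (.a j i)) = false)
    (hd : ∀ j, z' (.inr (.b j)) = false → bitsVal (fun i => z' (.inr (.d j i))) < M) :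
    Circuit.op O (l.map fun j => Gate.ctrlQuery (copyEmbedding j) false) z z' =
      if ∀ a, z (.inr a) = z' (.inr a) then
        ((l.reverse.map (dupFactor H α t fun a => z' (.inr a))).prod) (fun i => z (.inl i)) (fun i => z' (.inl i)) else 0 := by
  classical
  induction l generalizing z' with
  | nil =>
    rw [List.map_nil, Circuit.op_nil, Matrix.one_apply]
    simp only [List.reverse_nil, List.map_nil, List.prod_nil, Matrix.one_apply]
    rw [← ite_and]
    refine if_congr ?_ rfl rfl
    simp only [funext_iff, Sum.forall]
    exact and_comm
  | cons j l ih =>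
    rw [List.nodup_cons] at hl
    rw [List.map_cons, Circuit.op_cons, Matrix.mul_apply, sum_eq_sum_system (fun a => z' (.inr a))]
    · have hstep : ∀ s : Fin ns → Bool,
          Circuit.op O (l.map fun j => Gate.ctrlQuery (copyEmbedding j) false) z
            (Sum.elim s fun a => z' (.inr a)) *
          (Gate.ctrlQuery (copyEmbedding j) false).op O (Sum.elim s fun a => z' (.inr a)) z' =
          if ∀ a, z (.inr a) = z' (.inr a) then
            ((l.reverse.map (dupFactor H α t fun a => z' (.inr a))).prod) (fun i => z (.inl i)) s *
            dupFactor H α t (fun a => z' (.inr a)) j s (fun i => z' (.inl i)) else 0 := by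
        intro s
        have h1 := ih hl.2 (z' := Sum.elim s fun a => z' (.inr a)) ha' hd
        have h2 := ctrlQuery_apply hO (copyEmbedding j) (fun _ => rfl) (fun i h => by cases h)
          (fun r i h => by cases h) (z := Sum.elim s fun a => z' (.inr a)) (ha' j) (ha' j) (hd j)
        rw [h1, h2.trans (if_pos fun _ => rfl), ite_mul, zero_mul]
        rfl
      rw [Finset.sum_congr rfl fun s _ => hstep s]
      split_ifs
      -- The first query stands rightmost in the operator product, hence the reversed list.
      · rw [List.reverse_cons, List.map_append, List.prod_append, List.map_singleton,
          List.prod_singleton, Matrix.mul_apply]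
      · exact Finset.sum_const_zero
    · intro y hy
      by_contra hne
      have h1 := left_ne_zero_of_mul hne
      have h2 := right_ne_zero_of_mul hne
      -- Each ancilla register of the oracle is touched by one query only. Between queries it
      -- therefore has either its initial or its final value, and both are zero.
      have hya : ∀ j' i, y (.inr (.a j' i)) = false := by
        intro j' i
        by_cases hj : j' = j
        · subst hj
          rw [← ha j' i]
          refine (Circuit.eq_off_of_op_ne_zero O (S := {q | q ≠ .inr (.a j' i)}) ?_ h1
            (fun h => h rfl)).symm
          intro g hg
          obtain ⟨j, hj, rfl⟩ := List.mem_map.1 hg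
          rintro _ ⟨o, rfl⟩ he
          exact hl.1 (copyEmbedding_eq_a he ▸ hj)
        · rw [← ha' j' i]
          refine Circuit.eq_off_of_op_ne_zero O (C := [Gate.ctrlQuery (copyEmbedding j) false])
            (S := {q | q ≠ .inr (.a j' i)}) ?_ ?_ (fun h => h rfl)
          · intro g hg
            rw [List.mem_singleton] at hg
            subst hg
            rintro _ ⟨o, rfl⟩ he
            exact hj (copyEmbedding_eq_a he).symm
          · rwa [Circuit.op_cons, Circuit.op_nil, Matrix.one_mul]
      rw [ctrlQuery_apply hO (copyEmbedding j) (fun _ => rfl) (fun i h => by cases h)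
        (fun r i h => by cases h) (hya j) (ha' j) (hd j)] at h2
      refine hy fun q => ?_
      by_contra hq
      exact h2 (if_neg fun hall => hq (hall q))

/-- The state after exchanging the flag qubits. -/
def swapFlags (x : DupQubit ns na M K w → Bool) : DupQubit ns na M K w → Bool
  | .inr (.c i) => x (.inr (.c (Equiv.swap 0 1 i)))
  | q => x q

theorem swapFlags_involutive : Function.Involutive (swapFlags (ns := ns) (na := na) (M := M)
    (K := K) (w := w)) := by
  intro x
  funext q
  rcases q with i | (_ | _ | _ | _ | _ | _) <;> simp [swapFlags]

theorem swapGate_op (O : Operator (OracleReg ns na M)) :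
    (Gate.prim 2 le_rfl flagEmbedding swapGate : Gate (OracleReg ns na M)
      (DupQubit ns na M K w)).op O = permOp swapFlags := by
  classical
  ext x y
  simp only [Gate.op]
  rw [applyOn_apply, permOp_apply]
  simp only [swapGate, Matrix.of_apply]
  rw [← ite_and]
  refine if_congr ?_ rfl rfl
  constructor
  · rintro ⟨h1, h2⟩
    funext q
    by_cases hq : ∃ i, q = .inr (.c i)
    · obtain ⟨i, rfl⟩ := hq
      exact congrFun h2 i
    · have e : swapFlags y q = y q := by
        rcases q with i | (_ | _ | i | _ | _ | _)
        case inr.c => exact absurd ⟨i, rfl⟩ hq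
        all_goals rfl
      rw [e]
      refine h1 q ?_
      rintro ⟨i, rfl⟩
      exact hq ⟨i, rfl⟩
  · rintro rfl
    refine ⟨fun q hq => ?_, rfl⟩
    rcases q with i | (_ | _ | i | _ | _ | _)
    case inr.c => exact absurd ⟨i, rfl⟩ hq
    all_goals rfl

/-- If the first flag is zero before and after the swap, the second was zero before and is zero
after. So between such states the components marked as disordered drop out, and otherwise the
ancillas are unchanged. -/
theorem hamTK_apply {O : Operator (OracleReg ns na M)} {H : ℝ → Operator (Fin ns)} {α t : ℝ}
    (hO : IsHamT O H α t) {z z' : DupQubit ns na M K w → Bool}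
    (ha : ∀ j i, z (.inr (.a j i)) = false) (ha' : ∀ j i, z' (.inr (.a j i)) = false)
    (hc : z (.inr (.c 0)) = false) (hc' : z' (.inr (.c 0)) = false)
    (hd : ∀ j, z' (.inr (.b j)) = false → bitsVal (fun i => z' (.inr (.d j i))) < M)
    [Decidable (z' (.inr (.c 1)) = false ∧ ∀ a, z (.inr a) = z' (.inr a))] :
    Circuit.op O hamTK z z' =
      if z' (.inr (.c 1)) = false ∧ ∀ a, z (.inr a) = z' (.inr a) then
        (((List.finRange K).reverse.map (dupFactor H α t fun a => z' (.inr a))).prod) (fun i => z (.inl i)) (fun i => z' (.inl i)) else 0 := by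
  classical
  have e : Circuit.op O [(Gate.prim 2 le_rfl flagEmbedding swapGate : Gate (OracleReg ns na M)
      (DupQubit ns na M K w))] = permOp swapFlags := by
    rw [Circuit.op_cons, Circuit.op_nil, Matrix.one_mul, swapGate_op]
  rw [hamTK, Circuit.op_append, e, permOp_mul_apply swapFlags_involutive,
    queryList_apply hO (List.nodup_finRange K) (z := swapFlags z) (fun j i => ha j i) ha' hd]
  refine if_congr ?_ rfl rfl
  constructor
  · intro h
    have h0 := h (.c 0)
    have h1 := h (.c 1)
    simp only [swapFlags, Equiv.swap_apply_left, Equiv.swap_apply_right] at h0 h1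
    rw [hc] at h1
    refine ⟨h1.symm, fun a => ?_⟩
    rcases a with _ | _ | i | _ | _ | _
    case c =>
      fin_cases i
      · exact hc.trans hc'.symm
      · exact h0.trans (hc'.trans h1)
    all_goals first
      | exact h (.a _ _) | exact h (.b _) | exact h (.d _ _) | exact h .p | exact h (.work _)
  · rintro ⟨h1, h⟩ a
    rcases a with _ | _ | i | _ | _ | _
    case c =>
      fin_cases i
      · exact (h (.c 1)).trans (h1.trans hc'.symm)
      · exact hc.trans h1.symm
    all_goals exact h _

/-- The circuit `C` prepares the amplitudes `f` on the order register and the qubit `p`. -/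
def PreparesOrder (O : Operator (OracleReg ns na M))
    (C : Circuit (OracleReg ns na M) (DupQubit ns na M K w)) (f : (Fin K → Bool) → Bool → ℂ) : Prop :=
  open Classical in
  ∀ x y : DupQubit ns na M K w → Bool, (∀ j, y (.inr (.b j)) = false) → y (.inr .p) = false →
    Circuit.op O C x y =
      if ∀ q, (∀ j, q ≠ .inr (.b j)) → q ≠ .inr .p → x q = y q then
        f (fun j => x (.inr (.b j))) (x (.inr .p)) else 0

/-- The value of the disorder flag, as determined by the registers `b` and `d`. -/
theorem prep_order_apply (hw : EnoughWork na M K w) {O : Operator (OracleReg ns na M)}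
    {C : Circuit (OracleReg ns na M) (DupQubit ns na M K w)} {f : (Fin K → Bool) → Bool → ℂ}
    (hC : PreparesOrder O C f) (z : DupQubit ns na M K w → Bool) (s : Fin ns → Bool)
    [Decidable (∀ q, (∀ j, q ≠ .inr (.b j)) → q ≠ .inr .p → (∀ j i, q ≠ .inr (.d j i)) →
        flipAt (.inr (.c 1)) disorderExp.eval z q =
          (Sum.elim s (fun _ => false) : DupQubit ns na M K w → Bool) q)] :
    (Circuit.op O prepCirc * Circuit.op O C : Operator (DupQubit ns na M K w)) z (Sum.elim s fun _ => false) =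
      if ∀ q, (∀ j, q ≠ .inr (.b j)) → q ≠ .inr .p → (∀ j i, q ≠ .inr (.d j i)) →
        flipAt (.inr (.c 1)) disorderExp.eval z q =
          (Sum.elim s (fun _ => false) : DupQubit ns na M K w → Bool) q then
        f (fun j => z (.inr (.b j))) (z (.inr .p)) * ((List.finRange K).map (timeAmp z z)).prod
      else 0 := by
  classical
  set y : DupQubit ns na M K w → Bool := Sum.elim s fun _ => false with hy
  have hoff : ∀ q, q ≠ .inr (.c 1) → flipAt (.inr (.c 1)) disorderExp.eval z q = z q :=
    fun q hq => Function.update_of_ne hq _ _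
  have hCy := fun x => hC x y (fun _ => rfl) rfl
  -- The coefficient circuit changes only `b` and `p`, which the preparation preserves; this
  -- determines the intermediate state.
  set u : DupQubit ns na M K w → Bool :=
    fun q => if (∃ j, q = .inr (.b j)) ∨ q = .inr .p then z q else y q with hu
  have hub : ∀ j, u (.inr (.b j)) = z (.inr (.b j)) := fun j => if_pos (Or.inl ⟨j, rfl⟩)
  have hup : u (.inr .p) = z (.inr .p) := if_pos (Or.inr rfl)
  have huq : ∀ q, (∀ j, q ≠ .inr (.b j)) → q ≠ .inr .p → u q = y q := fun q h1 h2 =>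
    if_neg (by rintro (⟨j, h⟩ | h); exacts [h1 j h, h2 h])
  have hclr : Clear dupWork w u := (clear_dupWork_iff u).2 fun i => huq _ (by simp) (by simp)
  have hud : ∀ j i, u (.inr (.d j i)) = false := fun j i => huq _ (by simp) (by simp)
  rw [Matrix.mul_apply, Finset.sum_eq_single u]
  · rw [hCy, if_pos huq, prepCirc_col hw O hclr hud, ite_mul, zero_mul]
    have hiff : (∀ q, (∀ j i, q ≠ .inr (.d j i)) →
        flipAt (.inr (.c 1)) disorderExp.eval z q = u q) ↔
        ∀ q, (∀ j, q ≠ .inr (.b j)) → q ≠ .inr .p → (∀ j i, q ≠ .inr (.d j i)) →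
          flipAt (.inr (.c 1)) disorderExp.eval z q = y q := by
      constructor
      · intro h q h1 h2 h3
        rw [h q h3, huq q h1 h2]
      · intro h q h3
        by_cases h1 : ∃ j, q = .inr (.b j)
        · obtain ⟨j, rfl⟩ := h1
          rw [hub, hoff _ (by simp)]
        by_cases h2 : q = .inr .p
        · rw [h2, hup, hoff _ (by simp)]
        push Not at h1
        rw [h q h1 h2 h3, huq q h1 h2]
    have hamp : ∀ j, timeAmp u z j = timeAmp z z j := fun j => by rw [timeAmp, timeAmp, hub]
    by_cases hall : ∀ q, (∀ j, q ≠ .inr (.b j)) → q ≠ .inr .p → (∀ j i, q ≠ .inr (.d j i)) →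
        flipAt (.inr (.c 1)) disorderExp.eval z q = y q
    · rw [if_pos hall, if_pos (hiff.2 hall), mul_comm, funext hamp]
      simp only [hub, hup]
    · rw [if_neg hall, if_neg fun h => hall (hiff.1 h)]
  · intro v _ hv
    by_contra hne
    have h1 := left_ne_zero_of_mul hne
    have h2 := right_ne_zero_of_mul hne
    rw [hCy] at h2
    have h3 : ∀ q, (∀ j, q ≠ .inr (.b j)) → q ≠ .inr .p → v q = y q := by
      by_contra h
      exact h2 (if_neg h)
    rw [prepCirc_col hw O ((clear_dupWork_iff v).2 fun i => h3 _ (by simp) (by simp))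
      fun j i => h3 _ (by simp) (by simp)] at h1
    have h4 : ∀ q, (∀ j i, q ≠ .inr (.d j i)) →
        flipAt (.inr (.c 1)) disorderExp.eval z q = v q := by
      by_contra h
      exact h1 (if_neg h)
    apply hv
    funext q
    by_cases hqb : ∃ j, q = .inr (.b j)
    · obtain ⟨j, rfl⟩ := hqb
      rw [hub, ← h4 _ (by simp), hoff _ (by simp)]
    by_cases hqp : q = .inr .p
    · rw [hqp, hup, ← h4 _ (by simp), hoff _ (by simp)]
    push Not at hqb
    rw [huq q hqb hqp, h3 q hqb hqp]
  · simp

/-- The ancillas in the state `a`, and the system in the state zero. -/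
def ancState (ns : ℕ) (a : DupAncilla na M K w → Bool) : DupQubit ns na M K w → Bool :=
  Sum.elim (fun _ => false) a

/-- The amplitude of an index state. -/
def orderAmp (ns : ℕ) (f : (Fin K → Bool) → Bool → ℂ) (a : DupAncilla na M K w → Bool) : ℂ :=
  f (fun j => a (.b j)) (a .p) *
    ((List.finRange K).map (timeAmp (ancState ns a) (ancState ns a))).prod

theorem eval_disorderExp_elim (s : Fin ns → Bool) (a : DupAncilla na M K w → Bool) :
    disorderExp.eval (Sum.elim s a : DupQubit ns na M K w → Bool) =
      disorderExp.eval (ancState ns a) := by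
  refine BExp.eval_congr fun q hq => ?_
  rcases vars_disorderExp hq with ⟨j, rfl⟩ | ⟨j, i, rfl⟩ <;> rfl

theorem prep_order_elim (hw : EnoughWork na M K w) {O : Operator (OracleReg ns na M)}
    {C : Circuit (OracleReg ns na M) (DupQubit ns na M K w)} {f : (Fin K → Bool) → Bool → ℂ}
    (hC : PreparesOrder O C f) (s : Fin ns → Bool) (a : DupAncilla na M K w → Bool)
    [Decidable ((∀ j i, a (.a j i) = false) ∧ a (.c 0) = false ∧ (∀ i, a (.work i) = false) ∧
      a (.c 1) = disorderExp.eval (ancState ns a))] :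
    (Circuit.op O prepCirc * Circuit.op O C : Operator (DupQubit ns na M K w)) (Sum.elim s a)
      (Sum.elim s fun _ => false) =
      if (∀ j i, a (.a j i) = false) ∧ a (.c 0) = false ∧ (∀ i, a (.work i) = false) ∧
        a (.c 1) = disorderExp.eval (ancState ns a) then orderAmp ns f a else 0 := by
  classical
  rw [prep_order_apply hw hC]
  refine if_congr ?_ rfl rfl
  have hoff : ∀ q : DupQubit ns na M K w, q ≠ .inr (.c 1) →
      flipAt (.inr (.c 1)) disorderExp.eval (Sum.elim s a : DupQubit ns na M K w → Bool) q =
        (Sum.elim s a : DupQubit ns na M K w → Bool) q :=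
    fun q hq => Function.update_of_ne hq _ _
  constructor
  · intro h
    refine ⟨fun j i => ?_, ?_, fun i => ?_, ?_⟩
    · have := h (.inr (.a j i)) (by simp) (by simp) (by simp)
      rwa [hoff _ (by simp)] at this
    · have := h (.inr (.c 0)) (by simp) (by simp) (by simp)
      rwa [hoff _ (by simp)] at this
    · have := h (.inr (.work i)) (by simp) (by simp) (by simp)
      rwa [hoff _ (by simp)] at this
    · have := h (.inr (.c 1)) (by simp) (by simp) (by simp)
      rw [flipAt_self, eval_disorderExp_elim] at this
      exact Bool.eq_iff_iff.2 (by simpa using this)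
  · rintro ⟨h1, h2, h3, h4⟩ q hqb hqp hqd
    rcases q with i | (⟨j, i⟩ | j | i | ⟨j, i⟩ | _ | i)
    · rw [hoff _ (by simp)]
      rfl
    · rw [hoff _ (by simp)]
      exact h1 j i
    · exact absurd rfl (hqb j)
    · fin_cases i
      · exact (hoff _ (by simp)).trans h2
      · change flipAt (Sum.inr (DupAncilla.c 1)) _ _ (Sum.inr (DupAncilla.c 1)) = false
        rw [flipAt_self, eval_disorderExp_elim, Sum.elim_inr, h4, Bool.xor_self]
    · exact absurd rfl (hqd j i)
    · exact absurd rfl hqp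
    · rw [hoff _ (by simp)]
      exact h3 i

theorem prep_order_eq_zero (hw : EnoughWork na M K w) {O : Operator (OracleReg ns na M)}
    {C : Circuit (OracleReg ns na M) (DupQubit ns na M K w)} {f : (Fin K → Bool) → Bool → ℂ}
    (hC : PreparesOrder O C f) {s : Fin ns → Bool} {z : DupQubit ns na M K w → Bool}
    (hz : ¬ ∀ i, z (.inl i) = s i) :
    (Circuit.op O prepCirc * Circuit.op O C : Operator (DupQubit ns na M K w)) z
      (Sum.elim s fun _ => false) = 0 := by
  classical
  rw [prep_order_apply hw hC, if_neg]
  intro h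
  refine hz fun i => ?_
  have := h (.inl i) (by simp) (by simp) (by simp)
  rwa [flipAt, Function.update_of_ne (by simp)] at this

theorem sum_eq_sum_ancilla {A : Type} [Fintype A] [DecidableEq A] (s : Fin ns → Bool)
    (g : (Fin ns ⊕ A → Bool) → ℂ) (hg : ∀ z, (¬ ∀ q, z (.inl q) = s q) → g z = 0) :
    ∑ z, g z = ∑ a : A → Bool, g (Sum.elim s a) := by
  rw [← Equiv.sum_comp (Equiv.sumArrowEquivProdArrow (Fin ns) A Bool).symm,
    Fintype.sum_prod_type, Finset.sum_eq_single s]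
  · rfl
  · intro b _ hb
    refine Finset.sum_eq_zero fun a _ => hg _ fun h => hb ?_
    funext q
    exact h q
  · simp

/-- Only time indices below `M` are ever prepared, so the behaviour of the oracle at other indices
is irrelevant. -/
theorem lt_of_orderAmp_ne_zero {f : (Fin K → Bool) → Bool → ℂ} {a : DupAncilla na M K w → Bool}
    (h : orderAmp ns f a ≠ 0) (j : Fin K) (hj : a (.b j) = false) :
    bitsVal (fun i => a (.d j i)) < M := by
  have h1 := right_ne_zero_of_mul h
  rw [← Fin.prod_univ_def] at h1
  have h2 := Finset.prod_ne_zero_iff.1 h1 j (Finset.mem_univ j)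
  have h3 : timeAmp (ancState ns a) (ancState ns a) j =
      (if !a (.b j) then unifAmp M (Nat.clog 2 M) else zeroAmp (Nat.clog 2 M))
        fun i => a (.d j i) := rfl
  rw [h3, hj] at h2
  by_contra hlt
  exact h2 (if_neg hlt)

/-- The block of `V`. -/
theorem ancillaBlock_tdsStep (hw : EnoughWork na M K w) {O : Operator (OracleReg ns na M)}
    {H : ℝ → Operator (Fin ns)} {α t : ℝ} (hO : IsHamT O H α t)
    {C C' : Circuit (OracleReg ns na M) (DupQubit ns na M K w)}
    {f f' : (Fin K → Bool) → Bool → ℂ} (hC : PreparesOrder O C f) (hC' : PreparesOrder O C' f')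
    [∀ a : DupAncilla na M K w → Bool, Decidable ((∀ j i, a (.a j i) = false) ∧
      (∀ i, a (.c i) = false) ∧ (∀ i, a (.work i) = false) ∧
        disorderExp.eval (ancState ns a) = false)] :
    ancillaBlock (Circuit.op O (tdsStep C C' prepCirc)) =
      ∑ a : DupAncilla na M K w → Bool, (if (∀ j i, a (.a j i) = false) ∧
        (∀ i, a (.c i) = false) ∧ (∀ i, a (.work i) = false) ∧
          disorderExp.eval (ancState ns a) = false then
        star (orderAmp ns f' a) * orderAmp ns f a else 0) •
        ((List.finRange K).reverse.map (dupFactor H α t a)).prod := by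
  classical
  have hop : Circuit.op O (tdsStep C C' prepCirc) =
      (Circuit.op O prepCirc * Circuit.op O C')ᴴ *
        (Circuit.op O hamTK * (Circuit.op O prepCirc * Circuit.op O C)) := by
    simp only [tdsStep, Circuit.op_append, Circuit.op_adj, Matrix.conjTranspose_mul,
      Matrix.mul_assoc]
  ext x y
  rw [hop, ancillaBlock, Matrix.of_apply, Matrix.mul_apply, Matrix.sum_apply,
    sum_eq_sum_ancilla x]
  swap
  · intro z hz
    rw [Matrix.conjTranspose_apply, prep_order_eq_zero hw hC' hz, star_zero, zero_mul]
  refine Finset.sum_congr rfl fun a _ => ?_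
  rw [Matrix.conjTranspose_apply, prep_order_elim hw hC', Matrix.mul_apply, sum_eq_sum_ancilla y]
  swap
  · intro z hz
    rw [prep_order_eq_zero hw hC hz, mul_zero]
  -- The double sum over ancilla states reduces to its diagonal, because the queries preserve them
  -- between states with cleared oracle ancillas and first flag.
  have hterm : ∀ a', star (if (∀ j i, a (.a j i) = false) ∧ a (.c 0) = false ∧
      (∀ i, a (.work i) = false) ∧ a (.c 1) = disorderExp.eval (ancState ns a) then
        orderAmp ns f' a else 0) *
      (Circuit.op O hamTK (Sum.elim x a) (Sum.elim y a') *
        (Circuit.op O prepCirc * Circuit.op O C : Operator (DupQubit ns na M K w)) (Sum.elim y a')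
          (Sum.elim y fun _ => false)) =
      if a' = a then ((if (∀ j i, a (.a j i) = false) ∧
        (∀ i, a (.c i) = false) ∧ (∀ i, a (.work i) = false) ∧
          disorderExp.eval (ancState ns a) = false then
        star (orderAmp ns f' a) * orderAmp ns f a else 0) •
        ((List.finRange K).reverse.map (dupFactor H α t a)).prod) x y else 0 := by
    intro a'
    rw [prep_order_elim hw hC]
    by_cases h : (∀ j i, a (.a j i) = false) ∧ a (.c 0) = false ∧
      (∀ i, a (.work i) = false) ∧ a (.c 1) = disorderExp.eval (ancState ns a)
    swap
    · have hn : ¬ ((∀ j i, a (.a j i) = false) ∧ (∀ i, a (.c i) = false) ∧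
          (∀ i, a (.work i) = false) ∧ disorderExp.eval (ancState ns a) = false) := by
        rintro ⟨h1, h2, h3, h4⟩
        exact h ⟨h1, h2 0, h3, by rw [h4, h2]⟩
      rw [if_neg h, star_zero, zero_mul, if_neg hn, zero_smul, Matrix.zero_apply, ite_self]
    by_cases h' : (∀ j i, a' (.a j i) = false) ∧ a' (.c 0) = false ∧
      (∀ i, a' (.work i) = false) ∧ a' (.c 1) = disorderExp.eval (ancState ns a')
    swap
    · rw [if_neg h', mul_zero, mul_zero]
      by_cases haa : a' = a
      · subst haa
        exact absurd h h'
      · rw [if_neg haa]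
    rw [if_pos h, if_pos h']
    by_cases h0 : orderAmp ns f a' = 0
    · rw [h0, mul_zero, mul_zero]
      by_cases haa : a' = a
      · subst haa
        rw [h0, mul_zero, ite_self, zero_smul, Matrix.zero_apply, ite_self]
      · rw [if_neg haa]
    rw [hamTK_apply hO h.1 h'.1 h.2.1 h'.2.1 fun j hj => lt_of_orderAmp_ne_zero h0 j hj]
    by_cases haa : a' = a
    · subst haa
      simp only [if_true, Sum.elim_inr, implies_true, and_true]
      by_cases hc : a' (.c 1) = false
      · rw [if_pos hc, if_pos, Matrix.smul_apply, smul_eq_mul]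
        · rw [mul_assoc, mul_comm (orderAmp ns f a')]
          rfl
        · refine ⟨h.1, fun i => ?_, h.2.2.1, by rw [← h.2.2.2, hc]⟩
          fin_cases i
          exacts [h.2.1, hc]
      · rw [if_neg hc, zero_mul, mul_zero, if_neg, zero_smul, Matrix.zero_apply]
        exact fun h => hc (h.2.1 1)
    · rw [if_neg haa, if_neg, zero_mul, mul_zero]
      rintro ⟨-, h⟩
      exact haa (funext fun q => (h q).symm)
  rw [Finset.mul_sum, Finset.sum_congr rfl fun a' _ => hterm a', Finset.sum_ite_eq' _ a,
    if_pos (Finset.mem_univ _)]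

end DupBlock
/-! ### The weights of the circuit with duplicated registers -/

section DupWeights

variable {ns na M K w : ℕ}

/-- The state of the ancillas that encodes the sequence `t` of time indices. -/
def indexState (na w K : ℕ) {M k : ℕ} (t : Fin k → Fin M) : DupAncilla na M K w → Bool
  | .b j => decide (k ≤ (j : ℕ))
  | .d j i => natBits (Nat.clog 2 M) (entry t j) i
  | _ => false

theorem entry_of_lt {k : ℕ} (t : Fin k → Fin M) {j : ℕ} (h : j < k) : entry t j = t ⟨j, h⟩ :=
  dif_pos h

theorem entry_of_le {k : ℕ} (t : Fin k → Fin M) {j : ℕ} (h : k ≤ j) : entry t j = 0 :=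
  dif_neg (by omega)

theorem bitsVal_indexState (hM : 0 < M) {k : ℕ} (t : Fin k → Fin M) (j : Fin K) :
    bitsVal (fun i => indexState na w K t (.d j i)) = entry t j := by
  refine bitsVal_natBits (lt_of_lt_of_le ?_ (Nat.le_pow_clog one_lt_two M))
  unfold entry
  split_ifs
  · exact Fin.is_lt _
  · exact hM

theorem indexState_injective (hM : 0 < M) : Function.Injective
    fun p : Σ k : Fin (K + 1), Fin k → Fin M => indexState na w K p.2 := by
  rintro ⟨k, t⟩ ⟨k', t'⟩ h
  simp only at h
  have hk : k = k' := by
    have hb : ∀ j < K, (k : ℕ) ≤ j ↔ (k' : ℕ) ≤ j := fun j hj => by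
      have := congrFun h (.b ⟨j, hj⟩)
      exact decide_eq_decide.1 this
    have h1 := k.2
    have h2 := k'.2
    refine Fin.ext (le_antisymm ?_ ?_)
    · by_contra hlt
      have := (hb k' (by omega)).2 le_rfl
      omega
    · by_contra hlt
      have := (hb k (by omega)).1 le_rfl
      omega
  subst hk
  congr 1
  funext j
  have hj : (j : ℕ) < K := by omega
  have h1 := bitsVal_indexState (na := na) (w := w) hM t ⟨j, hj⟩
  have h2 := bitsVal_indexState (na := na) (w := w) hM t' ⟨j, hj⟩
  rw [h] at h1
  rw [h1] at h2
  rw [entry_of_lt t j.2, entry_of_lt t' j.2] at h2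
  exact Fin.ext h2

theorem eval_disorderExp_indexState (hM : 0 < M) {k : ℕ} (hk : k ≤ K) (t : Fin k → Fin M) :
    disorderExp.eval (ancState ns (indexState na w K t)) = false ↔ StrictMono t := by
  rw [eval_disorderExp]
  have hv : ∀ j : Fin K, (bitsVal fun i => ancState ns (indexState na w K t) (.inr (.d j i))) =
      entry t j := bitsVal_indexState (na := na) (w := w) hM t
  simp only [hv]
  have hb : ∀ j : Fin K, ancState ns (indexState na w K t) (.inr (.b j)) = false ↔ (j : ℕ) < k := by
    intro j
    rw [ancState, Sum.elim_inr, indexState, decide_eq_false_iff_not, not_le]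
  simp only [hb]
  constructor
  · intro h i j hij
    have := ordered_of_consecutive (K := K) (k := k) (m := fun j => entry t j)
      (fun j hj hjk => h j hj hjk) ⟨i, by omega⟩ ⟨j, by omega⟩ hij j.2
    simp only at this
    rwa [entry_of_lt t i.2, entry_of_lt t j.2] at this
  · intro h j hj hjk
    rw [entry_of_lt t (show j < k by omega), entry_of_lt t hjk]
    exact h (Fin.mk_lt_mk.2 (Nat.lt_succ_self j))

theorem prod_timeAmp_indexState (hM : 0 < M) {k : ℕ} (hk : k ≤ K) (t : Fin k → Fin M) :
    ((List.finRange K).map (timeAmp (ancState ns (indexState na w K t))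
      (ancState ns (indexState na w K t)))).prod = (((√(M : ℝ))⁻¹ ^ k : ℝ) : ℂ) := by
  classical
  have hv : ∀ j : Fin K, (bitsVal fun i => ancState ns (indexState na w K t) (.inr (.d j i))) =
      entry t j := bitsVal_indexState (na := na) (w := w) hM t
  rw [prod_timeAmp hk fun j => rfl, if_pos]
  refine ⟨fun j hj => ?_, fun j hj => ?_⟩
  · rw [hv, entry_of_lt t hj]
    exact Fin.is_lt _
  · rw [hv, entry_of_le t hj]

theorem prod_dupFactor_indexState (hM : 0 < M) {k : ℕ} (hk : k ≤ K) (t : Fin k → Fin M)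
    (H : ℝ → Operator (Fin ns)) (α s : ℝ) :
    ((List.finRange K).reverse.map (dupFactor H α s (indexState na w K t))).prod =
      descProd (fun j => (α : ℂ)⁻¹ • H ((entry t j : ℝ) * s / (M : ℝ))) k := by
  have h1 : ∀ j : Fin K, dupFactor H α s (indexState na w K t) j =
      (fun j : ℕ => if k ≤ j then 1 else (α : ℂ)⁻¹ • H ((entry t j : ℝ) * s / (M : ℝ))) j := by
    intro j
    rw [dupFactor, bitsVal_indexState hM]
    simp [indexState]
  have h2 := descProd_eq_list
    (fun j : ℕ => if k ≤ j then 1 else (α : ℂ)⁻¹ • H ((entry t j : ℝ) * s / (M : ℝ))) K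
  rw [funext h1]
  refine h2.trans ?_
  rw [descProd_eq_of_le hk fun i hi => if_pos hi]
  exact descProd_congr fun i hi => if_neg (by omega)

/-- An ancilla state with nonzero amplitude has a unary order, times below `M` in the registers in
use and zero in the others, so it encodes a finite sequence. -/
theorem exists_indexState {f : (Fin K → Bool) → Bool → ℂ}
    (hf : ∀ b p, f b p ≠ 0 → p = false ∧ ∃ k ≤ K, ∀ j : Fin K, b j = decide (k ≤ (j : ℕ)))
    {a : DupAncilla na M K w → Bool} (h1 : ∀ j i, a (.a j i) = false) (h2 : ∀ i, a (.c i) = false)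
    (h3 : ∀ i, a (.work i) = false) (h4 : orderAmp ns f a ≠ 0) :
    ∃ p : Σ k : Fin (K + 1), Fin k → Fin M, indexState na w K p.2 = a := by
  obtain ⟨hp, k, hk, hb⟩ := hf _ _ (left_ne_zero_of_mul h4)
  have hlt := lt_of_orderAmp_ne_zero h4
  refine ⟨⟨⟨k, by omega⟩, fun j : Fin k => ⟨bitsVal fun i => a (.d ⟨j, by omega⟩ i), hlt _ ?_⟩⟩, ?_⟩
  · rw [hb]
    simp
  · funext q
    rcases q with ⟨j, i⟩ | j | i | ⟨j, i⟩ | _ | i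
    · exact (h1 j i).symm
    · exact (hb j).symm
    · exact (h2 i).symm
    · by_cases hjk : (j : ℕ) < k
      · have e : natBits (Nat.clog 2 M) (bitsVal fun i => a (.d j i)) = fun i => a (.d j i) :=
          bitsVal_injective (bitsVal_natBits (bitsVal_lt _))
        simp only [indexState, entry, dif_pos hjk]
        exact congrFun e i
      · have h0 : ∀ i, a (.d j i) = false := by
          have h5 := right_ne_zero_of_mul h4
          rw [← Fin.prod_univ_def] at h5
          have h6 := Finset.prod_ne_zero_iff.1 h5 j (Finset.mem_univ j)
          have h7 : timeAmp (ancState ns a) (ancState ns a) j =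
            (if !a (.b j) then unifAmp M (Nat.clog 2 M) else zeroAmp (Nat.clog 2 M))
              fun i => a (.d j i) := rfl
          have h8 : a (.b j) = true := by
            rw [hb]
            simpa using hjk
          rw [h7, h8] at h6
          by_contra hne
          exact h6 (if_neg hne)
        simp only [indexState, entry, dif_neg hjk, natBits, Nat.zero_testBit, h0]
    · exact hp.symm
    · exact (h3 i).symm

/-- The sum over ancilla states is a sum over pairs of an order and a sequence. Each time
contributes M^{-1/2} from both sides and each query 1/α; the increasing sequences sum up to
`orderedSum`. -/
theorem sum_weights (hM : 0 < M) (H : ℝ → Operator (Fin ns)) (α s : ℝ)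
    {f f' : (Fin K → Bool) → Bool → ℂ} {c : ℕ → ℂ}
    (hf : ∀ b p, f b p ≠ 0 → p = false ∧ ∃ k ≤ K, ∀ j : Fin K, b j = decide (k ≤ (j : ℕ)))
    (hc : ∀ k ≤ K, star (f' (fun j => decide (k ≤ (j : ℕ))) false) *
      f (fun j => decide (k ≤ (j : ℕ))) false = c k)
    [∀ a : DupAncilla na M K w → Bool, Decidable ((∀ j i, a (.a j i) = false) ∧
      (∀ i, a (.c i) = false) ∧ (∀ i, a (.work i) = false) ∧
        disorderExp.eval (ancState ns a) = false)] :
    (∑ a : DupAncilla na M K w → Bool, (if (∀ j i, a (.a j i) = false) ∧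
        (∀ i, a (.c i) = false) ∧ (∀ i, a (.work i) = false) ∧
          disorderExp.eval (ancState ns a) = false then
        star (orderAmp ns f' a) * orderAmp ns f a else 0) •
        ((List.finRange K).reverse.map (dupFactor H α s a)).prod) =
    ∑ k ∈ Finset.range (K + 1), (c k * ((M : ℂ)⁻¹ * (α : ℂ)⁻¹) ^ k) •
      orderedSum (fun m => H ((m : ℝ) * s / (M : ℝ))) k M := by
  classical
  rw [← Fintype.sum_of_injective (fun p : Σ k : Fin (K + 1), Fin k → Fin M =>
    indexState na w K p.2) (indexState_injective hM) (fun p => if StrictMono p.2 then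
      (c p.1 * ((M : ℂ)⁻¹) ^ (p.1 : ℕ)) • descProd (fun j =>
        (α : ℂ)⁻¹ • H ((entry p.2 j : ℝ) * s / (M : ℝ))) p.1 else 0)]
  · rw [Fintype.sum_sigma, ← Fin.sum_univ_eq_sum_range (fun k => (c k * ((M : ℂ)⁻¹ *
      (α : ℂ)⁻¹) ^ k) • orderedSum (fun m => H ((m : ℝ) * s / (M : ℝ))) k M) (K + 1)]
    refine Finset.sum_congr rfl fun k _ => ?_
    have h1 := sum_strictMono (fun m => (α : ℂ)⁻¹ • H ((m : ℝ) * s / (M : ℝ))) (k : ℕ) M le_rfl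
    rw [orderedSum_smul] at h1
    have h2 : ∀ t : Fin k → Fin M, (StrictMono t ∧ ∀ i, (t i : ℕ) < M) ↔ StrictMono t :=
      fun t => and_iff_left fun i => (t i).2
    simp only [h2] at h1
    simp only
    rw [mul_pow, ← mul_assoc, mul_smul, ← h1, Finset.smul_sum]
    refine Finset.sum_congr rfl fun t _ => ?_
    rw [smul_ite, smul_zero]
  · intro a ha
    by_cases h : (∀ j i, a (.a j i) = false) ∧ (∀ i, a (.c i) = false) ∧
        (∀ i, a (.work i) = false) ∧ disorderExp.eval (ancState ns a) = false
    · rw [if_pos h]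
      by_cases h0 : orderAmp ns f a = 0
      · rw [h0, mul_zero, zero_smul]
      · exact absurd (exists_indexState hf h.1 h.2.1 h.2.2.1 h0) ha
    · rw [if_neg h, zero_smul]
  · rintro ⟨k, t⟩
    have hk : (k : ℕ) ≤ K := by omega
    have hiff : ((∀ j i, indexState na w K t (.a j i) = false) ∧
        (∀ i, indexState na w K t (.c i) = false) ∧ (∀ i, indexState na w K t (.work i) = false) ∧
        disorderExp.eval (ancState ns (indexState na w K t)) = false) ↔ StrictMono t := by
      rw [eval_disorderExp_indexState hM hk]
      exact ⟨fun h => h.2.2.2, fun h => ⟨fun _ _ => rfl, fun _ => rfl, fun _ => rfl, h⟩⟩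
    simp only
    by_cases ht : StrictMono t
    · rw [if_pos ht, if_pos (hiff.2 ht), prod_dupFactor_indexState hM hk]
      congr 1
      rw [orderAmp, orderAmp, prod_timeAmp_indexState hM hk, ← hc k hk]
      have e : ((((√(M : ℝ))⁻¹ ^ (k : ℕ) : ℝ)) : ℂ) * (((√(M : ℝ))⁻¹ ^ (k : ℕ) : ℝ) : ℂ) =
          ((M : ℂ)⁻¹) ^ (k : ℕ) := by
        rw [← Complex.ofReal_mul, ← mul_pow, ← mul_inv, Real.mul_self_sqrt (Nat.cast_nonneg M)]
        push_cast
        rfl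
      rw [← e, star_mul', Complex.star_def, Complex.conj_ofReal]
      simp only [indexState]
      ring
    · rw [if_neg ht, if_neg fun h => ht (hiff.1 h), zero_smul]

end DupWeights
/-! ### The circuit with duplicated registers -/

section DupCircuit

variable {ns na M K w : ℕ}

/-- The qubits of the order register. -/
def orderBit (i : ℕ) : DupQubit ns na M K w := if h : i < K then .inr (.b ⟨i, h⟩) else .inr .p

theorem orderBit_of_lt {i : ℕ} (h : i < K) :
    (orderBit i : DupQubit ns na M K w) = .inr (.b ⟨i, h⟩) := dif_pos h

theorem works_orderBit : Works (orderBit : ℕ → DupQubit ns na M K w) K := by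
  intro i hi j hj h
  rw [orderBit_of_lt hi, orderBit_of_lt hj] at h
  simpa using h

theorem forall_orderBit_iff (q : DupQubit ns na M K w) :
    (∀ i < K, q ≠ orderBit i) ↔ ∀ j, q ≠ .inr (.b j) := by
  constructor
  · intro h j
    have := h j j.2
    rwa [orderBit_of_lt j.2] at this
  · intro h i hi
    rw [orderBit_of_lt hi]
    exact h _

/-- The qubits used by the coefficient circuits. -/
def coefQubits : Set (DupQubit ns na M K w) :=
  {q | ∃ j, q = .inr (.b j)} ∪ {.inr .p} ∪ {q | ∃ i, q = .inr (.work i)}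

theorem orderBit_mem (i : ℕ) : (orderBit i : DupQubit ns na M K w) ∈ coefQubits := by
  unfold orderBit
  split_ifs
  · exact Or.inl (Or.inl ⟨_, rfl⟩)
  · exact Or.inl (Or.inr rfl)

/-- Extends a sequence of bits. -/
def extBits (b : Fin K → Bool) (i : ℕ) : Bool := if h : i < K then b ⟨i, h⟩ else false

theorem extBits_of_lt (b : Fin K → Bool) {i : ℕ} (h : i < K) : extBits b i = b ⟨i, h⟩ := dif_pos h

/-- Prepares the amplitudes `√(x ^ k / ∑ x ^ i)`. -/
def coefCirc (x : ℝ) : Circuit (OracleReg ns na M) (DupQubit ns na M K w) :=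
  chain orderBit (geomCont x K) (geomStop x K) K

/-- The amplitudes of `coefCirc`. -/
def geomAmp (x : ℝ) (b : Fin K → Bool) : ℂ :=
  chainAmp (geomCont x K) (geomStop x K) K (extBits b)

/-- Half the sum of the squared weights. -/
def damping (x : ℝ) (K : ℕ) : ℝ := geomSum x K / 2

/-- For x ≤ 1/2 the geometric sum is at most 2, so half of it is the cosine of a rotation. This is
where αt ≤ 1/2 enters the circuits. -/
theorem damping_sq_add {x : ℝ} (hx : 0 ≤ x) (hx' : x ≤ 1 / 2) (K : ℕ) :
    damping x K ^ 2 + √(1 - damping x K ^ 2) ^ 2 = 1 := by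
  have h1 := one_le_geomSum hx K
  have h2 := geomSum_le_two hx hx' K
  have h3 : damping x K ≤ 1 := by rw [damping]; linarith
  have h4 : 0 ≤ damping x K := by rw [damping]; linarith
  rw [Real.sq_sqrt (by nlinarith)]
  ring

/-- Prepares the amplitudes of `coefCirc` with phases, damped by the rotation of a qubit. -/
def coefCirc' (x : ℝ) : Circuit (OracleReg ns na M) (DupQubit ns na M K w) :=
  -- This circuit is used inverted, so each zero of the order register contributes the conjugate -i,
  -- and the damping g/2 turns the normalization 1/g into exactly 1/2.
  coefCirc x ++ (phases orderBit (fun _ => Complex.I) K ++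
    gateOne (.inr .p) (rot (damping x K) √(1 - damping x K ^ 2)))

theorem coefCirc_cost (x : ℝ) :
    Cost (coefCirc x : Circuit (OracleReg ns na M) (DupQubit ns na M K w)) K coefQubits :=
  chain_cost _ _ _ _ fun i _ => orderBit_mem i

theorem coefCirc'_cost (x : ℝ) :
    Cost (coefCirc' x : Circuit (OracleReg ns na M) (DupQubit ns na M K w)) (2 * K + 1)
      coefQubits :=
  ((coefCirc_cost x).append ((phases_cost _ _ _ fun i _ => orderBit_mem i).append
    (gateOne_cost _ _ (Or.inl (Or.inr rfl))))).mono (by omega) subset_rfl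

theorem coefCirc_apply {x : ℝ} (hx : 0 ≤ x) (O : Operator (OracleReg ns na M))
    (z y : DupQubit ns na M K w → Bool) (hy : ∀ j, y (.inr (.b j)) = false)
    [Decidable (∀ q, (∀ j, q ≠ .inr (.b j)) → z q = y q)] :
    Circuit.op O (coefCirc x) z y = if ∀ q, (∀ j, q ≠ .inr (.b j)) → z q = y q then
      geomAmp x fun j => z (.inr (.b j)) else 0 := by
  classical
  rw [coefCirc, chain_apply O works_orderBit (fun i hi => geomCont_sq_add hx hi)
    (fun i hi => by rw [orderBit_of_lt hi, hy])]
  simp only [forall_orderBit_iff]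
  refine if_congr Iff.rfl (chainAmp_congr fun i hi => ?_) rfl
  rw [extBits_of_lt _ hi, orderBit_of_lt hi]

/-- The amplitudes of the order register and the qubit `p` after `coefCirc`. -/
def coefAmp (x : ℝ) (b : Fin K → Bool) (p : Bool) : ℂ := if p then 0 else geomAmp x b

theorem coefCirc_prepares {x : ℝ} (hx : 0 ≤ x) (O : Operator (OracleReg ns na M)) :
    PreparesOrder O (coefCirc x : Circuit (OracleReg ns na M) (DupQubit ns na M K w))
      (coefAmp x) := by
  classical
  intro z y hy hp
  rw [coefCirc_apply hx O z y hy, coefAmp]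
  by_cases hz : z (.inr .p) = false
  · rw [hz, if_neg Bool.false_ne_true]
    refine if_congr ?_ rfl rfl
    constructor
    · exact fun h q h1 _ => h q h1
    · intro h q h1
      by_cases hq : q = .inr .p
      · rw [hq, hz, hp]
      · exact h q h1 hq
  · rw [Bool.not_eq_false] at hz
    rw [hz, if_pos rfl, ite_self, if_neg]
    intro h
    have := h (.inr .p) (by simp)
    rw [hz, hp] at this
    cases this

/-- The amplitudes of the order register and the qubit `p` after `coefCirc'`. -/
def coefAmp' (x : ℝ) (b : Fin K → Bool) (p : Bool) : ℂ :=
  (if p then (√(1 - damping x K ^ 2) : ℂ) else damping x K) *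
    ((∏ i ∈ Finset.range K, if extBits b i then 1 else Complex.I) * geomAmp x b)

theorem coefCirc'_prepares {x : ℝ} (hx : 0 ≤ x) (hx' : x ≤ 1 / 2)
    (O : Operator (OracleReg ns na M)) :
    PreparesOrder O (coefCirc' x : Circuit (OracleReg ns na M) (DupQubit ns na M K w))
      (coefAmp' x) := by
  classical
  intro z y hy hp
  have hI : ∀ i : ℕ, (fun _ : ℕ => Complex.I) i * star ((fun _ : ℕ => Complex.I) i) = 1 := by simp
  have hA : ∀ z : DupQubit ns na M K w → Bool,
      (Circuit.op O (phases orderBit (fun _ => Complex.I) K) * Circuit.op O (coefCirc x) :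
        Operator (DupQubit ns na M K w)) z y =
      if ∀ q, (∀ j, q ≠ .inr (.b j)) → z q = y q then
        (∏ i ∈ Finset.range K, if extBits (fun j => z (.inr (.b j))) i then 1 else Complex.I) *
          geomAmp x fun j => z (.inr (.b j)) else 0 := by
    intro z
    rw [phases_op O _ hI, Matrix.diagonal_mul, coefCirc_apply hx O z y hy, mul_ite, mul_zero]
    refine if_congr Iff.rfl ?_ rfl
    congr 1
    refine Finset.prod_congr rfl fun i hi => ?_
    rw [Finset.mem_range] at hi
    rw [extBits_of_lt _ hi, orderBit_of_lt hi]
  rw [coefCirc', Circuit.op_append, Circuit.op_append, Matrix.mul_assoc,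
    rot_mul_apply O (damping_sq_add hx hx' K), hA, coefAmp', mul_ite, mul_zero]
  · have hu : ∀ q, q ≠ .inr .p → Function.update z (.inr .p) false q = z q :=
      fun q hq => Function.update_of_ne hq _ _
    have hb : ∀ j, Function.update z (.inr .p) false (.inr (.b j)) = z (.inr (.b j)) :=
      fun j => hu _ (by simp)
    simp only [hb]
    refine if_congr ?_ rfl rfl
    constructor
    · intro h q h1 h2
      rw [← h q h1, hu q h2]
    · intro h q h1
      by_cases hq : q = .inr .p
      · rw [hq, Function.update_self, hp]
      · rw [hu q hq, h q h1 hq]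
  · intro z hz
    rw [hA] at hz
    have : ∀ q, (∀ j, q ≠ .inr (.b j)) → z q = y q := by
      by_contra h
      exact hz (if_neg h)
    rw [this _ (by simp), hp]

theorem prod_phase_unary {k : ℕ} (hk : k ≤ K) :
    (∏ i ∈ Finset.range K, if extBits (fun j : Fin K => decide (k ≤ (j : ℕ))) i then 1
      else Complex.I) = Complex.I ^ k := by
  have h : ∀ i ∈ Finset.range K, (if extBits (fun j : Fin K => decide (k ≤ (j : ℕ))) i then 1
      else Complex.I) = if i < k then Complex.I else 1 := by
    intro i hi
    rw [extBits_of_lt _ (Finset.mem_range.1 hi)]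
    by_cases hik : i < k
    · rw [if_pos hik, if_neg]
      simpa using hik
    · rw [if_neg hik, if_pos]
      simpa using hik
  rw [Finset.prod_congr rfl h, Finset.prod_ite, Finset.prod_const_one, mul_one, Finset.prod_const]
  congr 1
  have : (Finset.range K).filter (fun i => i < k) = Finset.range k := by
    ext i
    simp only [Finset.mem_filter, Finset.mem_range]
    omega
  rw [this, Finset.card_range]

theorem geomAmp_unary {x : ℝ} (hx : 0 ≤ x) {k : ℕ} (hk : k ≤ K) :
    geomAmp x (fun j : Fin K => decide (k ≤ (j : ℕ))) = (√(x ^ k / geomSum x K) : ℝ) :=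
  chainAmp_geom hx hk fun _ hi => extBits_of_lt _ hi

/-- The ancillas that are not work qubits. -/
abbrev DupIndex (na M K : ℕ) : Type :=
  (Fin K × Fin na) ⊕ Fin K ⊕ Fin 2 ⊕ (Fin K × Fin (Nat.clog 2 M)) ⊕ Unit

/-- The ancillas that are not work qubits, as qubits. -/
def dupIndex : DupIndex na M K → DupAncilla na M K w
  | .inl (j, i) => .a j i
  | .inr (.inl j) => .b j
  | .inr (.inr (.inl i)) => .c i
  | .inr (.inr (.inr (.inl (j, i)))) => .d j i
  | .inr (.inr (.inr (.inr _))) => .p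

theorem card_dupIndex :
    Fintype.card (DupIndex na M K) = K * na + K + 2 + K * Nat.clog 2 M + 1 := by
  simp only [Fintype.card_sum, Fintype.card_prod, Fintype.card_fin, Fintype.card_unit]
  ring

theorem card_dupAncilla :
    Fintype.card (DupAncilla na M K w) = K * na + K + 2 + K * Nat.clog 2 M + 1 + w := by
  have e : DupAncilla na M K w ≃ DupIndex na M K ⊕ Fin w :=
    { toFun := fun
        | .a j i => .inl (.inl (j, i))
        | .b j => .inl (.inr (.inl j))
        | .c i => .inl (.inr (.inr (.inl i)))
        | .d j i => .inl (.inr (.inr (.inr (.inl (j, i)))))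
        | .p => .inl (.inr (.inr (.inr (.inr ()))))
        | .work i => .inr i
      invFun := Sum.elim dupIndex .work
      left_inv := by rintro (_ | _ | _ | _ | _ | _) <;> rfl
      right_inv := by rintro ((_ | _ | _ | _ | _) | _) <;> rfl }
  rw [Fintype.card_congr e, Fintype.card_sum, card_dupIndex, Fintype.card_fin]

/-- The reflection about the cleared ancillas. -/
def dupRef : Circuit (OracleReg ns na M) (DupQubit ns na M K w) :=
  refCirc dupWork (Finset.univ : Finset (DupIndex na M K)).toList dupIndex

theorem length_dupIndex : (Finset.univ : Finset (DupIndex na M K)).toList.length =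
    K * na + K + 2 + K * Nat.clog 2 M + 1 := by
  rw [Finset.length_toList, Finset.card_univ, card_dupIndex]

theorem dupRef_isReflection (hw : 1 + (K * na + K + 2 + K * Nat.clog 2 M + 1) * 4 < w)
    (O : Operator (OracleReg ns na M)) :
    IsReflection dupWork w (Circuit.op O (dupRef : Circuit (OracleReg ns na M)
      (DupQubit ns na M K w))) := by
  refine refCirc_isReflection O works_dupWork (fun i => free_dupWork fun j => ?_)
    (by rwa [length_dupIndex]) fun a => ?_
  · rcases i with _ | _ | _ | _ | _ <;> simp [dupIndex]
  · rcases a with ⟨j, i⟩ | j | i | ⟨j, i⟩ | _ | i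
    · exact Or.inl ⟨.inl (j, i), by simp, rfl⟩
    · exact Or.inl ⟨.inr (.inl j), by simp, rfl⟩
    · exact Or.inl ⟨.inr (.inr (.inl i)), by simp, rfl⟩
    · exact Or.inl ⟨.inr (.inr (.inr (.inl (j, i)))), by simp, rfl⟩
    · exact Or.inl ⟨.inr (.inr (.inr (.inr ()))), by simp, rfl⟩
    · exact Or.inr ⟨i, i.2, dupWork_of_lt i.2⟩

theorem dupRef_cost : Cost (dupRef : Circuit (OracleReg ns na M) (DupQubit ns na M K w))
    (49 + 192 * (K * na + K + 2 + K * Nat.clog 2 M + 1)) Set.univ := by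
  have h := refCirc_cost (R := OracleReg ns na M) (dupWork : ℕ → DupQubit ns na M K w)
    (Finset.univ : Finset (DupIndex na M K)).toList dupIndex
  rwa [length_dupIndex] at h

theorem isRef_dupRef (hw : 1 + (K * na + K + 2 + K * Nat.clog 2 M + 1) * 4 < w) :
    IsRef (dupRef : Circuit (OracleReg ns na M) (DupQubit ns na M K w)) := by
  classical
  refine ⟨dupRef_cost.queries, fun x y hy => ?_⟩
  rw [dupRef_isReflection hw 1 x y ((clear_dupWork_iff y).2 hy)]

theorem free_of_mem_order (i : ℕ) : Free dupWork w (orderBit i : DupQubit ns na M K w) := by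
  refine free_dupWork fun j => ?_
  unfold orderBit
  split_ifs <;> simp

theorem tdsStep_clean (hw : EnoughWork na M K w) (x : ℝ) {O : Operator (OracleReg ns na M)}
    (hO : O ∈ Matrix.unitaryGroup (OracleReg ns na M → Bool) ℂ) :
    Clean dupWork w (Circuit.op O (tdsStep (coefCirc x) (coefCirc' x) prepCirc :
      Circuit (OracleReg ns na M) (DupQubit ns na M K w))) := by
  have h1 : Clean dupWork w (Circuit.op O (coefCirc x : Circuit (OracleReg ns na M)
      (DupQubit ns na M K w))) :=
    Clean.of_actsOn O (chain_cost _ _ _ _ fun i _ => free_of_mem_order i).actsOn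
  have h2 : Clean dupWork w (Circuit.op O (coefCirc' x : Circuit (OracleReg ns na M)
      (DupQubit ns na M K w))) := by
    refine Clean.of_actsOn O (Cost.append (chain_cost _ _ _ _ fun i _ => free_of_mem_order i)
      ((phases_cost _ _ _ fun i _ => free_of_mem_order i).append (gateOne_cost _ _ ?_))).actsOn
    exact free_dupWork fun i => by simp
  have h3 : Clean dupWork w (Circuit.op O (hamTK : Circuit (OracleReg ns na M)
      (DupQubit ns na M K w))) := by
    refine Clean.of_actsOn O fun g hg => ?_
    rcases List.mem_append.1 hg with hg | hg
    · obtain ⟨j, -, rfl⟩ := List.mem_map.1 hg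
      rintro _ ⟨o, rfl⟩
      refine free_dupWork fun i => ?_
      rcases o with _ | r | r | r
      · exact fun h => by cases h
      · exact fun h => by cases h
      · exact fun h => by cases h
      · exact fun h => by cases h
    · rw [List.mem_singleton] at hg
      subst hg
      rintro _ ⟨o, rfl⟩
      exact free_dupWork fun i h => by cases h
  have h4 := prepCirc_clean (ns := ns) hw hO
  simp only [tdsStep, Circuit.op_append, Circuit.op_adj]
  exact h2.conjTranspose.mul (h4.conjTranspose.mul (h3.mul (h4.mul h1)))

/-- The weight of the order k is (g/2) · ((αt)^k/g) · (-i)^k · (Mα)^{-k} = (-i t/M)^k / 2. -/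
theorem ancillaBlock_tdsStep_coef (hw : EnoughWork na M K w) {O : Operator (OracleReg ns na M)}
    {H : ℝ → Operator (Fin ns)} {α t : ℝ} (hO : IsHamT O H α t) (hα : 0 < α) (ht : 0 ≤ t)
    (hαt : α * t ≤ 1 / 2) :
    ancillaBlock (Circuit.op O (tdsStep (coefCirc (α * t)) (coefCirc' (α * t)) prepCirc :
      Circuit (OracleReg ns na M) (DupQubit ns na M K w))) =
      (1 / 2 : ℂ) • truncatedDyson H t M K := by
  classical
  have hx : 0 ≤ α * t := by positivity
  rw [ancillaBlock_tdsStep hw hO (coefCirc_prepares hx O) (coefCirc'_prepares hx hαt O),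
    sum_weights hw.pos H α t (c := fun k => (1 / 2 : ℂ) * ((-Complex.I) * (α * t)) ^ k),
    truncatedDyson, Finset.smul_sum]
  · refine Finset.sum_congr rfl fun k _ => ?_
    rw [smul_smul]
    congr 1
    have hα' : (α : ℂ) ≠ 0 := by exact_mod_cast hα.ne'
    have hM' : (M : ℂ) ≠ 0 := by exact_mod_cast hw.pos.ne'
    rw [mul_assoc, ← mul_pow]
    congr 2
    push_cast
    field_simp
  · intro b p h
    cases p
    · refine ⟨rfl, ?_⟩
      rw [coefAmp, if_neg Bool.false_ne_true, geomAmp] at h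
      obtain ⟨k, hk, hb⟩ := exists_unary_of_chainAmp_ne_zero h
      exact ⟨k, hk, fun j => by rw [← hb j j.2, extBits_of_lt b j.2]⟩
    · exact absurd (if_pos rfl) h
  · intro k hk
    have hl := one_le_geomSum hx K
    have hs : ((√((α * t) ^ k / geomSum (α * t) K) : ℝ) : ℂ) *
        ((√((α * t) ^ k / geomSum (α * t) K) : ℝ) : ℂ) =
        (((α * t) ^ k / geomSum (α * t) K : ℝ) : ℂ) := by
      rw [← Complex.ofReal_mul, Real.mul_self_sqrt (by positivity)]
    have hg : ((geomSum (α * t) K : ℝ) : ℂ) ≠ 0 := by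
      have : geomSum (α * t) K ≠ 0 := by linarith
      exact_mod_cast this
    rw [coefAmp', coefAmp, prod_phase_unary hk, geomAmp_unary hx hk]
    simp only [Bool.false_eq_true, if_false]
    rw [star_mul', star_mul', Complex.star_def, map_pow, Complex.conj_I, Complex.conj_ofReal,
      Complex.conj_ofReal]
    have e : ∀ a b c : ℂ, a * (b * c) * c = a * b * (c * c) := fun a b c => by ring
    rw [e, hs, damping]
    push_cast
    field_simp
    ring

/-- A gate on no qubits is a global phase; it supplies the sign in front of the amplification round.
-/
theorem prim_neg_one_op {R Q : Type} [Fintype Q] [DecidableEq Q] (O : Operator R) (e : Fin 0 ↪ Q) :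
    (Gate.prim 0 (Nat.zero_le 2) e (-1) : Gate R Q).op O = -1 := by
  classical
  ext x y
  simp only [Gate.op]
  rw [applyOn_apply, Matrix.neg_apply, Matrix.one_apply]
  have hr : ∀ q, q ∉ Set.range e := by
    rintro q ⟨i, -⟩
    exact i.elim0
  have hv : ((-1 : Matrix.unitaryGroup (Fin 0 → Bool) ℂ) : Matrix (Fin 0 → Bool) (Fin 0 → Bool) ℂ)
      (x ∘ e) (y ∘ e) = -1 := by
    have : x ∘ e = y ∘ e := Subsingleton.elim _ _
    rw [this, Unitary.coe_neg, Matrix.neg_apply]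
    simp
  rw [hv]
  by_cases hxy : x = y
  · subst hxy
    simp
  · rw [if_neg hxy, if_neg, neg_zero]
    intro h
    exact hxy (funext fun q => h q (hr q))

theorem ancillaBlock_dupCircuit (hw : EnoughWork na M K w)
    (hw' : 1 + (K * na + K + 2 + K * Nat.clog 2 M + 1) * 4 < w) {O : Operator (OracleReg ns na M)}
    (hO : O ∈ Matrix.unitaryGroup (OracleReg ns na M → Bool) ℂ) (x : ℝ) {B : Operator (Fin ns)}
    (hB : ancillaBlock (Circuit.op O (tdsStep (coefCirc x) (coefCirc' x) prepCirc :
      Circuit (OracleReg ns na M) (DupQubit ns na M K w))) = B) :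
    ancillaBlock (Circuit.op O (dupCircuit (coefCirc x) (coefCirc' x) prepCirc dupRef :
      Circuit (OracleReg ns na M) (DupQubit ns na M K w))) =
      (3 : ℂ) • B - (4 : ℂ) • (B * Bᴴ * B) := by
  rw [← hB, ← ancillaBlock_amplify (wk := dupWork) (N := w)
    (fun j hj => ⟨_, dupWork_of_lt hj⟩) (Circuit.op_mem_unitary hO _) (tdsStep_clean hw x hO)
    (dupRef_isReflection hw' O)]
  simp only [dupCircuit, Circuit.op_append, Circuit.op_adj, Circuit.op_cons, Circuit.op_nil,
    prim_neg_one_op, Matrix.one_mul, neg_mul]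

theorem queries_dupCircuit (x : ℝ) (hw : EnoughWork na M K w) :
    (dupCircuit (coefCirc x) (coefCirc' x) prepCirc dupRef :
      Circuit (OracleReg ns na M) (DupQubit ns na M K w)).queries = 3 * K := by
  have h1 : (hamTK : Circuit (OracleReg ns na M) (DupQubit ns na M K w)).queries = K := by
    rw [hamTK, Circuit.queries_append]
    simp [Circuit.queries, Gate.isQuery, Function.comp_def]
  have h2 : Circuit.queries (R := OracleReg ns na M) (Q := DupQubit ns na M K w)
      [Gate.prim 0 (Nat.zero_le 2) ⟨Fin.elim0, fun i => i.elim0⟩ (-1)] = 0 := rfl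
  simp only [dupCircuit, tdsStep, Circuit.queries_append, Circuit.queries_adj, h1, h2,
    (coefCirc_cost x).queries, (coefCirc'_cost x).queries, (prepCirc_cost hw).queries,
    dupRef_cost.queries]
  ring

theorem primitives_dupCircuit (x : ℝ) (hw : EnoughWork na M K w) :
    (dupCircuit (coefCirc x) (coefCirc' x) prepCirc dupRef :
      Circuit (OracleReg ns na M) (DupQubit ns na M K w)).primitives ≤
        3000 * (K + 1) * (na + Nat.clog 2 M + 1) := by
  have h1 : (hamTK : Circuit (OracleReg ns na M) (DupQubit ns na M K w)).primitives = 1 := by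
    rw [hamTK, Circuit.primitives_append]
    simp [Circuit.primitives, Gate.isQuery, Function.comp_def]
  have h2 : Circuit.primitives (R := OracleReg ns na M) (Q := DupQubit ns na M K w)
      [Gate.prim 0 (Nat.zero_le 2) ⟨Fin.elim0, fun i => i.elim0⟩ (-1)] = 1 := rfl
  have h3 := (coefCirc_cost (ns := ns) (na := na) (M := M) (K := K) (w := w) x).primitives
  have h4 := (coefCirc'_cost (ns := ns) (na := na) (M := M) (K := K) (w := w) x).primitives
  have h5 := (prepCirc_cost (ns := ns) hw).primitives
  have h6 := (dupRef_cost (ns := ns) (na := na) (M := M) (K := K) (w := w)).primitives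
  simp only [dupCircuit, tdsStep, Circuit.primitives_append, Circuit.primitives_adj, h1, h2]
  nlinarith [Nat.zero_le (K * na), Nat.zero_le (K * Nat.clog 2 M)]

end DupCircuit
/-! ### Circuits with intermediate checks -/

section Checks

variable {R Q : Type} [Fintype Q] [DecidableEq Q] {wk : ℕ → Q} {N : ℕ}

/-- Cleanness of `A` ensures that the second program also starts from cleared work qubits, so both
programs act as the ideal permutation. -/
theorem conj_xorEval (O : Operator R) (hw : Works wk N) {E : BExp Q}
    (hE : ∀ q ∈ E.vars, Free wk N q) (hN : E.size < N) {t : Q} (ht : Free wk N t)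
    (ht' : t ∉ E.vars) {A : Operator Q} (hA : Clean wk N A) {x y : Q → Bool} (hy : Clear wk N y) :
    (Circuit.op O (stepsCirc (xorEval wk E t)) *
      (A * Circuit.op O (stepsCirc (xorEval wk E t)))) x y =
      A (flipAt t E.eval x) (flipAt t E.eval y) := by
  have hcol : ∀ z w, Clear wk N w → Circuit.op O (stepsCirc (xorEval wk E t)) z w =
      permOp (flipAt t E.eval) z w := fun z w h =>
    xorEval_col O hw hE hN (fun j _ h2 => ht j h2) ht' fun j _ h2 => h j h2
  have hy' : Clear wk N (flipAt t E.eval y) := fun j hj => by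
    rw [flipAt, Function.update_of_ne (ht j hj).symm, hy j hj]
  have h1 : ∀ B : Operator Q, (B * Circuit.op O (stepsCirc (xorEval wk E t))) x y =
      B x (flipAt t E.eval y) := by
    intro B
    rw [← mul_permOp_apply B, Matrix.mul_apply, Matrix.mul_apply]
    exact Finset.sum_congr rfl fun z _ => by rw [hcol z y hy]
  rw [← Matrix.mul_assoc, h1, mul_congr_left (B' := permOp (flipAt t E.eval)),
    permOp_mul_apply (flipAt_involutive (BExp.indep_eval ht'))]
  exact fun z hz => hcol x z ((hA z _ hz).2 hy')

/-- The value of a register is zero or the given label. -/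
def labelExp {r : ℕ} (fb : Fin r → Q) (s : ℕ) : BExp Q :=
  .node or (.regEq (List.finRange r) fb fun _ => false)
    (.regEq (List.finRange r) fb (natBits r s))

/-- The qubits of the register at which the label has a one. -/
def labelBits {r : ℕ} (fb : Fin r → Q) (s : ℕ) : List Q :=
  ((List.finRange r).filter fun i => natBits r s i).map fb

/-- If `E` is true and no failure has been recorded, records the failure `s`. -/
def checkSteps {r : ℕ} (wk : ℕ → Q) (fb : Fin r → Q) (E : BExp Q) (s : ℕ) : List (Step Q) :=
  condFlip wk (.node and E (labelExp fb s)) (labelBits fb s)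

/-- A circuit in stages, each with the condition that it has failed. -/
abbrev Stages (R Q : Type) := List (Circuit R Q × BExp Q)

/-- The stages of a circuit, each followed by a check whether it has failed. -/
def checkedCirc {r : ℕ} (wk : ℕ → Q) (fb : Fin r → Q) : Stages R Q → ℕ → Circuit R Q
  | [], _ => []
  | (U, E) :: l, s => U ++ (stepsCirc (checkSteps wk fb E (s + 1)) ++ checkedCirc wk fb l (s + 1))

/-- The projection to the states at which `E` is false. -/
def projFalse (E : BExp Q) : Operator Q := Matrix.diagonal fun x => if E.eval x then 0 else 1

/-- The stages of a circuit, each followed by the projection to success. -/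
def goodOp (O : Operator R) : Stages R Q → Operator Q
  | [] => 1
  | (U, E) :: l => goodOp O l * (projFalse E * Circuit.op O U)

theorem goodOp_append (O : Operator R) (l l' : Stages R Q) :
    goodOp O (l ++ l') = goodOp O l' * goodOp O l := by
  induction l with
  | nil => simp [goodOp]
  | cons p l ih =>
    obtain ⟨U, E⟩ := p
    rw [List.cons_append, goodOp, goodOp, ih, Matrix.mul_assoc]

/-- Hypotheses on a stage. -/
structure StageOK {r : ℕ} (wk : ℕ → Q) (N : ℕ) (fb : Fin r → Q) (O : Operator R)
    (p : Circuit R Q × BExp Q) : Prop where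
  clean : Clean wk N (Circuit.op O p.1)
  agree : ∀ x y, Circuit.op O p.1 x y ≠ 0 → ∀ i, x (fb i) = y (fb i)
  free : ∀ q ∈ p.2.vars, Free wk N q
  notMem : ∀ i, fb i ∉ p.2.vars
  size : p.2.size + 8 * r + 4 < N

variable {r : ℕ} {fb : Fin r → Q}

theorem eval_labelExp (s : ℕ) (x : Q → Bool) : (labelExp fb s).eval x = true ↔
    (∀ i, x (fb i) = false) ∨ ∀ i, x (fb i) = natBits r s i := by
  simp only [labelExp, BExp.eval, Bool.or_eq_true, BExp.eval_regEq, List.mem_finRange, true_imp_iff]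

theorem mem_labelBits (hfb : Function.Injective fb) (s : ℕ) (i : Fin r) :
    fb i ∈ labelBits fb s ↔ natBits r s i = true := by
  simp only [labelBits, List.mem_map, List.mem_filter, List.mem_finRange, true_and]
  constructor
  · rintro ⟨j, hj, h⟩
    rwa [← hfb h]
  · exact fun h => ⟨i, h, rfl⟩

theorem flipList_labelBits (hfb : Function.Injective fb) (s : ℕ) (x : Q → Bool) (i : Fin r) :
    flipList (labelBits fb s) x (fb i) = (x (fb i) ^^ natBits r s i) := by
  simp only [flipList, mem_labelBits hfb, Bool.decide_eq_true]

theorem flipList_of_ne {s : ℕ} {x : Q → Bool} {q : Q} (hq : ∀ i, fb i ≠ q) :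
    flipList (labelBits fb s) x q = x q := by
  have : q ∉ labelBits fb s := by
    intro h
    obtain ⟨i, -, h⟩ := List.mem_map.1 h
    exact hq i h
  simp [flipList, this]

variable {O : Operator R} {E : BExp Q}

theorem vars_labelExp (s : ℕ) : (labelExp fb s).vars ⊆ Set.range fb :=
  Set.union_subset (BExp.vars_regEq fun i _ => ⟨i, rfl⟩) (BExp.vars_regEq fun i _ => ⟨i, rfl⟩)

theorem size_labelExp (s : ℕ) : (labelExp fb s).size ≤ 3 + 8 * r := by
  have h1 := BExp.size_regEq (List.finRange r) fb fun _ => false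
  have h2 := BExp.size_regEq (List.finRange r) fb (natBits r s)
  rw [List.length_finRange] at h1 h2
  simp only [labelExp, BExp.size]
  omega

theorem checkSteps_hyps (hfw : ∀ i, Free wk N (fb i)) (hE : ∀ q ∈ E.vars, Free wk N q)
    (hN : E.size + 8 * r + 4 < N) (s : ℕ) :
    (∀ q ∈ (BExp.node and E (labelExp fb s)).vars, Free wk N q) ∧
      (BExp.node and E (labelExp fb s)).size < N ∧ ∀ q ∈ labelBits fb s, Free wk N q := by
  refine ⟨?_, ?_, ?_⟩
  · rintro q (hq | hq)
    · exact hE q hq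
    · obtain ⟨i, rfl⟩ := vars_labelExp s hq
      exact hfw i
  · have := size_labelExp (fb := fb) s
    simp only [BExp.size]
    omega
  · intro q hq
    obtain ⟨i, -, rfl⟩ := List.mem_map.1 hq
    exact hfw i

theorem checkSteps_WF (hw : Works wk N) (hfw : ∀ i, Free wk N (fb i))
    (hE : ∀ q ∈ E.vars, Free wk N q) (hN : E.size + 8 * r + 4 < N) (s : ℕ) :
    ∀ a ∈ checkSteps wk fb E s, a.WF := fun _ ha =>
  have h := checkSteps_hyps hfw hE hN s
  condFlip_WF hw h.1 h.2.1 h.2.2 ha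

/-- Adding the label exchanges the values zero and `s` of the failure register. The condition that
the register has one of these two values is thus invariant, which is what `condFlip_fn` needs. -/
theorem checkSteps_fn (hw : Works wk N) (hfb : Function.Injective fb) (hfw : ∀ i, Free wk N (fb i))
    (hE : ∀ q ∈ E.vars, Free wk N q) (hfE : ∀ i, fb i ∉ E.vars) (hN : E.size + 8 * r + 4 < N)
    (s : ℕ) {x : Q → Bool} (hx : Clear wk N x) :
    stepsFn (checkSteps wk fb E s) x =
      if E.eval x && (labelExp fb s).eval x then flipList (labelBits fb s) x else x := by
  have h := checkSteps_hyps hfw hE hN s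
  refine condFlip_fn hw h.1 h.2.1 h.2.2 ?_ hx ?_
  · exact ((List.nodup_finRange r).filter _).map hfb
  · simp only [BExp.eval]
    congr 1
    · refine BExp.eval_congr fun q hq => flipList_of_ne fun i h => hfE i (h ▸ hq)
    · rw [Bool.eq_iff_iff, eval_labelExp, eval_labelExp]
      simp only [flipList_labelBits hfb]
      have e1 : ∀ u v : Bool, (u ^^ v) = false ↔ u = v := by decide
      have e2 : ∀ u v : Bool, (u ^^ v) = v ↔ u = false := by decide
      simp only [e1, e2]
      exact or_comm

theorem checkSteps_clean [Fintype R] [DecidableEq R]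
    (hO : O ∈ Matrix.unitaryGroup (R → Bool) ℂ) (hw : Works wk N) (hfb : Function.Injective fb)
    (hfw : ∀ i, Free wk N (fb i)) (hE : ∀ q ∈ E.vars, Free wk N q) (hfE : ∀ i, fb i ∉ E.vars)
    (hN : E.size + 8 * r + 4 < N) (s : ℕ) :
    Clean wk N (Circuit.op O (stepsCirc (checkSteps wk fb E s))) := by
  have hu := Circuit.op_mem_unitary hO (stepsCirc (checkSteps wk fb E s))
  rw [stepsCirc_op O (checkSteps_WF hw hfw hE hN s)] at hu ⊢
  refine Clean.permOp hu fun y hy => ?_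
  rw [checkSteps_fn hw hfb hfw hE hfE hN s hy]
  split_ifs
  · intro j hj
    rw [flipList_of_ne fun i => hfw i j hj, hy j hj]
  · exact hy

theorem checkedCirc_clean [Fintype R] [DecidableEq R]
    (hO : O ∈ Matrix.unitaryGroup (R → Bool) ℂ) (hw : Works wk N) (hfb : Function.Injective fb)
    (hfw : ∀ i, Free wk N (fb i)) {l : Stages R Q} (hl : ∀ p ∈ l, StageOK wk N fb O p) (s : ℕ) :
    Clean wk N (Circuit.op O (checkedCirc wk fb l s)) := by
  induction l generalizing s with
  | nil => exact Clean.one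
  | cons p l ih =>
    obtain ⟨U, E⟩ := p
    have h := hl _ List.mem_cons_self
    rw [checkedCirc, Circuit.op_append, Circuit.op_append]
    exact ((ih (fun p hp => hl p (List.mem_cons_of_mem _ hp)) _).mul
      (checkSteps_clean hO hw hfb hfw h.free h.notMem h.size _)).mul h.clean

/-- On states without recorded failure, the checks act as projections. -/
theorem checkedCirc_apply (hw : Works wk N) (hfb : Function.Injective fb)
    (hfw : ∀ i, Free wk N (fb i)) {l : Stages R Q} (hl : ∀ p ∈ l, StageOK wk N fb O p) {s : ℕ}
    (hs : s + l.length < 2 ^ r) {x y : Q → Bool} (hx : ∀ i, x (fb i) = false) (hy : Clear wk N y)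
    (hys : bitsVal (fun i => y (fb i)) ≤ s) :
    Circuit.op O (checkedCirc wk fb l s) x y =
      if bitsVal (fun i => y (fb i)) = 0 then goodOp O l x y else 0 := by
  induction l generalizing s y with
  | nil =>
    rw [checkedCirc, Circuit.op_nil, goodOp]
    split_ifs with h
    · rfl
    · refine Matrix.one_apply_ne ?_
      rintro rfl
      exact h ((bitsVal_eq_zero_iff _).2 hx)
  | cons p l ih =>
    obtain ⟨U, E⟩ := p
    have h := hl _ List.mem_cons_self
    rw [List.length_cons] at hs
    rw [checkedCirc, Circuit.op_append, Circuit.op_append, goodOp]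
    have hrow : ∀ z, Circuit.op O U z y ≠ 0 →
        (Circuit.op O (checkedCirc wk fb l (s + 1)) *
          Circuit.op O (stepsCirc (checkSteps wk fb E (s + 1)))) x z =
        if bitsVal (fun i => y (fb i)) = 0 then (goodOp O l * projFalse E) x z else 0 := by
      intro z hz
      have hzc : Clear wk N z := (h.clean z y hz).2 hy
      have hzf : (fun i => z (fb i)) = fun i => y (fb i) := funext fun i => h.agree z y hz i
      rw [stepsCirc_op O (checkSteps_WF hw hfw h.free h.size _), mul_permOp_apply,
        checkSteps_fn hw hfb hfw h.free h.notMem h.size _ hzc, projFalse, Matrix.mul_diagonal]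
      have hih : ∀ y : Q → Bool, Clear wk N y → bitsVal (fun i => y (fb i)) ≤ s + 1 →
          Circuit.op O (checkedCirc wk fb l (s + 1)) x y =
            if bitsVal (fun i => y (fb i)) = 0 then goodOp O l x y else 0 := fun y h1 h2 =>
        ih (fun p hp => hl p (List.mem_cons_of_mem _ hp)) (by omega) h1 h2
      -- Only labels up to `s` can have been recorded, so the alternative that the register equals s
      -- + 1 is void and the check acts only if no failure is recorded.
      have hlab : (labelExp fb (s + 1)).eval z = true ↔ bitsVal (fun i => y (fb i)) = 0 := by
        rw [eval_labelExp, bitsVal_eq_zero_iff]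
        simp only [fun i => congrFun hzf i]
        refine or_iff_left fun h' => ?_
        have h3 := bitsVal_natBits (n := r) (m := s + 1) (by omega)
        rw [← funext h'] at h3
        omega
      have hvz : bitsVal (fun i => z (fb i)) = bitsVal fun i => y (fb i) := by rw [hzf]
      cases hEz : E.eval z
      · rw [Bool.false_and, if_neg Bool.false_ne_true, if_neg Bool.false_ne_true, mul_one,
          hih z hzc (by omega), hvz]
      · rw [Bool.true_and, if_pos rfl, mul_zero, ite_self]
        by_cases hv : bitsVal (fun i => y (fb i)) = 0
        · rw [if_pos (hlab.2 hv)]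
          -- A new failure leaves the label s + 1 ≠ 0, after which, by induction, the register
          -- cannot return to zero.
          have hfl : (fun i => flipList (labelBits fb (s + 1)) z (fb i)) = natBits r (s + 1) := by
            funext i
            rw [flipList_labelBits hfb, (bitsVal_eq_zero_iff _).1 (hvz.trans hv) i,
              Bool.false_xor]
          have hval : bitsVal (fun i => flipList (labelBits fb (s + 1)) z (fb i)) = s + 1 := by
            rw [hfl, bitsVal_natBits (by omega)]
          rw [hih _ ?_ hval.le, hval, if_neg (Nat.succ_ne_zero s)]
          intro j hj
          rw [flipList_of_ne fun i => hfw i j hj, hzc j hj]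
        · rw [if_neg (mt hlab.1 hv), hih z hzc (by omega), hvz, if_neg hv]
    rw [Matrix.mul_apply]
    split_ifs with hv
    · rw [← Matrix.mul_assoc, Matrix.mul_apply]
      refine Finset.sum_congr rfl fun z _ => ?_
      by_cases hz : Circuit.op O U z y = 0
      · rw [hz, mul_zero, mul_zero]
      · rw [hrow z hz, if_pos hv]
    · refine Finset.sum_eq_zero fun z _ => ?_
      by_cases hz : Circuit.op O U z y = 0
      · rw [hz, mul_zero]
      · rw [hrow z hz, if_neg hv, zero_mul]

theorem checkedCirc_cost {S : Set Q} {n q e : ℕ} (hfb : ∀ i, fb i ∈ S) (hwk : ∀ j < N, wk j ∈ S)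
    {l : Stages R Q} (hq : ∀ p ∈ l, p.1.queries ≤ q) (hn : ∀ p ∈ l, p.1.primitives ≤ n)
    (hE : ∀ p ∈ l, p.2.vars ⊆ S) (he : ∀ p ∈ l, p.2.size ≤ e) (heN : e + 8 * r + 4 < N) (s : ℕ) :
    (checkedCirc wk fb l s).queries ≤ l.length * q ∧
      (checkedCirc wk fb l s).primitives ≤ l.length * (n + 48 * (e + 8 * r + 4) + 8 * r) := by
  induction l generalizing s with
  | nil => exact ⟨Nat.zero_le _, Nat.zero_le _⟩
  | cons p l ih =>
    obtain ⟨U, E⟩ := p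
    have h1 := hq _ List.mem_cons_self
    have h2 := hn _ List.mem_cons_self
    have h3 := hE _ List.mem_cons_self
    have h4 := he _ List.mem_cons_self
    obtain ⟨h5, h6⟩ := ih (fun p hp => hq p (List.mem_cons_of_mem _ hp))
      (fun p hp => hn p (List.mem_cons_of_mem _ hp)) (fun p hp => hE p (List.mem_cons_of_mem _ hp))
      (fun p hp => he p (List.mem_cons_of_mem _ hp)) (s + 1)
    have hsz : (BExp.node and E (labelExp fb (s + 1))).size ≤ e + 8 * r + 4 := by
      have := size_labelExp (fb := fb) (s + 1)
      simp only [BExp.size]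
      simp only at h4
      omega
    have hlen : (labelBits fb (s + 1)).length ≤ r := by
      rw [labelBits, List.length_map]
      exact (List.length_filter_le _ _).trans (List.length_finRange).le
    have hc : Cost (stepsCirc (checkSteps wk fb E (s + 1)) : Circuit R Q)
        (48 * (e + 8 * r + 4) + 8 * r) S := by
      refine (condFlip_cost wk _ _ ?_ ?_ ?_).mono (by omega) subset_rfl
      · refine Set.union_subset h3 ((vars_labelExp _).trans ?_)
        rintro _ ⟨i, rfl⟩
        exact hfb i
      · intro t ht
        obtain ⟨i, -, rfl⟩ := List.mem_map.1 ht
        exact hfb i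
      · exact fun j hj => hwk j (by omega)
    have h7 := hc.primitives
    simp only at h1 h2
    rw [checkedCirc, Circuit.queries_append, Circuit.queries_append, Circuit.primitives_append,
      Circuit.primitives_append, hc.queries, List.length_cons, Nat.succ_mul, Nat.succ_mul]
    constructor <;> omega

end Checks
/-! ### The sequential circuit -/

/-- Ancilla qubits of the sequential circuit: the ancilla register `a` of the oracle, two time
registers `d`, a binary order register `k`, a register `f` that records failures, a qubit `idle`
that controls the queries, a qubit `p` that rescales the success amplitude, and `w` work qubits. -/
inductive SeqAncilla (na M r w : ℕ) : Type where
  | a (i : Fin na) : SeqAncilla na M r w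
  | d (c : Bool) (i : Fin (Nat.clog 2 M)) : SeqAncilla na M r w
  | k (i : Fin r) : SeqAncilla na M r w
  | f (i : Fin (r + 1)) : SeqAncilla na M r w
  | idle : SeqAncilla na M r w
  | p : SeqAncilla na M r w
  | work (i : Fin w) : SeqAncilla na M r w
  deriving DecidableEq, Fintype

/-- All qubits of the sequential circuit. -/
abbrev SeqQubit (ns na M r w : ℕ) := Fin ns ⊕ SeqAncilla na M r w

/-- Enough work qubits for the sequential circuit. -/
structure EnoughSeqWork (na M r w : ℕ) : Prop where
  pos : 0 < M
  size : 4 * na + 8 * Nat.clog 2 M + 16 * r + 30 < w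

section Seq

variable {ns na M r w : ℕ}

/-- The work qubits of the sequential circuit. -/
def seqWork (i : ℕ) : SeqQubit ns na M r w := if h : i < w then .inr (.work ⟨i, h⟩) else .inr .p

/-- The qubits of the time registers. -/
def seqTime (c : Bool) (i : ℕ) : SeqQubit ns na M r w :=
  if h : i < Nat.clog 2 M then .inr (.d c ⟨i, h⟩) else .inr .p

theorem seqWork_of_lt {i : ℕ} (h : i < w) :
    (seqWork i : SeqQubit ns na M r w) = .inr (.work ⟨i, h⟩) := dif_pos h

theorem seqTime_of_lt (c : Bool) {i : ℕ} (h : i < Nat.clog 2 M) :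
    (seqTime c i : SeqQubit ns na M r w) = .inr (.d c ⟨i, h⟩) := dif_pos h

theorem works_seqWork : Works (seqWork : ℕ → SeqQubit ns na M r w) w := by
  intro i hi j hj h
  rw [seqWork_of_lt hi, seqWork_of_lt hj] at h
  simpa using h

theorem free_seqWork {q : SeqQubit ns na M r w} (h : ∀ i, q ≠ .inr (.work i)) :
    Free seqWork w q := by
  intro j hj
  rw [seqWork_of_lt hj]
  exact h _

theorem clear_seqWork_iff (x : SeqQubit ns na M r w → Bool) :
    Clear seqWork w x ↔ ∀ i, x (.inr (.work i)) = false := by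
  constructor
  · intro h i
    have := h i i.2
    rwa [seqWork_of_lt i.2] at this
  · intro h j hj
    rw [seqWork_of_lt hj]
    exact h _

theorem forall_seqTime_iff (c : Bool) (q : SeqQubit ns na M r w) :
    (∀ i < Nat.clog 2 M, q ≠ seqTime c i) ↔ ∀ i, q ≠ .inr (.d c i) := by
  constructor
  · intro h i
    have := h i i.2
    rwa [seqTime_of_lt c i.2] at this
  · intro h i hi
    rw [seqTime_of_lt c hi]
    exact h _

/-- The qubits of a query with the time register `c`, controlled by `idle`. -/
def seqEmbedding (c : Bool) : Option (OracleReg ns na M) ↪ SeqQubit ns na M r w where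
  toFun
    | none => .inr .idle
    | some (.inl i) => .inr (.d c i)
    | some (.inr (.inl i)) => .inr (.a i)
    | some (.inr (.inr i)) => .inl i
  inj' := by
    rintro (_ | _ | _ | _) (_ | _ | _ | _) h <;> simp_all

/-- The order is larger than `j`. -/
def activeExp (j : ℕ) : BExp (SeqQubit ns na M r w) :=
  BExp.lt r (fun i => .const (natBits r j i)) fun i => .lit (.inr (.k i))

/-- The order is at most `j`. -/
def idleExp (j : ℕ) : BExp (SeqQubit ns na M r w) := .node (fun u _ => !u) (activeExp j) (.const true)

theorem eval_activeExp {j : ℕ} (hj : j < 2 ^ r) (x : SeqQubit ns na M r w → Bool) :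
    (activeExp j).eval x = decide (j < bitsVal fun i => x (.inr (.k i))) := by
  have h : (fun i => (BExp.const (natBits r j i) : BExp (SeqQubit ns na M r w)).eval x) =
      natBits r j := rfl
  rw [Bool.eq_iff_iff, decide_eq_true_iff, activeExp, BExp.eval_lt, decide_eq_true_iff, h,
    bitsVal_natBits hj]
  rfl

theorem eval_idleExp {j : ℕ} (hj : j < 2 ^ r) (x : SeqQubit ns na M r w → Bool) :
    (idleExp j).eval x = decide (bitsVal (fun i => x (.inr (.k i))) ≤ j) := by
  rw [idleExp, BExp.eval, eval_activeExp hj, ← decide_not]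
  simp only [not_lt]

theorem vars_activeExp (j : ℕ) : (activeExp j : BExp (SeqQubit ns na M r w)).vars ⊆
    {q | ∃ i, q = .inr (.k i)} :=
  BExp.vars_lt (fun _ => Set.empty_subset _) fun i => Set.singleton_subset_iff.2 ⟨i, rfl⟩

theorem vars_idleExp (j : ℕ) : (idleExp j : BExp (SeqQubit ns na M r w)).vars ⊆
    {q | ∃ i, q = .inr (.k i)} :=
  Set.union_subset (vars_activeExp j) (Set.empty_subset _)

theorem size_activeExp (j : ℕ) : (activeExp j : BExp (SeqQubit ns na M r w)).size = 8 * r + 1 :=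
  BExp.size_lt (fun _ => rfl) fun _ => rfl

theorem size_idleExp (j : ℕ) : (idleExp j : BExp (SeqQubit ns na M r w)).size = 8 * r + 3 := by
  rw [idleExp, BExp.size, size_activeExp, BExp.size]
  omega

/-- Computes into `idle` whether the order is at most `j`. -/
def idleCirc (j : ℕ) : Circuit (OracleReg ns na M) (SeqQubit ns na M r w) :=
  stepsCirc (xorEval seqWork (idleExp j) (.inr .idle))

/-- Prepares the time register `c` unless `idle` is one. -/
def timeCirc (c : Bool) : Circuit (OracleReg ns na M) (SeqQubit ns na M r w) :=
  unifIf [.cnot (.inr .idle) (seqWork 0), .not (seqWork 0)] (seqTime c) seqWork (Nat.clog 2 M) M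

/-- Prepares the time register `c` and queries the Hamiltonian at this time, if the order is larger
than `j`. -/
def forwardStage (c : Bool) (j : ℕ) : Circuit (OracleReg ns na M) (SeqQubit ns na M r w) :=
  idleCirc j ++ ((timeCirc c ++ [Gate.ctrlQuery (seqEmbedding c) false]) ++ idleCirc j)

/-- Clears the time register `c`, if the order is larger than `j`. -/
def backStage (c : Bool) (j : ℕ) : Circuit (OracleReg ns na M) (SeqQubit ns na M r w) :=
  idleCirc j ++ ((timeCirc c).adj ++ idleCirc j)

/-- The times are not increasing. -/
def orderCheck (c : Bool) (j : ℕ) : BExp (SeqQubit ns na M r w) :=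
  -- The previous time is in the other register `!c`; the first time has none before it.
  if j = 0 then .const false else .node (fun u v => u && !v) (activeExp j)
    (BExp.ltReg (Nat.clog 2 M) (fun i => .inr (.d (!c) i)) fun i => .inr (.d c i))

/-- The register `a` is not cleared or the times are not increasing. -/
def forwardCheck (c : Bool) (j : ℕ) : BExp (SeqQubit ns na M r w) :=
  .node (fun u v => !u || v) (BExp.regEq (List.finRange na) (fun i => .inr (.a i)) fun _ => false)
    (orderCheck c j)

/-- The time register `c` is not cleared. -/
def backCheck (c : Bool) : BExp (SeqQubit ns na M r w) :=
  .node (fun u _ => !u) (BExp.regEq (List.finRange (Nat.clog 2 M)) (fun i => .inr (.d c i))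
    fun _ => false) (.const true)

/-- The basis state of the ancillas with order `k` and times `D`. -/
def seqState (k : Fin r → Bool) (D : Bool → Fin (Nat.clog 2 M) → Bool) : SeqAncilla na M r w → Bool
  | .d c i => D c i
  | .k i => k i
  | _ => false

/-- The amplitudes of the `j`-th time. -/
def seqAmp (M j : ℕ) (k : Fin r → Bool) : (Fin (Nat.clog 2 M) → Bool) → ℂ :=
  if bitsVal k ≤ j then zeroAmp (Nat.clog 2 M) else unifAmp M (Nat.clog 2 M)

/-- The factor of the `j`-th time. -/
def seqFactor (H : ℝ → Operator (Fin ns)) (α t : ℝ) (j : ℕ) (k : Fin r → Bool)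
    (b : Fin (Nat.clog 2 M) → Bool) : Operator (Fin ns) :=
  if bitsVal k ≤ j then 1 else (α : ℂ)⁻¹ • H ((bitsVal b : ℝ) * t / (M : ℝ))

theorem timeCirc_ok (hw : EnoughSeqWork na M r w) (c : Bool) :
    UnifIfOK (Q := SeqQubit ns na M r w) [.cnot (.inr .idle) (seqWork 0), .not (seqWork 0)]
      (fun y => !y (.inr .idle)) (seqTime c) seqWork (Nat.clog 2 M) w := by
  have hs := hw.size
  have h0 : (seqWork 0 : SeqQubit ns na M r w) = .inr (.work ⟨0, by omega⟩) :=
    seqWork_of_lt (by omega)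
  have hb : (.inr .idle : SeqQubit ns na M r w) ≠ seqWork 0 := by simp [h0]
  refine ⟨by omega, works_seqWork, fun i hi i' hi' h => ?_, fun i hi => free_seqWork ?_, ?_, ?_, ?_,
    ?_⟩
  · rw [seqTime_of_lt c hi, seqTime_of_lt c hi'] at h
    simpa using h
  · rw [seqTime_of_lt c hi]
    simp
  · intro s hs
    simp only [List.mem_cons, List.not_mem_nil, or_false] at hs
    rcases hs with rfl | rfl
    · exact hb
    · trivial
  · funext x
    have e : stepsFn [.cnot (.inr .idle) (seqWork 0), .not (seqWork 0)] x =
      flipAt (seqWork 0) (fun _ => true) (flipAt (seqWork 0) (fun y => y (.inr .idle)) x) := rfl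
    rw [e, Indep.flipAt_flipAt fun _ _ _ => rfl]
    simp
  · intro x y h
    simp only [h _ hb]
  · intro x y h
    rw [h _ ((forall_seqTime_iff c _).2 fun i => by simp)]

theorem timeCirc_col (hw : EnoughSeqWork na M r w) (O : Operator (OracleReg ns na M))
    (c : Bool) {x y : SeqQubit ns na M r w → Bool} (hy : Clear seqWork w y)
    (hd : ∀ i, y (.inr (.d c i)) = false)
    [Decidable (∀ q, (∀ i, q ≠ .inr (.d c i)) → x q = y q)] :
    Circuit.op O (timeCirc c) x y =
      if ∀ q, (∀ i, q ≠ .inr (.d c i)) → x q = y q then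
        (if y (.inr .idle) then zeroAmp (Nat.clog 2 M) else unifAmp M (Nat.clog 2 M))
          fun i => x (.inr (.d c i)) else 0 := by
  classical
  rw [timeCirc, unifIf_col (timeCirc_ok hw c) O hw.pos (Nat.le_pow_clog one_lt_two M) hy
    fun i hi => by rw [seqTime_of_lt c hi, hd], regState_apply]
  simp only [forall_seqTime_iff]
  have e : (fun i : Fin (Nat.clog 2 M) => x (seqTime c i)) = fun i => x (.inr (.d c i)) := by
    funext i
    rw [seqTime_of_lt c i.2]
  rw [e]
  refine if_congr Iff.rfl ?_ rfl
  cases y (.inr .idle) <;> rfl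

theorem free_of_mem_vars_idleExp {j : ℕ} {q : SeqQubit ns na M r w} (hq : q ∈ (idleExp j).vars) :
    Free seqWork w q := by
  obtain ⟨i, rfl⟩ := vars_idleExp j hq
  exact free_seqWork fun i => by simp

theorem idle_notMem_vars (j : ℕ) : (.inr .idle : SeqQubit ns na M r w) ∉ (idleExp j).vars := by
  intro h
  obtain ⟨i, hi⟩ := vars_idleExp j h
  simp at hi

theorem conj_idleCirc (hw : EnoughSeqWork na M r w) (O : Operator (OracleReg ns na M)) (j : ℕ)
    {A : Operator (SeqQubit ns na M r w)} (hA : Clean seqWork w A)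
    {x y : SeqQubit ns na M r w → Bool} (hy : Clear seqWork w y) :
    (Circuit.op O (idleCirc j) * (A * Circuit.op O (idleCirc j)) :
      Operator (SeqQubit ns na M r w)) x y =
      A (flipAt (.inr .idle) (idleExp j).eval x) (flipAt (.inr .idle) (idleExp j).eval y) :=
  conj_xorEval O works_seqWork (fun _ => free_of_mem_vars_idleExp)
    (by rw [size_idleExp]; have := hw.size; omega) (free_seqWork fun i => by simp)
    (idle_notMem_vars j) hA hy

theorem query_clean (O : Operator (OracleReg ns na M)) (c : Bool) :
    Clean seqWork w (Circuit.op O ([Gate.ctrlQuery (seqEmbedding c) false] :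
      Circuit (OracleReg ns na M) (SeqQubit ns na M r w))) := by
  refine Clean.of_actsOn O fun g hg => ?_
  rw [List.mem_singleton] at hg
  subst hg
  rintro _ ⟨o, rfl⟩
  refine free_seqWork fun i h => ?_
  rcases o with _ | o | o | o <;> cases h

theorem timeCirc_clean (hw : EnoughSeqWork na M r w) (O : Operator (OracleReg ns na M)) (c : Bool) :
    Clean seqWork w (Circuit.op O (timeCirc c : Circuit (OracleReg ns na M)
      (SeqQubit ns na M r w))) := unifIf_clean (timeCirc_ok hw c) O

theorem idleCirc_clean (hw : EnoughSeqWork na M r w) {O : Operator (OracleReg ns na M)}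
    (hO : O ∈ Matrix.unitaryGroup (OracleReg ns na M → Bool) ℂ) (j : ℕ) :
    Clean seqWork w (Circuit.op O (idleCirc j : Circuit (OracleReg ns na M)
      (SeqQubit ns na M r w))) :=
  xorEval_clean hO works_seqWork (fun _ => free_of_mem_vars_idleExp)
    (by rw [size_idleExp]; have := hw.size; omega) (free_seqWork fun i => by simp)
    (idle_notMem_vars j)

theorem clear_seqState (k : Fin r → Bool) (D : Bool → Fin (Nat.clog 2 M) → Bool)
    (y : Fin ns → Bool) : Clear seqWork w (Sum.elim y (seqState (na := na) (w := w) k D)) :=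
  (clear_seqWork_iff _).2 fun _ => rfl

theorem clear_flip_idle {x : SeqQubit ns na M r w → Bool} (hx : Clear seqWork w x)
    (g : (SeqQubit ns na M r w → Bool) → Bool) : Clear seqWork w (flipAt (.inr .idle) g x) := by
  rw [clear_seqWork_iff] at hx ⊢
  intro i
  rw [flipAt, Function.update_of_ne (by simp), hx]

theorem flip_idle_of_ne (g : (SeqQubit ns na M r w → Bool) → Bool) (x : SeqQubit ns na M r w → Bool)
    {q : SeqQubit ns na M r w} (hq : q ≠ .inr .idle) : flipAt (.inr .idle) g x q = x q :=
  Function.update_of_ne hq _ _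

/-- Two basis states agree off a time register, if they do when `idle` is computed. -/
theorem agree_flip_idle_iff {j : ℕ} (hj : j < 2 ^ r) (c : Bool)
    (x y : SeqQubit ns na M r w → Bool) :
    (∀ q, (∀ i, q ≠ .inr (.d c i)) → flipAt (.inr .idle) (idleExp j).eval x q =
      flipAt (.inr .idle) (idleExp j).eval y q) ↔
      ∀ q, (∀ i, q ≠ .inr (.d c i)) → x q = y q := by
  have key : (∀ i, x (.inr (.k i)) = y (.inr (.k i))) → (idleExp j).eval x = (idleExp j).eval y := by
    intro h
    rw [eval_idleExp hj, eval_idleExp hj, funext h]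
  constructor
  · intro h q hq
    by_cases hi : q = .inr .idle
    · subst hi
      have h1 := h _ hq
      have h2 := key fun i => by
        have := h (.inr (.k i)) (by simp)
        rwa [flip_idle_of_ne _ _ (by simp), flip_idle_of_ne _ _ (by simp)] at this
      rw [flipAt_self, flipAt_self, h2] at h1
      simpa using h1
    · have := h q hq
      rwa [flip_idle_of_ne _ _ hi, flip_idle_of_ne _ _ hi] at this
  · intro h q hq
    by_cases hi : q = .inr .idle
    · subst hi
      rw [flipAt_self, flipAt_self, h _ hq, key fun i => h _ (by simp)]
    · rw [flip_idle_of_ne _ _ hi, flip_idle_of_ne _ _ hi, h q hq]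

theorem eq_seqState_update_iff (c : Bool) (k : Fin r → Bool)
    (D : Bool → Fin (Nat.clog 2 M) → Bool) (y : Fin ns → Bool) (a : SeqAncilla na M r w → Bool) :
    (∀ q : SeqQubit ns na M r w, (∀ i, q ≠ .inr (.d c i)) →
      Sum.elim y a q = Sum.elim y (seqState k D) q) ↔
      a = seqState k (Function.update D c fun i => a (.d c i)) := by
  constructor
  · intro h
    funext q
    by_cases hq : ∃ i, q = .d c i
    · obtain ⟨i, rfl⟩ := hq
      simp [seqState]
    · have h1 := h (.inr q) fun i he => hq ⟨i, Sum.inr.inj he⟩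
      simp only [Sum.elim_inr] at h1
      rw [h1]
      rcases q with i | ⟨c', i⟩ | i | i | _ | _ | i
      case d =>
        have hc : c' ≠ c := fun he => hq ⟨i, by rw [he]⟩
        simp only [seqState, Function.update_of_ne hc]
      all_goals rfl
  · intro h q hq
    rcases q with s | q
    · rfl
    · simp only [Sum.elim_inr]
      rw [h]
      rcases q with i | ⟨c', i⟩ | i | i | _ | _ | i
      case d =>
        have hc : c' ≠ c := fun he => hq i (by rw [he])
        simp only [seqState, Function.update_of_ne hc]
      all_goals rfl

/-- The times are in order. -/
def SeqOrdered (c : Bool) (j : ℕ) (k : Fin r → Bool) (D : Bool → Fin (Nat.clog 2 M) → Bool) : Prop :=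
  j = 0 ∨ bitsVal k ≤ j ∨ bitsVal (D !c) < bitsVal (D c)

theorem eval_orderCheck {j : ℕ} (hj : j < 2 ^ r) (c : Bool) (x : Fin ns → Bool) (k : Fin r → Bool)
    (D : Bool → Fin (Nat.clog 2 M) → Bool) :
    (orderCheck c j).eval (Sum.elim x (seqState (na := na) (w := w) k D)) = true ↔
      ¬ SeqOrdered c j k D := by
  unfold orderCheck SeqOrdered
  by_cases h0 : j = 0
  · simp [h0, BExp.eval]
  · rw [if_neg h0, BExp.eval, eval_activeExp hj, BExp.eval_ltReg]
    simp only [Sum.elim_inr, seqState, h0, false_or, Bool.and_eq_true, Bool.not_eq_true', not_or,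
      not_le]
    exact and_congr decide_eq_true_iff decide_eq_false_iff_not

/-- From a cleared register `c`, the stage writes a time there with the amplitudes `seqAmp` and
applies the factor of that time to the system; the projection enforces a cleared oracle register and
increasing times. -/
theorem forwardStage_apply (hw : EnoughSeqWork na M r w) {O : Operator (OracleReg ns na M)}
    {H : ℝ → Operator (Fin ns)} {α t : ℝ} (hO : IsHamT O H α t) (c : Bool) {j : ℕ} (hj : j < 2 ^ r)
    (k : Fin r → Bool) {D : Bool → Fin (Nat.clog 2 M) → Bool} (hD : D c = fun _ => false)
    (x y : Fin ns → Bool) (a : SeqAncilla na M r w → Bool)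
    [Decidable (a = seqState k (Function.update D c fun i => a (.d c i)) ∧
        SeqOrdered c j k (Function.update D c fun i => a (.d c i)))] :
    (projFalse (forwardCheck c j) * Circuit.op O (forwardStage c j) :
      Operator (SeqQubit ns na M r w)) (Sum.elim x a) (Sum.elim y (seqState k D)) =
      if a = seqState k (Function.update D c fun i => a (.d c i)) ∧
        SeqOrdered c j k (Function.update D c fun i => a (.d c i))
      then seqAmp M j k (fun i => a (.d c i)) *
        seqFactor H α t j k (fun i => a (.d c i)) x y else 0 := by
  classical
  rw [projFalse, Matrix.diagonal_mul, forwardCheck, BExp.eval]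
  -- The projection removes rows with uncleared oracle ancillas; for the others the block of the
  -- oracle is known.
  by_cases ha : ∀ i, a (.a i) = false
  swap
  · have h1 : (BExp.regEq (List.finRange na) (fun i => (.inr (.a i) : SeqQubit ns na M r w))
        fun _ => false).eval (Sum.elim x a) = false := by
      rw [Bool.eq_false_iff, ne_eq, BExp.eval_regEq]
      exact fun h => ha fun i => h i (List.mem_finRange i)
    rw [h1, Bool.not_false, Bool.true_or, if_pos rfl, zero_mul, if_neg]
    rintro ⟨h2, -⟩
    refine ha fun i => ?_
    rw [h2]
    rfl
  have h1 : (BExp.regEq (List.finRange na) (fun i => (.inr (.a i) : SeqQubit ns na M r w))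
      fun _ => false).eval (Sum.elim x a) = true := by
    rw [BExp.eval_regEq]
    exact fun i _ => ha i
  rw [h1, Bool.not_true, Bool.false_or]
  set y0 : SeqQubit ns na M r w → Bool := Sum.elim y (seqState k D) with hy0
  set f := flipAt (.inr .idle) (idleExp (ns := ns) (na := na) (M := M) (r := r) (w := w) j).eval with hf
  have hyc : Clear seqWork w y0 := clear_seqState k D y
  have hfi : f y0 (.inr .idle) = decide (bitsVal k ≤ j) := by
    rw [hf, flipAt_self, eval_idleExp hj]
    exact Bool.false_xor _
  have hne : ∀ (z : SeqQubit ns na M r w → Bool) q, q ≠ .inr .idle → f z q = z q :=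
    fun z q hq => flip_idle_of_ne _ z hq
  have hop : Circuit.op O (forwardStage c j) (Sum.elim x a) y0 =
      ∑ z, (Gate.ctrlQuery (seqEmbedding c) false).op O (f (Sum.elim x a)) z *
        Circuit.op O (timeCirc c) z (f y0) := by
    rw [forwardStage, Circuit.op_append, Circuit.op_append, Matrix.mul_assoc, conj_idleCirc hw O j _ hyc,
      Circuit.op_append, Matrix.mul_apply]
    · rw [Circuit.op_cons, Circuit.op_nil, Matrix.one_mul]
    · rw [Circuit.op_append]
      exact (query_clean O c).mul (timeCirc_clean hw O c)
  have hcol : ∀ z, Circuit.op O (timeCirc c) z (f y0) =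
      if ∀ q, (∀ i, q ≠ .inr (.d c i)) → z q = f y0 q then
        seqAmp M j k (fun i => z (.inr (.d c i))) else 0 := by
    intro z
    rw [timeCirc_col hw O c (y := f y0) (clear_flip_idle hyc _), hfi]
    · simp only [seqAmp, decide_eq_true_eq]
    · intro i
      rw [hne _ _ (by simp), hy0]
      exact congrFun hD i
  -- Between cleared oracle ancillas the query changes only the system. The state before the query
  -- thus has the initial system value and the ancillas of the final state, with `idle` computed.
  set z0 : SeqQubit ns na M r w → Bool := Sum.elim y fun q => f (Sum.elim x a) (.inr q) with hz0
  have hq : ∀ z, Circuit.op O (timeCirc c) z (f y0) ≠ 0 →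
      (Gate.ctrlQuery (seqEmbedding c) false).op O (f (Sum.elim x a)) z =
        if z = z0 then seqFactor H α t j k (fun i => z (.inr (.d c i))) x y else 0 := by
    intro z hz
    rw [hcol] at hz
    have hag : ∀ q, (∀ i, q ≠ .inr (.d c i)) → z q = f y0 q := by
      by_contra h
      exact hz (if_neg h)
    rw [if_pos hag] at hz
    have hzi : z (.inr .idle) = decide (bitsVal k ≤ j) := by rw [hag _ (by simp), hfi]
    rw [ctrlQuery_apply hO (seqEmbedding c) (fun _ => rfl) (fun _ => by simp [seqEmbedding])
      (fun _ _ => by simp [seqEmbedding])]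
    · have hzs : (fun i => z (.inl i)) = y := by
        funext i
        rw [hag _ (by simp), hne _ _ (by simp), hy0]
        rfl
      have hxs : (fun i => f (Sum.elim x a) (.inl i)) = x := by
        funext i
        rw [hne _ _ (by simp)]
        rfl
      rw [hxs, hzs]
      have hiff : (∀ q, f (Sum.elim x a) (.inr q) = z (.inr q)) ↔ z = z0 := by
        rw [hz0]
        constructor
        · intro h
          funext q
          rcases q with s | q
          · exact congrFun hzs s
          · exact (h q).symm
        · rintro rfl q
          rfl
      rw [if_congr hiff rfl rfl]
      have he : z (seqEmbedding (ns := ns) (na := na) (r := r) (w := w) c none) =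
          decide (bitsVal k ≤ j) := hzi
      rw [he, seqFactor]
      simp only [decide_eq_true_eq]
      rfl
    · intro i
      change f (Sum.elim x a) (.inr (.a i)) = false
      rw [hne _ _ (by simp)]
      exact ha i
    · intro i
      change z (.inr (.a i)) = false
      rw [hag _ (by simp), hne _ _ (by simp)]
      rfl
    · intro hi
      change z (.inr .idle) = false at hi
      change bitsVal (fun i => z (.inr (.d c i))) < M
      rw [hzi, decide_eq_false_iff_not] at hi
      rw [seqAmp, if_neg hi, unifAmp] at hz
      by_contra h
      exact hz (if_neg h)
  have hsum : Circuit.op O (forwardStage c j) (Sum.elim x a) y0 =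
      if a = seqState k (Function.update D c fun i => a (.d c i)) then
        seqAmp M j k (fun i => a (.d c i)) * seqFactor H α t j k (fun i => a (.d c i)) x y
      else 0 := by
    have hd0 : (fun i => z0 (.inr (.d c i))) = fun i => a (.d c i) := by
      funext i
      rw [hz0, Sum.elim_inr, hne _ _ (by simp), Sum.elim_inr]
    rw [hop, Finset.sum_eq_single z0]
    · by_cases h0 : Circuit.op O (timeCirc c) z0 (f y0) = 0
      · rw [h0, mul_zero]
        rw [hcol] at h0
        split_ifs with h2
        · rw [if_pos, hd0] at h0
          · rw [h0, zero_mul]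
          · intro q hq
            have h3 := (agree_flip_idle_iff hj c (Sum.elim y a) y0).2
              ((eq_seqState_update_iff c k D y a).2 h2) q hq
            rw [hf, ← h3]
            rcases q with s | q
            · rw [flip_idle_of_ne _ _ (by simp)]
              rfl
            · rw [hz0, Sum.elim_inr]
              by_cases hi : q = .idle
              · subst hi
                rw [hf, flipAt_self, flipAt_self, eval_idleExp hj, eval_idleExp hj]
                rfl
              · rw [hf, flip_idle_of_ne _ _ (by simpa using hi),
                  flip_idle_of_ne _ _ (by simpa using hi)]
                rfl
        · rfl
      · rw [hq z0 h0, if_pos rfl, hd0, hcol]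
        rw [hcol] at h0
        have hag : ∀ q, (∀ i, q ≠ .inr (.d c i)) → z0 q = f y0 q := by
          by_contra h
          exact h0 (if_neg h)
        rw [if_pos hag, hd0, mul_comm, if_pos]
        rw [← eq_seqState_update_iff c k D y a, ← agree_flip_idle_iff hj]
        intro q hq
        rw [← hy0, ← hf, ← hag q hq]
        rcases q with s | q
        · rw [hne _ _ (by simp)]
          rfl
        · rw [hz0, Sum.elim_inr]
          by_cases hi : q = .idle
          · subst hi
            rw [hf, flipAt_self, flipAt_self, eval_idleExp hj, eval_idleExp hj]
            rfl
          · rw [hne _ _ (by simpa using hi), hne _ _ (by simpa using hi)]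
            rfl
    · intro z _ hz
      by_cases h0 : Circuit.op O (timeCirc c) z (f y0) = 0
      · rw [h0, mul_zero]
      · rw [hq z h0, if_neg hz, zero_mul]
    · simp
  rw [hsum]
  by_cases h2 : a = seqState k (Function.update D c fun i => a (.d c i))
  · rw [if_pos h2]
    have h3 := eval_orderCheck (na := na) (w := w) hj c x k (Function.update D c fun i => a (.d c i))
    rw [← h2] at h3
    by_cases h4 : SeqOrdered c j k (Function.update D c fun i => a (.d c i))
    · rw [if_neg (mt h3.1 (not_not.2 h4)), one_mul, if_pos ⟨h2, h4⟩]
    · rw [if_pos (h3.2 h4), zero_mul, if_neg fun h => h4 h.2]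
  · rw [if_neg h2, mul_zero, if_neg fun h => h2 h.1]

/-- Unpreparing the time and projecting its register to zero is taking the scalar product with the
prepared time state. Its amplitudes are real, so conjugation can be ignored. -/
theorem backStage_apply (hw : EnoughSeqWork na M r w) (O : Operator (OracleReg ns na M))
    (c : Bool) {j : ℕ} (hj : j < 2 ^ r) (k : Fin r → Bool) (D : Bool → Fin (Nat.clog 2 M) → Bool)
    (x y : Fin ns → Bool) (a : SeqAncilla na M r w → Bool)
    [Decidable (a = seqState k (Function.update D c fun _ => false))] :
    (projFalse (backCheck c) * Circuit.op O (backStage c j) :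
      Operator (SeqQubit ns na M r w)) (Sum.elim x a) (Sum.elim y (seqState k D)) =
      if a = seqState k (Function.update D c fun _ => false)
      then seqAmp M j k (D c) * (1 : Operator (Fin ns)) x y else 0 := by
  classical
  rw [projFalse, Matrix.diagonal_mul, backCheck, BExp.eval]
  by_cases hd : ∀ i, a (.d c i) = false
  swap
  · have h1 : (BExp.regEq (List.finRange (Nat.clog 2 M))
        (fun i => (.inr (.d c i) : SeqQubit ns na M r w)) fun _ => false).eval (Sum.elim x a) =
        false := by
      rw [Bool.eq_false_iff, ne_eq, BExp.eval_regEq]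
      exact fun h => hd fun i => h i (List.mem_finRange i)
    rw [h1, Bool.not_false, if_pos rfl, zero_mul, if_neg]
    intro h2
    refine hd fun i => ?_
    rw [h2]
    simp [seqState]
  have h1 : (BExp.regEq (List.finRange (Nat.clog 2 M))
      (fun i => (.inr (.d c i) : SeqQubit ns na M r w)) fun _ => false).eval (Sum.elim x a) =
      true := by
    rw [BExp.eval_regEq]
    exact fun i _ => hd i
  rw [h1, Bool.not_true, if_neg Bool.false_ne_true, one_mul]
  set y0 : SeqQubit ns na M r w → Bool := Sum.elim y (seqState k D) with hy0
  set f := flipAt (.inr .idle) (idleExp (ns := ns) (na := na) (M := M) (r := r) (w := w) j).eval with hf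
  have hyc : Clear seqWork w y0 := clear_seqState k D y
  have hne : ∀ (z : SeqQubit ns na M r w → Bool) q, q ≠ .inr .idle → f z q = z q :=
    fun z q hq => flip_idle_of_ne _ z hq
  have hop : Circuit.op O (backStage c j) (Sum.elim x a) y0 =
      star (Circuit.op O (timeCirc c) (f y0) (f (Sum.elim x a))) := by
    rw [backStage, Circuit.op_append, Circuit.op_append, Matrix.mul_assoc, conj_idleCirc hw O j _ hyc,
      Circuit.op_adj, Matrix.conjTranspose_apply]
    rw [Circuit.op_adj]
    exact (timeCirc_clean hw O c).conjTranspose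
  rw [hop]
  have hiff : (∀ q, (∀ i, q ≠ .inr (.d c i)) → f y0 q = f (Sum.elim x a) q) ↔
      x = y ∧ a = seqState k (Function.update D c fun _ => false) := by
    rw [hf, agree_flip_idle_iff hj]
    have h2 : (fun i => a (.d c i)) = fun _ => false := funext hd
    rw [← h2, ← eq_seqState_update_iff c k D y a]
    constructor
    · intro h
      have hxy : x = y := funext fun i => (h (.inl i) (by simp)).symm
      subst hxy
      exact ⟨rfl, fun q hq => (h q hq).symm⟩
    · rintro ⟨rfl, h⟩ q hq
      exact (h q hq).symm
  by_cases hac : Clear seqWork w (Sum.elim x a)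
  · rw [timeCirc_col hw O c (y := f (Sum.elim x a)) (clear_flip_idle hac _), if_congr hiff rfl rfl]
    · by_cases h2 : a = seqState k (Function.update D c fun _ => false)
      · rw [if_pos h2, Matrix.one_apply]
        by_cases hxy : x = y
        · rw [if_pos ⟨hxy, h2⟩, if_pos hxy, mul_one]
          have hi : f (Sum.elim x a) (.inr .idle) = decide (bitsVal k ≤ j) := by
            rw [hf, flipAt_self, eval_idleExp hj, h2]
            exact Bool.false_xor _
          have hD : (fun i => f y0 (.inr (.d c i))) = D c := by
            funext i
            rw [hne _ _ (by simp)]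
            rfl
          rw [hi, hD, seqAmp]
          simp only [decide_eq_true_eq]
          split_ifs
          · rw [zeroAmp]
            split_ifs <;> simp
          · rw [unifAmp]
            split_ifs
            · rw [Complex.star_def, Complex.conj_ofReal]
            · exact star_zero _
        · rw [if_neg fun h => hxy h.1, if_neg hxy, mul_zero, star_zero]
      · rw [if_neg fun h => h2 h.2, if_neg h2, star_zero]
    · intro i
      rw [hne _ _ (by simp)]
      exact hd i
  · rw [if_neg, star_eq_zero]
    · by_contra h0
      have := (timeCirc_clean hw O c _ _ h0).1 (clear_flip_idle hyc _)
      apply hac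
      rw [clear_seqWork_iff] at this ⊢
      intro i
      have h3 := this i
      rwa [hne _ _ (by simp)] at h3
    · rintro rfl
      exact hac (clear_seqState _ _ x)

end Seq
/-! ### The amplitudes of the sequential circuit -/

section SeqRepresents

variable {ns na M r w : ℕ}

/-- The values of the time registers. -/
def seqTimes (a : SeqAncilla na M r w → Bool) : Bool → Fin (Nat.clog 2 M) → Bool :=
  fun c i => a (.d c i)

theorem seqTimes_seqState (k : Fin r → Bool) (D : Bool → Fin (Nat.clog 2 M) → Bool) :
    seqTimes (seqState k D : SeqAncilla na M r w → Bool) = D := rfl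

theorem seqState_injective (k : Fin r → Bool) :
    Function.Injective (seqState k : _ → SeqAncilla na M r w → Bool) := fun D D' h => by
  rw [← seqTimes_seqState (na := na) (w := w) k D, h, seqTimes_seqState]

theorem sum_eq_sum_seqState (k : Fin r → Bool) (g : (SeqQubit ns na M r w → Bool) → ℂ)
    (hg : ∀ s a, a ≠ seqState k (seqTimes a) → g (Sum.elim s a) = 0) :
    ∑ z, g z = ∑ D, ∑ s, g (Sum.elim s (seqState k D)) := by
  rw [← Equiv.sum_comp (Equiv.sumArrowEquivProdArrow (Fin ns) (SeqAncilla na M r w) Bool).symm,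
    Fintype.sum_prod_type_right]
  symm
  refine Fintype.sum_of_injective (seqState k) (seqState_injective k) _ _ (fun a ha => ?_)
    fun D => rfl
  exact Finset.sum_eq_zero fun s _ => hg s a fun h => ha ⟨_, h.symm⟩

/-- The columns of an operator at the cleared ancillas with order `k`. -/
def Represents (W : Operator (SeqQubit ns na M r w)) (k : Fin r → Bool)
    (Γ : (Bool → Fin (Nat.clog 2 M) → Bool) → Operator (Fin ns)) : Prop :=
  ∀ x y a, W (Sum.elim x a) (Sum.elim y (seqState k fun _ _ => false)) =
    open Classical in if a = seqState k (seqTimes a) then Γ (seqTimes a) x y else 0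

variable {W : Operator (SeqQubit ns na M r w)} {k : Fin r → Bool}
  {Γ : (Bool → Fin (Nat.clog 2 M) → Bool) → Operator (Fin ns)}

theorem Represents.mul_apply (h : Represents W k Γ) (V : Operator (SeqQubit ns na M r w))
    (x y : Fin ns → Bool) (a : SeqAncilla na M r w → Bool) :
    (V * W : Operator (SeqQubit ns na M r w)) (Sum.elim x a)
      (Sum.elim y (seqState k fun _ _ => false)) =
      ∑ D, ∑ s, V (Sum.elim x a) (Sum.elim s (seqState k D)) * Γ D s y := by
  rw [Matrix.mul_apply, sum_eq_sum_seqState k]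
  · refine Finset.sum_congr rfl fun D _ => Finset.sum_congr rfl fun s _ => ?_
    rw [h, seqTimes_seqState, if_pos rfl]
  · intro s a' ha'
    rw [h, if_neg ha', mul_zero]

/-- `hΓ` says that the register `c` is cleared beforehand, so only one earlier value of the times
leads to the given one. -/
theorem Represents.forward (h : Represents W k Γ) (hw : EnoughSeqWork na M r w)
    {O : Operator (OracleReg ns na M)} {H : ℝ → Operator (Fin ns)} {α t : ℝ} (hO : IsHamT O H α t)
    (c : Bool) {j : ℕ} (hj : j < 2 ^ r) (hΓ : ∀ D, D c ≠ (fun _ => false) → Γ D = 0) :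
    Represents (projFalse (forwardCheck c j) * Circuit.op O (forwardStage c j) * W) k fun D =>
      open Classical in if SeqOrdered c j k D then
        seqAmp M j k (D c) • (seqFactor H α t j k (D c) *
          Γ (Function.update D c fun _ => false)) else 0 := by
  classical
  intro x y a
  rw [h.mul_apply]
  set D0 := Function.update (seqTimes a) c fun _ => false with hD0
  have hup : ∀ D : Bool → Fin (Nat.clog 2 M) → Bool, a = seqState k (Function.update D c
      fun i => a (.d c i)) → D c = (fun _ => false) → D = D0 := by
    intro D hD hc
    rw [hD0, hD, seqTimes_seqState, Function.update_idem, ← hc, Function.update_eq_self]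
  rw [Finset.sum_eq_single D0]
  · have hc : D0 c = fun _ => false := Function.update_self ..
    have h1 : Function.update D0 c (fun i => a (.d c i)) = seqTimes a := by
      rw [hD0, Function.update_idem]
      exact Function.update_eq_self c (seqTimes a)
    by_cases h2 : a = seqState k (seqTimes a)
    · rw [if_pos h2]
      beta_reduce
      by_cases h3 : SeqOrdered c j k (seqTimes a)
      · rw [if_pos h3, Matrix.smul_apply, smul_eq_mul, Matrix.mul_apply, Finset.mul_sum]
        refine Finset.sum_congr rfl fun s _ => ?_
        rw [forwardStage_apply hw hO c hj k hc, h1, if_pos ⟨h2, h3⟩, mul_assoc]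
        rfl
      · rw [if_neg h3, Matrix.zero_apply]
        refine Finset.sum_eq_zero fun s _ => ?_
        rw [forwardStage_apply hw hO c hj k hc, h1, if_neg fun h => h3 h.2, zero_mul]
    · rw [if_neg h2]
      refine Finset.sum_eq_zero fun s _ => ?_
      rw [forwardStage_apply hw hO c hj k hc, h1, if_neg fun h => h2 h.1, zero_mul]
  · intro D _ hD
    refine Finset.sum_eq_zero fun s _ => ?_
    by_cases hc : D c = fun _ => false
    · rw [forwardStage_apply hw hO c hj k hc, if_neg fun h => hD (hup D h.1 hc), zero_mul]
    · rw [hΓ D hc, Matrix.zero_apply, mul_zero]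
  · simp

/-- The scalar product with the time state becomes a sum over the old time `o`, after which its
register is zero. -/
theorem Represents.back (h : Represents W k Γ) (hw : EnoughSeqWork na M r w)
    (O : Operator (OracleReg ns na M)) (c : Bool) {j : ℕ} (hj : j < 2 ^ r) :
    Represents (projFalse (backCheck c) * Circuit.op O (backStage c j) * W) k fun D =>
      open Classical in if D c = fun _ => false then
        ∑ o, seqAmp M j k o • Γ (Function.update D c o) else 0 := by
  classical
  intro x y a
  rw [h.mul_apply]
  have hs : ∀ D : Bool → Fin (Nat.clog 2 M) → Bool,
      ∑ s, (projFalse (backCheck c) * Circuit.op O (backStage c j) : Operator (SeqQubit ns na M r w))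
        (Sum.elim x a) (Sum.elim s (seqState k D)) * Γ D s y =
      if a = seqState k (Function.update D c fun _ => false) then seqAmp M j k (D c) * Γ D x y
      else 0 := by
    intro D
    simp only [backStage_apply hw O c hj k]
    split_ifs
    · simp only [mul_assoc, ← Finset.mul_sum]
      rw [← Matrix.mul_apply, Matrix.one_mul]
    · simp
  simp only [hs]
  by_cases h2 : a = seqState k (seqTimes a)
  · rw [if_pos h2]
    by_cases h3 : seqTimes a c = fun _ => false
    · rw [if_pos h3, Matrix.sum_apply]
      symm
      refine Fintype.sum_of_injective (fun o => Function.update (seqTimes a) c o)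
        (fun o o' h => by simpa using congrFun h c) _ _ (fun D hD => if_neg fun h4 => hD ⟨D c, ?_⟩) fun o => ?_
      · rw [h4, seqTimes_seqState]
        simp
      · rw [if_pos, Function.update_self, Matrix.smul_apply, smul_eq_mul]
        rw [Function.update_idem, ← h3, Function.update_eq_self]
        exact h2
    · rw [if_neg h3, Matrix.zero_apply]
      refine Finset.sum_eq_zero fun D _ => if_neg fun h4 => h3 ?_
      rw [h4, seqTimes_seqState, Function.update_self]
  · rw [if_neg h2]
    refine Finset.sum_eq_zero fun D _ => if_neg fun h4 => h2 ?_
    rw [h4, seqTimes_seqState]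

/-- The stages of the sequential circuit up to the `j`-th query. -/
def seqStages : ℕ → Stages (OracleReg ns na M) (SeqQubit ns na M r w)
  | 0 => [(forwardStage false 0, forwardCheck false 0)]
  -- The parity of the index selects the register. The old time is cleared only after the new one
  -- has been compared with it.
  | j + 1 => seqStages j ++ [(forwardStage (j + 1).bodd (j + 1), forwardCheck (j + 1).bodd (j + 1)),
      (backStage j.bodd j, backCheck j.bodd)]

theorem length_seqStages (j : ℕ) :
    (seqStages j : Stages (OracleReg ns na M) (SeqQubit ns na M r w)).length = 2 * j + 1 := by
  induction j with
  | zero => rfl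
  | succ j ih =>
    rw [seqStages, List.length_append, ih]
    simp only [List.length_cons, List.length_nil]
    omega

/-- The operators after the `j`-th query, depending on the last time. -/
def seqPartial (H : ℝ → Operator (Fin ns)) (α t : ℝ) (M j : ℕ) (k : Fin r → Bool)
    (b : Fin (Nat.clog 2 M) → Bool) : Operator (Fin ns) :=
  if bitsVal k ≤ j then
    (zeroAmp (Nat.clog 2 M) b * ((M : ℂ) * α)⁻¹ ^ bitsVal k) •
      orderedSum (fun m => H ((m : ℝ) * t / (M : ℝ))) (bitsVal k) M
  else (unifAmp M (Nat.clog 2 M) b * ((M : ℂ) * α)⁻¹ ^ j * (α : ℂ)⁻¹) •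
    (H ((bitsVal b : ℝ) * t / (M : ℝ)) *
      orderedSum (fun m => H ((m : ℝ) * t / (M : ℝ))) j (bitsVal b))

theorem sum_bits_lt {A : Type*} [AddCommMonoid A] {n M m : ℕ} (hm : m ≤ M) (hn : M ≤ 2 ^ n)
    (g : ℕ → A) :
    (∑ b : Fin n → Bool, if bitsVal b < m then g (bitsVal b) else 0) =
      ∑ l ∈ Finset.range m, g l := by
  classical
  rw [← Finset.sum_filter]
  refine Finset.sum_bij (fun b _ => bitsVal b) ?_ ?_ ?_ fun _ _ => rfl
  · intro b hb
    simpa using hb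
  · exact fun b _ b' _ h => bitsVal_injective h
  · intro l hl
    rw [Finset.mem_range] at hl
    have := bitsVal_natBits (n := n) (m := l) (by omega)
    exact ⟨natBits n l, by simpa [this] using hl, this⟩

theorem unifAmp_mul_self (M n : ℕ) (b : Fin n → Bool) :
    unifAmp M n b * unifAmp M n b = if bitsVal b < M then (M : ℂ)⁻¹ else 0 := by
  rw [unifAmp]
  split_ifs
  · rw [← Complex.ofReal_mul, ← mul_inv, Real.mul_self_sqrt (Nat.cast_nonneg M)]
    simp
  · simp

theorem sum_zeroAmp {A : Type*} [AddCommMonoid A] [Module ℂ A] (n : ℕ) (g : (Fin n → Bool) → A) :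
    ∑ b, (zeroAmp n b * zeroAmp n b) • g b = g fun _ => false := by
  rw [Finset.sum_eq_single fun _ => false]
  · simp [zeroAmp]
  · intro b _ hb
    have : ¬ ∀ i, b i = false := fun h => hb (funext h)
    simp [zeroAmp, this]
  · simp

theorem seqPartial_zero (H : ℝ → Operator (Fin ns)) (α t : ℝ) (k : Fin r → Bool)
    (b : Fin (Nat.clog 2 M) → Bool) :
    seqPartial H α t M 0 k b = seqAmp M 0 k b • seqFactor H α t 0 k b := by
  rw [seqPartial, seqAmp, seqFactor]
  split_ifs with h
  · simp [Nat.le_zero.1 h, orderedSum]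
  · simp [orderedSum, smul_smul]

/-- The old time is summed with the squared amplitude 1/M. If order k > j + 1, it is bounded by the
new time and yields `orderedSum` up to that time; if k = j + 1, it was the last one and runs up to
`M`; for smaller k both stages are idle. -/
theorem seqPartial_succ (H : ℝ → Operator (Fin ns)) (α t : ℝ) (j : ℕ) (k : Fin r → Bool)
    (b : Fin (Nat.clog 2 M) → Bool)
    [∀ o : Fin (Nat.clog 2 M) → Bool, Decidable (bitsVal k ≤ j + 1 ∨ bitsVal o < bitsVal b)] :
    seqPartial H α t M (j + 1) k b =
      seqAmp M (j + 1) k b • (seqFactor H α t (j + 1) k b *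
        ∑ o, if bitsVal k ≤ j + 1 ∨ bitsVal o < bitsVal b then
          seqAmp M j k o • seqPartial H α t M j k o else 0) := by
  set h : ℕ → Operator (Fin ns) := fun m => H ((m : ℝ) * t / (M : ℝ)) with hh
  have hn := Nat.le_pow_clog one_lt_two M
  -- Summing over an old time below `m` raises the order of the ordered sum by one and supplies a
  -- factor 1/(Mα).
  have key : ∀ m ≤ M, (∑ o : Fin (Nat.clog 2 M) → Bool, if bitsVal o < m then
      unifAmp M (Nat.clog 2 M) o • (unifAmp M (Nat.clog 2 M) o * ((M : ℂ) * α)⁻¹ ^ j * (α : ℂ)⁻¹) •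
        (h (bitsVal o) * orderedSum h j (bitsVal o)) else 0) =
      ((M : ℂ) * α)⁻¹ ^ (j + 1) • orderedSum h (j + 1) m := by
    intro m hm
    rw [orderedSum_succ, ← sum_bits_lt hm hn, Finset.smul_sum]
    refine Finset.sum_congr rfl fun o _ => ?_
    by_cases ho : bitsVal o < m
    · rw [if_pos ho, if_pos ho, smul_smul]
      congr 1
      rw [← mul_assoc, ← mul_assoc, unifAmp_mul_self, if_pos (ho.trans_le hm), pow_succ, mul_inv]
      ring
    · rw [if_neg ho, if_neg ho, smul_zero]
  rcases lt_trichotomy (bitsVal k) (j + 1) with hk | hk | hk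
  · have h1 : bitsVal k ≤ j := by omega
    simp only [seqPartial, seqAmp, seqFactor, hk.le, h1, if_true, true_or, Matrix.one_mul]
    simp only [smul_smul, ← mul_assoc]
    have h2 := sum_zeroAmp (Nat.clog 2 M) fun _ : Fin (Nat.clog 2 M) → Bool =>
      ((M : ℂ) * α)⁻¹ ^ bitsVal k • orderedSum h (bitsVal k) M
    simp only [smul_smul] at h2
    rw [h2, smul_smul]
  · have h1 : ¬ j + 1 ≤ j := by omega
    simp only [seqPartial, seqAmp, seqFactor, hk, h1, le_refl, if_true, if_false, true_or,
      Matrix.one_mul]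
    rw [mul_smul, ← key M le_rfl]
    congr 1
    refine Finset.sum_congr rfl fun o _ => ?_
    by_cases ho : bitsVal o < M
    · rw [if_pos ho]
    · rw [if_neg ho, unifAmp, if_neg ho, zero_smul]
  · have h1 : ¬ bitsVal k ≤ j + 1 := by omega
    have h2 : ¬ bitsVal k ≤ j := by omega
    simp only [seqPartial, seqAmp, seqFactor, h1, h2, if_false, false_or]
    by_cases hb : bitsVal b < M
    · rw [key _ hb.le, Matrix.mul_smul, Matrix.smul_mul, smul_smul, smul_smul]
    · rw [unifAmp, if_neg hb, zero_mul, zero_mul, zero_smul, zero_smul]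

theorem represents_one (k : Fin r → Bool) :
    Represents (1 : Operator (SeqQubit ns na M r w)) k fun D =>
      open Classical in if D = fun _ _ => false then 1 else 0 := by
  classical
  intro x y a
  rw [Matrix.one_apply]
  by_cases h2 : a = seqState k (seqTimes a)
  · rw [if_pos h2]
    beta_reduce
    by_cases h3 : seqTimes a = fun _ _ => false
    · rw [if_pos h3, Matrix.one_apply]
      refine if_congr ?_ rfl rfl
      rw [h2, h3]
      exact ⟨fun h => funext fun i => congrFun h (.inl i), fun h => by rw [h]⟩
    · rw [if_neg h3, if_neg]
      · rfl
      · intro h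
        apply h3
        funext c i
        exact congrFun h (.inr (.d c i))
  · rw [if_neg h2, if_neg]
    intro h
    apply h2
    have h4 : a = seqState k fun _ _ => false := funext fun q => congrFun h (.inr q)
    rw [h4, seqTimes_seqState]

/-- Invariant of the stages: after the `j`-th query and clearing, the register of the other parity
is zero and the system operator depends only on the last time. -/
theorem represents_seqStages (hw : EnoughSeqWork na M r w) {O : Operator (OracleReg ns na M)}
    {H : ℝ → Operator (Fin ns)} {α t : ℝ} (hO : IsHamT O H α t) (k : Fin r → Bool) {j : ℕ}
    (hj : j < 2 ^ r) :
    Represents (goodOp O (seqStages j) : Operator (SeqQubit ns na M r w)) k fun D =>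
      open Classical in if D (!j.bodd) = fun _ => false then seqPartial H α t M j k (D j.bodd)
        else 0 := by
  classical
  induction j with
  | zero =>
    have h := (represents_one (ns := ns) (na := na) (M := M) (w := w) k).forward hw hO false hj
      fun D hD => if_neg fun h => hD (congrFun h _)
    rw [seqStages, goodOp, goodOp, Matrix.one_mul]
    rw [Matrix.mul_one] at h
    convert h using 2 with D
    rw [if_pos (show SeqOrdered false 0 k D from Or.inl rfl)]
    have hiff : (D (!Nat.bodd 0) = fun _ => false) ↔
        Function.update D false (fun _ => false) = fun _ _ => false := by
      constructor
      · intro h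
        funext c
        cases c
        · simp
        · simpa using h
      · intro h
        simpa using congrFun h true
    by_cases hD : D (!Nat.bodd 0) = fun _ => false
    · rw [if_pos hD, if_pos (hiff.1 hD), Matrix.mul_one, seqPartial_zero]
      rfl
    · rw [if_neg hD, if_neg (mt hiff.2 hD), Matrix.mul_zero, smul_zero]
  | succ j ih =>
    -- The new time goes to the register that was just cleared, and the old one is then unprepared.
    have hb : (j + 1).bodd = !j.bodd := Nat.bodd_succ j
    have h := ((ih (by omega)).forward hw hO (!j.bodd) hj fun D hD => if_neg hD).back hw O j.bodd
      (j := j) (by omega)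
    rw [seqStages, goodOp_append, goodOp, goodOp, goodOp, Matrix.one_mul, hb, Bool.not_not,
      Matrix.mul_assoc]
    convert h using 2 with D
    refine if_congr Iff.rfl ?_ rfl
    rw [seqPartial_succ, Matrix.mul_sum, Finset.smul_sum]
    refine Finset.sum_congr rfl fun o _ => ?_
    have e1 : Function.update D j.bodd o (!j.bodd) = D (!j.bodd) :=
      Function.update_of_ne (by cases j.bodd <;> decide) _ _
    have e2 : Function.update (Function.update D j.bodd o) (!j.bodd) (fun _ => false) j.bodd = o := by
      rw [Function.update_of_ne (by cases j.bodd <;> decide), Function.update_self]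
    have hiff : SeqOrdered (!j.bodd) (j + 1) k (Function.update D j.bodd o) ↔
        bitsVal k ≤ j + 1 ∨ bitsVal o < bitsVal (D (!j.bodd)) := by
      rw [SeqOrdered, Bool.not_not, e1, Function.update_self]
      simp
    by_cases ho : bitsVal k ≤ j + 1 ∨ bitsVal o < bitsVal (D (!j.bodd))
    · rw [if_pos ho, if_pos (hiff.2 ho), Function.update_self, if_pos rfl, e1, e2, Matrix.mul_smul,
        smul_smul, smul_smul, mul_comm]
    · rw [if_neg ho, if_neg (mt hiff.1 ho), Matrix.mul_zero, smul_zero, smul_zero]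

end SeqRepresents
/-! ### Product states of the order register -/

section ProductState

variable {R Q : Type} [Fintype Q] [DecidableEq Q]

/-- A gate on a cleared qubit after a circuit that does not involve it. -/
theorem gateOne_mul_apply (O : Operator R) {p : Q} (U : Matrix.unitaryGroup Bool ℂ) {A : Operator Q}
    {x y : Q → Bool} (hA : ∀ x, A x y ≠ 0 → x p = false) :
    (Circuit.op O (gateOne p U) * A) x y =
      (U : Matrix Bool Bool ℂ) (x p) false * A (Function.update x p false) y := by
  have e := muxOp_mulVec p (F := fun _ => (U : Matrix Bool Bool ℂ)) (fun _ _ _ => rfl)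
    (fun z => A z y) x
  rw [gateOne_op]
  refine Eq.trans (show _ = (muxOp p (fun _ => (U : Matrix Bool Bool ℂ)) *ᵥ fun z => A z y) x
    from rfl) (e.trans ?_)
  have h0 : A (Function.update x p true) y = 0 := by
    by_contra h
    have := hA _ h
    simp at this
  rw [Fintype.sum_bool, h0, mul_zero, zero_add]

/-- Applies a gate to each of the first `n` bits. -/
def productCirc (bit : ℕ → Q) (U : ℕ → Matrix.unitaryGroup Bool ℂ) : ℕ → Circuit R Q
  | 0 => []
  | n + 1 => productCirc bit U n ++ gateOne (bit n) (U n)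

theorem productCirc_apply (O : Operator R) {bit : ℕ → Q} (U : ℕ → Matrix.unitaryGroup Bool ℂ) {n : ℕ}
    (hbit : Works bit n) {y : Q → Bool} (hy : ∀ i < n, y (bit i) = false) (x : Q → Bool)
    [Decidable (∀ q, (∀ i < n, q ≠ bit i) → x q = y q)] :
    Circuit.op O (productCirc bit U n) x y =
      if ∀ q, (∀ i < n, q ≠ bit i) → x q = y q then
        ∏ i ∈ Finset.range n, (U i : Matrix Bool Bool ℂ) (x (bit i)) false else 0 := by
  classical
  induction n generalizing x with
  | zero =>
    rw [productCirc, Circuit.op_nil, Matrix.one_apply, Finset.prod_range_zero]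
    refine if_congr ?_ rfl rfl
    simp [funext_iff]
  | succ n ih =>
    have hbit' : Works bit n := fun i hi j hj => hbit i (by omega) j (by omega)
    have hn : ∀ i < n, bit i ≠ bit n := fun i hi h => by
      have := hbit i (by omega) n (by omega) h
      omega
    have hIH := fun x => ih hbit' (fun i hi => hy i (by omega)) x
    rw [productCirc, Circuit.op_append, gateOne_mul_apply, hIH, mul_ite, mul_zero,
      Finset.prod_range_succ]
    · refine if_congr ?_ ?_ rfl
      · constructor
        · intro h q hq
          have := h q fun i hi => hq i (by omega)
          rwa [Function.update_of_ne (hq n (by omega))] at this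
        · intro h q hq
          by_cases hqn : q = bit n
          · rw [hqn, Function.update_self, hy n (by omega)]
          · rw [Function.update_of_ne hqn]
            refine h q fun i hi => ?_
            rcases (Nat.lt_succ_iff.1 hi).lt_or_eq with h' | rfl
            · exact hq i h'
            · exact hqn
      · rw [mul_comm]
        congr 1
        refine Finset.prod_congr rfl fun i hi => ?_
        rw [Function.update_of_ne (hn i (Finset.mem_range.1 hi))]
    · intro x hx
      rw [hIH] at hx
      have h : ∀ q, (∀ i < n, q ≠ bit i) → x q = y q := by
        by_contra h
        exact hx (if_neg h)
      rw [h _ fun i hi => (hn i hi).symm, hy n (by omega)]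

theorem productCirc_cost (bit : ℕ → Q) (U : ℕ → Matrix.unitaryGroup Bool ℂ) (n : ℕ) {S : Set Q}
    (hbit : ∀ i < n, bit i ∈ S) : Cost (productCirc bit U n : Circuit R Q) n S := by
  induction n with
  | zero => exact Cost.nil S
  | succ n ih => exact (ih fun i hi => hbit i (by omega)).append (gateOne_cost _ _ (hbit n (by omega)))

end ProductState

/-- The rotation with cosine `c` and sine `s`, followed by a phase on `|1⟩`. -/
def phasedRot (u : ℂ) (c s : ℝ) : Matrix.unitaryGroup Bool ℂ :=
  -- `phaseGate` puts its phase on zero; conjugation with the flip moves it to one.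
  ⟨xMat true, xMat_mem_unitary _⟩ * phaseGate u * ⟨xMat true, xMat_mem_unitary _⟩ * rot c s

theorem phasedRot_apply {u : ℂ} (hu : u * star u = 1) {c s : ℝ} (h : c ^ 2 + s ^ 2 = 1) (i : Bool) :
    (phasedRot u c s : Matrix Bool Bool ℂ) i false = if i then u * s else c := by
  have e : (phasedRot u c s : Matrix Bool Bool ℂ) =
    xMat true * (phaseGate u : Matrix Bool Bool ℂ) * xMat true * rotMat c s := by
    rw [← rot_val h]
    rfl
  rw [e]
  cases i <;> simp [Matrix.mul_apply, phaseGate_apply hu, xMat, rotMat]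

/-- Every exponent below 2^r has a unique binary expansion. Geometric weights up to order 2^r - 1
are therefore a product over the binary digits of the order. -/
theorem prod_one_add_pow (x : ℝ) (r : ℕ) :
    ∏ i ∈ Finset.range r, (1 + x ^ 2 ^ i) = geomSum x (2 ^ r - 1) := by
  have h : ∀ r : ℕ, 2 ^ r - 1 + 1 = 2 ^ r := fun r => Nat.sub_add_cancel Nat.one_le_two_pow
  rw [geomSum, h]
  induction r with
  | zero => simp
  | succ r ih =>
    rw [Finset.prod_range_succ, ih, pow_succ, mul_two, Finset.sum_range_add]
    simp only [pow_add, ← Finset.mul_sum]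
    ring

/-- The amplitudes `u ^ k √(x ^ k / geomSum x (2 ^ r - 1))`, as a product. -/
theorem prod_phasedRot {u : ℂ} (hu : u * star u = 1) {x : ℝ} (hx : 0 ≤ x) {r : ℕ}
    (b : Fin r → Bool) :
    (∏ i : Fin r, (phasedRot (u ^ 2 ^ (i : ℕ)) √(1 / (1 + x ^ 2 ^ (i : ℕ)))
        √(x ^ 2 ^ (i : ℕ) / (1 + x ^ 2 ^ (i : ℕ))) : Matrix Bool Bool ℂ) (b i) false) =
      u ^ bitsVal b * (√(x ^ bitsVal b / geomSum x (2 ^ r - 1)) : ℝ) := by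
  have h1 : ∀ i : Fin r, (phasedRot (u ^ 2 ^ (i : ℕ)) √(1 / (1 + x ^ 2 ^ (i : ℕ)))
      √(x ^ 2 ^ (i : ℕ) / (1 + x ^ 2 ^ (i : ℕ))) : Matrix Bool Bool ℂ) (b i) false =
      u ^ (if b i then 2 ^ (i : ℕ) else 0) *
        (√(x ^ (if b i then 2 ^ (i : ℕ) else 0) / (1 + x ^ 2 ^ (i : ℕ))) : ℝ) := by
    intro i
    have hp : 0 ≤ x ^ 2 ^ (i : ℕ) := by positivity
    rw [phasedRot_apply]
    · split_ifs <;> simp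
    · rw [star_pow, ← mul_pow, hu, one_pow]
    · rw [Real.sq_sqrt (by positivity), Real.sq_sqrt (by positivity)]
      field_simp
  rw [Finset.prod_congr rfl fun i _ => h1 i, Finset.prod_mul_distrib, Finset.prod_pow_eq_pow_sum,
    ← Complex.ofReal_prod, ← Real.sqrt_prod _ fun i _ => by positivity, Finset.prod_div_distrib,
    Finset.prod_pow_eq_pow_sum, ← prod_one_add_pow, Finset.prod_range]
  rfl

/-! ### The block and the costs of the sequential circuit. -/

section SeqBlock

variable {ns na M r w : ℕ}

/-- The qubits of the order register. -/
def seqOrder (i : ℕ) : SeqQubit ns na M r w := if h : i < r then .inr (.k ⟨i, h⟩) else .inr .p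

theorem seqOrder_of_lt {i : ℕ} (h : i < r) :
    (seqOrder i : SeqQubit ns na M r w) = .inr (.k ⟨i, h⟩) := dif_pos h

theorem works_seqOrder : Works (seqOrder : ℕ → SeqQubit ns na M r w) r := by
  intro i hi j hj h
  rw [seqOrder_of_lt hi, seqOrder_of_lt hj] at h
  simpa using h

/-- Prepares the amplitudes of the orders. -/
def seqCoef (u : ℂ) (x : ℝ) : Circuit (OracleReg ns na M) (SeqQubit ns na M r w) :=
  productCirc seqOrder (fun i => phasedRot (u ^ 2 ^ i) √(1 / (1 + x ^ 2 ^ i))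
    √(x ^ 2 ^ i / (1 + x ^ 2 ^ i))) r

/-- Prepares the amplitudes of the orders, damped by the rotation of a qubit. -/
def seqCoef' (u : ℂ) (x : ℝ) : Circuit (OracleReg ns na M) (SeqQubit ns na M r w) :=
  seqCoef u x ++ gateOne (.inr .p)
    (rot (damping x (2 ^ r - 1)) √(1 - damping x (2 ^ r - 1) ^ 2))

/-- The amplitude of the order `k`. -/
def seqWeight (u : ℂ) (x : ℝ) (k : Fin r → Bool) : ℂ :=
  u ^ bitsVal k * (√(x ^ bitsVal k / geomSum x (2 ^ r - 1)) : ℝ)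

theorem seqCoef_apply {u : ℂ} (hu : u * star u = 1) {x : ℝ} (hx : 0 ≤ x)
    (O : Operator (OracleReg ns na M)) (s : Fin ns → Bool) (z : SeqQubit ns na M r w → Bool)
    [Decidable (∀ q, (∀ i, q ≠ .inr (.k i)) → z q =
      (Sum.elim s fun _ => false : SeqQubit ns na M r w → Bool) q)] :
    Circuit.op O (seqCoef u x) z (Sum.elim s fun _ => false) =
      if ∀ q, (∀ i, q ≠ .inr (.k i)) → z q =
        (Sum.elim s fun _ => false : SeqQubit ns na M r w → Bool) q then
        seqWeight u x fun i => z (.inr (.k i)) else 0 := by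
  classical
  rw [seqCoef, productCirc_apply O _ works_seqOrder fun i hi => by rw [seqOrder_of_lt hi]; rfl]
  refine if_congr ?_ ?_ rfl
  · refine forall_congr' fun q => imp_congr_left ⟨fun h i => ?_, fun h i hi => ?_⟩
    · have := h i i.2
      rwa [seqOrder_of_lt i.2] at this
    · rw [seqOrder_of_lt hi]
      exact h _
  · rw [Finset.prod_range, seqWeight, ← prod_phasedRot hu hx]
    refine Finset.prod_congr rfl fun i _ => ?_
    rw [seqOrder_of_lt i.2]

/-- The stages of the sequential circuit with checks. -/
def seqChecked : Circuit (OracleReg ns na M) (SeqQubit ns na M r w) :=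
  -- All orders are at most 2^r - 1, so the last query is always idle; for r > 0 its stage lets the
  -- preceding time be cleared. There are 2(2^r - 1) + 1 stages, whose labels fit into r + 1 qubits.
  checkedCirc seqWork (fun i : Fin (r + 1) => .inr (.f i)) (seqStages (2 ^ r - 1)) 0

/-- The circuit that is amplified. -/
def seqStep (x : ℝ) : Circuit (OracleReg ns na M) (SeqQubit ns na M r w) :=
  seqCoef 1 x ++ seqChecked ++ (seqCoef' Complex.I x).adj

theorem idleCirc_cost (j : ℕ) {S : Set (SeqQubit ns na M r w)} (hS : ∀ i, .inr (.k i) ∈ S)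
    (hi : .inr .idle ∈ S) (hw : ∀ j, seqWork j ∈ S) :
    Cost (idleCirc j : Circuit (OracleReg ns na M) (SeqQubit ns na M r w)) (24 * (8 * r + 3)) S := by
  rw [← size_idleExp (ns := ns) (na := na) (M := M) (r := r) (w := w) j]
  refine xorEval_cost _ _ _ ((vars_idleExp j).trans ?_) hi fun j _ => hw j
  rintro _ ⟨i, rfl⟩
  exact hS i

theorem timeCirc_cost (c : Bool) {S : Set (SeqQubit ns na M r w)} (hS : ∀ i, seqTime c i ∈ S)
    (hi : .inr .idle ∈ S) (hw : ∀ j, seqWork j ∈ S) :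
    Cost (timeCirc c : Circuit (OracleReg ns na M) (SeqQubit ns na M r w))
      (32 + 18 * Nat.clog 2 M) S := by
  refine unifIf_cost (fun s hs => ?_) (fun i _ => hS i) fun i _ => hw i
  simp only [List.mem_cons, List.not_mem_nil, or_false] at hs
  rcases hs with rfl | rfl
  · rintro q (rfl | rfl)
    · exact hi
    · exact hw 0
  · rintro q rfl
    exact hw 0

theorem stage_costs (c : Bool) (j : ℕ) :
    (forwardStage c j : Circuit (OracleReg ns na M) (SeqQubit ns na M r w)).queries ≤ 1 ∧
    (backStage c j : Circuit (OracleReg ns na M) (SeqQubit ns na M r w)).queries ≤ 1 ∧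
    (forwardStage c j : Circuit (OracleReg ns na M) (SeqQubit ns na M r w)).primitives ≤
      18 * Nat.clog 2 M + 384 * r + 176 ∧
    (backStage c j : Circuit (OracleReg ns na M) (SeqQubit ns na M r w)).primitives ≤
      18 * Nat.clog 2 M + 384 * r + 176 := by
  have h1 := idleCirc_cost (ns := ns) (na := na) (M := M) (r := r) (w := w) j (S := Set.univ)
    (by simp) (by simp) (by simp)
  have h2 := timeCirc_cost (ns := ns) (na := na) (M := M) (r := r) (w := w) c (S := Set.univ)
    (by simp) (by simp) (by simp)
  have h3 : Circuit.queries (R := OracleReg ns na M) (Q := SeqQubit ns na M r w)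
      [Gate.ctrlQuery (seqEmbedding c) false] = 1 := rfl
  have h4 : Circuit.primitives (R := OracleReg ns na M) (Q := SeqQubit ns na M r w)
      [Gate.ctrlQuery (seqEmbedding c) false] = 0 := rfl
  have h5 := h1.primitives
  have h6 := h2.primitives
  simp only [forwardStage, backStage, Circuit.queries_append, Circuit.primitives_append,
    Circuit.queries_adj, Circuit.primitives_adj, h1.queries, h2.queries, h3, h4]
  omega

theorem stages_actsOn (c : Bool) (j : ℕ) :
    (forwardStage c j : Circuit (OracleReg ns na M) (SeqQubit ns na M r w)).ActsOn
      {q | ∀ i, q ≠ .inr (.f i)} ∧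
    (backStage c j : Circuit (OracleReg ns na M) (SeqQubit ns na M r w)).ActsOn
      {q | ∀ i, q ≠ .inr (.f i)} := by
  have hw : ∀ j i, (seqWork j : SeqQubit ns na M r w) ≠ .inr (.f i) := by
    intro j i
    unfold seqWork
    split_ifs <;> simp
  have ht : ∀ j i, (seqTime c j : SeqQubit ns na M r w) ≠ .inr (.f i) := by
    intro j i
    unfold seqTime
    split_ifs <;> simp
  have h1 := (idleCirc_cost (ns := ns) (na := na) (M := M) (r := r) (w := w) j
    (S := {q | ∀ i, q ≠ .inr (.f i)}) (by simp) (by simp) hw).actsOn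
  have h2 := timeCirc_cost (ns := ns) (na := na) (M := M) (r := r) (w := w) c
    (S := {q | ∀ i, q ≠ .inr (.f i)}) ht (by simp) hw
  refine ⟨h1.append ((h2.actsOn.append fun g hg => ?_).append h1),
    h1.append (h2.adj.actsOn.append h1)⟩
  rw [List.mem_singleton] at hg
  subst hg
  rintro _ ⟨o, rfl⟩ i h
  rcases o with _ | o | o | o <;> cases h

theorem checks_hyps (c : Bool) (j : ℕ) :
    (forwardCheck c j : BExp (SeqQubit ns na M r w)).vars ⊆
      {q | Free seqWork w q ∧ ∀ i, q ≠ .inr (.f i)} ∧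
    (backCheck c : BExp (SeqQubit ns na M r w)).vars ⊆
      {q | Free seqWork w q ∧ ∀ i, q ≠ .inr (.f i)} ∧
    (forwardCheck c j : BExp (SeqQubit ns na M r w)).size ≤ 4 * na + 8 * Nat.clog 2 M + 8 * r + 5 ∧
    (backCheck c : BExp (SeqQubit ns na M r w)).size ≤ 4 * na + 8 * Nat.clog 2 M + 8 * r + 5 := by
  have hf : ∀ q : SeqQubit ns na M r w, (∀ i, q ≠ .inr (.work i)) → (∀ i, q ≠ .inr (.f i)) →
      q ∈ {q : SeqQubit ns na M r w | Free seqWork w q ∧ ∀ i, q ≠ .inr (.f i)} :=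
    fun q h1 h2 => ⟨free_seqWork h1, h2⟩
  have h1 : (orderCheck c j : BExp (SeqQubit ns na M r w)).vars ⊆
      {q | Free seqWork w q ∧ ∀ i, q ≠ .inr (.f i)} ∧
      (orderCheck c j : BExp (SeqQubit ns na M r w)).size ≤ 8 * Nat.clog 2 M + 8 * r + 3 := by
    unfold orderCheck
    split_ifs
    · exact ⟨Set.empty_subset _, by simp only [BExp.size]; omega⟩
    · refine ⟨Set.union_subset ((vars_activeExp j).trans ?_) (BExp.vars_ltReg (fun i => ?_)
        fun i => ?_), ?_⟩
      · rintro _ ⟨i, rfl⟩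
        exact hf _ (by simp) (by simp)
      · exact hf _ (by simp) (by simp)
      · exact hf _ (by simp) (by simp)
      · rw [BExp.size, size_activeExp, BExp.size_ltReg]
        omega
  have h2 := BExp.size_regEq (List.finRange na) (fun i => (.inr (.a i) : SeqQubit ns na M r w))
    fun _ => false
  have h3 := BExp.size_regEq (List.finRange (Nat.clog 2 M))
    (fun i => (.inr (.d c i) : SeqQubit ns na M r w)) fun _ => false
  rw [List.length_finRange] at h2 h3
  refine ⟨Set.union_subset (BExp.vars_regEq fun i _ => hf _ (by simp) (by simp)) h1.1,
    Set.union_subset (BExp.vars_regEq fun i _ => hf _ (by simp) (by simp)) (Set.empty_subset _),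
    ?_, ?_⟩
  · have := h1.2
    rw [forwardCheck, BExp.size]
    omega
  · rw [backCheck, BExp.size]
    simp only [BExp.size]
    omega

theorem seqStages_ok (hw : EnoughSeqWork na M r w) {O : Operator (OracleReg ns na M)}
    (hO : O ∈ Matrix.unitaryGroup (OracleReg ns na M → Bool) ℂ) (j : ℕ) :
    ∀ p ∈ (seqStages j : Stages (OracleReg ns na M) (SeqQubit ns na M r w)),
      StageOK seqWork w (fun i : Fin (r + 1) => .inr (.f i)) O p := by
  have hs := hw.size
  have hF : ∀ c j, StageOK (Q := SeqQubit ns na M r w) seqWork w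
      (fun i : Fin (r + 1) => .inr (.f i)) O (forwardStage c j, forwardCheck c j) := by
    intro c j
    obtain ⟨h1, -, h2, -⟩ := checks_hyps (ns := ns) (na := na) (M := M) (r := r) (w := w) c j
    refine ⟨?_, fun x y h i => Circuit.eq_off_of_op_ne_zero O (stages_actsOn c j).1 h
      fun hi => hi i rfl, fun q hq => (h1 hq).1, fun i hi => (h1 hi).2 i rfl, by simp only; omega⟩
    simp only [forwardStage, Circuit.op_append]
    exact ((idleCirc_clean hw hO j).mul ((query_clean O c).mul (timeCirc_clean hw O c))).mul
      (idleCirc_clean hw hO j)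
  have hB : ∀ c j, StageOK (Q := SeqQubit ns na M r w) seqWork w
      (fun i : Fin (r + 1) => .inr (.f i)) O (backStage c j, backCheck c) := by
    intro c j
    obtain ⟨-, h1, -, h2⟩ := checks_hyps (ns := ns) (na := na) (M := M) (r := r) (w := w) c j
    refine ⟨?_, fun x y h i => Circuit.eq_off_of_op_ne_zero O (stages_actsOn c j).2 h
      fun hi => hi i rfl, fun q hq => (h1 hq).1, fun i hi => (h1 hi).2 i rfl, by simp only; omega⟩
    simp only [backStage, Circuit.op_append, Circuit.op_adj]
    exact ((idleCirc_clean hw hO j).mul (timeCirc_clean hw O c).conjTranspose).mul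
      (idleCirc_clean hw hO j)
  induction j with
  | zero =>
    intro p hp
    rw [seqStages, List.mem_singleton] at hp
    rw [hp]
    exact hF _ _
  | succ j ih =>
    intro p hp
    rw [seqStages, List.mem_append] at hp
    rcases hp with hp | hp
    · exact ih p hp
    · simp only [List.mem_cons, List.not_mem_nil, or_false] at hp
      rcases hp with rfl | rfl
      · exact hF _ _
      · exact hB _ _

theorem failure_injective : Function.Injective
    (fun i : Fin (r + 1) => (.inr (.f i) : SeqQubit ns na M r w)) := fun i j h => by simpa using h

theorem two_pow_pred (r : ℕ) : 2 * (2 ^ r - 1) + 1 < 2 ^ (r + 1) := by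
  have : 1 ≤ 2 ^ r := Nat.one_le_two_pow
  rw [pow_succ]
  omega

/-- With the failure register zero at both ends the checks are projections. At the last stage every
order is complete, so the invariant gives the full ordered sum with cleared time registers. -/
theorem seqChecked_apply (hw : EnoughSeqWork na M r w) {O : Operator (OracleReg ns na M)}
    {H : ℝ → Operator (Fin ns)} {α t : ℝ} (hO : IsHamT O H α t) (k : Fin r → Bool)
    (x y : Fin ns → Bool) (a : SeqAncilla na M r w → Bool) (haf : ∀ i, a (.f i) = false)
    (had : ∀ c i, a (.d c i) = false)
    [Decidable (a = seqState k fun _ _ => false)] :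
    Circuit.op O (seqChecked : Circuit (OracleReg ns na M) (SeqQubit ns na M r w)) (Sum.elim x a)
      (Sum.elim y (seqState k fun _ _ => false)) =
      if a = seqState k (fun _ _ => false) then
        ((M : ℂ) * α)⁻¹ ^ bitsVal k •
          orderedSum (fun m => H ((m : ℝ) * t / (M : ℝ))) (bitsVal k) M x y else 0 := by
  classical
  have hk := bitsVal_lt k
  have h0 : bitsVal (fun i : Fin (r + 1) => (Sum.elim y (seqState k fun _ _ => false) :
      SeqQubit ns na M r w → Bool) (.inr (.f i))) = 0 := (bitsVal_eq_zero_iff _).2 fun _ => rfl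
  rw [seqChecked, checkedCirc_apply works_seqWork failure_injective
    (fun i => free_seqWork fun j => by simp) (seqStages_ok hw hO.1 _)
    (by rw [length_seqStages]; have := two_pow_pred r; omega) haf (clear_seqState k _ y) h0.le,
    if_pos h0, represents_seqStages hw hO k (by omega)]
  have hta : seqTimes a = fun _ _ => false := funext fun c => funext fun i => had c i
  rw [hta]
  by_cases h2 : a = seqState k fun _ _ => false
  · rw [if_pos h2, if_pos h2]
    simp only [if_true, seqPartial]
    rw [if_pos (by omega), zeroAmp, if_pos fun _ => rfl, one_mul]
    rfl
  · rw [if_neg h2, if_neg h2]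

theorem seqCoef'_apply {u : ℂ} (hu : u * star u = 1) {x : ℝ} (hx : 0 ≤ x) (hx' : x ≤ 1 / 2)
    (O : Operator (OracleReg ns na M)) (s : Fin ns → Bool) (z : SeqQubit ns na M r w → Bool) :
    (Circuit.op O (seqCoef' u x) z (Sum.elim s fun _ => false) ≠ 0 →
      ∀ q, (∀ i, q ≠ .inr (.k i)) → q ≠ .inr .p →
        z q = (Sum.elim s fun _ => false : SeqQubit ns na M r w → Bool) q) ∧
    ∀ k, Circuit.op O (seqCoef' u x : Circuit (OracleReg ns na M) (SeqQubit ns na M r w))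
      (Sum.elim s (seqState k fun _ _ => false)) (Sum.elim s fun _ => false) =
        damping x (2 ^ r - 1) * seqWeight u x k := by
  classical
  have hA : ∀ z : SeqQubit ns na M r w → Bool,
      Circuit.op O (seqCoef u x) z (Sum.elim s fun _ => false) ≠ 0 →
      ∀ q, (∀ i, q ≠ .inr (.k i)) →
        z q = (Sum.elim s fun _ => false : SeqQubit ns na M r w → Bool) q := by
    intro z hz
    rw [seqCoef_apply hu hx] at hz
    by_contra h
    exact hz (if_neg h)
  have hop := fun z : SeqQubit ns na M r w → Bool => rot_mul_apply O (p := .inr .p) (x := z)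
    (damping_sq_add hx hx' (2 ^ r - 1)) (A := Circuit.op O (seqCoef u x))
    (y := Sum.elim s fun _ => false) fun z hz => hA z hz _ (by simp)
  rw [seqCoef', Circuit.op_append, hop]
  constructor
  · intro hz q hq hqp
    have := hA _ (right_ne_zero_of_mul hz) q hq
    rwa [Function.update_of_ne hqp] at this
  · intro k
    rw [hop]
    have hu' : Function.update (Sum.elim s (seqState k fun _ _ => false) :
        SeqQubit ns na M r w → Bool) (.inr .p) false = Sum.elim s (seqState k fun _ _ => false) :=
      Function.update_eq_self (.inr .p : SeqQubit ns na M r w) _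
    rw [hu', seqCoef_apply hu hx, if_neg (show ¬ (Sum.elim s (seqState k fun _ _ => false) :
      SeqQubit ns na M r w → Bool) (.inr .p) = true from Bool.false_ne_true), if_pos]
    · rfl
    · intro q hq
      rcases q with q | q
      · rfl
      · rcases q with i | ⟨c', i⟩ | i | i | _ | _ | i
        case k => exact absurd rfl (hq i)
        all_goals rfl

/-- The weight of the order k is again (g/2) · ((αt)^k/g) · (-i)^k · (Mα)^{-k}, now summed over the
binary orders below 2^r. -/
theorem ancillaBlock_seqStep (hw : EnoughSeqWork na M r w) {O : Operator (OracleReg ns na M)}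
    {H : ℝ → Operator (Fin ns)} {α t : ℝ} (hO : IsHamT O H α t) (hα : 0 < α) (ht : 0 ≤ t)
    (hαt : α * t ≤ 1 / 2) :
    ancillaBlock (Circuit.op O (seqStep (α * t) : Circuit (OracleReg ns na M)
      (SeqQubit ns na M r w))) = (1 / 2 : ℂ) • truncatedDyson H t M (2 ^ r - 1) := by
  classical
  have hx : 0 ≤ α * t := by positivity
  have hI : Complex.I * star Complex.I = 1 := by simp
  have h1 : (1 : ℂ) * star 1 = 1 := by simp
  ext x y
  have hinj : Function.Injective fun k : Fin r → Bool =>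
      (Sum.elim y (seqState k fun _ _ => false) : SeqQubit ns na M r w → Bool) :=
    fun k k' h => funext fun i => congrFun h (.inr (.k i))
  have hin : ∀ z, (Circuit.op O seqChecked * Circuit.op O (seqCoef 1 (α * t)) :
      Operator (SeqQubit ns na M r w)) z (Sum.elim y fun _ => false) =
      ∑ k, Circuit.op O seqChecked z (Sum.elim y (seqState k fun _ _ => false)) *
        seqWeight 1 (α * t) k := by
    intro z
    rw [Matrix.mul_apply]
    symm
    refine Fintype.sum_of_injective _ hinj _ _ (fun z' hz' => ?_) fun k => ?_
    · rw [seqCoef_apply h1 hx, if_neg, mul_zero]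
      intro h
      refine hz' ⟨fun i => z' (.inr (.k i)), ?_⟩
      have h' : ∀ q, (∀ i, q ≠ .k i) → z' (.inr q) = false := fun q hq =>
        h (.inr q) fun i hi => hq i (Sum.inr.inj hi)
      funext q
      rcases q with q | q
      · exact (h (.inl q) (by simp)).symm
      · rcases q with i | ⟨c', i⟩ | i | i | _ | _ | i
        case k => rfl
        all_goals exact (h' _ (by simp)).symm
    · rw [seqCoef_apply h1 hx, if_pos]
      · rfl
      · intro q hq
        rcases q with q | q
        · rfl
        · rcases q with i | ⟨c', i⟩ | i | i | _ | _ | i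
          case k => exact absurd rfl (hq i)
          all_goals rfl
  -- The stages preserve the order register, so only the same order k contributes from the inverted
  -- coefficient circuit.
  have hk : ∀ k : Fin r → Bool, (∑ z, star (Circuit.op O (seqCoef' Complex.I (α * t) :
      Circuit (OracleReg ns na M) (SeqQubit ns na M r w)) z (Sum.elim x fun _ => false)) *
      (Circuit.op O seqChecked z (Sum.elim y (seqState k fun _ _ => false)) *
        seqWeight 1 (α * t) k)) =
      star ((damping (α * t) (2 ^ r - 1) : ℂ) * seqWeight Complex.I (α * t) k) *
        ((((M : ℂ) * α)⁻¹ ^ bitsVal k •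
          orderedSum (fun m => H ((m : ℝ) * t / (M : ℝ))) (bitsVal k) M x y) *
            seqWeight 1 (α * t) k) := by
    intro k
    rw [Finset.sum_eq_single (Sum.elim x (seqState k fun _ _ => false))]
    · rw [(seqCoef'_apply hI hx hαt O x fun _ => false).2 k, seqChecked_apply hw hO k x y _
        (fun _ => rfl) (fun _ _ => rfl), if_pos rfl]
    · intro z _ hz
      by_cases h0 : Circuit.op O (seqCoef' Complex.I (α * t)) z (Sum.elim x fun _ => false) = 0
      · rw [h0, star_zero, zero_mul]
      · have hag := (seqCoef'_apply hI hx hαt O x z).1 h0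
        have hzx : z = Sum.elim x fun q => z (.inr q) := by
          funext q
          rcases q with q | q
          · exact hag (.inl q) (by simp) (by simp)
          · rfl
        rw [hzx, seqChecked_apply hw hO k x y _ (fun i => hag (.inr (.f i)) (by simp) (by simp))
          (fun c i => hag (.inr (.d c i)) (by simp) (by simp)), if_neg, zero_mul, mul_zero]
        intro h
        exact hz (by rw [hzx, h])
    · simp
  have hopen : ancillaBlock (Circuit.op O (seqStep (α * t) : Circuit (OracleReg ns na M)
      (SeqQubit ns na M r w))) x y = ∑ z, star (Circuit.op O (seqCoef' Complex.I (α * t)) z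
        (Sum.elim x fun _ => false)) * (Circuit.op O seqChecked *
          Circuit.op O (seqCoef 1 (α * t)) : Operator (SeqQubit ns na M r w)) z
            (Sum.elim y fun _ => false) := by
    rw [ancillaBlock, Matrix.of_apply, seqStep, Circuit.op_append, Circuit.op_append,
      Circuit.op_adj, Matrix.mul_apply]
    rfl
  rw [hopen]
  simp only [hin, Finset.mul_sum]
  rw [Finset.sum_comm]
  simp only [hk]
  have hsum := sum_bits_lt (n := r) (M := 2 ^ r) le_rfl le_rfl fun κ =>
    ((1 / 2 : ℂ) • ((-Complex.I * (t / M : ℝ)) ^ κ •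
      orderedSum (fun m => H ((m : ℝ) * t / (M : ℝ))) κ M)) x y
  have hr : 2 ^ r - 1 + 1 = 2 ^ r := Nat.sub_add_cancel Nat.one_le_two_pow
  rw [truncatedDyson, hr, Finset.smul_sum, Matrix.sum_apply, ← hsum]
  refine Finset.sum_congr rfl fun k _ => ?_
  rw [if_pos (bitsVal_lt k), seqWeight, seqWeight, one_pow, one_mul, damping]
  have hg1 := one_le_geomSum hx (2 ^ r - 1)
  have hs : ((√((α * t) ^ bitsVal k / geomSum (α * t) (2 ^ r - 1)) : ℝ) : ℂ) *
      ((√((α * t) ^ bitsVal k / geomSum (α * t) (2 ^ r - 1)) : ℝ) : ℂ) =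
      (((α * t) ^ bitsVal k / geomSum (α * t) (2 ^ r - 1) : ℝ) : ℂ) := by
    rw [← Complex.ofReal_mul, Real.mul_self_sqrt (by positivity)]
  have hg : ((geomSum (α * t) (2 ^ r - 1) : ℝ) : ℂ) ≠ 0 := by
    have : geomSum (α * t) (2 ^ r - 1) ≠ 0 := by linarith
    exact_mod_cast this
  have hα' : (α : ℂ) ≠ 0 := by exact_mod_cast hα.ne'
  have hM' : (M : ℂ) ≠ 0 := by exact_mod_cast hw.pos.ne'
  simp only [star_mul', star_pow, Complex.star_def, Complex.conj_I, Complex.conj_ofReal,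
    Matrix.smul_apply, smul_eq_mul]
  set S : ℂ := ((√((α * t) ^ bitsVal k / geomSum (α * t) (2 ^ r - 1)) : ℝ) : ℂ)
  set o := orderedSum (fun m => H ((m : ℝ) * t / (M : ℝ))) (bitsVal k) M x y
  have e : ∀ a b c d : ℂ, a * (b * S) * (c * d * S) = a * b * c * d * (S * S) :=
    fun a b c d => by ring
  rw [e, hs]
  push_cast
  rw [mul_pow (-Complex.I), div_pow, inv_pow, mul_pow (M : ℂ)]
  field_simp
  rw [mul_pow]
  ring

end SeqBlock
/-! ### Relabelling the qubits of a circuit -/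

section Relabel

variable {R Q Q' : Type}

/-- The gate with its qubits relabelled. -/
def Gate.relabel (e : Q ≃ Q') : Gate R Q → Gate R Q'
  | .prim k hk f U => .prim k hk (f.trans e.toEmbedding) U
  | .query f dag => .query (f.trans e.toEmbedding) dag
  | .ctrlQuery f dag => .ctrlQuery (f.trans e.toEmbedding) dag

/-- The circuit with its qubits relabelled. -/
def Circuit.relabel (e : Q ≃ Q') (C : Circuit R Q) : Circuit R Q' := C.map (Gate.relabel e)

theorem applyOn_relabel {S : Type} (e : Q ≃ Q') (f : S ↪ Q) (U : Operator S) :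
    applyOn (f.trans e.toEmbedding) U = (applyOn f U).submatrix (fun x => x ∘ e) fun x => x ∘ e := by
  classical
  ext x y
  rw [Matrix.submatrix_apply, applyOn_apply, applyOn_apply]
  refine if_congr ⟨fun h q hq => h (e q) ?_, fun h q hq => ?_⟩ rfl rfl
  · rintro ⟨i, hi⟩
    exact hq ⟨i, e.injective hi⟩
  · have := h (e.symm q) fun ⟨i, hi⟩ => hq ⟨i, by simp [hi]⟩
    simpa using this

theorem Gate.relabel_op (O : Operator R) (e : Q ≃ Q') (g : Gate R Q) :
    (g.relabel e).op O = (g.op O).submatrix (fun x => x ∘ e) fun x => x ∘ e := by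
  cases g <;> exact applyOn_relabel e _ _

theorem Circuit.relabel_op [Fintype Q] [DecidableEq Q] [Fintype Q'] [DecidableEq Q'] (O : Operator R)
    (e : Q ≃ Q') (C : Circuit R Q) : Circuit.op O (C.relabel e) =
      (Circuit.op O C).submatrix (fun x => x ∘ e) fun x => x ∘ e := by
  have he : Function.Bijective fun x : Q' → Bool => x ∘ e :=
    (e.symm.arrowCongr (Equiv.refl Bool)).bijective
  induction C with
  | nil =>
    ext x y
    rw [Matrix.submatrix_apply]
    simp only [Circuit.relabel, List.map_nil, Circuit.op, Matrix.one_apply]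
    exact if_congr he.injective.eq_iff.symm rfl rfl
  | cons g C ih =>
    change Circuit.op O (Circuit.relabel e C) * (g.relabel e).op O = _
    rw [ih, Gate.relabel_op, Circuit.op, Matrix.submatrix_mul _ _ _ (fun x => x ∘ e) _ he]

theorem Gate.relabel_isQuery (e : Q ≃ Q') (g : Gate R Q) : (g.relabel e).isQuery = g.isQuery := by
  cases g <;> rfl

theorem Circuit.relabel_queries (e : Q ≃ Q') (C : Circuit R Q) :
    (C.relabel e).queries = C.queries := by
  simp only [Circuit.queries, Circuit.relabel, List.countP_map, Function.comp_def,
    Gate.relabel_isQuery]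

theorem Circuit.relabel_primitives (e : Q ≃ Q') (C : Circuit R Q) :
    (C.relabel e).primitives = C.primitives := by
  simp only [Circuit.primitives, Circuit.relabel, List.countP_map, Function.comp_def,
    Gate.relabel_isQuery]

/-- Numbering the ancillas does not affect the block; this passes from named ancillas to `Fin m`. -/
theorem ancillaBlock_relabel {ns : ℕ} {A A' : Type} (e : A ≃ A') (V : Operator (Fin ns ⊕ A)) :
    ancillaBlock (V.submatrix (fun x : Fin ns ⊕ A' → Bool => x ∘ Equiv.sumCongr (Equiv.refl _) e)
      fun x => x ∘ Equiv.sumCongr (Equiv.refl _) e) = ancillaBlock V := by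
  have h : ∀ x : Fin ns → Bool, (Sum.elim x fun _ => false : Fin ns ⊕ A' → Bool) ∘
      Equiv.sumCongr (Equiv.refl _) e = Sum.elim x fun _ => false := by
    intro x
    funext q
    rcases q with q | q <;> rfl
  ext x y
  simp only [ancillaBlock, Matrix.of_apply, Matrix.submatrix_apply, h]

end Relabel

/-! ### The amplified sequential circuit -/

section SeqCirc

variable {ns na M r w : ℕ}

/-- The ancillas that are not work qubits. -/
abbrev SeqIndex (na M r : ℕ) : Type :=
  Fin na ⊕ (Bool × Fin (Nat.clog 2 M)) ⊕ Fin r ⊕ Fin (r + 1) ⊕ Bool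

/-- The ancillas that are not work qubits, as qubits. -/
def seqIndex : SeqIndex na M r → SeqAncilla na M r w
  | .inl i => .a i
  | .inr (.inl (c, i)) => .d c i
  | .inr (.inr (.inl i)) => .k i
  | .inr (.inr (.inr (.inl i))) => .f i
  | .inr (.inr (.inr (.inr b))) => if b then .idle else .p

theorem card_seqIndex :
    Fintype.card (SeqIndex na M r) = na + 2 * Nat.clog 2 M + 2 * r + 3 := by
  simp only [Fintype.card_sum, Fintype.card_prod, Fintype.card_fin, Fintype.card_bool]
  ring

theorem card_seqAncilla :
    Fintype.card (SeqAncilla na M r w) = na + 2 * Nat.clog 2 M + 2 * r + 3 + w := by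
  have e : SeqAncilla na M r w ≃ SeqIndex na M r ⊕ Fin w :=
    { toFun := fun
        | .a i => .inl (.inl i)
        | .d c i => .inl (.inr (.inl (c, i)))
        | .k i => .inl (.inr (.inr (.inl i)))
        | .f i => .inl (.inr (.inr (.inr (.inl i))))
        | .idle => .inl (.inr (.inr (.inr (.inr true))))
        | .p => .inl (.inr (.inr (.inr (.inr false))))
        | .work i => .inr i
      invFun := Sum.elim seqIndex .work
      left_inv := by rintro (_ | _ | _ | _ | _ | _ | _) <;> rfl
      right_inv := by rintro ((_ | _ | _ | _ | _ | _) | _) <;> rfl }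
  rw [Fintype.card_congr e, Fintype.card_sum, card_seqIndex, Fintype.card_fin]

/-- The reflection about the cleared ancillas. -/
def seqRef : Circuit (OracleReg ns na M) (SeqQubit ns na M r w) :=
  refCirc seqWork (Finset.univ : Finset (SeqIndex na M r)).toList seqIndex

theorem length_seqIndex : (Finset.univ : Finset (SeqIndex na M r)).toList.length =
    na + 2 * Nat.clog 2 M + 2 * r + 3 := by
  rw [Finset.length_toList, Finset.card_univ, card_seqIndex]

theorem seqRef_isReflection (hw : EnoughSeqWork na M r w) (O : Operator (OracleReg ns na M)) :
    IsReflection seqWork w (Circuit.op O (seqRef : Circuit (OracleReg ns na M)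
      (SeqQubit ns na M r w))) := by
  have hs := hw.size
  refine refCirc_isReflection O works_seqWork (fun i => free_seqWork fun j => ?_)
    (by rw [length_seqIndex]; omega) fun a => ?_
  · rcases i with _ | _ | _ | _ | _ | _ <;> simp [seqIndex]
  · rcases a with i | ⟨c, i⟩ | i | i | _ | _ | i
    · exact Or.inl ⟨.inl i, by simp, rfl⟩
    · exact Or.inl ⟨.inr (.inl (c, i)), by simp, rfl⟩
    · exact Or.inl ⟨.inr (.inr (.inl i)), by simp, rfl⟩
    · exact Or.inl ⟨.inr (.inr (.inr (.inl i))), by simp, rfl⟩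
    · exact Or.inl ⟨.inr (.inr (.inr (.inr true))), by simp, rfl⟩
    · exact Or.inl ⟨.inr (.inr (.inr (.inr false))), by simp, rfl⟩
    · exact Or.inr ⟨i, i.2, seqWork_of_lt i.2⟩

theorem seqRef_cost : Cost (seqRef : Circuit (OracleReg ns na M) (SeqQubit ns na M r w))
    (49 + 192 * (na + 2 * Nat.clog 2 M + 2 * r + 3)) Set.univ := by
  have h := refCirc_cost (R := OracleReg ns na M) (seqWork : ℕ → SeqQubit ns na M r w)
    (Finset.univ : Finset (SeqIndex na M r)).toList seqIndex
  rwa [length_seqIndex] at h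

/-- The sequential circuit, with one round of amplitude amplification. -/
def seqCirc (x : ℝ) : Circuit (OracleReg ns na M) (SeqQubit ns na M r w) :=
  seqStep x ++ seqRef ++ (seqStep x).adj ++ seqRef ++ seqStep x ++
    [Gate.prim 0 (Nat.zero_le 2) ⟨Fin.elim0, fun i => i.elim0⟩ (-1)]

theorem free_seqOrder (i : ℕ) : Free seqWork w (seqOrder i : SeqQubit ns na M r w) := by
  refine free_seqWork fun j => ?_
  unfold seqOrder
  split_ifs <;> simp

theorem seqCoef'_cost (u : ℂ) (x : ℝ) :
    Cost (seqCoef' u x : Circuit (OracleReg ns na M) (SeqQubit ns na M r w)) (r + 1)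
      {q | Free seqWork w q} :=
  (productCirc_cost _ _ _ fun i _ => free_seqOrder i).append
    (gateOne_cost _ _ (free_seqWork fun i => by simp))

theorem seqStep_clean (hw : EnoughSeqWork na M r w) (x : ℝ) {O : Operator (OracleReg ns na M)}
    (hO : O ∈ Matrix.unitaryGroup (OracleReg ns na M → Bool) ℂ) :
    Clean seqWork w (Circuit.op O (seqStep x : Circuit (OracleReg ns na M)
      (SeqQubit ns na M r w))) := by
  have h1 : Clean seqWork w (Circuit.op O (seqCoef 1 x : Circuit (OracleReg ns na M)
      (SeqQubit ns na M r w))) :=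
    Clean.of_actsOn O (productCirc_cost _ _ _ fun i _ => free_seqOrder i).actsOn
  have h2 : Clean seqWork w (Circuit.op O (seqCoef' Complex.I x : Circuit (OracleReg ns na M)
      (SeqQubit ns na M r w))) := Clean.of_actsOn O (seqCoef'_cost _ _).actsOn
  have h3 : Clean seqWork w (Circuit.op O (seqChecked : Circuit (OracleReg ns na M)
      (SeqQubit ns na M r w))) :=
    checkedCirc_clean hO works_seqWork failure_injective (fun i => free_seqWork fun j => by simp)
      (seqStages_ok hw hO _) _
  simp only [seqStep, Circuit.op_append, Circuit.op_adj]
  exact h2.conjTranspose.mul (h3.mul h1)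

theorem ancillaBlock_seqCirc (hw : EnoughSeqWork na M r w) {O : Operator (OracleReg ns na M)}
    (hO : O ∈ Matrix.unitaryGroup (OracleReg ns na M → Bool) ℂ) (x : ℝ) {B : Operator (Fin ns)}
    (hB : ancillaBlock (Circuit.op O (seqStep x : Circuit (OracleReg ns na M)
      (SeqQubit ns na M r w))) = B) :
    ancillaBlock (Circuit.op O (seqCirc x : Circuit (OracleReg ns na M) (SeqQubit ns na M r w))) =
      (3 : ℂ) • B - (4 : ℂ) • (B * Bᴴ * B) := by
  rw [← hB, ← ancillaBlock_amplify (wk := seqWork) (N := w)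
    (fun j hj => ⟨_, seqWork_of_lt hj⟩) (Circuit.op_mem_unitary hO _) (seqStep_clean hw x hO)
    (seqRef_isReflection hw O)]
  simp only [seqCirc, Circuit.op_append, Circuit.op_adj, Circuit.op_cons, Circuit.op_nil,
    prim_neg_one_op, Matrix.one_mul, neg_mul]

theorem seqStages_cost (j : ℕ) :
    ∀ p ∈ (seqStages j : Stages (OracleReg ns na M) (SeqQubit ns na M r w)),
      p.1.queries ≤ 1 ∧ p.1.primitives ≤ 18 * Nat.clog 2 M + 384 * r + 176 ∧
        p.2.size ≤ 4 * na + 8 * Nat.clog 2 M + 8 * r + 5 := by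
  have hF := fun c j => stage_costs (ns := ns) (na := na) (M := M) (r := r) (w := w) c j
  have hE := fun c j => checks_hyps (ns := ns) (na := na) (M := M) (r := r) (w := w) c j
  induction j with
  | zero =>
    intro p hp
    rw [seqStages, List.mem_singleton] at hp
    rw [hp]
    exact ⟨(hF _ _).1, (hF _ _).2.2.1, (hE _ _).2.2.1⟩
  | succ j ih =>
    intro p hp
    rw [seqStages, List.mem_append] at hp
    rcases hp with hp | hp
    · exact ih p hp
    · simp only [List.mem_cons, List.not_mem_nil, or_false] at hp
      rcases hp with rfl | rfl
      · exact ⟨(hF _ _).1, (hF _ _).2.2.1, (hE _ _).2.2.1⟩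
      · exact ⟨(hF _ _).2.1, (hF _ _).2.2.2, (hE _ 0).2.2.2⟩

theorem seqCirc_cost (hw : EnoughSeqWork na M r w) (x : ℝ) :
    (seqCirc x : Circuit (OracleReg ns na M) (SeqQubit ns na M r w)).queries ≤ 6 * 2 ^ r ∧
      (seqCirc x : Circuit (OracleReg ns na M) (SeqQubit ns na M r w)).primitives ≤
        10000 * 2 ^ r * (na + Nat.clog 2 M + r + 1) := by
  have h2 : Circuit.queries (R := OracleReg ns na M) (Q := SeqQubit ns na M r w)
      [Gate.prim 0 (Nat.zero_le 2) ⟨Fin.elim0, fun i => i.elim0⟩ (-1)] = 0 := rfl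
  have h2' : Circuit.primitives (R := OracleReg ns na M) (Q := SeqQubit ns na M r w)
      [Gate.prim 0 (Nat.zero_le 2) ⟨Fin.elim0, fun i => i.elim0⟩ (-1)] = 1 := rfl
  have hs := seqStages_cost (ns := ns) (na := na) (M := M) (r := r) (w := w) (2 ^ r - 1)
  have h3 := checkedCirc_cost (wk := seqWork) (N := w)
    (fb := fun i : Fin (r + 1) => (.inr (.f i) : SeqQubit ns na M r w)) (S := Set.univ)
    (fun _ => Set.mem_univ _) (fun _ _ => Set.mem_univ _) (fun p hp => (hs p hp).1)
    (fun p hp => (hs p hp).2.1) (fun _ _ => Set.subset_univ _) (fun p hp => (hs p hp).2.2)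
    (by have := hw.size; omega) 0
  rw [length_seqStages] at h3
  have h4 : Cost (seqCoef 1 x : Circuit (OracleReg ns na M) (SeqQubit ns na M r w)) r
    Set.univ := productCirc_cost _ _ _ fun i _ => Set.mem_univ _
  have h5 := seqCoef'_cost (ns := ns) (na := na) (M := M) (r := r) (w := w) Complex.I x
  have h6 := seqRef_cost (ns := ns) (na := na) (M := M) (r := r) (w := w)
  have hp : 1 ≤ 2 ^ r := Nat.one_le_two_pow
  constructor
  · simp only [seqCirc, seqStep, seqChecked, Circuit.queries_append, Circuit.queries_adj, h2,
      h4.queries, h5.queries, h6.queries]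
    omega
  · have h7 := h3.2
    have h8 := h4.primitives
    have h9 := h5.primitives
    have h10 := h6.primitives
    simp only [seqCirc, seqStep, seqChecked, Circuit.primitives_append, Circuit.primitives_adj, h2']
    obtain ⟨K, hK⟩ : ∃ K, 2 ^ r = K + 1 := ⟨2 ^ r - 1, by omega⟩
    rw [hK, Nat.add_sub_cancel] at h7 ⊢
    nlinarith [Nat.zero_le (K * na), Nat.zero_le (K * Nat.clog 2 M), Nat.zero_le (K * r)]

end SeqCirc
/-! ### The time-ordered exponential -/

section Dyson

open MeasureTheory

variable {ns : ℕ} {H : ℝ → Operator (Fin ns)}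

/-- The Hamiltonian is controlled only on [0, t]. This permits replacing it by a continuous bounded
function on the whole line. -/
theorem dysonTerm_congr {G : ℝ → Operator (Fin ns)} {t : ℝ} (h : ∀ s ∈ Set.Icc 0 t, H s = G s) (k : ℕ) :
    ∀ s ∈ Set.Icc 0 t, dysonTerm H k s = dysonTerm G k s := by
  induction k with
  | zero => exact fun _ _ => rfl
  | succ k ih =>
    intro s hs
    refine intervalIntegral.integral_congr fun x hx => ?_
    rw [Set.uIcc_of_le hs.1] at hx
    have hx' : x ∈ Set.Icc 0 t := ⟨hx.1, hx.2.trans hs.2⟩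
    simp only [h x hx', ih x hx']

theorem continuous_dysonTerm (hH : Continuous H) (k : ℕ) : Continuous (dysonTerm H k) := by
  induction k with
  | zero => exact continuous_const
  | succ k ih => exact continuous_iff_continuousAt.2 fun s =>
      ((hH.mul ih).integral_hasStrictDerivAt 0 s).hasDerivAt.continuousAt

theorem hasDerivAt_dysonTerm (hH : Continuous H) (k : ℕ) (s : ℝ) :
    HasDerivAt (dysonTerm H (k + 1)) (H s * dysonTerm H k s) s :=
  ((hH.mul (continuous_dysonTerm hH k)).integral_hasStrictDerivAt 0 s).hasDerivAt

theorem norm_one_le_one : ‖(1 : Operator (Fin ns))‖ ≤ 1 := by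
  have h := Matrix.l2_opNorm_conjTranspose_mul_self (1 : Operator (Fin ns))
  rw [Matrix.conjTranspose_one, Matrix.one_mul] at h
  nlinarith [norm_nonneg (1 : Operator (Fin ns))]

/-- Integrating (α|x|)^k/k! raises the order by one. Negative times are included because two-sided
derivatives are taken at every real point. -/
theorem norm_dysonTerm_le (hH : Continuous H) {α : ℝ} (hα : ∀ s, ‖H s‖ ≤ α) (k : ℕ) (s : ℝ) :
    ‖dysonTerm H k s‖ ≤ (α * |s|) ^ k / k ! := by
  have hα0 : 0 ≤ α := (norm_nonneg _).trans (hα 0)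
  induction k generalizing s with
  | zero => simp [dysonTerm]
  | succ k ih =>
    refine (intervalIntegral.norm_integral_le_integral_norm_uIoc).trans ?_
    have h1 : ∫ x in Set.uIoc 0 s, ‖H x * dysonTerm H k x‖ ≤
        ∫ x in Set.uIoc 0 s, α ^ (k + 1) / k ! * |x - 0| ^ k := by
      refine setIntegral_mono_on ?_ ?_ measurableSet_uIoc fun x _ => ?_
      · exact ((hH.mul (continuous_dysonTerm hH k)).norm.intervalIntegrable 0 s).def'
      · exact (Continuous.intervalIntegrable (by fun_prop) 0 s).def'
      · refine (norm_mul_le _ _).trans ((mul_le_mul (hα x) (ih x) (norm_nonneg _) hα0).trans_eq ?_)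
        rw [sub_zero]
        ring
    refine h1.trans_eq ?_
    rw [integral_const_mul, integral_pow_abs_sub_uIoc, sub_zero, Nat.factorial_succ, mul_pow]
    push_cast
    field_simp

theorem summable_dysonTerm (hH : Continuous H) {α : ℝ} (hα : ∀ s, ‖H s‖ ≤ α) (s : ℝ) :
    Summable fun k : ℕ => (-Complex.I) ^ k • dysonTerm H k s := by
  refine Summable.of_norm_bounded (Real.summable_pow_div_factorial (α * |s|)) fun k => ?_
  rw [norm_smul, norm_pow, norm_neg, Complex.norm_I, one_pow, one_mul]
  exact norm_dysonTerm_le hH hα k s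

theorem timeOrderedExp_zero (H : ℝ → Operator (Fin ns)) : timeOrderedExp H 0 = 1 := by
  rw [timeOrderedExp, tsum_eq_single 0]
  · simp [dysonTerm]
  · intro k hk
    obtain ⟨k, rfl⟩ := Nat.exists_eq_succ_of_ne_zero hk
    simp [dysonTerm]

/-- Termwise differentiation; near `s` the differentiated series is dominated by α times the
exponential series at α(|s| + 1). -/
theorem hasDerivAt_timeOrderedExp (hH : Continuous H) {α : ℝ} (hα : ∀ s, ‖H s‖ ≤ α) (s : ℝ) :
    HasDerivAt (timeOrderedExp H) (-Complex.I • (H s * timeOrderedExp H s)) s := by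
  have hα0 : 0 ≤ α := (norm_nonneg _).trans (hα 0)
  have e1 : timeOrderedExp H = fun s => 1 + ∑' k : ℕ, (-Complex.I) ^ (k + 1) • dysonTerm H (k + 1) s := by
    funext s
    rw [timeOrderedExp, (summable_dysonTerm hH hα s).tsum_eq_zero_add]
    simp [dysonTerm]
  have e2 : -Complex.I • (H s * timeOrderedExp H s) =
      ∑' k : ℕ, (-Complex.I) ^ (k + 1) • (H s * dysonTerm H k s) := by
    rw [timeOrderedExp, ← (summable_dysonTerm hH hα s).tsum_mul_left,
      ← ((summable_dysonTerm hH hα s).mul_left (H s)).tsum_const_smul]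
    refine tsum_congr fun k => ?_
    rw [mul_smul_comm, smul_smul, pow_succ']
  rw [e2, e1]
  refine HasDerivAt.const_add _ ?_
  refine hasDerivAt_tsum_of_isPreconnected
    (g := fun k y => (-Complex.I) ^ (k + 1) • dysonTerm H (k + 1) y)
    (g' := fun k y => (-Complex.I) ^ (k + 1) • (H y * dysonTerm H k y))
    (u := fun k : ℕ => α * ((α * (|s| + 1)) ^ k / k !)) (t := Metric.ball 0 (|s| + 1)) (y₀ := s) (y := s)
    ((Real.summable_pow_div_factorial _).mul_left α) Metric.isOpen_ball
    (convex_ball _ _).isPreconnected (fun k y _ => (hasDerivAt_dysonTerm hH k y).const_smul ((-Complex.I) ^ (k + 1)))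
    (fun k y hy => ?_) (by simp) ?_ (by simp)
  · rw [norm_smul, norm_pow, norm_neg, Complex.norm_I, one_pow, one_mul]
    refine (norm_mul_le _ _).trans (mul_le_mul (hα y) ?_ (norm_nonneg _) hα0)
    rw [mem_ball_zero_iff, Real.norm_eq_abs] at hy
    refine (norm_dysonTerm_le hH hα k y).trans ?_
    gcongr
  · exact (summable_nat_add_iff 1).2 (summable_dysonTerm hH hα s)

/-- By Hermiticity the derivative of U†U is U†(iH - iH)U = 0, and U†U = 1 at time zero. -/
theorem timeOrderedExp_isometry (hH : Continuous H) {α : ℝ} (hα : ∀ s, ‖H s‖ ≤ α)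
    (hh : ∀ s, (H s).IsHermitian) (s : ℝ) : (timeOrderedExp H s)ᴴ * timeOrderedExp H s = 1 := by
  have hd : ∀ s, HasDerivAt (fun s => star (timeOrderedExp H s) * timeOrderedExp H s) 0 s := by
    intro s
    have h := (hasDerivAt_timeOrderedExp hH hα s).star.mul (hasDerivAt_timeOrderedExp hH hα s)
    refine h.congr_deriv ?_
    have e : star (H s) = H s := hh s
    simp only [star_smul, star_mul, e, star_neg, Complex.star_def, Complex.conj_I, neg_neg,
      smul_mul_assoc, mul_smul_comm, neg_smul, mul_neg, mul_assoc]
    exact add_neg_cancel _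
  have h := is_const_of_deriv_eq_zero (fun s => (hd s).differentiableAt) (fun s => (hd s).deriv) s 0
  simp only [timeOrderedExp_zero, star_one, mul_one] at h
  exact h

theorem norm_le_one_of_isometry {U : Operator (Fin ns)} (h : Uᴴ * U = 1) : ‖U‖ ≤ 1 := by
  have h' := Matrix.l2_opNorm_conjTranspose_mul_self U
  rw [h] at h'
  nlinarith [norm_nonneg U, norm_one_le_one (ns := ns)]

end Dyson
/-! ### The error of the truncated series -/

section Truncation

variable {ns : ℕ}

/-- The remainder has the derivative -i((G(s) - G(a))U(s) + G(a)(U(s) - U(a))). The first term is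
bounded by the variation of G, the second by h · h(b - a), after a first use of the mean value
inequality for U. -/
theorem euler_step {U G : ℝ → Operator (Fin ns)} {a b h V : ℝ} (hab : a ≤ b)
    (hU : ∀ s ∈ Set.Icc a b, HasDerivAt U (-Complex.I • (G s * U s)) s)
    (hU1 : ∀ s ∈ Set.Icc a b, ‖U s‖ ≤ 1) (hG : ∀ s ∈ Set.Icc a b, ‖G s‖ ≤ h)
    (hV : ∀ s ∈ Set.Icc a b, ‖G s - G a‖ ≤ V) :
    ‖U b - (U a - (b - a) • (Complex.I • (G a * U a)))‖ ≤ (V + h * (h * (b - a))) * (b - a) := by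
  have ha : a ∈ Set.Icc a b := ⟨le_rfl, hab⟩
  have h0 : 0 ≤ h := (norm_nonneg _).trans (hG a ha)
  have hn : ∀ X : Operator (Fin ns), ‖-Complex.I • X‖ = ‖X‖ := fun X => by
    rw [norm_smul, norm_neg, Complex.norm_I, one_mul]
  have h1 := norm_image_sub_le_of_norm_deriv_le_segment' (fun s hs => (hU s hs).hasDerivWithinAt)
    (C := h) fun s hs => by
      have hs' := Set.Ico_subset_Icc_self hs
      rw [hn]
      exact (norm_mul_le _ _).trans ((mul_le_mul (hG s hs') (hU1 s hs') (norm_nonneg _) h0).trans_eq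
        (mul_one h))
  have h2 := norm_image_sub_le_of_norm_deriv_le_segment'
    (f := fun s => U s + (s - a) • (Complex.I • (G a * U a)))
    (f' := fun s => -Complex.I • (G s * U s) + (1 : ℝ) • (Complex.I • (G a * U a)))
    (C := V + h * (h * (b - a))) (fun s hs => ((hU s hs).add
      (((hasDerivAt_id s).sub_const a).smul_const _)).hasDerivWithinAt) (fun s hs => by
      have hs' := Set.Ico_subset_Icc_self hs
      have e : -Complex.I • (G s * U s) + (1 : ℝ) • (Complex.I • (G a * U a)) =
          -Complex.I • ((G s - G a) * U s + G a * (U s - U a)) := by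
        rw [one_smul, sub_mul, mul_sub]
        module
      rw [e, hn]
      refine (norm_add_le _ _).trans (add_le_add ?_ ?_)
      · exact (norm_mul_le _ _).trans ((mul_le_mul (hV s hs') (hU1 s hs') (norm_nonneg _)
          ((norm_nonneg _).trans (hV s hs'))).trans_eq (mul_one V))
      · refine (norm_mul_le _ _).trans (mul_le_mul (hG a ha) ((h1 s hs').trans ?_) (norm_nonneg _) h0)
        exact mul_le_mul_of_nonneg_left (by linarith [hs'.2]) h0) b ⟨hab, le_rfl⟩
  have e : U b - (U a - (b - a) • (Complex.I • (G a * U a))) =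
      U b + (b - a) • (Complex.I • (G a * U a)) - (U a + (a - a) • (Complex.I • (G a * U a))) := by
    rw [sub_self, zero_smul]
    abel
  rw [e]
  exact h2

/-- The distance of the time-ordered exponential to the Euler product. -/
theorem norm_timeOrderedExp_sub_le {H : ℝ → Operator (Fin ns)} {t α : ℝ} (ht : 0 ≤ t)
    (hherm : ∀ s ∈ Set.Icc 0 t, (H s).IsHermitian) (hd : DifferentiableOn ℝ H (Set.Icc 0 t))
    (hint : IntervalIntegrable (fun s => derivWithin H (Set.Icc 0 t) s) MeasureTheory.volume 0 t)
    (hα : ∀ s ∈ Set.Icc 0 t, ‖H s‖ ≤ α) (hαt : α * t ≤ 1 / 2) {M : ℕ} (hM : 0 < M) :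
    (timeOrderedExp H t)ᴴ * timeOrderedExp H t = 1 ∧
      ‖timeOrderedExp H t -
        descProd (fun m => 1 + (-Complex.I * (t / M : ℝ)) • H ((m : ℝ) * t / M)) M‖ ≤
        2 * (t ^ 2 / M * (avgRate H t + maxNorm H t ^ 2)) := by
  -- Clamping the time to [0, t] extends H to a continuous bounded Hermitian function on the line
  -- with the same Dyson series on [0, t].
  set c : ℝ → ℝ := fun s => max 0 (min s t) with hc
  have hcm : ∀ s, c s ∈ Set.Icc 0 t := fun s => ⟨le_max_left _ _, max_le ht (min_le_right _ _)⟩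
  have hcs : ∀ s ∈ Set.Icc 0 t, c s = s := fun s hs => by
    rw [hc]
    simp only [min_eq_left hs.2, max_eq_right hs.1]
  set G : ℝ → Operator (Fin ns) := fun s => H (c s) with hG
  have hGH : ∀ s ∈ Set.Icc 0 t, H s = G s := fun s hs => by rw [hG]; simp only [hcs s hs]
  have hGc : Continuous G := hd.continuousOn.comp_continuous (by fun_prop) hcm
  have hGα : ∀ s, ‖G s‖ ≤ α := fun s => hα _ (hcm s)
  have hα0 : 0 ≤ α := (norm_nonneg _).trans (hGα 0)
  set U := timeOrderedExp G with hU
  have hUt : timeOrderedExp H t = U t := tsum_congr fun k => by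
    rw [dysonTerm_congr hGH k t ⟨ht, le_rfl⟩]
  have hUU := timeOrderedExp_isometry hGc hGα fun s => hherm _ (hcm s)
  have hU1 : ∀ s, ‖U s‖ ≤ 1 := fun s => norm_le_one_of_isometry (hUU s)
  rw [hUt]
  refine ⟨hUU t, ?_⟩
  set h := maxNorm H t with hh
  have hmax : ∀ s ∈ Set.Icc 0 t, ‖H s‖ ≤ h := fun s hs =>
    le_csSup ⟨α, by rintro _ ⟨x, hx, rfl⟩; exact hα x hx⟩ ⟨s, hs, rfl⟩
  set v : ℝ → ℝ := fun s => ‖derivWithin H (Set.Icc 0 t) s‖ with hv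
  have hvint : IntervalIntegrable v MeasureTheory.volume 0 t := hint.norm
  have hsub : ∀ {a b}, 0 ≤ a → a ≤ b → b ≤ t → Set.uIcc a b ⊆ Set.uIcc 0 t := fun h1 h2 h3 => by
    rw [Set.uIcc_of_le h2, Set.uIcc_of_le ht]
    exact Set.Icc_subset_Icc h1 h3
  -- The fundamental theorem of calculus, for which the derivative must be integrable, bounds the
  -- variation on a bin by the integral of ‖Ḣ‖ over it.
  have hvar : ∀ a b, 0 ≤ a → b ≤ t → ∀ s ∈ Set.Icc a b, ‖G s - G a‖ ≤ ∫ x in a..b, v x := by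
    intro a b h1 h2 s hs
    have hst := hs.2.trans h2
    rw [← hGH s ⟨h1.trans hs.1, hst⟩, ← hGH a ⟨h1, hs.1.trans hst⟩,
      ← intervalIntegral.integral_eq_sub_of_hasDerivAt_of_le hs.1
        (hd.continuousOn.mono (Set.Icc_subset_Icc h1 hst)) (fun x hx =>
          (hd x ⟨h1.trans hx.1.le, hx.2.le.trans hst⟩).hasDerivWithinAt.hasDerivAt
            (Icc_mem_nhds (h1.trans_lt hx.1) (hx.2.trans_le hst)))
        (hint.mono_set (hsub h1 hs.1 hst))]
    refine (intervalIntegral.norm_integral_le_integral_norm hs.1).trans ?_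
    exact intervalIntegral.integral_mono_interval le_rfl hs.1 hs.2
      (Filter.Eventually.of_forall fun x => norm_nonneg _)
      (hvint.mono_set (hsub h1 (hs.1.trans hs.2) h2))
  have hM0 : (0 : ℝ) < M := by exact_mod_cast hM
  set δ := t / M with hδ
  have hδ0 : 0 ≤ δ := by positivity
  have ha : ∀ m : ℕ, (m : ℝ) * t / M = m * δ := fun m => mul_div_assoc _ _ _
  have hat : ∀ m ≤ M, (m : ℝ) * δ ∈ Set.Icc 0 t := fun m hm => by
    have hm' : (m : ℝ) ≤ M := by exact_mod_cast hm
    refine ⟨by positivity, (mul_le_mul_of_nonneg_right hm' hδ0).trans_eq ?_⟩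
    rw [hδ]
    field_simp
  set V : ℕ → ℝ := fun m => ∫ x in (m * δ)..((m + 1 : ℕ) * δ), v x with hV
  have hV0 : ∀ m, 0 ≤ V m := fun m => intervalIntegral.integral_nonneg
    (mul_le_mul_of_nonneg_right (by push_cast; linarith) hδ0) fun x _ => norm_nonneg _
  -- Accumulated errors: the exact evolution has norm at most one, and an Euler factor enlarges
  -- earlier errors by at most 1 + δα.
  have key : ∀ m ≤ M, ‖U (m * δ) - descProd (fun m => 1 + (-Complex.I * δ) • H ((m : ℝ) * t / M)) m‖ ≤
      (1 + δ * α) ^ m * ∑ l ∈ Finset.range m, (V l + h * (h * δ)) * δ := by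
    intro m hm
    induction m with
    | zero => simp [descProd, hU, timeOrderedExp_zero]
    | succ m ih =>
      have hm' : m ≤ M := by omega
      have hstep : ((m + 1 : ℕ) : ℝ) * δ - m * δ = δ := by push_cast; ring
      have hle : (m : ℝ) * δ ≤ (m + 1 : ℕ) * δ := by linarith
      have h1 := euler_step hle (fun s _ => hasDerivAt_timeOrderedExp hGc hGα s)
        (fun s _ => hU1 s) (h := h) (fun s _ => hmax _ (hcm s))
        (hvar _ _ (hat m hm').1 (hat _ hm).2)
      rw [hstep] at h1
      set P := descProd (fun m => 1 + (-Complex.I * δ) • H ((m : ℝ) * t / M)) m with hP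
      have hGm : H ((m : ℝ) * t / M) = G (m * δ) := by rw [ha, hGH _ (hat m hm')]
      have e : U ((m + 1 : ℕ) * δ) -
          descProd (fun m => 1 + (-Complex.I * δ) • H ((m : ℝ) * t / M)) (m + 1) =
          (U ((m + 1 : ℕ) * δ) - (U (m * δ) - δ • (Complex.I • (G (m * δ) * U (m * δ))))) +
            (1 + (-Complex.I * δ) • G (m * δ)) * (U (m * δ) - P) := by
        rw [descProd, ← hP, hGm, mul_sub, add_mul, add_mul, one_mul, one_mul, smul_mul_assoc,
          smul_mul_assoc, ← Complex.coe_smul, smul_smul, neg_mul, neg_smul, neg_smul,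
          mul_comm (δ : ℂ)]
        abel
      have hn : ‖1 + (-Complex.I * δ) • G (m * δ)‖ ≤ 1 + δ * α := by
        refine (norm_add_le _ _).trans (add_le_add norm_one_le_one ?_)
        rw [norm_smul, norm_mul, norm_neg, Complex.norm_I, one_mul, Complex.norm_real,
          Real.norm_of_nonneg hδ0]
        exact mul_le_mul_of_nonneg_left (hGα _) hδ0
      rw [e, Finset.sum_range_succ]
      refine (norm_add_le _ _).trans ((add_le_add h1 ((norm_mul_le _ _).trans
        (mul_le_mul hn (ih hm') (norm_nonneg _) (by positivity)))).trans ?_)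
      have h3 : 0 ≤ (V m + h * (h * δ)) * δ :=
        mul_nonneg (add_nonneg (hV0 m) (by
          rw [← mul_assoc]; exact mul_nonneg (mul_self_nonneg h) hδ0)) hδ0
      have h4 := le_mul_of_one_le_left h3 (one_le_pow₀ (n := m + 1)
        (show 1 ≤ 1 + δ * α by linarith [mul_nonneg hδ0 hα0]))
      rw [mul_add, pow_succ']
      rw [pow_succ'] at h4
      linarith
  have hfin := key M le_rfl
  have hMδ : (M : ℝ) * δ = t := by rw [hδ]; field_simp
  rw [hMδ] at hfin
  refine hfin.trans ?_
  have hsum : ∑ l ∈ Finset.range M, (V l + h * (h * δ)) * δ =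
      t ^ 2 / M * (avgRate H t + h ^ 2) := by
    have h1 : ∑ l ∈ Finset.range M, V l = ∫ x in (0 : ℝ)..t, v x := by
      have := intervalIntegral.sum_integral_adjacent_intervals (f := v)
        (μ := MeasureTheory.volume) (a := fun m : ℕ => (m : ℝ) * δ) (n := M) fun k hk =>
          hvint.mono_set (hsub (hat k hk.le).1 (mul_le_mul_of_nonneg_right (by push_cast; linarith)
            hδ0) (hat _ hk).2)
      rw [hV]
      simpa [hMδ] using this
    -- For t = 0 both sides vanish, whatever the value of the quotient 1/0.
    have h2 : t * avgRate H t = ∫ x in (0 : ℝ)..t, v x := by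
      rcases ht.eq_or_lt with rfl | h0
      · simp
      · rw [avgRate, ← mul_assoc, mul_one_div_cancel h0.ne', one_mul]
    rw [← Finset.sum_mul, Finset.sum_add_distrib, h1, ← h2, Finset.sum_const, Finset.card_range,
      nsmul_eq_mul, hδ]
    field_simp
  rw [hsum]
  refine mul_le_mul_of_nonneg_right ?_ (hsum ▸ Finset.sum_nonneg fun l _ =>
    mul_nonneg (add_nonneg (hV0 l) (by
          rw [← mul_assoc]; exact mul_nonneg (mul_self_nonneg h) hδ0)) hδ0)
  -- The growth factor is at most e^{αt} ≤ e^{1/2}, and e < 4 makes this less than 2.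
  have h1 : (1 + δ * α) ^ M ≤ Real.exp (1 / 2) := by
    refine (pow_le_pow_left₀ (by positivity) (add_comm 1 (δ * α) ▸ Real.add_one_le_exp _) M).trans ?_
    rw [← Real.exp_nat_mul]
    refine Real.exp_le_exp.2 ?_
    rw [← mul_assoc, hMδ, mul_comm]
    exact hαt
  have h2 : Real.exp (1 / 2) ^ 2 < 4 := by
    rw [← Real.exp_nat_mul]
    norm_num
    linarith [Real.exp_one_lt_d9]
  nlinarith [Real.exp_pos (1 / 2)]

theorem orderedSum_eq_zero {A : Type*} [Ring A] (h : ℕ → A) {k m : ℕ} (hk : m < k) :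
    orderedSum h k m = 0 := by
  induction m generalizing k with
  | zero =>
    obtain ⟨k, rfl⟩ := Nat.exists_eq_succ_of_ne_zero hk.ne'
    rfl
  | succ m ih =>
    obtain ⟨k, rfl⟩ := Nat.exists_eq_succ_of_ne_zero (show k ≠ 0 by omega)
    rw [orderedSum, ih (by omega), ih (by omega), mul_zero, add_zero]

/-- Expanding the Euler product chooses a set of factors, so every strictly increasing sequence of
times occurs once; orders above the number of factors contribute nothing. -/
theorem descProd_eq_sum (c : ℂ) (h : ℕ → Operator (Fin ns)) {m N : ℕ} (hm : m ≤ N) :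
    descProd (fun i => 1 + c • h i) m = ∑ k ∈ Finset.range (N + 1), c ^ k • orderedSum h k m := by
  induction m with
  | zero =>
    rw [Finset.sum_range_succ', Finset.sum_eq_zero fun k _ => by rw [orderedSum, smul_zero]]
    simp [descProd, orderedSum]
  | succ m ih =>
    have h1 := ih (by omega)
    have h2 : c • h m * ∑ k ∈ Finset.range (N + 1), c ^ k • orderedSum h k m =
        ∑ k ∈ Finset.range N, c ^ (k + 1) • (h m * orderedSum h k m) := by
      rw [Finset.sum_range_succ, orderedSum_eq_zero h (show m < N by omega), smul_zero, add_zero,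
        Finset.mul_sum]
      exact Finset.sum_congr rfl fun k _ => by rw [smul_mul_smul_comm, pow_succ']
    rw [descProd, h1, add_mul, one_mul, h2, Finset.sum_range_succ',
      Finset.sum_range_succ' (fun k => c ^ k • orderedSum h k (m + 1)), add_right_comm,
      ← Finset.sum_add_distrib]
    refine congrArg₂ _ (Finset.sum_congr rfl fun k _ => ?_) ?_
    · rw [orderedSum, smul_add]
    · cases m <;> rfl

/-- There are `m.choose k` increasing sequences; the induction is Pascal's rule. -/
theorem norm_orderedSum_le {h : ℕ → Operator (Fin ns)} {α : ℝ} {M : ℕ} (hα : ∀ l < M, ‖h l‖ ≤ α)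
    (hα0 : 0 ≤ α) (k : ℕ) {m : ℕ} (hm : m ≤ M) : ‖orderedSum h k m‖ ≤ α ^ k * m.choose k := by
  induction m generalizing k with
  | zero =>
    cases k with
    | zero => simp [orderedSum]
    | succ k => simp [orderedSum]
  | succ m ih =>
    cases k with
    | zero => simp [orderedSum]
    | succ k =>
      rw [orderedSum, Nat.choose_succ_succ]
      refine (norm_add_le _ _).trans ((add_le_add (ih _ (by omega)) ((norm_mul_le _ _).trans
        (mul_le_mul (hα m hm) (ih k (by omega)) (norm_nonneg _) hα0))).trans_eq ?_)
      push_cast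
      ring

theorem sum_half_pow_le (n m : ℕ) : ∑ k ∈ Finset.Ico (n + 1) (m + 1), (1 / 2 : ℝ) ^ k ≤ 1 := by
  rcases le_total n m with h | h
  · rw [geom_sum_Ico (by norm_num) (by omega)]
    have h1 : (0 : ℝ) < (1 / 2) ^ (m + 1) := by positivity
    have h2 : (1 / 2 : ℝ) ^ (n + 1) ≤ 1 / 2 := by
      rw [pow_succ]
      linarith [pow_le_one₀ (n := n) (show (0 : ℝ) ≤ 1 / 2 by norm_num) (by norm_num)]
    rw [div_le_iff_of_neg (by norm_num)]
    linarith
  · rw [Finset.Ico_eq_empty (by omega)]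
    simp

/-- The error of the truncation, and a bound for the truncated series. -/
theorem truncatedDyson_bounds {H : ℝ → Operator (Fin ns)} {t α : ℝ} (ht : 0 ≤ t)
    (hα : ∀ s ∈ Set.Icc 0 t, ‖H s‖ ≤ α) (hαt : α * t ≤ 1 / 2) {M : ℕ} (hM : 0 < M) (K : ℕ) :
    ‖truncatedDyson H t M K‖ ≤ 2 ∧
      ‖truncatedDyson H t M K -
        descProd (fun m => 1 + (-Complex.I * (t / M : ℝ)) • H ((m : ℝ) * t / M)) M‖ ≤
        1 / (K + 1)! ∧
      (M ≤ K → truncatedDyson H t M K =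
        descProd (fun m => 1 + (-Complex.I * (t / M : ℝ)) • H ((m : ℝ) * t / M)) M) := by
  have hM0 : (0 : ℝ) < M := by exact_mod_cast hM
  have hα0 : 0 ≤ α := (norm_nonneg _).trans (hα 0 ⟨le_rfl, ht⟩)
  set h : ℕ → Operator (Fin ns) := fun m => H ((m : ℝ) * t / M) with hh
  set c : ℂ := -Complex.I * (t / M : ℝ) with hc
  -- The bound M^k/k! for the binomial coefficient absorbs the grid and leaves (αt)^k/k!.
  have hterm : ∀ k, ‖c ^ k • orderedSum h k M‖ ≤ (1 / 2) ^ k / k ! := by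
    intro k
    have h1 := norm_orderedSum_le (h := h) (M := M) (fun l hl => hα _ ⟨by positivity, by
      rw [div_le_iff₀ hM0, mul_comm]
      exact mul_le_mul_of_nonneg_left (by exact_mod_cast hl.le) ht⟩) hα0 k le_rfl
    have h2 : ‖c‖ = t / M := by
      rw [hc, norm_mul, norm_neg, Complex.norm_I, one_mul, Complex.norm_real,
        Real.norm_of_nonneg (by positivity)]
    rw [norm_smul, norm_pow, h2]
    have h3 : (M.choose k : ℝ) ≤ (M : ℝ) ^ k / k ! := Nat.choose_le_pow_div k M
    calc (t / M) ^ k * ‖orderedSum h k M‖ ≤ (t / M) ^ k * (α ^ k * ((M : ℝ) ^ k / k !)) := by gcongr; exact h1.trans (by gcongr)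
      _ = (α * t) ^ k / k ! := by
        rw [div_pow, mul_pow]
        field_simp
      _ ≤ _ := by gcongr
  have hfact : ∀ {j k : ℕ}, j ≤ k → (1 / 2 : ℝ) ^ k / k ! ≤ (1 / 2) ^ k * (1 / j !) := by
    intro j k hjk
    rw [div_eq_mul_one_div]
    gcongr
  have htail : ∀ n m j : ℕ, j ≤ n + 1 →
      ‖∑ k ∈ Finset.Ico (n + 1) (m + 1), c ^ k • orderedSum h k M‖ ≤ 1 / j ! := by
    intro n m j hj
    refine (norm_sum_le _ _).trans ((Finset.sum_le_sum fun k hk => (hterm k).trans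
      (hfact (hj.trans (Finset.mem_Ico.1 hk).1))).trans ?_)
    rw [← Finset.sum_mul]
    exact mul_le_of_le_one_left (by positivity) (sum_half_pow_le n m)
  have hS : truncatedDyson H t M K = ∑ k ∈ Finset.range (K + 1), c ^ k • orderedSum h k M := rfl
  have hP : ∀ N, M ≤ N → descProd (fun i => 1 + c • h i) M =
      ∑ k ∈ Finset.range (N + 1), c ^ k • orderedSum h k M := fun N hN => descProd_eq_sum c h hN
  refine ⟨?_, ?_, fun hMK => by rw [hS]; exact (hP K hMK).symm⟩
  -- The term of order zero has norm at most one, and the remaining ones together at most 1/0! = 1.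
  · rw [hS, Finset.range_eq_Ico, Finset.sum_eq_sum_Ico_succ_bot (by omega)]
    refine (norm_add_le _ _).trans ?_
    have h1 := hterm 0
    have h2 := htail 0 K 0 (by omega)
    simp only [pow_zero, Nat.factorial_zero, Nat.cast_one, div_one, zero_add] at h1 h2 ⊢
    linarith
  -- The Euler product is also the series cut off at the larger of `K` and `M`, so the difference is
  -- a tail.
  · rw [norm_sub_rev, show descProd (fun m => 1 + c • H ((m : ℝ) * t / M)) M = _ from
      hP (max K M) (le_max_right _ _), hS, ← Finset.sum_Ico_eq_sub _ (by omega)]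
    exact htail K _ (K + 1) le_rfl

end Truncation
/-! ### The truncation order and the size of the registers -/

section Parameters

theorem exp_one_le_log_inv (ε : ℝ) (hε : 0 < ε) :
    Real.exp 1 ≤ Real.log (1 / min ε (Real.exp (-Real.exp 1))) := by
  have hδ : 0 < min ε (Real.exp (-Real.exp 1)) := lt_min hε (Real.exp_pos _)
  rw [one_div, Real.log_inv, le_neg, Real.log_le_iff_le_exp hδ]
  exact min_le_right _ _

/-- This is u ≤ e^{u-1} at u = log y. -/
theorem exp_one_mul_log_le {y : ℝ} (hy : 0 < y) : Real.exp 1 * Real.log y ≤ y := by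
  have h1 := Real.add_one_le_exp (Real.log y - 1)
  rw [Real.exp_sub, Real.exp_log hy, sub_add_cancel, le_div_iff₀ (Real.exp_pos 1)] at h1
  linarith

/-- The cutoff e^{-e} is where log log(1/ε) = 1; below it, L ≥ e log L for L = log(1/ε). -/
theorem one_le_logRatio {ε : ℝ} (hε : 0 < ε) : 1 ≤ logRatio ε := by
  have h1 := exp_one_le_log_inv ε hε
  have he := Real.exp_pos 1
  have h2 : 1 ≤ Real.log (Real.log (1 / min ε (Real.exp (-Real.exp 1)))) :=
    (Real.le_log_iff_exp_le (he.trans_le h1)).2 h1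
  rw [logRatio, one_le_div (by linarith)]
  have h3 := exp_one_mul_log_le (he.trans_le h1)
  nlinarith [Real.add_one_le_exp (1 : ℝ)]

/-- With R = L/log L take N = ⌈4R⌉, which is at most 5R as R ≥ 1. From N! ≥ (N/e)^N and N(log N - 1)
≥ 4R · (log L)/2 = 2L it follows that N! ≥ e^{2L}. -/
theorem exists_factorial_ge {ε : ℝ} (hε : 0 < ε) :
    ∃ N : ℕ, 2 ≤ N ∧ (N : ℝ) ≤ 5 * logRatio ε ∧ 10 ≤ ε * N ! := by
  have hR := one_le_logRatio hε
  have h1 := exp_one_le_log_inv ε hε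
  have he : (2.7 : ℝ) < Real.exp 1 := by linarith [Real.exp_one_gt_d9]
  set δ := min ε (Real.exp (-Real.exp 1)) with hδ
  have hδ0 : 0 < δ := lt_min hε (Real.exp_pos _)
  set L := Real.log (1 / δ) with hL
  set R := logRatio ε with hR'
  have hL0 : 0 < L := by linarith
  have hl : 1 ≤ Real.log L := (Real.le_log_iff_exp_le hL0).2 h1
  have hRL : R * Real.log L = L := div_mul_cancel₀ _ (by linarith)
  have hN := Nat.le_ceil (4 * R)
  have hN' := Nat.ceil_lt_add_one (show 0 ≤ 4 * R by linarith)
  set N := ⌈4 * R⌉₊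
  have hN2 : (2 : ℝ) ≤ N := by linarith
  refine ⟨N, by exact_mod_cast hN2, by linarith, ?_⟩
  -- log 4 ≥ 1 supplies the one, and log log L ≤ (log L)/2 shows that R is large enough.
  have hlogN : 1 + Real.log L / 2 ≤ Real.log N := by
    have h2 : Real.log (4 * R) ≤ Real.log N := Real.log_le_log (by linarith) hN
    have h3 : Real.log R = Real.log L - Real.log (Real.log L) := by
      rw [← Real.log_div hL0.ne' (by linarith)]
      rfl
    have h4 : 1 ≤ Real.log 4 := (Real.le_log_iff_exp_le (by norm_num)).2
      (by linarith [Real.exp_one_lt_d9])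
    rw [Real.log_mul (by norm_num) (by linarith), h3] at h2
    nlinarith [exp_one_mul_log_le (show 0 < Real.log L by linarith), Real.log_nonneg hl]
  have h2 : 2 * L ≤ N * Real.log N - N := by nlinarith
  have h3 : Real.exp (2 * L) ≤ N ! := by
    have h4 := Real.pow_div_factorial_le_exp (N : ℝ) (by linarith) N
    have hf : (0 : ℝ) < N ! := by exact_mod_cast Nat.factorial_pos N
    rw [div_le_iff₀ hf] at h4
    have h5 : (N : ℝ) ^ N = Real.exp (N * Real.log N) := by
      rw [Real.exp_nat_mul, Real.exp_log (by linarith)]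
    rw [h5] at h4
    refine (Real.exp_le_exp.2 h2).trans ?_
    rw [Real.exp_sub, div_le_iff₀ (Real.exp_pos _), mul_comm (N ! : ℝ)]
    exact h4
  have h4 : Real.exp L = 1 / δ := Real.exp_log (by positivity)
  -- N! is at least the square of 1/δ: one factor exceeds 10 because L ≥ e > 2.5, the other
  -- compensates ε ≥ δ.
  have h5 : (10 : ℝ) ≤ Real.exp L := by
    refine le_trans ?_ (Real.exp_le_exp.2 (show (2.5 : ℝ) ≤ L by linarith))
    have h6 : Real.exp 2.5 ^ 2 = Real.exp 1 ^ 5 := by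
      rw [← Real.exp_nat_mul, ← Real.exp_nat_mul]
      norm_num
    have h7 : (100 : ℝ) ≤ Real.exp 1 ^ 5 :=
      le_trans (by norm_num) (pow_le_pow_left₀ (by norm_num) he.le 5)
    nlinarith [Real.exp_pos 2.5]
  rw [two_mul, Real.exp_add, h4] at h3
  rw [h4] at h5
  have h6 : δ ≤ ε := min_le_left _ _
  calc (10 : ℝ) ≤ 1 / δ := h5
    _ = δ * (1 / δ * (1 / δ)) := by field_simp
    _ ≤ ε * N ! := by gcongr

/-- Rounds the smaller of N and M + 1 up to a power of two, which at most doubles it. Limiting by M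
+ 1 loses nothing, as the series is complete at order M, and makes r = O(log M) however small ε is.
-/
theorem exists_truncation_order {ε : ℝ} (hε : 0 < ε) {M : ℕ} (hM : 0 < M) :
    ∃ r : ℕ, (2 : ℝ) ^ r ≤ 10 * logRatio ε ∧ r ≤ Nat.clog 2 M + 1 ∧
      (10 ≤ ε * (2 ^ r)! ∨ M ≤ 2 ^ r - 1) := by
  obtain ⟨N, hN2, hN, hN'⟩ := exists_factorial_ge hε
  have hmin : 2 ≤ min N (M + 1) := le_min hN2 (Nat.succ_le_succ hM)
  have h1 : 2 ^ (Nat.clog 2 (min N (M + 1)) - 1) < min N (M + 1) :=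
    Nat.pow_pred_clog_lt_self one_lt_two hmin
  have h0 : 0 < Nat.clog 2 (min N (M + 1)) := Nat.clog_pos one_lt_two hmin
  have h2 : min N (M + 1) ≤ 2 ^ Nat.clog 2 (min N (M + 1)) := Nat.le_pow_clog one_lt_two _
  refine ⟨Nat.clog 2 (min N (M + 1)), ?_, ?_, ?_⟩
  · have h3 : 2 ^ Nat.clog 2 (min N (M + 1)) ≤ 2 * N := by
      obtain ⟨r, hr⟩ := Nat.exists_eq_succ_of_ne_zero h0.ne'
      rw [hr, Nat.succ_sub_one] at h1
      rw [hr, pow_succ]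
      omega
    have h4 : (2 : ℝ) ^ Nat.clog 2 (min N (M + 1)) ≤ 2 * N := by exact_mod_cast h3
    linarith
  · refine Nat.clog_le_of_le_pow ((min_le_right _ _).trans ?_)
    have h3 : M ≤ 2 ^ Nat.clog 2 M := Nat.le_pow_clog one_lt_two _
    rw [pow_succ]
    omega
  · rcases le_total N (M + 1) with h | h
    · rw [min_eq_left h] at h2 ⊢
      refine Or.inl (hN'.trans (mul_le_mul_of_nonneg_left ?_ hε.le))
      exact_mod_cast Nat.factorial_le h2
    · rw [min_eq_right h] at h2 ⊢
      exact Or.inr (by omega)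

/-- Rounding up costs one, and 1/log 2 ≤ 2. -/
theorem clog_two_le (M : ℕ) : (Nat.clog 2 M : ℝ) ≤ 2 * Real.log M + 1 := by
  rcases Nat.lt_or_ge 1 M with h | h
  · have h1 : 2 ^ (Nat.clog 2 M - 1) < M := Nat.pow_pred_clog_lt_self one_lt_two h
    have h0 : 0 < Nat.clog 2 M := Nat.clog_pos one_lt_two h
    obtain ⟨r, hr⟩ := Nat.exists_eq_succ_of_ne_zero h0.ne'
    rw [hr, Nat.succ_sub_one] at h1
    have h2 : Real.log ((2 : ℝ) ^ r) ≤ Real.log M :=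
      Real.log_le_log (by positivity) (by exact_mod_cast h1.le)
    rw [Real.log_pow] at h2
    rw [hr]
    push_cast
    nlinarith [Real.log_two_gt_d9, (Nat.cast_nonneg r : (0 : ℝ) ≤ r)]
  · rw [Nat.clog_of_right_le_one h]
    have := Real.log_natCast_nonneg M
    push_cast
    linarith

variable {ns : ℕ} {H : ℝ → Operator (Fin ns)} {t ε : ℝ}

theorem one_le_logGrid : 1 ≤ logGrid H t ε := by
  rw [logGrid, Real.le_log_iff_exp_le (lt_max_of_lt_right (Real.exp_pos 1))]
  exact le_max_right _ _

/-- Needs only the upper bound on M, which forces c₁ > 0. The constant comes from 2(|log c₁| + ℓ) +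
2 ≤ (4 + 2|log c₁|)ℓ, by ℓ ≥ 1. -/
theorem clog_le_logGrid {M : ℕ} (hM : 0 < M) {c₁ : ℝ} (h : (M : ℝ) ≤ c₁ * max 1 (gridSize H t ε)) :
    (Nat.clog 2 M : ℝ) + 1 ≤ (4 + 2 * |Real.log c₁|) * logGrid H t ε := by
  have hM0 : (0 : ℝ) < M := by exact_mod_cast hM
  have h1 : (0 : ℝ) < max 1 (gridSize H t ε) := lt_max_of_lt_left one_pos
  have hc : 0 < c₁ := pos_of_mul_pos_left (hM0.trans_le h) h1.le
  have h2 := Real.log_le_log hM0 h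
  rw [Real.log_mul hc.ne' h1.ne'] at h2
  have h3 : Real.log (max 1 (gridSize H t ε)) ≤ logGrid H t ε := by
    refine Real.log_le_log h1 (max_le (le_max_of_le_right ?_) (le_max_left _ _))
    linarith [Real.add_one_le_exp (1 : ℝ)]
  have h4 : 1 ≤ logGrid H t ε := one_le_logGrid
  nlinarith [clog_two_le M, le_abs_self (Real.log c₁), abs_nonneg (Real.log c₁)]

/-- Amplifying the truncated series simulates the time-ordered exponential. -/
theorem simulates_amplify {α : ℝ} (ht : 0 ≤ t) (hε : 0 < ε)
    (hherm : ∀ s ∈ Set.Icc 0 t, (H s).IsHermitian) (hd : DifferentiableOn ℝ H (Set.Icc 0 t))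
    (hint : IntervalIntegrable (fun s => derivWithin H (Set.Icc 0 t) s) MeasureTheory.volume 0 t)
    (hα : ∀ s ∈ Set.Icc 0 t, ‖H s‖ ≤ α) (hαt : α * t ≤ 1 / 2) {M : ℕ} (hM : 0 < M)
    (hgrid : 20 * gridSize H t ε ≤ M) {K : ℕ} (hK : 10 ≤ ε * (K + 1)! ∨ M ≤ K)
    {B : Operator (Fin ns)} (hB : B = (1 / 2 : ℂ) • truncatedDyson H t M K) :
    Simulates ((3 : ℂ) • B - (4 : ℂ) • (B * Bᴴ * B)) (timeOrderedExp H t) ε (2 * ε) := by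
  obtain ⟨hU, hUP⟩ := norm_timeOrderedExp_sub_le ht hherm hd hint hα hαt hM
  obtain ⟨hS, hSP, hSP'⟩ := truncatedDyson_bounds ht hα hαt hM K
  set P := descProd (fun m => 1 + (-Complex.I * (t / M : ℝ)) • H ((m : ℝ) * t / M)) M
  have hM0 : (0 : ℝ) < M := by exact_mod_cast hM
  -- The discretization error is 2εX/M, so M ≥ 20 X gives ε/10.
  have h1 : 2 * (t ^ 2 / M * (avgRate H t + maxNorm H t ^ 2)) ≤ ε / 10 := by
    rw [show 2 * (t ^ 2 / M * (avgRate H t + maxNorm H t ^ 2)) =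
      2 * ε * gridSize H t ε / M by rw [gridSize]; field_simp, div_le_iff₀ hM0]
    nlinarith
  have h2 : ‖truncatedDyson H t M K - P‖ ≤ ε / 10 := by
    rcases hK with hK | hK
    · refine hSP.trans ?_
      rw [div_le_div_iff₀ (by exact_mod_cast Nat.factorial_pos _) (by norm_num)]
      linarith
    · rw [hSP' hK, sub_self, norm_zero]
      positivity
  -- Two errors of ε/10; the factor 5 of the amplification then gives ε.
  have h3 : ‖truncatedDyson H t M K - timeOrderedExp H t‖ ≤ ε / 5 := by
    rw [← sub_sub_sub_cancel_right _ _ P]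
    refine (norm_sub_le _ _).trans ?_
    linarith
  refine simulates_of_norm_le hU ((norm_amplify_sub_le (norm_le_one_of_isometry hU)
    (mul_eq_one_comm.1 hU) hS h3 hB).trans_eq (by ring))

end Parameters

/-! ### The two circuits -/

section Circuits

variable {ns na M r w : ℕ}

/-- The sequential circuit, on a numbered set of ancillas. -/
def seqCircFin (x : ℝ) : Circuit (OracleReg ns na M)
    (Fin ns ⊕ Fin (Fintype.card (SeqAncilla na M r w))) :=
  Circuit.relabel (Equiv.sumCongr (Equiv.refl _) (Fintype.equivFin (SeqAncilla na M r w)))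
    (seqCirc x)

theorem ancillaBlock_seqCircFin (hw : EnoughSeqWork na M r w) {O : Operator (OracleReg ns na M)}
    {H : ℝ → Operator (Fin ns)} {α t : ℝ} (hO : IsHamT O H α t) (hα : 0 < α) (ht : 0 ≤ t)
    (hαt : α * t ≤ 1 / 2) {B : Operator (Fin ns)}
    (hB : B = (1 / 2 : ℂ) • truncatedDyson H t M (2 ^ r - 1)) :
    ancillaBlock (Circuit.op O (seqCircFin (r := r) (w := w) (α * t))) =
      (3 : ℂ) • B - (4 : ℂ) • (B * Bᴴ * B) := by
  rw [seqCircFin, Circuit.relabel_op, ancillaBlock_relabel,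
    ancillaBlock_seqCirc hw hO.1 _ ((ancillaBlock_seqStep hw hO hα ht hαt).trans hB.symm)]

/-- The bound on r makes all registers of the sequential circuit linear in na + log M + 1, without
dependence on ε. -/
theorem exists_enoughSeqWork (na : ℕ) (hM : 0 < M) (hr : r ≤ Nat.clog 2 M + 1) :
    ∃ w, EnoughSeqWork na M r w ∧
      Fintype.card (SeqAncilla na M r w) ≤ 52 * (na + Nat.clog 2 M + 1) := by
  refine ⟨4 * na + 8 * Nat.clog 2 M + 16 * r + 31, ⟨hM, Nat.lt_succ_self _⟩, ?_⟩
  rw [card_seqAncilla]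
  omega

theorem exists_enoughWork (na : ℕ) (hM : 0 < M) (K : ℕ) :
    ∃ w, EnoughWork na M K w ∧ 1 + (K * na + K + 2 + K * Nat.clog 2 M + 1) * 4 < w ∧
      Fintype.card (DupAncilla na M K w) ≤ 20 * (K + 1) * (na + Nat.clog 2 M + 1) := by
  refine ⟨16 * (K + 1) * (na + Nat.clog 2 M + 1), ⟨hM, ?_, ?_⟩, ?_, ?_⟩
  · nlinarith [Nat.zero_le (K * na), Nat.zero_le (K * Nat.clog 2 M)]
  · nlinarith [Nat.zero_le (K * na), Nat.zero_le (K * Nat.clog 2 M)]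
  · nlinarith [Nat.zero_le (K * na), Nat.zero_le (K * Nat.clog 2 M)]
  · rw [card_dupAncilla]
    nlinarith [Nat.zero_le (K * na), Nat.zero_le (K * Nat.clog 2 M)]

end Circuits

end DysonSim

end

/-! ### The main theorem: choice of the constants and of the circuits. -/

theorem mainTheorem9 :
    ∃ c₀ : ℝ, 0 < c₀ ∧ ∀ c₁ : ℝ, ∃ C : ℝ, 0 < C ∧
      ∀ (ns na M : ℕ) (α t ε : ℝ), 0 < M → 0 < α → 0 ≤ t → t ≤ 1 / (2 * α) → 0 < ε →
        ∃ (m : ℕ)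
          (circ : DysonSim.Circuit (DysonSim.OracleReg ns na M) (Fin ns ⊕ Fin m))
          (K w : ℕ)
          (coef coef' prep ref : DysonSim.Circuit (DysonSim.OracleReg ns na M)
            (DysonSim.DupQubit ns na M K w)),
          DysonSim.IsCoef coef ∧ DysonSim.IsCoef coef' ∧ DysonSim.IsPrep prep ∧
          DysonSim.IsRef ref ∧
          ∀ (H : ℝ → DysonSim.Operator (Fin ns))
            (O : DysonSim.Operator (DysonSim.OracleReg ns na M)),
            (∀ s ∈ Set.Icc 0 t, (H s).IsHermitian) →
            DifferentiableOn ℝ H (Set.Icc 0 t) →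
            IntervalIntegrable (fun s => derivWithin H (Set.Icc 0 t) s)
              MeasureTheory.volume 0 t →
            (∀ s ∈ Set.Icc 0 t, ‖H s‖ ≤ α) →
            c₀ * DysonSim.gridSize H t ε ≤ (M : ℝ) →
            (M : ℝ) ≤ c₁ * max 1 (DysonSim.gridSize H t ε) →
            DysonSim.IsHamT O H α t →
            -- a circuit with the stated query, qubit and gate costs
            (DysonSim.Simulates (DysonSim.ancillaBlock (circ.op O))
                (DysonSim.timeOrderedExp H t) ε (C * ε) ∧
              (circ.queries : ℝ) ≤ C * DysonSim.logRatio ε ∧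
              (m : ℝ) ≤ C * ((na : ℝ) + DysonSim.logGrid H t ε) ∧
              (circ.primitives : ℝ) ≤
                C * (((na : ℝ) + DysonSim.logGrid H t ε) * DysonSim.logRatio ε)) ∧
            -- the circuit with duplicated registers
            (DysonSim.Simulates
                (DysonSim.ancillaBlock ((DysonSim.dupCircuit coef coef' prep ref).op O))
                (DysonSim.timeOrderedExp H t) ε (C * ε) ∧
              ((DysonSim.dupCircuit coef coef' prep ref).queries : ℝ) ≤
                C * DysonSim.logRatio ε ∧
              (Fintype.card (DysonSim.DupAncilla na M K w) : ℝ) ≤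
                C * (((na : ℝ) + DysonSim.logGrid H t ε) * DysonSim.logRatio ε) ∧
              ((DysonSim.dupCircuit coef coef' prep ref).primitives : ℝ) ≤
                C * (((na : ℝ) + DysonSim.logGrid H t ε) * DysonSim.logRatio ε)) := by
  -- 20 is the constant of `simulates_amplify`. The largest cost is the gate count 10000 · 2^r ·
  -- 2(na + log M + 1) of the sequential circuit; with 2^r ≤ 10 r(ε) this gives 200000, and the
  -- remaining factor comes from `clog_le_logGrid`.
  refine ⟨20, by norm_num, fun c₁ => ⟨200000 * (4 + 2 * |Real.log c₁|), by positivity, ?_⟩⟩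
  intro ns na M α t ε hM hα ht htα hε
  -- The order depends on ε and M only, and the coefficients below on αt, so the circuits are fixed
  -- before H and the oracle.
  obtain ⟨r, hrR, hrM, hr⟩ := DysonSim.exists_truncation_order hε hM
  obtain ⟨w₁, hw₁, hm₁⟩ := DysonSim.exists_enoughSeqWork na hM hrM
  have hK : 2 ^ r - 1 + 1 = 2 ^ r := Nat.sub_add_cancel Nat.one_le_two_pow
  obtain ⟨w₂, hw₂, hw₂', hm₂⟩ := DysonSim.exists_enoughWork na hM (2 ^ r - 1)
  refine ⟨_, DysonSim.seqCircFin (r := r) (w := w₁) (α * t), 2 ^ r - 1, w₂,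
    DysonSim.coefCirc (α * t), DysonSim.coefCirc' (α * t), DysonSim.prepCirc, DysonSim.dupRef,
    ⟨(DysonSim.coefCirc_cost _).queries, (DysonSim.coefCirc_cost _).actsOn⟩,
    ⟨(DysonSim.coefCirc'_cost _).queries, (DysonSim.coefCirc'_cost _).actsOn⟩,
    DysonSim.isPrep_prepCirc hw₂, DysonSim.isRef_dupRef hw₂', ?_⟩
  intro H O hherm hd hint hHα hgrid hgrid' hO
  have hαt : α * t ≤ 1 / 2 := by
    rw [le_div_iff₀ (by positivity)] at htα
    linarith
  have hsim := DysonSim.simulates_amplify ht hε hherm hd hint hHα hαt hM hgrid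
    (K := 2 ^ r - 1) (by rwa [hK]) rfl
  have hlog := DysonSim.clog_le_logGrid hM hgrid'
  have hg := DysonSim.one_le_logGrid (H := H) (t := t) (ε := ε)
  have hR := DysonSim.one_le_logRatio hε
  set g := DysonSim.logGrid H t ε
  set R := DysonSim.logRatio ε
  have hc := abs_nonneg (Real.log c₁)
  set c := 4 + 2 * |Real.log c₁| with hc'
  have hc4 : 4 ≤ c := by linarith
  have hna : (0 : ℝ) ≤ na := Nat.cast_nonneg na
  have hA : (na : ℝ) + Nat.clog 2 M + 1 ≤ c * (na + g) := by nlinarith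
  have hsize : (2 : ℝ) ^ r * (na + Nat.clog 2 M + 1) ≤ 10 * (c * ((na + g) * R)) :=
    (mul_le_mul hrR hA (by positivity) (by positivity)).trans_eq (by ring)
  have hX : 0 ≤ c * ((na + g) * R) := by positivity
  have hcR : 4 * R ≤ c * R := mul_le_mul_of_nonneg_right hc4 (by linarith)
  have hfail : ∀ {W : DysonSim.Operator (Fin ns)},
      DysonSim.Simulates W (DysonSim.timeOrderedExp H t) ε (2 * ε) →
        DysonSim.Simulates W (DysonSim.timeOrderedExp H t) ε (200000 * c * ε) := fun h =>
    ⟨h.1, fun ψ hψ => (h.2 ψ hψ).trans (mul_le_mul_of_nonneg_right (by linarith) hε.le)⟩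
  refine ⟨⟨hfail ?_, ?_, ?_, ?_⟩, hfail ?_, ?_, ?_, ?_⟩
  · rw [DysonSim.ancillaBlock_seqCircFin hw₁ hO hα ht hαt rfl]
    exact hsim
  · rw [DysonSim.seqCircFin, DysonSim.Circuit.relabel_queries]
    have h : ((DysonSim.Circuit.queries (DysonSim.seqCirc (ns := ns) (na := na) (M := M) (r := r)
      (w := w₁) (α * t)) : ℕ) : ℝ) ≤ (6 * 2 ^ r : ℕ) :=
      Nat.cast_le.2 (DysonSim.seqCirc_cost hw₁ (α * t)).1
    push_cast at h
    linarith
  · have h : (Fintype.card (DysonSim.SeqAncilla na M r w₁) : ℝ) ≤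
      (52 * (na + Nat.clog 2 M + 1) : ℕ) := Nat.cast_le.2 hm₁
    push_cast at h
    nlinarith
  · rw [DysonSim.seqCircFin, DysonSim.Circuit.relabel_primitives]
    have h : ((DysonSim.Circuit.primitives (DysonSim.seqCirc (ns := ns) (na := na) (M := M)
      (r := r) (w := w₁) (α * t)) : ℕ) : ℝ) ≤
      -- The term r in the gate count is absorbed, because r is at most `Nat.clog 2 M + 1`.
      (10000 * 2 ^ r * (2 * (na + Nat.clog 2 M + 1)) : ℕ) := Nat.cast_le.2
        ((DysonSim.seqCirc_cost hw₁ (α * t)).2.trans (Nat.mul_le_mul_left _ (by omega)))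
    push_cast at h
    linarith
  · rw [DysonSim.ancillaBlock_dupCircuit hw₂ hw₂' hO.1 _
      (DysonSim.ancillaBlock_tdsStep_coef hw₂ hO hα ht hαt)]
    exact hsim
  · have h : ((3 * (2 ^ r - 1) : ℕ) : ℝ) ≤ (3 * 2 ^ r : ℕ) := Nat.cast_le.2 (by omega)
    rw [DysonSim.queries_dupCircuit _ hw₂]
    push_cast at h ⊢
    linarith
  · rw [hK] at hm₂
    have h : (Fintype.card (DysonSim.DupAncilla na M (2 ^ r - 1) w₂) : ℝ) ≤
      (20 * 2 ^ r * (na + Nat.clog 2 M + 1) : ℕ) := Nat.cast_le.2 hm₂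
    push_cast at h
    linarith
  · have h1 := DysonSim.primitives_dupCircuit (ns := ns) (α * t) hw₂
    rw [hK] at h1
    have h : ((DysonSim.dupCircuit (DysonSim.coefCirc (ns := ns) (na := na) (M := M)
      (K := 2 ^ r - 1) (w := w₂) (α * t)) (DysonSim.coefCirc' (α * t)) DysonSim.prepCirc
      DysonSim.dupRef).primitives : ℝ) ≤
      (3000 * 2 ^ r * (na + Nat.clog 2 M + 1) : ℕ) := Nat.cast_le.2 h1
    push_cast at h
    linarith
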